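/- **Setting.** Let $\mathcal G$ be a finite-dimensional semisimple ribbon Hopf-$*$-algebra over $\mathbb C$, with universal $R$-matrix $R=\sum r^1\otimes r^2$ (and $R'=\sum r^2\otimes r^1$), ribbon element $v$, co-product $\Delta$, co-unit $\epsilon$ and antipode $\mathcal S$; co-product and $R$ are compatible with $(\xi\otimes\eta)^*=\eta^*\otimes\xi^*$, i.e. $\Delta(\xi^*)=\Delta(\xi)^*$ and $R^*=R^{-1}$, and $v^*=v^{-1}$. Let $\tau^I$ ($I\in\mathcal I$, finite) be a complete set of representatives of the irreducible representations of $\mathcal G$, each of them a $*$-representation on a finite-dimensional Hilbert space $V^I$, and let $0\in\mathcal I$ be the label of $\epsilon$. Write $X^{IJ}=(\tau^I\otimes\tau^J)(X)$ and $X^I=(\tau^I\otimes \mathrm{id})(X)$ for $X\in\mathcal G\otimes\mathcal G$. Assume that there are numbers $\kappa_I$ with $\kappa_I^2=\tau^I(v)$ and bases $C^a[IJ|K]$ of the spaces of intertwiners $V^I\otimes V^J\to V^K$ with $$C^a[IJ|K]\,(R')^{IJ}\,C^b[IJ|L]^*=\delta_{a,b}\,\delta_{K,L}\,\frac{\kappa_I\kappa_J}{\kappa_K},$$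 and fix such a choice; let $\kappa\in\mathcal G$ be the central element with $\tau^I(\kappa)=\kappa_I$. With $u=\sum\mathcal S(r^2)r^1$, $g=u^{-1}v$ and $tr^I_q(X)=tr(X\tau^I(g))$, assume that all quantum dimensions $d_I=tr\,\tau^I(g)$ are strictly positive and that the matrix $S_{IJ}=(\sum_K d_K^2)^{-1/2}\,(tr^I_q\otimes tr^J_q)(R'R)$ is invertible. The *handle algebra* $\mathcal T=\mathcal L_{1,0}$ is the unital associative algebra generated by the matrix elements of $A^I,B^I\in \mathrm{End}(V^I)\otimes\mathcal T$ with the relations $A^0=B^0=1$ and $$A^I_1R^{IJ}A^J_2=\sum_{K,a} C^a[IJ|K]^*A^KC^a[IJ|K],\qquad B^I_1R^{IJ}B^J_2=\sum_{K,a} C^a[IJ|K]^*B^KC^a[IJ|K],$$ $$(R^{-1})^{IJ}A^I_1R^{IJ}B^J_2=B^J_2(R')^{IJ}A^I_1R^{IJ},$$ where the lower index names the tensor factor of $\mathrm{End}(V^I)\otimes\mathrm{End}(V^J)$ in which a matrix acts. The semi-direct product $\mathcal T\rtimes\mathcal G$ is generated by $\mathcal T$ and $\mathcal G$ with the cross relations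 $\mu^I(\xi)A^I=A^I\mu^I(\xi)$, $\mu^I(\xi)B^I=B^I\mu^I(\xi)$, where $\mu^I(\xi)=(\tau^I\otimes\mathrm{id})\Delta(\xi)$. Let $\mathcal L(A)\subset\mathcal T$ be the subalgebra generated by the matrix elements of the $A^I$, and $\mathcal L(A)\rtimes\mathcal G\subset\mathcal T\rtimes\mathcal G$ the subalgebra generated by these and $\mathcal G$. Put $\Re=\bigoplus_I\mathrm{End}(V^I)$. **Theorem.** There are a representation $\pi$ of $\mathcal T$ on $\Re$ and a nonzero cyclic vector $|0\rangle\in\Re$ with $$\pi(B^I)|0\rangle=|0\rangle\,\kappa_I^{-1}\quad\text{for all } I .$$ Moreover: 1. (Uniqueness.) If $\rho$ is a representation of $\mathcal T$ on a complex vector space $W$ with a nonzero cyclic vector $w$ such that $\rho(B^I)w=w\,\kappa_I^{-1}$ for all $I$, then there is a unique isomorphism of representations $\Re\to W$ that maps $|0\rangle$ to $w$. 2. $\pi$ is faithful on $\mathcal T$, and it is irreducible. 3. $\pi$ extends to a representation of $\mathcal T\rtimes\mathcal G$, again denoted $\pi$, such that $\pi(\xi)|0\rangle=|0\rangle\,\epsilon(\xi)$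 for all $\xi\in\mathcal G$. 4. There is a unique antilinear, anti-multiplicative involution $*$ of $\mathcal T\rtimes\mathcal G$ which extends the $*$-operation of $\mathcal G$ and satisfies $$(A^I)^*=\kappa^{-1}R^I(A^I)^{-1}(R^{-1})^I\kappa,\qquad (B^I)^*=\kappa^{-1}R^I(B^I)^{-1}(R^{-1})^I\kappa,$$ the matrices $A^I,B^I$ being invertible; and there is a unique linear functional $\omega_A$ on $\mathcal L(A)\rtimes\mathcal G$ with $\omega_A(A^I_{ab}\,\xi)=\delta_{I,0}\,\epsilon(\xi)$ for all $I,a,b,\xi$. Every vector of $\Re$ is of the form $\pi(X)|0\rangle$ with $X\in\mathcal L(A)$, and $$\langle\pi(X)|0\rangle,\pi(Y)|0\rangle\rangle=\omega_A(X^*Y)\qquad(X,Y\in\mathcal L(A))$$ is a well-defined positive definite scalar product on $\Re$, for which $\pi$ is a $*$-representation of $\mathcal T\rtimes\mathcal G$. -/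

import Mathlib

open scoped TensorProduct Kronecker ComplexConjugate

universe u v w

noncomputable section

namespace HandleAlg

/-! ### Representations of associative algebras -/

/-- Irreducibility of a representation `ρ` of an algebra: the space is nonzero and has no invariant
subspaces except `0` and itself. -/
def IsIrred {A : Type*} [Ring A] [Algebra ℂ A] {W : Type*} [AddCommGroup W] [Module ℂ W]
    (ρ : A →ₐ[ℂ] Module.End ℂ W) : Prop :=
  Nontrivial W ∧ ∀ p : Submodule ℂ W, (∀ a : A, ∀ x ∈ p, ρ a x ∈ p) → p = ⊥ ∨ p = ⊤

/-- Equivalence of two representations of an algebra. -/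
def IsEquivRep {A : Type*} [Ring A] [Algebra ℂ A] {W W' : Type*} [AddCommGroup W] [Module ℂ W]
    [AddCommGroup W'] [Module ℂ W'] (ρ : A →ₐ[ℂ] Module.End ℂ W)
    (σ : A →ₐ[ℂ] Module.End ℂ W') : Prop :=
  ∃ e : W ≃ₗ[ℂ] W', ∀ a x, e (ρ a x) = σ a (e x)

/-! ### Ribbon Hopf *-algebras -/

section Ribbon

variable (G : Type u) [Ring G] [HopfAlgebra ℂ G] [StarRing G] [StarModule ℂ G]

/-- The exchange `ξ ⊗ η ↦ η ⊗ ξ` of the two factors. -/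
abbrev swap : (G ⊗[ℂ] G) ≃ₐ[ℂ] (G ⊗[ℂ] G) := Algebra.TensorProduct.comm ℂ G G

/-- `x ⊗ y ↦ x ⊗ y ⊗ 1`. -/
abbrev leg12 : (G ⊗[ℂ] G) →ₐ[ℂ] (G ⊗[ℂ] (G ⊗[ℂ] G)) :=
  Algebra.TensorProduct.map (AlgHom.id ℂ G) Algebra.TensorProduct.includeLeft

/-- `x ⊗ y ↦ x ⊗ 1 ⊗ y`. -/
abbrev leg13 : (G ⊗[ℂ] G) →ₐ[ℂ] (G ⊗[ℂ] (G ⊗[ℂ] G)) :=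
  Algebra.TensorProduct.map (AlgHom.id ℂ G) Algebra.TensorProduct.includeRight

/-- `x ⊗ y ↦ 1 ⊗ x ⊗ y`. -/
abbrev leg23 : (G ⊗[ℂ] G) →ₐ[ℂ] (G ⊗[ℂ] (G ⊗[ℂ] G)) :=
  Algebra.TensorProduct.includeRight

/-- `Δ ⊗ id`, with values in `G ⊗ (G ⊗ G)`. -/
abbrev comulId : (G ⊗[ℂ] G) →ₐ[ℂ] (G ⊗[ℂ] (G ⊗[ℂ] G)) :=
  (Algebra.TensorProduct.assoc ℂ ℂ ℂ G G G).toAlgHom.comp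
    (Algebra.TensorProduct.map (Bialgebra.comulAlgHom ℂ G) (AlgHom.id ℂ G))

/-- `id ⊗ Δ`. -/
abbrev idComul : (G ⊗[ℂ] G) →ₐ[ℂ] (G ⊗[ℂ] (G ⊗[ℂ] G)) :=
  Algebra.TensorProduct.map (AlgHom.id ℂ G) (Bialgebra.comulAlgHom ℂ G)

variable {G}

/-- For `x = ∑ x¹ ⊗ x²` the element `∑ S(x²) x¹`. -/
def drinfeld (x : G ⊗[ℂ] G) : G :=
  LinearMap.mul' ℂ G
    (TensorProduct.map (HopfAlgebra.antipode ℂ (A := G)) LinearMap.id (swap G x))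

variable (G)

/-- A ribbon Hopf *-algebra structure on the Hopf algebra and *-algebra `G`. The `*` of `G ⊗ G` in
which the co-product and the `R`-matrix are compatible with `*` is `(ξ ⊗ η)* = η* ⊗ ξ*`,
i.e. `x ↦ swap (star x)` for Mathlib's componentwise `star` on the tensor product. -/
structure RibbonHopfStar where
  /-- the universal `R`-matrix -/
  R : (G ⊗[ℂ] G)ˣ
  /-- the ribbon element -/
  ribbon : Gˣ
  comul_star : ∀ x : G, Coalgebra.comul (R := ℂ) (star x) =
    swap G (star (Coalgebra.comul (R := ℂ) x))
  R_comul : ∀ x : G, (R : G ⊗[ℂ] G) * Coalgebra.comul (R := ℂ) x =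
    swap G (Coalgebra.comul (R := ℂ) x) * R
  comulId_R : comulId G (R : G ⊗[ℂ] G) = leg13 G R * leg23 G R
  idComul_R : idComul G (R : G ⊗[ℂ] G) = leg13 G R * leg12 G R
  star_R : swap G (star (R : G ⊗[ℂ] G)) = ((R⁻¹ : (G ⊗[ℂ] G)ˣ) : G ⊗[ℂ] G)
  ribbon_central : ∀ x : G, (ribbon : G) * x = x * ribbon
  ribbon_sq : (ribbon : G) * ribbon =
    drinfeld (R : G ⊗[ℂ] G) * HopfAlgebra.antipode ℂ (drinfeld (R : G ⊗[ℂ] G))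
  antipode_ribbon : HopfAlgebra.antipode ℂ (ribbon : G) = ribbon
  counit_ribbon : Coalgebra.counit (R := ℂ) (ribbon : G) = 1
  star_ribbon : star (ribbon : G) = ((ribbon⁻¹ : Gˣ) : G)
  comul_ribbon : (swap G (R : G ⊗[ℂ] G) * R) * Coalgebra.comul (R := ℂ) (ribbon : G) =
    (ribbon : G) ⊗ₜ[ℂ] (ribbon : G)

variable {G}

/-- `R' = ∑ r² ⊗ r¹`. -/
def RibbonHopfStar.R' (H : RibbonHopfStar G) : G ⊗[ℂ] G := swap G (H.R : G ⊗[ℂ] G)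

/-- `u = ∑ S(r²) r¹`. -/
def RibbonHopfStar.u (H : RibbonHopfStar G) : G := drinfeld (H.R : G ⊗[ℂ] G)

/-- The grouplike element `g = u⁻¹ v` (`u` is invertible in every quasi-triangular Hopf algebra). -/
def RibbonHopfStar.g (H : RibbonHopfStar G) : G := Ring.inverse H.u * (H.ribbon : G)

end Ribbon

/-! ### Irreducible representations and Clebsch-Gordan maps -/

section Irreps

variable (G : Type u) [Ring G] [HopfAlgebra ℂ G] [StarRing G] [StarModule ℂ G]
  (ι : Type v) [Fintype ι] [DecidableEq ι]

/-- A complete set of representatives `τ^I` of the irreducible representations of `G`, each of them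
a *-representation on the Hilbert space `V^I = ℂ^(n I)`. -/
structure IrrepSystem where
  /-- the dimension of `V^I` -/
  n : ι → ℕ
  /-- the representation `τ^I` -/
  τ : ∀ I, G →⋆ₐ[ℂ] Matrix (Fin (n I)) (Fin (n I)) ℂ
  irred : ∀ I, IsIrred (Matrix.toLinAlgEquiv'.toAlgHom.comp (τ I).toAlgHom)
  inequiv : ∀ I J, IsEquivRep (Matrix.toLinAlgEquiv'.toAlgHom.comp (τ I).toAlgHom)
    (Matrix.toLinAlgEquiv'.toAlgHom.comp (τ J).toAlgHom) → I = J
  complete : ∀ (m : ℕ) (ρ : G →ₐ[ℂ] Module.End ℂ (Fin m → ℂ)), IsIrred ρ →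
    ∃ I, IsEquivRep ρ (Matrix.toLinAlgEquiv'.toAlgHom.comp (τ I).toAlgHom)
  /-- the label of the trivial representation -/
  zero : ι
  τ_zero : ∀ x : G, τ zero x = Coalgebra.counit (R := ℂ) x • 1

variable {G ι}

namespace IrrepSystem

variable (D : IrrepSystem G ι)

/-- Index type of the standard basis of `V^I`. -/
abbrev V (I : ι) : Type := Fin (D.n I)

/-- `(τ^I ⊗ τ^J)(x)` for `x ∈ G ⊗ G`. -/
def tau2 (I J : ι) : G ⊗[ℂ] G →ₗ[ℂ] Matrix (D.V I × D.V J) (D.V I × D.V J) ℂ :=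
  TensorProduct.lift (LinearMap.mk₂ ℂ
    (fun x y => D.τ I x ⊗ₖ D.τ J y)
    (fun x x' y => by ext p q; simp [add_mul])
    (fun c x y => by ext p q; simp [mul_assoc])
    (fun x y y' => by ext p q; simp [mul_add])
    (fun c x y => by ext p q; simp [mul_left_comm]))

/-- `(τ^I ⊗ id)(x) ∈ End(V^I) ⊗ G` for `x ∈ G ⊗ G`, as a matrix with entries in `G`. -/
def tauId (I : ι) : G ⊗[ℂ] G →ₗ[ℂ] Matrix (D.V I) (D.V I) G :=
  TensorProduct.lift (LinearMap.mk₂ ℂ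
    (fun x y => Matrix.of fun a b => D.τ I x a b • y)
    (fun x x' y => by ext a b; simp [add_smul])
    (fun c x y => by ext a b; simp [mul_smul])
    (fun x y y' => by ext a b; simp)
    (fun c x y => by ext a b; simp [smul_comm c]))

/-- The generating matrix `μ^I(ξ) = (τ^I ⊗ id) Δ(ξ)`. -/
def mu (I : ι) (x : G) : Matrix (D.V I) (D.V I) G := D.tauId I (Coalgebra.comul (R := ℂ) x)

/-- The intertwiners `V^I ⊗ V^J → V^K`. -/
def Intertwiner (I J K : ι) : Submodule ℂ (Matrix (D.V K) (D.V I × D.V J) ℂ) where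
  carrier := {C | ∀ x : G, C * D.tau2 I J (Coalgebra.comul (R := ℂ) x) = D.τ K x * C}
  add_mem' := by
    intro a b ha hb x
    simp only [Set.mem_ofPred_eq] at ha hb
    rw [Matrix.add_mul, Matrix.mul_add, ha, hb]
  zero_mem' := by intro x; simp
  smul_mem' := by
    intro c a ha x
    simp only [Set.mem_ofPred_eq] at ha
    rw [Matrix.smul_mul, Matrix.mul_smul, ha]

/-- The fusion rule `N^{IJ}_K`, the multiplicity of `τ^K` in the tensor product of `τ^I`, `τ^J`. -/
def N (I J K : ι) : ℕ := Module.finrank ℂ (D.Intertwiner I J K)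

end IrrepSystem

/-- The square roots `κ_I` of `v_I = τ^I(v)` and a choice of Clebsch-Gordan maps `C^a[IJ|K]`,
normalized with respect to the `R`-matrix. -/
structure ClebschGordan (H : RibbonHopfStar G) (D : IrrepSystem G ι) where
  /-- the numbers `κ_I` -/
  κ : ι → ℂ
  κ_sq : ∀ I, D.τ I (H.ribbon : G) = (κ I) ^ 2 • 1
  /-- the element `κ` of `G` with `τ^I(κ) = κ_I` for all `I`; it exists and is unique -/
  κel : Gˣ
  τ_κel : ∀ I, D.τ I (κel : G) = κ I • 1
  /-- the Clebsch-Gordan maps, a basis of the space of intertwiners -/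
  C : ∀ I J K, Module.Basis (Fin (D.N I J K)) ℂ (D.Intertwiner I J K)
  norm_same : ∀ I J K (a b : Fin (D.N I J K)),
    (C I J K a : Matrix (D.V K) (D.V I × D.V J) ℂ) * D.tau2 I J H.R' *
        (C I J K b : Matrix (D.V K) (D.V I × D.V J) ℂ).conjTranspose =
      if a = b then (κ I * κ J / κ K) • 1 else 0
  norm_diff : ∀ I J K L (a : Fin (D.N I J K)) (b : Fin (D.N I J L)), K ≠ L →
    (C I J K a : Matrix (D.V K) (D.V I × D.V J) ℂ) * D.tau2 I J H.R' *
        (C I J L b : Matrix (D.V L) (D.V I × D.V J) ℂ).conjTranspose = 0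

/-- The quantum dimension `d_I = tr(τ^I(g))`. -/
def qdim (H : RibbonHopfStar G) (D : IrrepSystem G ι) (I : ι) : ℂ :=
  (D.τ I H.g).trace

/-- The matrix `S_{IJ} = 𝒩 (tr_q^I ⊗ tr_q^J)(R'R)`, `𝒩 = (∑_K d_K²)^(-1/2)` (for real `d_K`). -/
def SMatrix (H : RibbonHopfStar G) (D : IrrepSystem G ι) : Matrix ι ι ℂ :=
  Matrix.of fun I J => (((Real.sqrt (∑ K, (qdim H D K).re ^ 2))⁻¹ : ℝ) : ℂ) *
    (D.tau2 I J (H.R' * (H.R : G ⊗[ℂ] G)) * (D.τ I H.g ⊗ₖ D.τ J H.g)).trace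

end Irreps

/-! ### The handle algebra -/

section Handle

variable {G : Type u} [Ring G] [HopfAlgebra ℂ G] [StarRing G] [StarModule ℂ G]
  {ι : Type v} [Fintype ι] [DecidableEq ι] {H : RibbonHopfStar G} {D : IrrepSystem G ι}

/-- A matrix of complex numbers, regarded as a matrix over a complex algebra. -/
abbrev num (X : Type*) [Ring X] [Algebra ℂ X] {m n : Type*} (M : Matrix m n ℂ) : Matrix m n X :=
  M.map (algebraMap ℂ X)

/-- `M ∈ End(V^I) ⊗ X` acting in the first factor of `End(V^I) ⊗ End(V^J) ⊗ X`. -/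
abbrev inFirst {X : Type*} [Ring X] (m' : Type*) [DecidableEq m'] {m : Type*}
    (M : Matrix m m X) : Matrix (m × m') (m × m') X :=
  Matrix.of fun p q => if p.2 = q.2 then M p.1 q.1 else 0

/-- `M ∈ End(V^J) ⊗ X` acting in the second factor of `End(V^I) ⊗ End(V^J) ⊗ X`. -/
abbrev inSecond {X : Type*} [Ring X] (m' : Type*) [DecidableEq m'] {m : Type*}
    (M : Matrix m m X) : Matrix (m' × m) (m' × m) X :=
  Matrix.of fun p q => if p.1 = q.1 then M p.2 q.2 else 0

/-- `∑_{K,a} C^a[IJ|K]* M^K C^a[IJ|K]`. -/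
def fuse (c : ClebschGordan H D) {X : Type*} [Ring X] [Algebra ℂ X]
    (M : ∀ I, Matrix (D.V I) (D.V I) X) (I J : ι) : Matrix (D.V I × D.V J) (D.V I × D.V J) X :=
  ∑ K, ∑ a : Fin (D.N I J K),
    num X (c.C I J K a : Matrix (D.V K) (D.V I × D.V J) ℂ).conjTranspose * M K *
      num X (c.C I J K a : Matrix (D.V K) (D.V I × D.V J) ℂ)

/-- The defining relations of the handle algebra for matrices `A^I`, `B^I` over an algebra `X`:
the monodromies of the trivial representation are the unit element, functoriality of the `A^I` and
of the `B^I`, and the exchange relations. They are read entry by entry. -/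
inductive HandleRel (c : ClebschGordan H D) {X : Type*} [Ring X] [Algebra ℂ X]
    (A B : ∀ I, Matrix (D.V I) (D.V I) X) : X → X → Prop
  | unit_A (a b : D.V D.zero) :
      HandleRel c A B (A D.zero a b) ((1 : Matrix (D.V D.zero) (D.V D.zero) X) a b)
  | unit_B (a b : D.V D.zero) :
      HandleRel c A B (B D.zero a b) ((1 : Matrix (D.V D.zero) (D.V D.zero) X) a b)
  | fun_A (I J : ι) (p q : D.V I × D.V J) : HandleRel c A B
      ((inFirst (D.V J) (A I) * num X (D.tau2 I J H.R) * inSecond (D.V I) (A J)) p q)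
      (fuse c A I J p q)
  | fun_B (I J : ι) (p q : D.V I × D.V J) : HandleRel c A B
      ((inFirst (D.V J) (B I) * num X (D.tau2 I J H.R) * inSecond (D.V I) (B J)) p q)
      (fuse c B I J p q)
  | exchange (I J : ι) (p q : D.V I × D.V J) : HandleRel c A B
      ((num X (D.tau2 I J ((H.R⁻¹ : (G ⊗[ℂ] G)ˣ) : G ⊗[ℂ] G)) * inFirst (D.V J) (A I) *
        num X (D.tau2 I J H.R) * inSecond (D.V I) (B J)) p q)
      ((inSecond (D.V I) (B J) * num X (D.tau2 I J H.R') * inFirst (D.V J) (A I) *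
        num X (D.tau2 I J H.R)) p q)

theorem num_map {X Y : Type*} [Ring X] [Algebra ℂ X] [Ring Y] [Algebra ℂ Y] (f : X →ₐ[ℂ] Y)
    {m n : Type*} (M : Matrix m n ℂ) : (num X M).map f = num Y M := by
  ext; simp

theorem inFirst_map {X Y : Type*} [Ring X] [Algebra ℂ X] [Ring Y] [Algebra ℂ Y] (f : X →ₐ[ℂ] Y)
    (m' : Type*) [DecidableEq m'] {m : Type*} (M : Matrix m m X) :
    (inFirst m' M).map f = inFirst m' (M.map f) := by
  ext p q; by_cases h : p.2 = q.2 <;> simp [h]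

theorem inSecond_map {X Y : Type*} [Ring X] [Algebra ℂ X] [Ring Y] [Algebra ℂ Y] (f : X →ₐ[ℂ] Y)
    (m' : Type*) [DecidableEq m'] {m : Type*} (M : Matrix m m X) :
    (inSecond m' M).map f = inSecond m' (M.map f) := by
  ext p q; by_cases h : p.1 = q.1 <;> simp [h]

theorem fuse_map (c : ClebschGordan H D) {X Y : Type*} [Ring X] [Algebra ℂ X] [Ring Y]
    [Algebra ℂ Y] (f : X →ₐ[ℂ] Y) (M : ∀ I, Matrix (D.V I) (D.V I) X) (I J : ι) :
    (fuse c M I J).map f = fuse c (fun K => (M K).map f) I J := by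
  ext p q
  simp only [fuse, Matrix.map_apply, Matrix.sum_apply, map_sum]
  refine Finset.sum_congr rfl fun K _ => Finset.sum_congr rfl fun a _ => ?_
  rw [← Matrix.map_apply (f := f), Matrix.map_mul, Matrix.map_mul, num_map, num_map]

theorem HandleRel.map {c : ClebschGordan H D} {X Y : Type*} [Ring X] [Algebra ℂ X] [Ring Y]
    [Algebra ℂ Y] (f : X →ₐ[ℂ] Y) {A B : ∀ I, Matrix (D.V I) (D.V I) X} {x y : X}
    (h : HandleRel c A B x y) :
    HandleRel c (fun I => (A I).map f) (fun I => (B I).map f) (f x) (f y) := by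
  cases h with
  | unit_A a b =>
      have := HandleRel.unit_A (c := c) (A := fun I => (A I).map f) (B := fun I => (B I).map f) a b
      rw [← Matrix.map_one f (map_zero f) (map_one f)] at this
      exact this
  | unit_B a b =>
      have := HandleRel.unit_B (c := c) (A := fun I => (A I).map f) (B := fun I => (B I).map f) a b
      rw [← Matrix.map_one f (map_zero f) (map_one f)] at this
      exact this
  | fun_A I J p q =>
      have := HandleRel.fun_A (c := c) (A := fun I => (A I).map f) (B := fun I => (B I).map f)
        I J p q
      rw [← fuse_map, ← inFirst_map, ← inSecond_map, ← num_map f, ← Matrix.map_mul,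
        ← Matrix.map_mul] at this
      exact this
  | fun_B I J p q =>
      have := HandleRel.fun_B (c := c) (A := fun I => (A I).map f) (B := fun I => (B I).map f)
        I J p q
      rw [← fuse_map, ← inFirst_map, ← inSecond_map, ← num_map f, ← Matrix.map_mul,
        ← Matrix.map_mul] at this
      exact this
  | exchange I J p q =>
      have := HandleRel.exchange (c := c) (A := fun I => (A I).map f) (B := fun I => (B I).map f)
        I J p q
      simp only [← inFirst_map, ← inSecond_map, ← num_map f, ← Matrix.map_mul] at this
      exact this

variable (D) in
/-- Labels of the matrix entries `A^I_{ab}` (left) and `B^I_{ab}` (right). -/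
abbrev Gen : Type v := (Σ I : ι, D.V I × D.V I) ⊕ (Σ I : ι, D.V I × D.V I)

/-- The handle algebra `T = L_{1,0}`: generated by the entries of `A^I`, `B^I`. -/
abbrev Handle (c : ClebschGordan H D) : Type v :=
  RingQuot (HandleRel c (X := FreeAlgebra ℂ (Gen D))
    (fun I => Matrix.of fun a b => FreeAlgebra.ι ℂ (Sum.inl ⟨I, a, b⟩))
    (fun I => Matrix.of fun a b => FreeAlgebra.ι ℂ (Sum.inr ⟨I, a, b⟩)))

/-- The monodromy `A^I`, with entries in the handle algebra. -/
def Handle.A (c : ClebschGordan H D) (I : ι) : Matrix (D.V I) (D.V I) (Handle c) :=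
  Matrix.of fun a b => RingQuot.mkAlgHom ℂ _ (FreeAlgebra.ι ℂ (Sum.inl ⟨I, a, b⟩))

/-- The monodromy `B^I`, with entries in the handle algebra. -/
def Handle.B (c : ClebschGordan H D) (I : ι) : Matrix (D.V I) (D.V I) (Handle c) :=
  Matrix.of fun a b => RingQuot.mkAlgHom ℂ _ (FreeAlgebra.ι ℂ (Sum.inr ⟨I, a, b⟩))

/-- The subalgebra `L(A)` of the handle algebra generated by the entries of the `A^I`. -/
def Handle.LA (c : ClebschGordan H D) : Subalgebra ℂ (Handle c) :=
  Algebra.adjoin ℂ {x | ∃ I a b, x = Handle.A c I a b}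

/-- The defining relations of the semi-direct product of the handle algebra and `G`: the relations
of the handle algebra, the relations of `G`, and the covariance relations
`μ^I(ξ) A^I = A^I μ^I(ξ)`, `μ^I(ξ) B^I = B^I μ^I(ξ)`. Here `j x` is the generator assigned
to `x ∈ G`. -/
inductive SemiRel (c : ClebschGordan H D) {X : Type*} [Ring X] [Algebra ℂ X]
    (A B : ∀ I, Matrix (D.V I) (D.V I) X) (j : G → X) : X → X → Prop
  | handle {x y : X} : HandleRel c A B x y → SemiRel c A B j x y
  | add (x y : G) : SemiRel c A B j (j (x + y)) (j x + j y)
  | smul (r : ℂ) (x : G) : SemiRel c A B j (j (r • x)) (r • j x)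
  | one : SemiRel c A B j (j 1) 1
  | mul (x y : G) : SemiRel c A B j (j (x * y)) (j x * j y)
  | cov_A (x : G) (I : ι) (a b : D.V I) :
      SemiRel c A B j (((D.mu I x).map j * A I) a b) ((A I * (D.mu I x).map j) a b)
  | cov_B (x : G) (I : ι) (a b : D.V I) :
      SemiRel c A B j (((D.mu I x).map j * B I) a b) ((B I * (D.mu I x).map j) a b)

/-- The semi-direct product `T ⋊ G` of the handle algebra and `G`. -/
abbrev Semi (c : ClebschGordan H D) : Type (max u v) :=
  RingQuot (SemiRel c (X := FreeAlgebra ℂ (Gen D ⊕ G))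
    (fun I => Matrix.of fun a b => FreeAlgebra.ι ℂ (Sum.inl (Sum.inl ⟨I, a, b⟩)))
    (fun I => Matrix.of fun a b => FreeAlgebra.ι ℂ (Sum.inl (Sum.inr ⟨I, a, b⟩)))
    (fun x => FreeAlgebra.ι ℂ (Sum.inr x)))

namespace Semi

/-- The monodromy `A^I`, with entries in the semi-direct product. -/
def A (c : ClebschGordan H D) (I : ι) : Matrix (D.V I) (D.V I) (Semi c) :=
  Matrix.of fun a b => RingQuot.mkAlgHom ℂ _ (FreeAlgebra.ι ℂ (Sum.inl (Sum.inl ⟨I, a, b⟩)))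

/-- The monodromy `B^I`, with entries in the semi-direct product. -/
def B (c : ClebschGordan H D) (I : ι) : Matrix (D.V I) (D.V I) (Semi c) :=
  Matrix.of fun a b => RingQuot.mkAlgHom ℂ _ (FreeAlgebra.ι ℂ (Sum.inl (Sum.inr ⟨I, a, b⟩)))

/-- The element of the semi-direct product given by `ξ ∈ G`. -/
def ofG (c : ClebschGordan H D) (x : G) : Semi c :=
  RingQuot.mkAlgHom ℂ _ (FreeAlgebra.ι ℂ (Sum.inr x))

/-- The homomorphism `T → T ⋊ G`, `A^I ↦ A^I`, `B^I ↦ B^I`. -/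
def ofHandle (c : ClebschGordan H D) : Handle c →ₐ[ℂ] Semi c :=
  RingQuot.liftAlgHom ℂ
    ⟨FreeAlgebra.lift ℂ (Sum.elim (fun i => A c i.1 i.2.1 i.2.2) (fun i => B c i.1 i.2.1 i.2.2)),
      by
        intro x y h
        have key : FreeAlgebra.lift ℂ (Sum.elim (fun i => A c i.1 i.2.1 i.2.2)
              (fun i => B c i.1 i.2.1 i.2.2)) =
            (RingQuot.mkAlgHom ℂ _).comp (FreeAlgebra.lift ℂ
              (fun i : Gen D => FreeAlgebra.ι ℂ (Sum.inl i : Gen D ⊕ G))) := by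
          ext i
          rcases i with i | i <;> simp [A, B]
        rw [key]
        have h' := h.map (FreeAlgebra.lift ℂ
              (fun i : Gen D => FreeAlgebra.ι ℂ (Sum.inl i : Gen D ⊕ G)))
        have eA : ∀ I : ι, (Matrix.of fun a b : D.V I => FreeAlgebra.ι ℂ
              (Sum.inl ⟨I, a, b⟩ : Gen D)).map (FreeAlgebra.lift ℂ
              (fun i : Gen D => FreeAlgebra.ι ℂ (Sum.inl i : Gen D ⊕ G))) =
            Matrix.of fun a b : D.V I => FreeAlgebra.ι ℂ (Sum.inl (Sum.inl ⟨I, a, b⟩)) := by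
          intro I; ext a b; simp
        have eB : ∀ I : ι, (Matrix.of fun a b : D.V I => FreeAlgebra.ι ℂ
              (Sum.inr ⟨I, a, b⟩ : Gen D)).map (FreeAlgebra.lift ℂ
              (fun i : Gen D => FreeAlgebra.ι ℂ (Sum.inl i : Gen D ⊕ G))) =
            Matrix.of fun a b : D.V I => FreeAlgebra.ι ℂ (Sum.inl (Sum.inr ⟨I, a, b⟩)) := by
          intro I; ext a b; simp
        simp only [eA, eB] at h'
        exact RingQuot.mkAlgHom_rel ℂ (SemiRel.handle h')⟩

theorem ofHandle_A (c : ClebschGordan H D) (I : ι) (a b : D.V I) :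
    ofHandle c (Handle.A c I a b) = A c I a b := by
  simp [ofHandle, Handle.A]

theorem ofHandle_B (c : ClebschGordan H D) (I : ι) (a b : D.V I) :
    ofHandle c (Handle.B c I a b) = B c I a b := by
  simp [ofHandle, Handle.B]

/-- The subalgebra `L(A) ⋊ G` of `T ⋊ G`, generated by the entries of the `A^I` and by `G`. -/
def LAG (c : ClebschGordan H D) : Subalgebra ℂ (Semi c) :=
  Algebra.adjoin ℂ ({x | ∃ I a b, x = A c I a b} ∪ Set.range (ofG c))

/-- `A^I_{ab} ξ` as an element of `L(A) ⋊ G`. -/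
def LAG.monomial (c : ClebschGordan H D) (I : ι) (a b : D.V I) (x : G) : LAG c :=
  ⟨A c I a b * ofG c x, (LAG c).mul_mem
    (Algebra.subset_adjoin (Or.inl ⟨I, a, b, rfl⟩))
    (Algebra.subset_adjoin (Or.inr ⟨x, rfl⟩))⟩

end Semi

/-- `st` is the *-operation of `T ⋊ G`: an antilinear anti-multiplicative involution which extends
the one of `G` and satisfies `(A^I)* = κ⁻¹ R^I (A^I)⁻¹ (R⁻¹)^I κ`, and the same for `B^I`. Here
`R^I = (τ^I ⊗ id)(R)`, and `*` acts on `End(V^I) ⊗ (T ⋊ G)` in both factors. -/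
structure IsHandleStar (c : ClebschGordan H D) (st : Semi c → Semi c) : Prop where
  add : ∀ x y, st (x + y) = st x + st y
  smul : ∀ (r : ℂ) x, st (r • x) = conj r • st x
  mul : ∀ x y, st (x * y) = st y * st x
  invol : ∀ x, st (st x) = x
  ofG : ∀ x : G, st (Semi.ofG c x) = Semi.ofG c (star x)
  A : ∀ I, ∃ A' : Matrix (D.V I) (D.V I) (Semi c),
    Semi.A c I * A' = 1 ∧ A' * Semi.A c I = 1 ∧
    ∀ a b, st (Semi.A c I b a) = Semi.ofG c ((c.κel⁻¹ : Gˣ) : G) *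
      ((D.tauId I H.R).map (Semi.ofG c) * A' *
        (D.tauId I ((H.R⁻¹ : (G ⊗[ℂ] G)ˣ) : G ⊗[ℂ] G)).map (Semi.ofG c)) a b *
      Semi.ofG c (c.κel : G)
  B : ∀ I, ∃ B' : Matrix (D.V I) (D.V I) (Semi c),
    Semi.B c I * B' = 1 ∧ B' * Semi.B c I = 1 ∧
    ∀ a b, st (Semi.B c I b a) = Semi.ofG c ((c.κel⁻¹ : Gˣ) : G) *
      ((D.tauId I H.R).map (Semi.ofG c) * B' *
        (D.tauId I ((H.R⁻¹ : (G ⊗[ℂ] G)ˣ) : G ⊗[ℂ] G)).map (Semi.ofG c)) a b *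
      Semi.ofG c (c.κel : G)

/-- `ω` is the integral `ω_A` on `L(A) ⋊ G`: `ω_A(A^I_{ab} ξ) = δ_{I,0} ε(ξ)`. (For `I = 0` the
matrix `A^0` has one entry.) -/
def IsIntegralA (c : ClebschGordan H D) (ω : Semi.LAG c →ₗ[ℂ] ℂ) : Prop :=
  ∀ (I : ι) (a b : D.V I) (x : G), ω (Semi.LAG.monomial c I a b x) =
    if I = D.zero then Coalgebra.counit (R := ℂ) x else 0

variable (D) in
/-- The space `ℜ = ⊕_I End(V^I)` (a finite direct sum). -/
abbrev Reg : Type v := ∀ I : ι, Matrix (D.V I) (D.V I) ℂ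

/-- `|w⟩` is a nonzero cyclic vector of the representation `ρ` of the handle algebra with
`ρ(B^I)|w⟩ = |w⟩ κ_I⁻¹` (that is, `ρ(B^I_{ab})|w⟩ = δ_{ab} κ_I⁻¹ |w⟩`). -/
structure IsVacuum (c : ClebschGordan H D) {W : Type*} [AddCommGroup W] [Module ℂ W]
    (ρ : Handle c →ₐ[ℂ] Module.End ℂ W) (w : W) : Prop where
  ne_zero : w ≠ 0
  cyclic : ∀ x : W, ∃ t : Handle c, ρ t w = x
  B_apply : ∀ (I : ι) (a b : D.V I), ρ (Handle.B c I a b) w =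
    if a = b then (c.κ I)⁻¹ • w else 0

end Handle

end HandleAlg

end

/-! The representations `τ^I` identify `G` with `⊕ End(V^I)`, so a family of matrices `A^I` over an
algebra `X` is one element of `G ⊗ X`. For the rescaled element `M = κ⁻¹A` (`datum`) the
normalization of the Clebsch-Gordan maps removes the sum over them, and functoriality becomes `R₂₁
M₁₃ R₁₂ M₂₃ = (Δ ⊗ id)M` together with `(ε ⊗ id)M = 1` (`IsFus`). From then on the work is done with
the hexagon identities, quasi-triangularity and the Yang-Baxter equation, in arbitrary commuting
legs.

Structure of `T`. The element `v₁⁻¹R'R` of `G ⊗ G` solves the functoriality relations (`isFus_Qv`).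
Invertibility of the S-matrix makes the contractions of `R'R` exhaust `G` (`ct_Q_surjective`): a
combination of quantum traces contracts to the Haar integral, and the contractions of the co-product
of the Haar integral span `G`. Hence `v₁⁻¹R'R` is the universal solution: every other one is its
image under an algebra homomorphism from `G` (`IsFus.exists_hom`). The subalgebras generated by the
`A^I` and by the `B^I` are therefore quotients of `G`. The exchange relation moves all `A` to the
left of all `B`, so the dimension of `T` is at most `(dim G)²`.

The representation. It is built on the functionals on `G`, a copy of `ℜ`, with ground state `ε`. `B`
is the universal solution with its second leg acting by left translations. `A` is multiplication of
functionals, dressed by R-matrices in the left and right translations. These translations act on `ε`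
through the co-unit, so the dressing disappears there: `A` creates every functional from `ε`, and
`B` has the eigenvalue `v⁻¹`, which is `κ_I⁻¹` after undoing the rescaling. Some element of the
algebra of the `B^I` acts as the Haar integral, that is, as a projection onto `ε`. Between a
contraction of `A` and one of `A⁻¹` it yields every operator of rank one, so `π` is onto all
operators (`piD_surjective`). The dimension bound makes it injective, and irreducibility follows.
Normal ordering expresses any cyclic ground state through the `A^I` alone, which gives uniqueness.

The *-operation. An antilinear anti-homomorphism is a homomorphism to the conjugate opposite
algebra, so its existence means that `κ⁻¹RM⁻¹R⁻¹κ` satisfies the conjugated relations; this is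
computed in the group of units. Applied twice, the operation conjugates `M` by `v₁Δ(v)⁻¹`, because
`R'R Δ(v) = v ⊗ v` and `κ² = v`. Covariance and centrality of `v` show that this conjugation is
trivial.

The scalar product. The vacuum expectation value is evaluation at the Haar integral after acting on
`ε`. It is invariant under translations, which makes the expectation value of `X*Y` computable: it
is a sum over `I` of a weight times the trace form of the two functionals, with `Ω = (κ ⊗
κ)R'⁻¹Δ(κ⁻¹)` inserted. In `V^I ⊗ V^J` the element `Ω` is `∑ C*C`, hence positive
(`exists_Om_sqrt`). The weights are positive because the trace form with `Ω` is nonnegative on the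
quantum traces, where it can be evaluated (`weight_pos`). -/

set_option linter.unusedSectionVars false

noncomputable section

namespace HandleAlg

/-! ### Leg calculus -/

section Leg

variable {P X Y Z : Type*} [Ring P] [Algebra ℂ P] [Ring X] [Algebra ℂ X] [Ring Y] [Algebra ℂ Y]
  [Ring Z] [Algebra ℂ Z]

/-- Two homomorphisms with commuting images. -/
def Cm (f : P →ₐ[ℂ] Y) (k : X →ₐ[ℂ] Y) : Prop := ∀ x y, Commute (f x) (k y)

theorem Cm.symm {f : P →ₐ[ℂ] Y} {k : X →ₐ[ℂ] Y} (h : Cm f k) : Cm k f := fun x y => (h y x).symm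

theorem Cm.map {f : P →ₐ[ℂ] Y} {k : X →ₐ[ℂ] Y} (h : Cm f k) (φ : Y →ₐ[ℂ] Z) :
    Cm (φ.comp f) (φ.comp k) := fun x y => (h x y).map φ

/-- `x ⊗ a ↦ f x * k a`. -/
def leg (f : P →ₐ[ℂ] Y) (k : X →ₐ[ℂ] Y) : P ⊗[ℂ] X →ₗ[ℂ] Y :=
  LinearMap.mul' ℂ Y ∘ₗ TensorProduct.map f.toLinearMap k.toLinearMap

@[simp] theorem leg_tmul (f : P →ₐ[ℂ] Y) (k : X →ₐ[ℂ] Y) (x : P) (a : X) :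
    leg f k (x ⊗ₜ a) = f x * k a := rfl

@[simp] theorem leg_one (f : P →ₐ[ℂ] Y) (k : X →ₐ[ℂ] Y) : leg f k 1 = 1 := by
  simp [Algebra.TensorProduct.one_def]

theorem map_leg (φ : Y →ₐ[ℂ] Z) (f : P →ₐ[ℂ] Y) (k : X →ₐ[ℂ] Y) (z : P ⊗[ℂ] X) :
    φ (leg f k z) = leg (φ.comp f) (φ.comp k) z := by
  induction z with
  | zero => simp
  | tmul x y => simp
  | add x y hx hy => simp [hx, hy]

theorem Cm.leg_mul {f : P →ₐ[ℂ] Y} {k : X →ₐ[ℂ] Y} (h : Cm f k) (z w : P ⊗[ℂ] X) :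
    leg f k (z * w) = leg f k z * leg f k w := by
  induction z with
  | zero => simp
  | add x y hx hy => simp [hx, hy, add_mul]
  | tmul x y =>
    induction w with
    | zero => simp
    | add x y hx hy => simp [hx, hy, mul_add]
    | tmul x' y' =>
      simp only [Algebra.TensorProduct.tmul_mul_tmul, leg_tmul, map_mul]
      rw [mul_assoc, mul_assoc, ← mul_assoc (f x'), (h x' y).eq, mul_assoc]

theorem leg_eq_lift {f : P →ₐ[ℂ] Y} {k : X →ₐ[ℂ] Y} (h : Cm f k) (z : P ⊗[ℂ] X) :
    leg f k z = Algebra.TensorProduct.lift f k h z := by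
  induction z with
  | zero => simp
  | tmul x y => exact (Algebra.TensorProduct.lift_tmul f k h x y).symm
  | add x y hx hy => simp [hx, hy]

theorem Cm.leg_comm {f : P →ₐ[ℂ] Y} {k : X →ₐ[ℂ] Y} (h : Cm f k) (z : P ⊗[ℂ] X) :
    leg k f (Algebra.TensorProduct.comm ℂ P X z) = leg f k z := by
  induction z with
  | zero => simp
  | tmul x y => simp [(h x y).eq]
  | add x y hx hy => simp [hx, hy]

/-- Commutation with an R-matrix, or with `M` in two legs, is always checked one leg at a time by
this lemma. -/
theorem leg_semiconj {m : Y} {f f' : P →ₐ[ℂ] Y} {k k' : X →ₐ[ℂ] Y}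
    (hf : ∀ x, SemiconjBy m (f x) (f' x)) (hk : ∀ y, SemiconjBy m (k y) (k' y)) (z : P ⊗[ℂ] X) :
    SemiconjBy m (leg f k z) (leg f' k' z) := by
  induction z with
  | zero => simp
  | tmul x y => exact (hf x).mul_right (hk y)
  | add x y hx hy => simpa using hx.add_right hy

theorem commute_leg {m : Y} {f : P →ₐ[ℂ] Y} {k : X →ₐ[ℂ] Y}
    (hf : ∀ x, Commute m (f x)) (hk : ∀ y, Commute m (k y)) (z : P ⊗[ℂ] X) :
    Commute m (leg f k z) := leg_semiconj hf hk z

theorem Cm.leg_units {f : P →ₐ[ℂ] Y} {k : X →ₐ[ℂ] Y} (h : Cm f k) (U : (P ⊗[ℂ] X)ˣ) :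
    leg f k (U : P ⊗[ℂ] X) * leg f k ((U⁻¹ : (P ⊗[ℂ] X)ˣ) : P ⊗[ℂ] X) = 1 := by
  rw [← h.leg_mul]; simp

/-- The image of a unit of `P ⊗ X`. -/
def Cm.unit {f : P →ₐ[ℂ] Y} {k : X →ₐ[ℂ] Y} (h : Cm f k) (U : (P ⊗[ℂ] X)ˣ) : Yˣ where
  val := leg f k (U : P ⊗[ℂ] X)
  inv := leg f k ((U⁻¹ : (P ⊗[ℂ] X)ˣ) : P ⊗[ℂ] X)
  val_inv := h.leg_units U
  inv_val := by simpa using h.leg_units U⁻¹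

/-- Contraction of the first factor with a functional. -/
def ct (f : Module.Dual ℂ P) : P ⊗[ℂ] X →ₗ[ℂ] X :=
  (TensorProduct.lid ℂ X).toLinearMap ∘ₗ TensorProduct.map f LinearMap.id

@[simp] theorem ct_tmul (f : Module.Dual ℂ P) (x : P) (a : X) : ct f (x ⊗ₜ[ℂ] a) = f x • a := by
  simp [ct]

theorem ct_add_left (f g : Module.Dual ℂ P) (z : P ⊗[ℂ] X) :
    ct (f + g) z = ct f z + ct g z := by
  induction z with
  | zero => simp
  | tmul x y => simp [add_smul]
  | add x y hx hy => simp only [map_add, hx, hy]; abel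

theorem ct_smul_left (c : ℂ) (f : Module.Dual ℂ P) (z : P ⊗[ℂ] X) :
    ct (c • f) z = c • ct f z := by
  induction z with
  | zero => simp
  | tmul x y => simp [mul_smul]
  | add x y hx hy => simp [hx, hy]

/-- The contractions of a tensor, as a linear map of the functional. -/
def ctL (z : P ⊗[ℂ] X) : Module.Dual ℂ P →ₗ[ℂ] X where
  toFun f := ct f z
  map_add' f g := ct_add_left f g z
  map_smul' c f := ct_smul_left c f z

@[simp] theorem ctL_apply (z : P ⊗[ℂ] X) (f : Module.Dual ℂ P) : ctL z f = ct f z := rfl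

theorem map_ct (φ : X →ₗ[ℂ] Y) (f : Module.Dual ℂ P) (z : P ⊗[ℂ] X) :
    φ (ct f z) = ct f (TensorProduct.map LinearMap.id φ z) := by
  induction z with
  | zero => simp
  | tmul x y => simp
  | add x y hx hy => simp [hx, hy]

theorem sum_basis_ct {κ : Type*} [Fintype κ] [DecidableEq κ] (b : Module.Basis κ ℂ P)
    (z : P ⊗[ℂ] X) :
    ∑ i, b i ⊗ₜ[ℂ] ct (b.coord i) z = z := by
  induction z with
  | zero => simp
  | tmul x y =>
    simp only [ct_tmul, ← TensorProduct.smul_tmul]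
    rw [← TensorProduct.sum_tmul]
    congr 1
    simp [b.sum_repr x]
  | add x y hx hy => simp [TensorProduct.tmul_add, Finset.sum_add_distrib, hx, hy]

theorem ct_ext [FiniteDimensional ℂ P] {z w : P ⊗[ℂ] X} (h : ∀ f, ct f z = ct f w) : z = w := by
  classical
  have b := Module.finBasis ℂ P
  rw [← sum_basis_ct b z, ← sum_basis_ct b w]
  simp [h]

end Leg

/-! ### Convolution, the antipode, and the three legs of a tensor product. -/

section Convolution

variable {G : Type u} [Ring G] [HopfAlgebra ℂ G]
  {X Y Z : Type*} [Ring X] [Algebra ℂ X] [Ring Y] [Algebra ℂ Y] [Ring Z] [Algebra ℂ Z]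

/-- The convolution `x ↦ ∑ a(x₁) b(x₂)` of two linear maps. -/
def cvL (a b : G →ₗ[ℂ] Y) : G →ₗ[ℂ] Y :=
  (WithConv.toConv a * WithConv.toConv b).ofConv

theorem cvL_eq (a b : G →ₗ[ℂ] Y) (x : G) : cvL a b x =
    LinearMap.mul' ℂ Y (TensorProduct.map a b (Coalgebra.comul (R := ℂ) x)) := rfl

theorem cvL_assoc (a b c : G →ₗ[ℂ] Y) : cvL (cvL a b) c = cvL a (cvL b c) := by
  simp [cvL, mul_assoc]

/-- `x ↦ ε(x) 1`. -/
def epsL (Y : Type*) [Ring Y] [Algebra ℂ Y] : G →ₗ[ℂ] Y :=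
  Algebra.linearMap ℂ Y ∘ₗ Coalgebra.counit

@[simp] theorem epsL_apply (x : G) :
    epsL Y x = algebraMap ℂ Y (Coalgebra.counit (R := ℂ) x) := rfl

@[simp] theorem cvL_eps (a : G →ₗ[ℂ] Y) : cvL a (epsL Y) = a := by
  have : WithConv.toConv (epsL (G := G) Y) = 1 := rfl
  simp [cvL, this]

@[simp] theorem eps_cvL (a : G →ₗ[ℂ] Y) : cvL (epsL Y) a = a := by
  have : WithConv.toConv (epsL (G := G) Y) = 1 := rfl
  simp [cvL, this]

theorem cvL_antipode_left (f : G →ₐ[ℂ] Y) :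
    cvL (f.toLinearMap ∘ₗ HopfAlgebra.antipode ℂ) f.toLinearMap = epsL Y := by
  ext x
  rw [cvL_eq, epsL_apply, ← AlgHom.commutes f,
    ← HopfAlgebra.mul_antipode_rTensor_comul_apply (R := ℂ) x]
  induction Coalgebra.comul (R := ℂ) x with
  | zero => simp
  | tmul x y => simp
  | add x y hx hy => simp only [map_add, hx, hy]

theorem cvL_antipode_right (f : G →ₐ[ℂ] Y) :
    cvL f.toLinearMap (f.toLinearMap ∘ₗ HopfAlgebra.antipode ℂ) = epsL Y := by
  ext x
  rw [cvL_eq, epsL_apply, ← AlgHom.commutes f,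
    ← HopfAlgebra.mul_antipode_lTensor_comul_apply (R := ℂ) x]
  induction Coalgebra.comul (R := ℂ) x with
  | zero => simp
  | tmul x y => simp
  | add x y hx hy => simp only [map_add, hx, hy]

theorem cvL_mul_left (m : Y) (a b : G →ₗ[ℂ] Y) (x : G) :
    cvL (LinearMap.mulLeft ℂ m ∘ₗ a) b x = m * cvL a b x := by
  rw [cvL_eq, cvL_eq]
  induction Coalgebra.comul (R := ℂ) x with
  | zero => simp
  | tmul x y => simp [mul_assoc]
  | add x y hx hy => simp [hx, hy, mul_add]

theorem cvL_mul_right (m : Y) (a b : G →ₗ[ℂ] Y) (x : G) :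
    cvL a (LinearMap.mulRight ℂ m ∘ₗ b) x = cvL a b x * m := by
  rw [cvL_eq, cvL_eq]
  induction Coalgebra.comul (R := ℂ) x with
  | zero => simp
  | tmul x y => simp [mul_assoc]
  | add x y hx hy => simp [hx, hy, add_mul]

/-- The convolution of two commuting homomorphisms. -/
def cv (f g : G →ₐ[ℂ] Y) (h : Cm f g) : G →ₐ[ℂ] Y :=
  (Algebra.TensorProduct.lift f g h).comp (Bialgebra.comulAlgHom ℂ G)

theorem cv_apply (f g : G →ₐ[ℂ] Y) (h : Cm f g) (x : G) :
    cv f g h x = leg f g (Coalgebra.comul (R := ℂ) x) := by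
  rw [leg_eq_lift h]; rfl

theorem cv_toLinearMap (f g : G →ₐ[ℂ] Y) (h : Cm f g) :
    (cv f g h).toLinearMap = cvL f.toLinearMap g.toLinearMap := by
  ext x; exact cv_apply f g h x

theorem cv_eq_cvL (f g : G →ₐ[ℂ] Y) (h : Cm f g) (x : G) :
    cv f g h x = cvL f.toLinearMap g.toLinearMap x := cv_apply f g h x

theorem comp_cv (φ : Y →ₐ[ℂ] Z) (f g : G →ₐ[ℂ] Y) (h : Cm f g) :
    φ.comp (cv f g h) = cv (φ.comp f) (φ.comp g) (h.map φ) := by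
  ext x; simp [cv_apply, map_leg]

theorem Cm.cv_left {f g : G →ₐ[ℂ] Y} {h : Cm f g} {k : X →ₐ[ℂ] Y} (hf : Cm f k) (hg : Cm g k) :
    Cm (cv f g h) k := fun x y => by
  rw [cv_apply]
  exact (commute_leg (fun a => (hf a y).symm) (fun b => (hg b y).symm) _).symm

theorem Cm.cv_right {f g : G →ₐ[ℂ] Y} {h : Cm f g} {k : X →ₐ[ℂ] Y} (hf : Cm k f) (hg : Cm k g) :
    Cm k (cv f g h) := (Cm.cv_left hf.symm hg.symm).symm

theorem cv_assoc (f g k : G →ₐ[ℂ] Y) (hfg : Cm f g) (hgk : Cm g k) (hfk : Cm f k) :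
    cv (cv f g hfg) k (Cm.cv_left hfk hgk) = cv f (cv g k hgk) (Cm.cv_right hfg hfk) := by
  apply AlgHom.toLinearMap_injective
  simp only [cv_toLinearMap, cvL_assoc]

/-- A homomorphism defined on `G ⊗ (G ⊗ X)` by three commuting homomorphisms. -/
def lift3 (f g : G →ₐ[ℂ] Y) (k : X →ₐ[ℂ] Y) (hfg : Cm f g) (hfk : Cm f k) (hgk : Cm g k) :
    G ⊗[ℂ] (G ⊗[ℂ] X) →ₐ[ℂ] Y :=
  Algebra.TensorProduct.lift f (Algebra.TensorProduct.lift g k hgk) fun x y => by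
    rw [← leg_eq_lift hgk]
    exact commute_leg (hfg x) (hfk x) y

theorem lift3_tmul (f g : G →ₐ[ℂ] Y) (k : X →ₐ[ℂ] Y) (hfg : Cm f g) (hfk : Cm f k) (hgk : Cm g k)
    (x y : G) (a : X) : lift3 f g k hfg hfk hgk (x ⊗ₜ (y ⊗ₜ a)) = f x * (g y * k a) := rfl

variable (G X) in
/-- The first leg of `G ⊗ (G ⊗ X)`. -/
abbrev i1 : G →ₐ[ℂ] G ⊗[ℂ] (G ⊗[ℂ] X) := Algebra.TensorProduct.includeLeft

variable (G X) in
/-- The second leg of `G ⊗ (G ⊗ X)`. -/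
abbrev i2 : G →ₐ[ℂ] G ⊗[ℂ] (G ⊗[ℂ] X) :=
  Algebra.TensorProduct.includeRight.comp Algebra.TensorProduct.includeLeft

variable (G X) in
/-- The third leg of `G ⊗ (G ⊗ X)`. -/
abbrev i3 : X →ₐ[ℂ] G ⊗[ℂ] (G ⊗[ℂ] X) :=
  Algebra.TensorProduct.includeRight.comp Algebra.TensorProduct.includeRight

theorem cm_i12 : Cm (i1 G X) (i2 G X) := fun x y => by simp [commute_iff_eq]
theorem cm_i13 : Cm (i1 G X) (i3 G X) := fun x y => by simp [commute_iff_eq]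
theorem cm_i23 : Cm (i2 G X) (i3 G X) := fun x y => by simp [commute_iff_eq]

/-- An identity proved once in the legs of `G ⊗ (G ⊗ X)` is carried by `lift3` to any three
commuting homomorphisms; these rules tell where each leg goes. -/
theorem lift3_i1 (f g : G →ₐ[ℂ] Y) (k : X →ₐ[ℂ] Y) (hfg : Cm f g) (hfk : Cm f k) (hgk : Cm g k) :
    (lift3 f g k hfg hfk hgk).comp (i1 G X) = f := by
  ext x; exact (lift3_tmul f g k hfg hfk hgk _ _ _).trans (by simp)

theorem lift3_i2 (f g : G →ₐ[ℂ] Y) (k : X →ₐ[ℂ] Y) (hfg : Cm f g) (hfk : Cm f k) (hgk : Cm g k) :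
    (lift3 f g k hfg hfk hgk).comp (i2 G X) = g := by
  ext x; exact (lift3_tmul f g k hfg hfk hgk _ _ _).trans (by simp)

theorem lift3_i3 (f g : G →ₐ[ℂ] Y) (k : X →ₐ[ℂ] Y) (hfg : Cm f g) (hfk : Cm f k) (hgk : Cm g k) :
    (lift3 f g k hfg hfk hgk).comp (i3 G X) = k := by
  ext x; exact (lift3_tmul f g k hfg hfk hgk _ _ _).trans (by simp)

/-- The antipode reverses the co-product. -/
theorem comul_antipode (x : G) : Coalgebra.comul (R := ℂ) (HopfAlgebra.antipode ℂ x) =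
    cvL ((Algebra.TensorProduct.includeRight : G →ₐ[ℂ] G ⊗[ℂ] G).toLinearMap ∘ₗ
        HopfAlgebra.antipode ℂ)
      ((Algebra.TensorProduct.includeLeft : G →ₐ[ℂ] G ⊗[ℂ] G).toLinearMap ∘ₗ
        HopfAlgebra.antipode ℂ) x := by
  set a : G →ₐ[ℂ] G ⊗[ℂ] G := Algebra.TensorProduct.includeLeft
  set b : G →ₐ[ℂ] G ⊗[ℂ] G := Algebra.TensorProduct.includeRight
  have hd : (Coalgebra.comul : G →ₗ[ℂ] G ⊗[ℂ] G) = cvL a.toLinearMap b.toLinearMap := by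
    ext x
    rw [cvL_eq]
    induction Coalgebra.comul (R := ℂ) x with
    | zero => simp
    | tmul x y => simp [a, b]
    | add x y hx hy => simpa using congrArg₂ (· + ·) hx hy
  -- Uniqueness of convolution inverses: `Δ ∘ S` is a right inverse of `Δ`, and `bS * aS` is a left
  -- inverse because `Δ = a * b`.
  have h1 : cvL (Coalgebra.comul : G →ₗ[ℂ] G ⊗[ℂ] G)
      (Coalgebra.comul ∘ₗ HopfAlgebra.antipode ℂ) = epsL _ := 
    cvL_antipode_right (Bialgebra.comulAlgHom ℂ G)
  set bS := b.toLinearMap ∘ₗ HopfAlgebra.antipode ℂ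
  set aS := a.toLinearMap ∘ₗ HopfAlgebra.antipode ℂ
  have h2 : cvL (cvL bS aS) Coalgebra.comul = epsL (G ⊗[ℂ] G) := by
    rw [hd, cvL_assoc, ← cvL_assoc aS, cvL_antipode_left, eps_cvL, cvL_antipode_left]
  have h3 : Coalgebra.comul ∘ₗ HopfAlgebra.antipode ℂ = cvL bS aS := by
    rw [← cvL_eps (cvL bS aS), ← h1, ← cvL_assoc, h2, eps_cvL]
  exact LinearMap.congr_fun h3 x

end Convolution

/-! ### The R-matrix, the antipode and the Drinfeld element -/

section LinearLegs

variable {P X Y Z : Type*} [Ring P] [Algebra ℂ P] [Ring X] [Algebra ℂ X] [Ring Y] [Algebra ℂ Y]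
  [Ring Z] [Algebra ℂ Z]

/-- `x ⊗ a ↦ f x * k a` for linear maps. -/
def legL (f : P →ₗ[ℂ] Y) (k : X →ₗ[ℂ] Y) : P ⊗[ℂ] X →ₗ[ℂ] Y :=
  LinearMap.mul' ℂ Y ∘ₗ TensorProduct.map f k

@[simp] theorem legL_tmul (f : P →ₗ[ℂ] Y) (k : X →ₗ[ℂ] Y) (x : P) (a : X) :
    legL f k (x ⊗ₜ a) = f x * k a := rfl

theorem leg_eq_legL (f : P →ₐ[ℂ] Y) (k : X →ₐ[ℂ] Y) (z : P ⊗[ℂ] X) :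
    leg f k z = legL f.toLinearMap k.toLinearMap z := rfl

end LinearLegs

section RMatrix

variable {G : Type u} [Ring G] [HopfAlgebra ℂ G] [StarRing G] [StarModule ℂ G]
  (H : RibbonHopfStar G) {X Y Z : Type*} [Ring X] [Algebra ℂ X] [Ring Y] [Algebra ℂ Y]
  [Ring Z] [Algebra ℂ Z]

namespace RibbonHopfStar

/-- The `R`-matrix in the legs `f`, `g`. -/
def rm (f g : G →ₐ[ℂ] Y) : Y := leg f g (H.R : G ⊗[ℂ] G)

/-- The inverse `R`-matrix in the legs `f`, `g`. -/
def ri (f g : G →ₐ[ℂ] Y) : Y := leg f g ((H.R⁻¹ : (G ⊗[ℂ] G)ˣ) : G ⊗[ℂ] G)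

variable {H}

theorem map_rm (φ : Y →ₐ[ℂ] Z) (f g : G →ₐ[ℂ] Y) : φ (H.rm f g) = H.rm (φ.comp f) (φ.comp g) :=
  map_leg ..

theorem map_ri (φ : Y →ₐ[ℂ] Z) (f g : G →ₐ[ℂ] Y) : φ (H.ri f g) = H.ri (φ.comp f) (φ.comp g) :=
  map_leg ..

theorem rm_mul_ri {f g : G →ₐ[ℂ] Y} (h : Cm f g) : H.rm f g * H.ri f g = 1 := h.leg_units H.R

theorem ri_mul_rm {f g : G →ₐ[ℂ] Y} (h : Cm f g) : H.ri f g * H.rm f g = 1 := by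
  simpa [rm, ri] using h.leg_units H.R⁻¹

theorem rm_mul_ri_assoc {f g : G →ₐ[ℂ] Y} (h : Cm f g) (y : Y) :
    H.rm f g * (H.ri f g * y) = y := by rw [← mul_assoc, rm_mul_ri h, one_mul]

theorem ri_mul_rm_assoc {f g : G →ₐ[ℂ] Y} (h : Cm f g) (y : Y) :
    H.ri f g * (H.rm f g * y) = y := by rw [← mul_assoc, ri_mul_rm h, one_mul]

/-- The first hexagon identity with merely linear maps in the split leg, so that one of them may
contain the antipode. Only `b` has to be moved past `k`. -/
theorem legL_cvL_left {a b : G →ₗ[ℂ] Y} {k : G →ₐ[ℂ] Y} (hb : ∀ x y, Commute (b x) (k y)) :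
    legL (cvL a b) k.toLinearMap (H.R : G ⊗[ℂ] G) =
      legL a k.toLinearMap (H.R : G ⊗[ℂ] G) * legL b k.toLinearMap (H.R : G ⊗[ℂ] G) := by
  have h1 : ∀ z : G ⊗[ℂ] G, legL a (legL b k.toLinearMap) (comulId G z) =
      legL (cvL a b) k.toLinearMap z := by
    intro z
    induction z with
    | zero => simp
    | add x y hx hy => simp only [map_add, hx, hy]
    | tmul x y =>
      simp only [AlgHom.comp_apply, Algebra.TensorProduct.map_tmul, AlgHom.id_apply, legL_tmul,
        cvL_eq, Bialgebra.comulAlgHom_apply]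
      induction Coalgebra.comul (R := ℂ) x with
      | zero => simp
      | tmul p q => simp [mul_assoc]
      | add p q hp hq => simp only [TensorProduct.add_tmul, map_add, hp, hq, add_mul]
  have h2 : ∀ z w : G ⊗[ℂ] G, legL a (legL b k.toLinearMap) (leg13 G z * leg23 G w) =
      legL a k.toLinearMap z * legL b k.toLinearMap w := by
    intro z w
    induction z with
    | zero => simp
    | add x y hx hy => simp only [map_add, hx, hy, add_mul]
    | tmul x y =>
      induction w with
      | zero => simp
      | add p q hp hq => simp only [map_add, hp, hq, mul_add]
      | tmul p q =>
        simp only [Algebra.TensorProduct.map_tmul, AlgHom.id_apply,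
          Algebra.TensorProduct.includeRight_apply, Algebra.TensorProduct.tmul_mul_tmul, legL_tmul,
          mul_one, one_mul, AlgHom.toLinearMap_apply, map_mul]
        rw [← mul_assoc (b p), (hb p y).eq]
        simp only [mul_assoc]
  rw [← h1, H.comulId_R, h2]

theorem hexL {f g k : G →ₐ[ℂ] Y} (hfg : Cm f g) (hgk : Cm g k) :
    H.rm (cv f g hfg) k = H.rm f k * H.rm g k := by
  rw [rm, leg_eq_legL, cv_toLinearMap, legL_cvL_left (fun x y => hgk x y)]
  rfl

theorem legL_idComul (a b c : G →ₗ[ℂ] Y) (z : G ⊗[ℂ] G) :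
    legL a (legL b c) (idComul G z) = legL a (cvL b c) z := by
  induction z with
  | zero => simp
  | add x y hx hy => simp only [map_add, hx, hy]
  | tmul x y => rfl

/-- Inversion reverses the factors of the second hexagon identity. In this order the factors fit the
convention of `legL`, and only one commutation is needed in `legL_cvL_right_inv`; the identity for
`R` itself is then recovered by inverting again. -/
theorem idComul_R_inv : idComul G ((H.R⁻¹ : (G ⊗[ℂ] G)ˣ) : G ⊗[ℂ] G) =
    leg12 G ((H.R⁻¹ : (G ⊗[ℂ] G)ˣ) : G ⊗[ℂ] G) * leg13 G ((H.R⁻¹ : (G ⊗[ℂ] G)ˣ) : G ⊗[ℂ] G) := by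
  have h1 : idComul G ((H.R⁻¹ : (G ⊗[ℂ] G)ˣ) : G ⊗[ℂ] G) * idComul G (H.R : G ⊗[ℂ] G) = 1 := by
    rw [← map_mul]; simp
  have h2 : idComul G (H.R : G ⊗[ℂ] G) *
      (leg12 G ((H.R⁻¹ : (G ⊗[ℂ] G)ˣ) : G ⊗[ℂ] G) *
        leg13 G ((H.R⁻¹ : (G ⊗[ℂ] G)ˣ) : G ⊗[ℂ] G)) = 1 := by
    rw [H.idComul_R, mul_assoc, ← mul_assoc (leg12 G _), ← map_mul, Units.mul_inv, map_one,
      one_mul, ← map_mul, Units.mul_inv, map_one]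
  exact left_inv_eq_right_inv h1 h2

theorem legL_cvL_right_inv {f : G →ₐ[ℂ] Y} {b c : G →ₗ[ℂ] Y}
    (hb : ∀ x y, Commute (f x) (b y)) :
    legL f.toLinearMap (cvL b c) ((H.R⁻¹ : (G ⊗[ℂ] G)ˣ) : G ⊗[ℂ] G) =
      legL f.toLinearMap b ((H.R⁻¹ : (G ⊗[ℂ] G)ˣ) : G ⊗[ℂ] G) *
        legL f.toLinearMap c ((H.R⁻¹ : (G ⊗[ℂ] G)ˣ) : G ⊗[ℂ] G) := by
  have h2 : ∀ z w : G ⊗[ℂ] G, legL f.toLinearMap (legL b c) (leg12 G z * leg13 G w) =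
      legL f.toLinearMap b z * legL f.toLinearMap c w := by
    intro z w
    induction z with
    | zero => simp
    | add x y hx hy => simp only [map_add, hx, hy, add_mul]
    | tmul x y =>
      induction w with
      | zero => simp
      | add p q hp hq => simp only [map_add, hp, hq, mul_add]
      | tmul p q =>
        simp only [Algebra.TensorProduct.map_tmul, AlgHom.id_apply,
          Algebra.TensorProduct.includeRight_apply, Algebra.TensorProduct.includeLeft_apply,
          Algebra.TensorProduct.tmul_mul_tmul, legL_tmul,
          mul_one, one_mul, AlgHom.toLinearMap_apply, map_mul]
        rw [mul_assoc, mul_assoc, ← mul_assoc (f p), (hb p y).eq, mul_assoc]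
  rw [← legL_idComul, idComul_R_inv, h2]

/-- The sandwich form of the second hexagon identity. -/
theorem legL_cvL_right (f : G →ₐ[ℂ] Y) (b c : G →ₗ[ℂ] Y) (z : G ⊗[ℂ] G)
    (h : idComul G z = leg13 G z * leg12 G z) :
    legL f.toLinearMap (cvL b c) z =
      legL f.toLinearMap (legL b c) (leg13 G z * leg12 G z) := by
  rw [← h, legL_idComul]

theorem hexR {f g k : G →ₐ[ℂ] Y} (hgk : Cm g k) (hfg : Cm f g) (hfk : Cm f k) :
    H.rm f (cv g k hgk) = H.rm f k * H.rm f g := by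
  have e : H.ri f (cv g k hgk) = H.ri f g * H.ri f k := by
    rw [ri, leg_eq_legL, cv_toLinearMap, legL_cvL_right_inv (fun x y => hfg x y)]
    rfl
  have h1 : H.rm f (cv g k hgk) * (H.ri f g * H.ri f k) = 1 := by
    rw [← e, rm_mul_ri (Cm.cv_right hfg hfk)]
  have h2 : H.ri f g * H.ri f k * (H.rm f k * H.rm f g) = 1 := by
    rw [mul_assoc, ri_mul_rm_assoc hfk, ri_mul_rm hfg]
  exact left_inv_eq_right_inv h1 h2

theorem ri_hexR {f g k : G →ₐ[ℂ] Y} (hgk : Cm g k) (hfg : Cm f g) :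
    H.ri f (cv g k hgk) = H.ri f g * H.ri f k := by
  rw [ri, leg_eq_legL, cv_toLinearMap, legL_cvL_right_inv (fun x y => hfg x y)]
  rfl

theorem ri_hexL {f g k : G →ₐ[ℂ] Y} (hfg : Cm f g) (hgk : Cm g k) (hfk : Cm f k) :
    H.ri (cv f g hfg) k = H.ri g k * H.ri f k := by
  have h1 : H.ri (cv f g hfg) k * (H.rm f k * H.rm g k) = 1 := by
    rw [← hexL hfg hgk, ri_mul_rm (Cm.cv_left hfk hgk)]
  have h2 : H.rm f k * H.rm g k * (H.ri g k * H.ri f k) = 1 := by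
    rw [mul_assoc, rm_mul_ri_assoc hgk, rm_mul_ri hfk]
  exact left_inv_eq_right_inv h1 h2

theorem qtri {f g : G →ₐ[ℂ] Y} (h : Cm f g) (x : G) :
    SemiconjBy (H.rm f g) (cv f g h x) (cv g f h.symm x) := by
  rw [SemiconjBy, cv_apply, cv_apply, rm, ← h.leg_mul, H.R_comul, h.leg_mul]
  congr 1
  exact h.symm.leg_comm _

theorem rm_leg_left {f g : G →ₐ[ℂ] Y} {k : X →ₐ[ℂ] Y} (h : Cm f g) (hf : Cm f k) (hg : Cm g k)
    (z : G ⊗[ℂ] X) :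
    SemiconjBy (H.rm f g) (leg (cv f g h) k z) (leg (cv g f h.symm) k z) :=
  leg_semiconj (qtri h) (fun y => (commute_leg (fun x => (hf x y).symm)
    (fun x => (hg x y).symm) _).symm) z

/-- By the hexagon identity both triple products contain a co-product, or its opposite, in the first
leg of `R`; quasi-triangularity exchanges the two. -/
theorem yangBaxter {f g k : G →ₐ[ℂ] Y} (h : Cm f g) (hf : Cm f k) (hg : Cm g k) :
    H.rm f g * (H.rm f k * H.rm g k) = H.rm g k * (H.rm f k * H.rm f g) := by
  rw [← hexL h hg, ← mul_assoc, ← hexL h.symm hf]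
  exact (rm_leg_left h hf hg _).eq

end RibbonHopfStar

/-- The counit, as a homomorphism into an arbitrary algebra. -/
def eps (G : Type*) [Ring G] [HopfAlgebra ℂ G] (Y : Type*) [Ring Y] [Algebra ℂ Y] : G →ₐ[ℂ] Y :=
  (Algebra.ofId ℂ Y).comp (Bialgebra.counitAlgHom ℂ G)

theorem eps_apply (x : G) : eps G Y x = algebraMap ℂ Y (Coalgebra.counit (R := ℂ) x) := rfl

theorem eps_toLinearMap : (eps G Y).toLinearMap = epsL Y := rfl

theorem cm_eps (k : X →ₐ[ℂ] Y) : Cm (eps G Y) k := fun x y => by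
  rw [eps_apply]; exact Algebra.commutes _ _

theorem cv_eps_left (f : G →ₐ[ℂ] Y) : cv (eps G Y) f (cm_eps f) = f := by
  apply AlgHom.toLinearMap_injective
  rw [cv_toLinearMap, eps_toLinearMap, eps_cvL]

theorem leg_eps (k : X →ₐ[ℂ] Y) (z : G ⊗[ℂ] X) : leg (eps G Y) k z = k (ct Coalgebra.counit z) := by
  induction z with
  | zero => simp
  | tmul x y => simp [eps_apply, Algebra.smul_def]
  | add x y hx hy => simp [hx, hy]

namespace RibbonHopfStar

variable {H}

/-- The co-unit is idempotent for convolution, so the hexagon identity makes this element equal to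
its own square; it is also invertible. -/
theorem rm_eps_left (k : G →ₐ[ℂ] Y) : H.rm (eps G Y) k = 1 := by
  have h := hexL (H := H) (cm_eps (eps G Y)) (cm_eps k)
  rw [cv_eps_left] at h
  have h2 := congrArg (· * H.ri (eps G Y) k) h
  simpa [mul_assoc, rm_mul_ri (cm_eps k)] using h2.symm

theorem rm_eps_right (k : G →ₐ[ℂ] Y) : H.rm k (eps G Y) = 1 := by
  have h := hexR (H := H) (cm_eps (eps G Y)) (cm_eps k).symm (cm_eps k).symm
  rw [cv_eps_left] at h
  have h2 := congrArg (· * H.ri k (eps G Y)) h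
  simpa [mul_assoc, rm_mul_ri (cm_eps k).symm] using h2.symm

theorem ri_eps_left (k : G →ₐ[ℂ] Y) : H.ri (eps G Y) k = 1 := by
  simpa [rm_eps_left] using rm_mul_ri (H := H) (cm_eps k)

theorem ri_eps_right (k : G →ₐ[ℂ] Y) : H.ri k (eps G Y) = 1 := by
  simpa [rm_eps_right] using rm_mul_ri (H := H) (cm_eps k).symm

/-- The convolution of the antipode with `f` is the co-unit, and the co-unit leg of `R` is trivial.
The hexagon identity thus exhibits a left inverse of `R`. -/
theorem legL_antipode_left {f k : G →ₐ[ℂ] Y} (h : Cm f k) :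
    legL (f.toLinearMap ∘ₗ HopfAlgebra.antipode ℂ) k.toLinearMap (H.R : G ⊗[ℂ] G) = H.ri f k := by
  have e := legL_cvL_left (H := H) (a := f.toLinearMap ∘ₗ HopfAlgebra.antipode ℂ)
    (b := f.toLinearMap) (k := k) h
  rw [cvL_antipode_left] at e
  have e1 : legL (epsL Y) k.toLinearMap (H.R : G ⊗[ℂ] G) = 1 := rm_eps_left (H := H) k
  rw [e1] at e
  have e2 : legL f.toLinearMap k.toLinearMap (H.R : G ⊗[ℂ] G) = H.rm f k := rfl
  rw [e2] at e
  exact left_inv_eq_right_inv e.symm (rm_mul_ri h)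

theorem legL_antipode_right_inv {f k : G →ₐ[ℂ] Y} (h : Cm f k) :
    legL f.toLinearMap (k.toLinearMap ∘ₗ HopfAlgebra.antipode ℂ)
      ((H.R⁻¹ : (G ⊗[ℂ] G)ˣ) : G ⊗[ℂ] G) = H.rm f k := by
  have e := legL_cvL_right_inv (H := H) (f := f)
    (b := k.toLinearMap ∘ₗ HopfAlgebra.antipode ℂ) (c := k.toLinearMap) (fun x y => h x _)
  rw [cvL_antipode_left] at e
  have e1 : legL f.toLinearMap (epsL Y) ((H.R⁻¹ : (G ⊗[ℂ] G)ˣ) : G ⊗[ℂ] G) = 1 :=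
    ri_eps_right (H := H) f
  rw [e1] at e
  have e2 : legL f.toLinearMap k.toLinearMap ((H.R⁻¹ : (G ⊗[ℂ] G)ˣ) : G ⊗[ℂ] G) = H.ri f k := rfl
  rw [e2] at e
  exact left_inv_eq_right_inv e.symm (ri_mul_rm h)

theorem map_antipode_id_R : TensorProduct.map (HopfAlgebra.antipode ℂ) LinearMap.id
    (H.R : G ⊗[ℂ] G) = ((H.R⁻¹ : (G ⊗[ℂ] G)ˣ) : G ⊗[ℂ] G) := by
  have e := legL_antipode_left (H := H) (f := (Algebra.TensorProduct.includeLeft : G →ₐ[ℂ] G ⊗[ℂ] G))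
    (k := Algebra.TensorProduct.includeRight) (fun x y => by simp [commute_iff_eq])
  have h1 : ∀ z : G ⊗[ℂ] G, legL ((Algebra.TensorProduct.includeLeft :
      G →ₐ[ℂ] G ⊗[ℂ] G).toLinearMap ∘ₗ HopfAlgebra.antipode ℂ)
      (Algebra.TensorProduct.includeRight : G →ₐ[ℂ] G ⊗[ℂ] G).toLinearMap z =
      TensorProduct.map (HopfAlgebra.antipode ℂ) LinearMap.id z := fun z => by
    induction z with
    | zero => simp
    | tmul x y => simp
    | add x y hx hy => simp only [map_add, hx, hy]
  have h2 : ∀ z : G ⊗[ℂ] G, leg (Algebra.TensorProduct.includeLeft : G →ₐ[ℂ] G ⊗[ℂ] G)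
      Algebra.TensorProduct.includeRight z = z := fun z => by
    induction z with
    | zero => simp
    | tmul x y => simp
    | add x y hx hy => simp only [map_add, hx, hy]
  rw [← h1, e, ri, h2]

theorem map_id_antipode_R_inv : TensorProduct.map LinearMap.id (HopfAlgebra.antipode ℂ)
    ((H.R⁻¹ : (G ⊗[ℂ] G)ˣ) : G ⊗[ℂ] G) = (H.R : G ⊗[ℂ] G) := by
  have e := legL_antipode_right_inv (H := H)
    (f := (Algebra.TensorProduct.includeLeft : G →ₐ[ℂ] G ⊗[ℂ] G))
    (k := Algebra.TensorProduct.includeRight) (fun x y => by simp [commute_iff_eq])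
  have h1 : ∀ z : G ⊗[ℂ] G, legL (Algebra.TensorProduct.includeLeft :
      G →ₐ[ℂ] G ⊗[ℂ] G).toLinearMap ((Algebra.TensorProduct.includeRight :
        G →ₐ[ℂ] G ⊗[ℂ] G).toLinearMap ∘ₗ HopfAlgebra.antipode ℂ) z =
      TensorProduct.map LinearMap.id (HopfAlgebra.antipode ℂ) z := fun z => by
    induction z with
    | zero => simp
    | tmul x y => simp
    | add x y hx hy => simp only [map_add, hx, hy]
  have h2 : ∀ z : G ⊗[ℂ] G, leg (Algebra.TensorProduct.includeLeft : G →ₐ[ℂ] G ⊗[ℂ] G)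
      Algebra.TensorProduct.includeRight z = z := fun z => by
    induction z with
    | zero => simp
    | tmul x y => simp
    | add x y hx hy => simp only [map_add, hx, hy]
  rw [← h1, e, rm, h2]

theorem map_antipode_antipode_R_inv :
    TensorProduct.map (HopfAlgebra.antipode ℂ) (HopfAlgebra.antipode ℂ)
      ((H.R⁻¹ : (G ⊗[ℂ] G)ˣ) : G ⊗[ℂ] G) = ((H.R⁻¹ : (G ⊗[ℂ] G)ˣ) : G ⊗[ℂ] G) := by
  conv_rhs => rw [← map_antipode_id_R, ← map_id_antipode_R_inv, ← LinearMap.comp_apply,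
    ← TensorProduct.map_comp]
  rfl

theorem map_antipode_antipode_R :
    TensorProduct.map (HopfAlgebra.antipode ℂ) (HopfAlgebra.antipode ℂ)
      (H.R : G ⊗[ℂ] G) = (H.R : G ⊗[ℂ] G) := by
  conv_rhs => rw [← map_id_antipode_R_inv, ← map_antipode_id_R, ← LinearMap.comp_apply,
    ← TensorProduct.map_comp]
  rfl

/-! #### The Drinfeld element -/

theorem drinfeld_tmul (x y : G) : drinfeld (x ⊗ₜ[ℂ] y) = HopfAlgebra.antipode ℂ y * x := by
  simp [drinfeld]

theorem drinfeld_add (x y : G ⊗[ℂ] G) : drinfeld (x + y) = drinfeld x + drinfeld y := by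
  simp [drinfeld]

/-- `z ↦ ∑ S(z₂) m z₁`. -/
def sandwichS (m : G) : G ⊗[ℂ] G →ₗ[ℂ] G :=
  LinearMap.mul' ℂ G ∘ₗ TensorProduct.map (HopfAlgebra.antipode ℂ (A := G))
    (LinearMap.mulLeft ℂ m) ∘ₗ (swap G).toLinearMap

theorem sandwichS_tmul (m x y : G) :
    sandwichS m (x ⊗ₜ[ℂ] y) = HopfAlgebra.antipode ℂ y * (m * x) := rfl

theorem drinfeld_eq (z : G ⊗[ℂ] G) : drinfeld z = sandwichS 1 z := by
  have : LinearMap.mulLeft ℂ (1 : G) = LinearMap.id := by ext; simp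
  rw [drinfeld, sandwichS, this]
  rfl

theorem drinfeld_R_mul (z : G ⊗[ℂ] G) : drinfeld ((H.R : G ⊗[ℂ] G) * z) = sandwichS H.u z := by
  have : ∀ w : G ⊗[ℂ] G, drinfeld (w * z) = sandwichS (drinfeld w) z := fun w => by
    induction z with
    | zero => simp [drinfeld]
    | add x y hx hy => rw [mul_add, drinfeld_add, hx, hy, map_add]
    | tmul x y =>
      induction w with
      | zero => simp [drinfeld, sandwichS_tmul]
      | tmul p q =>
        simp [drinfeld_tmul, sandwichS_tmul, HopfAlgebra.antipode_mul_antidistrib, mul_assoc]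
      | add p q hp hq =>
        rw [add_mul, drinfeld_add, hp, hq, drinfeld_add]
        simp [sandwichS_tmul, add_mul, mul_add]
  exact this _

/-- The Drinfeld map is evaluated on `RΔ(x) = Δ'(x)R` in two ways: on one side `u` is produced
first, on the other the antipode axiom collapses `x`. -/
theorem sandwichS_comul (x : G) : sandwichS H.u (Coalgebra.comul (R := ℂ) x) =
    Coalgebra.counit (R := ℂ) x • H.u := by
  rw [← drinfeld_R_mul, H.R_comul, drinfeld_eq]
  have : ∀ z w : G ⊗[ℂ] G, sandwichS 1 (swap G z * w) =
      sandwichS (LinearMap.mul' ℂ G ((HopfAlgebra.antipode ℂ).rTensor G z)) w := fun z w => by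
    induction w with
    | zero => simp
    | add x y hx hy => simp only [mul_add, map_add, ← hx, ← hy]
    | tmul x y =>
      induction z with
      | zero => simp [sandwichS_tmul]
      | tmul p q =>
        simp [sandwichS_tmul, HopfAlgebra.antipode_mul_antidistrib, mul_assoc]
      | add p q hp hq =>
        simp only [map_add, add_mul, hp, hq]
        simp [sandwichS_tmul, add_mul, mul_add]
  rw [this, HopfAlgebra.mul_antipode_rTensor_comul_apply, Algebra.algebraMap_eq_smul_one]
  have : ∀ (c : ℂ) (w : G ⊗[ℂ] G), sandwichS (c • (1 : G)) w = c • sandwichS 1 w := fun c w => by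
    induction w with
    | zero => simp
    | tmul x y => simp [sandwichS_tmul]
    | add x y hx hy => simp only [map_add, hx, hy, smul_add]
  rw [this, ← drinfeld_eq]
  rfl

/-- The square of the antipode is implemented by the Drinfeld element. -/
theorem antipode_sq_mul_u (x : G) :
    HopfAlgebra.antipode ℂ (HopfAlgebra.antipode ℂ x) * H.u = H.u * x := by
  -- In the opposite algebra the antipode is a homomorphism `σ`, and `sandwichS_comul` computes the
  -- convolution `a * σ`. Convolving with `σ ∘ S`, the inverse of `σ`, isolates `a`, that is, `u x`.
  set σ := HopfAlgebra.antipodeAlgHomOp ℂ G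
  set o := (MulOpposite.opLinearEquiv ℂ (M := G)).toLinearMap
  set a := o ∘ₗ LinearMap.mulLeft ℂ H.u
  have h1 : cvL a σ.toLinearMap = LinearMap.mulLeft ℂ (MulOpposite.op H.u) ∘ₗ epsL _ := by
    ext x
    have : ∀ z : G ⊗[ℂ] G, LinearMap.mul' ℂ _ (TensorProduct.map a σ.toLinearMap z) =
        MulOpposite.op (sandwichS H.u z) := fun z => by
      induction z with
      | zero => simp
      | tmul x y => simp [a, o, σ, sandwichS_tmul]
      | add x y hx hy => simp only [map_add, hx, hy, MulOpposite.op_add]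
    rw [cvL_eq, this, sandwichS_comul]
    simp [Algebra.algebraMap_eq_smul_one]
  have h2 := cvL_assoc a σ.toLinearMap (σ.toLinearMap ∘ₗ HopfAlgebra.antipode ℂ)
  rw [cvL_antipode_right, cvL_eps, h1] at h2
  have h3 := LinearMap.congr_fun h2 x
  rw [cvL_mul_left, eps_cvL] at h3
  simpa [a, o, σ] using congrArg MulOpposite.unop h3

theorem sandwichS_R_inv : sandwichS H.u ((H.R⁻¹ : (G ⊗[ℂ] G)ˣ) : G ⊗[ℂ] G) = 1 := by
  rw [← drinfeld_R_mul, Units.mul_inv, Algebra.TensorProduct.one_def, drinfeld_tmul]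
  simp

section FiniteDim

variable [FiniteDimensional ℂ G]

variable (H) in
theorem isUnit_u : IsUnit H.u := by
  have : IsArtinianRing G := IsArtinianRing.of_finite ℂ G
  -- The relation `u S(u) = v²` yields a right inverse of `u`, and one-sided inverses are two-sided
  -- in finite dimension.
  have h : H.u * (HopfAlgebra.antipode ℂ H.u * ((H.ribbon⁻¹ : Gˣ) * (H.ribbon⁻¹ : Gˣ))) = 1 := by
    have h2 : H.u * HopfAlgebra.antipode ℂ H.u = H.ribbon * H.ribbon := H.ribbon_sq.symm
    rw [← mul_assoc, h2, mul_assoc, Units.mul_inv_cancel_left, Units.mul_inv]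
  exact IsUnit.of_mul_eq_one _ h

variable (H) in
/-- The Drinfeld element as a unit. -/
def uU : Gˣ := (isUnit_u H).unit

theorem uU_val : (H.uU : G) = H.u := rfl

/-- The inverse of the antipode. -/
theorem antipode_sq (x : G) :
    HopfAlgebra.antipode ℂ (HopfAlgebra.antipode ℂ x) = H.uU * x * (H.uU⁻¹ : Gˣ) := by
  rw [Units.eq_mul_inv_iff_mul_eq, uU_val, antipode_sq_mul_u]

variable (H) in
/-- The inverse of the antipode. -/
def sinv : G →ₗ[ℂ] G := LinearMap.mulLeft ℂ ((H.uU⁻¹ : Gˣ) : G) ∘ₗ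
  LinearMap.mulRight ℂ (H.uU : G) ∘ₗ HopfAlgebra.antipode ℂ

theorem sinv_apply (x : G) :
    H.sinv x = (H.uU⁻¹ : Gˣ) * (HopfAlgebra.antipode ℂ x * H.uU) := rfl

@[simp] theorem sinv_antipode (x : G) : H.sinv (HopfAlgebra.antipode ℂ x) = x := by
  rw [sinv_apply, antipode_sq (H := H)]; simp [mul_assoc]

@[simp] theorem antipode_sinv (x : G) : HopfAlgebra.antipode ℂ (H.sinv x) = x := by
  -- The antipode is injective by its left inverse, hence surjective on a finite-dimensional space.
  have hinj : Function.Injective (HopfAlgebra.antipode ℂ (A := G)) :=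
    Function.LeftInverse.injective (sinv_antipode (H := H))
  obtain ⟨y, rfl⟩ := LinearMap.surjective_of_injective hinj x
  rw [sinv_antipode]

theorem g_eq : H.g = (H.uU⁻¹ : Gˣ) * (H.ribbon : G) := by
  rw [RibbonHopfStar.g, ← uU_val, Ring.inverse_unit]

variable (H) in
/-- The grouplike element as a unit. -/
def gU : Gˣ := H.uU⁻¹ * H.ribbon

@[simp] theorem gU_val : (H.gU : G) = H.g := g_eq.symm

/-- `S²` is conjugation by `u`, and `g` differs from `u⁻¹` by the central element `v`. This is what
makes the trace with `g` invariant. -/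
theorem g_mul_antipode_sq (x : G) :
    H.g * HopfAlgebra.antipode ℂ (HopfAlgebra.antipode ℂ x) = x * H.g := by
  rw [antipode_sq (H := H), g_eq, mul_assoc, H.ribbon_central]
  simp only [mul_assoc, Units.inv_mul_cancel_left]

/-- `∑ S(s₂) u s₁ = 1` in terms of the inverse antipode. -/
theorem sum_sinv_R_inv : LinearMap.mul' ℂ G (TensorProduct.map H.sinv LinearMap.id
    (swap G ((H.R⁻¹ : (G ⊗[ℂ] G)ˣ) : G ⊗[ℂ] G))) = (H.uU⁻¹ : Gˣ) := by
  have : ∀ z : G ⊗[ℂ] G, LinearMap.mul' ℂ G (TensorProduct.map H.sinv LinearMap.id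
      (swap G z)) = (H.uU⁻¹ : Gˣ) * sandwichS H.u z := fun z => by
    induction z with
    | zero => simp
    | tmul x y => simp [sandwichS_tmul, sinv_apply, mul_assoc, uU_val]
    | add x y hx hy => simp only [map_add, hx, hy, mul_add]
  rw [this, sandwichS_R_inv, mul_one]

/-- `∑ r₂ g S(r₁) = v`. -/
theorem sum_g_R : LinearMap.mul' ℂ G (TensorProduct.map (LinearMap.mulRight ℂ H.g)
    (HopfAlgebra.antipode ℂ) (swap G (H.R : G ⊗[ℂ] G))) = H.ribbon := by
  rw [← map_antipode_antipode_R]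
  have : ∀ z : G ⊗[ℂ] G, LinearMap.mul' ℂ G (TensorProduct.map (LinearMap.mulRight ℂ H.g)
      (HopfAlgebra.antipode ℂ) (swap G (TensorProduct.map (HopfAlgebra.antipode ℂ)
        (HopfAlgebra.antipode ℂ) z))) = drinfeld z * H.g := fun z => by
    induction z with
    | zero => simp [drinfeld]
    | tmul x y => simp [drinfeld_tmul, mul_assoc, g_mul_antipode_sq]
    | add x y hx hy =>
      simp only [map_add, hx, hy, drinfeld_add, add_mul]
  rw [this]
  change H.u * H.g = _
  rw [g_eq, ← uU_val]
  exact Units.mul_inv_cancel_left _ _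

end FiniteDim

/-! #### The antipode and the *-operation -/

include H in
theorem counit_star (x : G) :
    Coalgebra.counit (R := ℂ) (star x) = conj (Coalgebra.counit (R := ℂ) x) := by
  have h1 : ∀ z : G ⊗[ℂ] G, TensorProduct.rid ℂ G (TensorProduct.map LinearMap.id
      (Coalgebra.counit (R := ℂ)) (swap G (star z))) =
      star (TensorProduct.lid ℂ G (TensorProduct.map
        (⟨⟨fun x => conj (Coalgebra.counit (R := ℂ) (star x)), by simp⟩, by simp⟩ : G →ₗ[ℂ] ℂ)
          LinearMap.id z)) := fun z => by
    induction z with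
    | zero => simp
    | tmul x y => simp
    | add x y hx hy => simp only [star_add, map_add, hx, hy]
  set e : G →ₗ[ℂ] ℂ := ⟨⟨fun x => conj (Coalgebra.counit (R := ℂ) (star x)), by simp⟩, by simp⟩
  -- Since `*` exchanges the two factors of the co-product, the conjugated co-unit `e` is a co-unit
  -- on the left; `ε` is one on the right, so the two coincide.
  have h2 : ∀ y : G, TensorProduct.lid ℂ G (TensorProduct.map e LinearMap.id
      (Coalgebra.comul (R := ℂ) y)) = y := fun y => by
    apply star_injective
    rw [← h1, ← H.comul_star]
    have := Coalgebra.lTensor_counit_comul (R := ℂ) (star y)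
    rw [LinearMap.lTensor] at this
    rw [this]
    simp
  have h3 : ∀ z : G ⊗[ℂ] G, Coalgebra.counit (R := ℂ) (TensorProduct.lid ℂ G
      (TensorProduct.map e LinearMap.id z)) = e (TensorProduct.rid ℂ G (TensorProduct.map
        LinearMap.id (Coalgebra.counit (R := ℂ)) z)) := fun z => by
    induction z with
    | zero => simp
    | tmul x y => simp [mul_comm]
    | add x y hx hy => simp only [map_add, hx, hy]
  have h4 := h3 (Coalgebra.comul (R := ℂ) x)
  rw [h2] at h4
  have := Coalgebra.lTensor_counit_comul (R := ℂ) x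
  rw [LinearMap.lTensor] at this
  rw [this] at h4
  simp only [TensorProduct.rid_tmul, one_smul] at h4
  rw [h4]
  simp [e]

include H in
theorem antipode_star (x : G) :
    HopfAlgebra.antipode ℂ (star x) = star (HopfAlgebra.antipode ℂ x) := by
  -- `S'` is a left convolution inverse of the identity, because `*` reverses products and also
  -- exchanges the factors of the co-product. It therefore equals the antipode.
  set S' : G →ₗ[ℂ] G := ⟨⟨fun x => star (HopfAlgebra.antipode ℂ (star x)), by simp⟩, by simp⟩
  have h1 : cvL S' (AlgHom.id ℂ G).toLinearMap = epsL G := by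
    ext x
    have : ∀ z : G ⊗[ℂ] G, LinearMap.mul' ℂ G (TensorProduct.map S' (AlgHom.id ℂ G).toLinearMap z) =
        star (LinearMap.mul' ℂ G ((HopfAlgebra.antipode ℂ).lTensor G (swap G (star z)))) :=
      fun z => by
        induction z with
        | zero => simp
        | tmul x y => simp [S']
        | add x y hx hy => simp only [star_add, map_add, hx, hy]
    rw [cvL_eq, this, ← H.comul_star, HopfAlgebra.mul_antipode_lTensor_comul_apply,
      counit_star (H := H)]
    simp [Algebra.algebraMap_eq_smul_one]
  have h2 := cvL_antipode_right (AlgHom.id ℂ G)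
  have h3 := cvL_assoc S' (AlgHom.id ℂ G).toLinearMap
    ((AlgHom.id ℂ G).toLinearMap ∘ₗ HopfAlgebra.antipode ℂ)
  rw [h1, h2, eps_cvL, cvL_eps] at h3
  have h4 := LinearMap.congr_fun h3 x
  rw [← star_star (HopfAlgebra.antipode ℂ (star x))]
  exact congrArg star h4.symm

/-- The relation `R* = R⁻¹` and the invariance of `R⁻¹` under `S ⊗ S` reduce `u*` to `∑ S(s₂) u s₁ ·
u⁻¹`, and the sum is `1`. -/
theorem star_u [FiniteDimensional ℂ G] : star H.u = (H.uU⁻¹ : Gˣ) := by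
  have h1 : ∀ z : G ⊗[ℂ] G, star (drinfeld z) = LinearMap.mul' ℂ G (TensorProduct.map LinearMap.id
      (HopfAlgebra.antipode ℂ) (swap G (swap G (star z)))) := fun z => by
    induction z with
    | zero => simp [drinfeld]
    | tmul x y => simp [drinfeld_tmul, antipode_star (H := H)]
    | add x y hx hy =>
      simp only [star_add, map_add, hx, hy, drinfeld_add]
  have h2 : ∀ z : G ⊗[ℂ] G, LinearMap.mul' ℂ G (TensorProduct.map LinearMap.id
      (HopfAlgebra.antipode ℂ) (swap G (TensorProduct.map (HopfAlgebra.antipode ℂ)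
        (HopfAlgebra.antipode ℂ) z))) = sandwichS H.u z * (H.uU⁻¹ : Gˣ) := fun z => by
    induction z with
    | zero => simp
    | tmul x y => simp [sandwichS_tmul, antipode_sq (H := H), mul_assoc, uU_val]
    | add x y hx hy => simp only [map_add, hx, hy, add_mul]
  rw [RibbonHopfStar.u, h1, H.star_R, ← map_antipode_antipode_R_inv, h2, sandwichS_R_inv, one_mul]

theorem star_g [FiniteDimensional ℂ G] : star H.g = (H.gU⁻¹ : Gˣ) := by
  have h : star ((H.uU⁻¹ : Gˣ) : G) = H.u := by
    rw [← star_u, star_star]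
  rw [g_eq, star_mul, H.star_ribbon, h]
  simp [gU, uU_val]

end RibbonHopfStar

end RMatrix

/-! ### The matrix units of a semisimple Hopf algebra -/

section Schur

variable {A : Type*} [Ring A] [Algebra ℂ A] {W W' W'' : Type*} [AddCommGroup W] [Module ℂ W]
  [AddCommGroup W'] [Module ℂ W'] [AddCommGroup W''] [Module ℂ W'']

theorem IsEquivRep.symm {ρ : A →ₐ[ℂ] Module.End ℂ W} {σ : A →ₐ[ℂ] Module.End ℂ W'}
    (h : IsEquivRep ρ σ) : IsEquivRep σ ρ := by
  obtain ⟨e, he⟩ := h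
  exact ⟨e.symm, fun a x => e.injective (by simp [he])⟩

theorem IsEquivRep.trans {ρ : A →ₐ[ℂ] Module.End ℂ W} {σ : A →ₐ[ℂ] Module.End ℂ W'}
    {τ : A →ₐ[ℂ] Module.End ℂ W''} (h : IsEquivRep ρ σ) (h' : IsEquivRep σ τ) :
    IsEquivRep ρ τ := by
  obtain ⟨e, he⟩ := h
  obtain ⟨e', he'⟩ := h'
  exact ⟨e.trans e', fun a x => by simp [he, he']⟩

/-- A nonzero intertwiner between irreducible representations is an equivalence. -/
theorem IsIrred.isEquivRep {ρ : A →ₐ[ℂ] Module.End ℂ W} {σ : A →ₐ[ℂ] Module.End ℂ W'}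
    (hρ : IsIrred ρ) (hσ : IsIrred σ) (L : W →ₗ[ℂ] W') (hL : ∀ a x, L (ρ a x) = σ a (L x))
    (h0 : L ≠ 0) : IsEquivRep ρ σ := by
  have hk : LinearMap.ker L = ⊥ := by
    rcases hρ.2 (LinearMap.ker L) (fun a x hx => by
      rw [LinearMap.mem_ker] at hx ⊢; rw [hL, hx, map_zero]) with h | h
    · exact h
    · exact absurd (LinearMap.ker_eq_top.mp h) h0
  have hr : LinearMap.range L = ⊤ := by
    rcases hσ.2 (LinearMap.range L) (fun a x hx => by
      obtain ⟨y, rfl⟩ := hx; exact ⟨ρ a y, hL a y⟩) with h | h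
    · exact absurd (LinearMap.range_eq_bot.mp h) h0
    · exact h
  exact ⟨LinearEquiv.ofBijective L ⟨LinearMap.ker_eq_bot.mp hk, LinearMap.range_eq_top.mp hr⟩, hL⟩

theorem isIrred_of_surjective {n : ℕ} [NeZero n]
    (f : A →ₐ[ℂ] Matrix (Fin n) (Fin n) ℂ) (hf : Function.Surjective f) :
    IsIrred (Matrix.toLinAlgEquiv'.toAlgHom.comp f) := by
  refine ⟨inferInstance, fun p hp => ?_⟩
  by_cases h : p = ⊥
  · exact Or.inl h
  right
  obtain ⟨x, hx, hx0⟩ := p.ne_bot_iff.mp h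
  obtain ⟨k, hk⟩ : ∃ k, x k ≠ 0 := Function.ne_iff.mp hx0
  rw [eq_top_iff]
  intro y _
  obtain ⟨a, ha⟩ := hf (Matrix.vecMulVec y (Pi.single k (x k)⁻¹))
  have h1 := hp a x hx
  have h2 : (Matrix.toLinAlgEquiv'.toAlgHom.comp f) a x = y := by
    change (f a).mulVec x = y
    rw [ha]
    ext i
    simp [Matrix.mulVec, dotProduct, Matrix.vecMulVec_apply, Pi.single_apply, mul_assoc, hk]
  rwa [h2] at h1

end Schur

section Units

variable {G : Type u} [Ring G] [HopfAlgebra ℂ G] [StarRing G] [StarModule ℂ G]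
  [FiniteDimensional ℂ G] [IsSemisimpleRing G]
  {ι : Type v} [Fintype ι] [DecidableEq ι] (D : IrrepSystem G ι)

namespace IrrepSystem

theorem vecMulVec_single_single {m : ℕ} (k : Fin m) :
    Matrix.vecMulVec (Pi.single k (1 : ℂ)) (Pi.single k 1) = Matrix.single k k (1 : ℂ) := by
  ext a b
  simp only [Matrix.vecMulVec_apply, Pi.single_apply, Matrix.single_apply]
  by_cases h1 : a = k <;> by_cases h2 : b = k <;> simp [h1, h2, eq_comm (a := k)]

/-- The sum of all irreducible representations. -/
def tauHom : G →ₐ[ℂ] (∀ I, Matrix (D.V I) (D.V I) ℂ) := AlgHom.pi fun I => (D.τ I).toAlgHom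

@[simp] theorem tauHom_apply (x : G) (I : ι) : D.tauHom x I = D.τ I x := rfl

/-- By Wedderburn `G` is a product of matrix algebras. Completeness attaches a label to each block;
every label occurs because some diagonal matrix unit acts nontrivially on `V^I`. Both halves of
bijectivity are then read off block by block. -/
theorem tauHom_bijective : Function.Bijective D.tauHom := by
  obtain ⟨n, d, hd, ⟨e⟩⟩ := IsSemisimpleRing.exists_algEquiv_pi_matrix_of_isAlgClosed ℂ G
  let p : ∀ i, G →ₐ[ℂ] Matrix (Fin (d i)) (Fin (d i)) ℂ := fun i =>
    (Pi.evalAlgHom ℂ (fun i => Matrix (Fin (d i)) (Fin (d i)) ℂ) i).comp e.toAlgHom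
  have hp : ∀ i, Function.Surjective (p i) := fun i M =>
    ⟨e.symm (Pi.single i M), by simp [p]⟩
  have hirr : ∀ i, IsIrred (Matrix.toLinAlgEquiv'.toAlgHom.comp (p i)) := fun i =>
    isIrred_of_surjective (p i) (hp i)
  choose f hf using fun i => D.complete (d i) _ (hirr i)
  have hsurj : Function.Surjective f := by
    intro I
    have h1 : (1 : G) = ∑ i, ∑ k, e.symm (Pi.single i (Matrix.single k k 1)) := by
      apply e.injective
      ext1 j
      have : ∀ i, (∑ k, (Pi.single i (Matrix.single k k (1 : ℂ)) :
          ∀ i, Matrix (Fin (d i)) (Fin (d i)) ℂ)) = Pi.single i 1 := fun i => by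
        rw [← Matrix.sum_single_one]
        exact (map_sum (AddMonoidHom.single
          (fun i => Matrix (Fin (d i)) (Fin (d i)) ℂ) i) _ _).symm
      simp only [map_one, map_sum, AlgEquiv.apply_symm_apply, this]
      exact congrFun (Finset.univ_sum_single (1 : ∀ i, Matrix (Fin (d i)) (Fin (d i)) ℂ)).symm j
    obtain ⟨i, k, hik⟩ : ∃ i k, D.τ I (e.symm (Pi.single i (Matrix.single k k 1))) ≠ 0 := by
      by_contra! hcon
      have h2 : D.τ I 1 = 0 := by
        rw [h1, map_sum]
        exact Finset.sum_eq_zero fun i _ => by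
          rw [map_sum]; exact Finset.sum_eq_zero fun k _ => hcon i k
      rw [map_one] at h2
      have := (D.irred I).1
      obtain ⟨x, hx⟩ := exists_ne (0 : Fin (D.n I) → ℂ)
      exact hx (by rw [← Matrix.one_mulVec x, h2, Matrix.zero_mulVec])
    obtain ⟨w, hw⟩ : ∃ w, (D.τ I (e.symm (Pi.single i (Matrix.single k k 1)))).mulVec w ≠ 0 := by
      by_contra! hcon
      exact hik (Matrix.toLin'.injective (by ext1; ext1; simp [hcon]))
    -- The matrices supported in column `k` of block `i` form a copy of the standard module;
    -- applying them to `w` gives an intertwiner into `V^I`, nonzero by the choice of `w`.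
    let q : (Fin (d i) → ℂ) →ₗ[ℂ] (Fin (D.n I) → ℂ) :=
      { toFun := fun y => (D.τ I (e.symm (Pi.single i (Matrix.vecMulVec y (Pi.single k 1))))).mulVec w
        map_add' := fun y z => by
          rw [Matrix.add_vecMulVec, Pi.single_add, map_add, map_add, Matrix.add_mulVec]
        map_smul' := fun c y => by
          rw [Matrix.smul_vecMulVec, Pi.single_smul, map_smul, map_smul, Matrix.smul_mulVec]
          rfl }
    have hq : ∀ y, q y = (D.τ I (e.symm (Pi.single i
        (Matrix.vecMulVec y (Pi.single k 1))))).mulVec w := fun y => rfl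
    have h3 := (hirr i).isEquivRep (D.irred I) q (fun a x => by
      change q ((p i a).mulVec x) = (D.τ I a).mulVec (q x)
      rw [hq, hq, Matrix.mulVec_mulVec, ← map_mul]
      congr 2
      apply e.injective
      ext1 j
      rw [AlgEquiv.apply_symm_apply, map_mul, AlgEquiv.apply_symm_apply, Pi.mul_apply]
      by_cases hj : j = i
      · subst hj
        rw [Pi.single_eq_same, Pi.single_eq_same, Matrix.mul_vecMulVec]
        rfl
      · rw [Pi.single_eq_of_ne hj, Pi.single_eq_of_ne hj, mul_zero]) (fun h0 => hw (by
        have h4 := LinearMap.congr_fun h0 (Pi.single k 1)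
        rwa [hq, vecMulVec_single_single] at h4))
    exact ⟨i, D.inequiv _ _ ((hf i).symm.trans h3)⟩
  choose T hT using hf
  constructor
  · rw [injective_iff_map_eq_zero]
    intro x hx
    apply e.injective
    rw [map_zero]
    ext1 i
    apply Matrix.toLin'.injective
    apply LinearMap.ext
    intro y
    apply (T i).injective
    have h1 := hT i x y
    have h2 : (Matrix.toLinAlgEquiv'.toAlgHom.comp (D.τ (f i)).toAlgHom) x (T i y) =
      (D.tauHom x (f i)).mulVec (T i y) := rfl
    rw [h2, hx, Pi.zero_apply, Matrix.zero_mulVec] at h1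
    rw [LinearEquiv.map_eq_zero_iff] at h1
    rw [Pi.zero_apply, map_zero, LinearMap.zero_apply]
    exact congrArg (T i) h1
  · intro m
    -- Transporting the prescribed matrix back along `T i`; a label hit by several blocks would
    -- cause no trouble here.
    let X : ∀ i, Matrix (Fin (d i)) (Fin (d i)) ℂ := fun i =>
      LinearMap.toMatrix' ((T i).symm.toLinearMap ∘ₗ Matrix.toLin' (m (f i)) ∘ₗ (T i).toLinearMap)
    refine ⟨e.symm X, funext fun I => ?_⟩
    obtain ⟨i, rfl⟩ := hsurj I
    apply Matrix.toLin'.injective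
    apply LinearMap.ext
    intro y
    obtain ⟨z, rfl⟩ := (T i).surjective y
    have h1 := hT i (e.symm X) z
    have h2 : (Matrix.toLinAlgEquiv'.toAlgHom.comp (p i)) (e.symm X) z = (X i).mulVec z := by
      change (e (e.symm X) i).mulVec z = _
      rw [AlgEquiv.apply_symm_apply]
    rw [h2] at h1
    change (D.τ (f i) (e.symm X)).mulVec (T i z) = (m (f i)).mulVec (T i z)
    refine (Eq.symm h1).trans ?_
    rw [← Matrix.toLin'_apply, Matrix.toLin'_toMatrix']
    simp

/-- The isomorphism of `G` with the sum of the matrix algebras. -/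
def tauEquiv : G ≃ₐ[ℂ] (∀ I, Matrix (D.V I) (D.V I) ℂ) :=
  AlgEquiv.ofBijective D.tauHom D.tauHom_bijective

theorem tau_ext {x y : G} (h : ∀ I, D.τ I x = D.τ I y) : x = y :=
  D.tauHom_bijective.1 (funext h)

/-- The element with prescribed values in all irreducible representations. -/
theorem exists_tau (m : ∀ I, Matrix (D.V I) (D.V I) ℂ) : ∃ x : G, ∀ I, D.τ I x = m I :=
  ⟨D.tauEquiv.symm m, fun I => congrFun (D.tauEquiv.apply_symm_apply m) I⟩

/-- The matrix unit `e^I_{ab}` of `G`. -/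
def e (I : ι) (a b : D.V I) : G := D.tauEquiv.symm (Pi.single I (Matrix.single a b 1))

theorem tau_e (J I : ι) (a b : D.V I) : D.τ J (D.e I a b) =
    (Pi.single I (Matrix.single a b 1) : ∀ I, Matrix (D.V I) (D.V I) ℂ) J :=
  congrFun (D.tauEquiv.apply_symm_apply _) J

@[simp] theorem tau_e_same (I : ι) (a b : D.V I) :
    D.τ I (D.e I a b) = Matrix.single a b 1 := by simp [tau_e]

theorem tau_e_ne {I J : ι} (h : J ≠ I) (a b : D.V I) : D.τ J (D.e I a b) = 0 := by
  simp [tau_e, h]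

/-- The matrix coefficients of `τ^I`, as functionals on `G`. -/
def coef (I : ι) (a b : D.V I) : Module.Dual ℂ G where
  toFun x := D.τ I x a b
  map_add' x y := by simp
  map_smul' c x := by simp

@[simp] theorem coef_apply (I : ι) (a b : D.V I) (x : G) : D.coef I a b x = D.τ I x a b := rfl

theorem sum_tau_e (x : G) : ∑ I, ∑ a, ∑ b, D.τ I x a b • D.e I a b = x := by
  apply D.tau_ext
  intro J
  simp only [map_sum, map_smul]
  rw [Finset.sum_eq_single J]
  · simp only [tau_e_same, Matrix.smul_single, smul_eq_mul, mul_one]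
    exact (Matrix.matrix_eq_sum_single _).symm
  · intro I _ hI
    simp [D.tau_e_ne hI.symm]
  · simp

theorem mul_e (x : G) (I : ι) (a b : D.V I) :
    x * D.e I a b = ∑ c, D.τ I x c a • D.e I c b := by
  apply D.tau_ext
  intro J
  simp only [map_sum, map_smul, map_mul]
  by_cases h : J = I
  · subst h
    ext p q
    simp [Matrix.sum_apply, Matrix.mul_apply, Matrix.single_apply, ite_and]
  · simp [D.tau_e_ne h]

theorem e_mul (x : G) (I : ι) (a b : D.V I) :
    D.e I a b * x = ∑ c, D.τ I x b c • D.e I a c := by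
  apply D.tau_ext
  intro J
  simp only [map_sum, map_smul, map_mul]
  by_cases h : J = I
  · subst h
    ext p q
    simp [Matrix.sum_apply, Matrix.mul_apply, Matrix.single_apply, ite_and]
  · simp [D.tau_e_ne h]

theorem star_e (I : ι) (a b : D.V I) : star (D.e I a b) = D.e I b a := by
  apply D.tau_ext
  intro J
  rw [map_star]
  by_cases h : J = I
  · subst h
    simp [Matrix.star_eq_conjTranspose]
  · simp [D.tau_e_ne h]

theorem functional_eq_sum (f : Module.Dual ℂ G) :
    f = ∑ I, ∑ a, ∑ b, f (D.e I a b) • D.coef I a b := by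
  ext x
  conv_lhs => rw [← D.sum_tau_e x]
  simp [mul_comm]

/-- The matrix in `End(V^I) ⊗ X` of an element of `G ⊗ X`. -/
theorem sum_e_ct {X : Type*} [Ring X] [Algebra ℂ X] (z : G ⊗[ℂ] X) :
    ∑ I, ∑ a, ∑ b, D.e I a b ⊗ₜ[ℂ] ct (D.coef I a b) z = z := by
  induction z with
  | zero => simp
  | add x y hx hy => simp only [map_add, TensorProduct.tmul_add, Finset.sum_add_distrib, hx, hy]
  | tmul x y =>
    simp only [ct_tmul, coef_apply, ← TensorProduct.smul_tmul]
    simp only [← TensorProduct.sum_tmul, sum_tau_e]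

theorem ct_coef_ext {X : Type*} [Ring X] [Algebra ℂ X] {z w : G ⊗[ℂ] X}
    (h : ∀ I a b, ct (D.coef I a b) z = ct (D.coef I a b) w) : z = w := by
  rw [← D.sum_e_ct z, ← D.sum_e_ct w]
  simp [h]

/-- A vector of the trivial representation space. -/
def zeroIdx : D.V D.zero := Classical.choice <| by
  have := (D.irred D.zero).1
  by_contra h
  rw [not_nonempty_iff] at h
  exact not_subsingleton (Fin (D.n D.zero) → ℂ) inferInstance

theorem counit_eq (x : G) : Coalgebra.counit (R := ℂ) x = D.τ D.zero x D.zeroIdx D.zeroIdx := by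
  simp [D.τ_zero]

theorem n_pos (I : ι) : 0 < D.n I := by
  have := (D.irred I).1
  by_contra h
  have h0 : D.n I = 0 := by omega
  have : IsEmpty (Fin (D.n I)) := by rw [h0]; infer_instance
  exact not_subsingleton (Fin (D.n I) → ℂ) inferInstance

/-- The trivial representation is one-dimensional. -/
theorem subsingleton_zero : Subsingleton (D.V D.zero) := by
  constructor
  intro a b
  by_contra hab
  have h := D.tau_e_same D.zero a b
  rw [D.τ_zero] at h
  have h1 := congrFun (congrFun h a) b
  simp [hab] at h1

/-! #### The Haar integral -/

/-- The Haar integral: the projector onto the trivial representation. -/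
def haar : G := D.e D.zero D.zeroIdx D.zeroIdx

theorem counit_haar : Coalgebra.counit (R := ℂ) D.haar = 1 := by
  rw [D.counit_eq, haar, tau_e_same]; simp

theorem mul_haar (x : G) : x * D.haar = Coalgebra.counit (R := ℂ) x • D.haar := by
  have := D.subsingleton_zero
  rw [haar, mul_e, Fintype.sum_eq_single D.zeroIdx (fun c hc => absurd (Subsingleton.elim _ _) hc),
    ← D.counit_eq]

theorem haar_mul (x : G) : D.haar * x = Coalgebra.counit (R := ℂ) x • D.haar := by
  have := D.subsingleton_zero
  rw [haar, e_mul, Fintype.sum_eq_single D.zeroIdx (fun c hc => absurd (Subsingleton.elim _ _) hc),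
    ← D.counit_eq]

theorem coef_haar (I : ι) (a b : D.V I) : D.τ I D.haar a b = if I = D.zero then 1 else 0 := by
  split_ifs with h
  · subst h
    have := D.subsingleton_zero
    rw [haar, tau_e_same, Subsingleton.elim a D.zeroIdx, Subsingleton.elim b D.zeroIdx]
    simp
  · rw [haar, D.tau_e_ne h]; rfl

end IrrepSystem

end Units

/-! ### Clebsch-Gordan maps -/

section CG

variable {G : Type u} [Ring G] [HopfAlgebra ℂ G] [StarRing G] [StarModule ℂ G]
  [FiniteDimensional ℂ G] [IsSemisimpleRing G]
  {ι : Type v} [Fintype ι] [DecidableEq ι] {H : RibbonHopfStar G} {D : IrrepSystem G ι}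

namespace IrrepSystem

variable (D)

@[simp] theorem tau2_tmul (I J : ι) (x y : G) :
    D.tau2 I J (x ⊗ₜ y) = D.τ I x ⊗ₖ D.τ J y := rfl

theorem tau2_mul (I J : ι) (z w : G ⊗[ℂ] G) :
    D.tau2 I J (z * w) = D.tau2 I J z * D.tau2 I J w := by
  induction z with
  | zero => simp
  | add x y hx hy => simp only [add_mul, map_add, hx, hy]
  | tmul x y =>
    induction w with
    | zero => simp
    | add p q hp hq => simp only [mul_add, map_add, hp, hq]
    | tmul p q => simp [Matrix.mul_kronecker_mul]

@[simp] theorem tau2_one (I J : ι) : D.tau2 I J 1 = 1 := by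
  simp [Algebra.TensorProduct.one_def]

theorem tau2_star (I J : ι) (z : G ⊗[ℂ] G) :
    D.tau2 I J (star z) = (D.tau2 I J z).conjTranspose := by
  induction z with
  | zero => simp
  | add x y hx hy => simp only [star_add, map_add, hx, hy, Matrix.conjTranspose_add]
  | tmul x y =>
    simp [map_star, Matrix.star_eq_conjTranspose, Matrix.conjTranspose_kronecker]

theorem tau2_apply (I J : ι) (z : G ⊗[ℂ] G) (p q : D.V I × D.V J) :
    D.tau2 I J z p q = D.τ J (ct (D.coef I p.1 q.1) z) p.2 q.2 := by
  induction z with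
  | zero => simp
  | add x y hx hy => simp only [map_add, Matrix.add_apply, hx, hy]
  | tmul x y => simp

theorem tau2_ext {z w : G ⊗[ℂ] G}
    (h : ∀ I J, D.tau2 I J z = D.tau2 I J w) : z = w := by
  refine D.ct_coef_ext fun I a b => D.tau_ext fun J => ?_
  ext c d
  have := congrFun (congrFun (h I J) (a, c)) (b, d)
  rwa [tau2_apply, tau2_apply] at this

theorem exists_tau2
    (m : ∀ I J, Matrix (D.V I × D.V J) (D.V I × D.V J) ℂ) :
    ∃ z : G ⊗[ℂ] G, ∀ I J, D.tau2 I J z = m I J := by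
  choose y hy using fun (I : ι) (a b : D.V I) =>
    D.exists_tau (fun J => Matrix.of fun c d => m I J (a, c) (b, d))
  refine ⟨∑ I, ∑ a, ∑ b, D.e I a b ⊗ₜ y I a b, fun I J => ?_⟩
  ext p q
  simp only [map_sum, tau2_tmul, Matrix.sum_apply]
  rw [Finset.sum_eq_single I]
  · simp [hy, Matrix.single_apply, ite_and]
  · intro K _ hK
    simp [D.tau_e_ne hK.symm]
  · simp

theorem mem_intertwiner {I J K : ι} {C : Matrix (D.V K) (D.V I × D.V J) ℂ} :
    C ∈ D.Intertwiner I J K ↔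
      ∀ x : G, C * D.tau2 I J (Coalgebra.comul (R := ℂ) x) = D.τ K x * C := Iff.rfl

/-- The intertwiners separate the points of a tensor product. -/
theorem eq_zero_of_intertwiner (I J : ι)
    (w : D.V I × D.V J → ℂ) (h : ∀ K, ∀ C ∈ D.Intertwiner I J K, C.mulVec w = 0) : w = 0 := by
  have h1 : ∀ K (b : D.V K) (p : D.V I × D.V J),
      (D.tau2 I J (Coalgebra.comul (R := ℂ) (D.e K b b))).mulVec w p = 0 := by
    intro K b p
    -- For fixed row `p` and fixed `b`, the entries of the operator of `e^K_{ba}` form, as `a`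
    -- varies, an intertwiner to `V^K`.
    have hC : (Matrix.of fun (a : D.V K) q => D.tau2 I J (Coalgebra.comul (R := ℂ) (D.e K b a)) p q) ∈
        D.Intertwiner I J K := by
      rw [mem_intertwiner]
      intro x
      ext a q
      have : D.e K b a * x = ∑ c, D.τ K x a c • D.e K b c := D.e_mul x K b a
      have h2 := congrArg (fun y => D.tau2 I J (Coalgebra.comul (R := ℂ) y) p q) this
      simp only [Bialgebra.comul_mul, tau2_mul, map_sum, map_smul, Matrix.sum_apply,
        Matrix.smul_apply, smul_eq_mul] at h2
      rw [Matrix.mul_apply] at h2 ⊢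
      simpa [Matrix.mul_apply] using h2
    simpa [Matrix.mulVec, dotProduct] using congrFun (h K _ hC) b
  have h3 : (1 : G) = ∑ K, ∑ b, D.e K b b := by
    apply D.tau_ext
    intro J
    rw [map_one, map_sum, Finset.sum_eq_single J]
    · simp [map_sum, Matrix.sum_single_one]
    · intro I _ hI
      simp [map_sum, D.tau_e_ne hI.symm]
    · simp
  have h4 : w = (D.tau2 I J (Coalgebra.comul (R := ℂ) (1 : G))).mulVec w := by
    rw [Bialgebra.comul_one, tau2_one, Matrix.one_mulVec]
  rw [h4, h3]
  ext p
  simp only [map_sum, Matrix.sum_mulVec, Finset.sum_apply, h1]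
  simp

end IrrepSystem

namespace ClebschGordan

variable (c : ClebschGordan H D)

theorem κel_central (x : G) : (c.κel : G) * x = x * c.κel := by
  refine D.tau_ext fun I => ?_
  simp [c.τ_κel]

theorem κel_sq : (c.κel : G) * c.κel = H.ribbon := by
  refine D.tau_ext fun I => ?_
  simp [c.τ_κel, c.κ_sq, smul_smul, sq]

theorem κ_ne_zero (I : ι) : c.κ I ≠ 0 := by
  intro h
  have h1 : D.τ I ((c.κel : G) * ((c.κel⁻¹ : Gˣ) : G)) = 1 := by rw [Units.mul_inv, map_one]
  rw [map_mul, c.τ_κel, h, zero_smul, zero_mul] at h1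
  have h2 := congrFun (congrFun h1 ⟨0, D.n_pos I⟩) ⟨0, D.n_pos I⟩
  simp at h2

theorem τ_κel_inv (I : ι) : D.τ I ((c.κel⁻¹ : Gˣ) : G) = (c.κ I)⁻¹ • 1 := by
  have h1 : D.τ I ((c.κel : G) * ((c.κel⁻¹ : Gˣ) : G)) = 1 := by rw [Units.mul_inv, map_one]
  rw [map_mul, c.τ_κel, smul_mul_assoc, one_mul] at h1
  rw [← h1, smul_smul, inv_mul_cancel₀ (c.κ_ne_zero I), one_smul]

/-- Unitarity of the ribbon element gives `|κ_I|⁴ = 1`. -/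
theorem conj_κ (I : ι) : conj (c.κ I) = (c.κ I)⁻¹ := by
  have h1 : D.τ I (star (H.ribbon : G) * H.ribbon) = 1 := by
    rw [H.star_ribbon, Units.inv_mul, map_one]
  rw [map_mul, map_star, c.κ_sq, Matrix.star_eq_conjTranspose] at h1
  have h2 := congrFun (congrFun h1 ⟨0, D.n_pos I⟩) ⟨0, D.n_pos I⟩
  simp only [Matrix.conjTranspose_smul, Matrix.conjTranspose_one, smul_mul_smul_comm, mul_one,
    Matrix.smul_apply, Matrix.one_apply_eq, smul_eq_mul, star_pow, ← mul_pow] at h2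
  have h3 : star (c.κ I) * c.κ I = ((Complex.normSq (c.κ I) : ℝ) : ℂ) := by
    rw [Complex.normSq_eq_conj_mul_self]; rfl
  rw [h3, ← Complex.ofReal_pow, Complex.ofReal_eq_one] at h2
  have h4 : Complex.normSq (c.κ I) = 1 := by nlinarith [Complex.normSq_nonneg (c.κ I)]
  rw [h4, Complex.ofReal_one] at h3
  exact eq_inv_of_mul_eq_one_left h3

theorem star_κel : star (c.κel : G) = ((c.κel⁻¹ : Gˣ) : G) := by
  refine D.tau_ext fun I => ?_
  rw [map_star, c.τ_κel, c.τ_κel_inv, ← c.conj_κ, Matrix.star_eq_conjTranspose]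
  simp

/-- `R'⁻¹`. -/
abbrev _root_.HandleAlg.RibbonHopfStar.Ri' (H : RibbonHopfStar G) : G ⊗[ℂ] G :=
  swap G ((H.R⁻¹ : (G ⊗[ℂ] G)ˣ) : G ⊗[ℂ] G)

theorem _root_.HandleAlg.RibbonHopfStar.Ri'_mul (H : RibbonHopfStar G) : H.Ri' * H.R' = 1 := by
  rw [RibbonHopfStar.Ri', RibbonHopfStar.R', ← map_mul, Units.inv_mul, map_one]

/-- Completeness of the Clebsch-Gordan maps. -/
theorem completeness (I J : ι) : ∑ K, ∑ a : Fin (D.N I J K), (c.κ K / (c.κ I * c.κ J)) •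
    (D.tau2 I J H.R' * (c.C I J K a : Matrix (D.V K) (D.V I × D.V J) ℂ).conjTranspose *
      (c.C I J K a : Matrix (D.V K) (D.V I × D.V J) ℂ)) = 1 := by
  set E := ∑ K, ∑ a : Fin (D.N I J K), (c.κ K / (c.κ I * c.κ J)) •
    (D.tau2 I J H.R' * (c.C I J K a : Matrix (D.V K) (D.V I × D.V J) ℂ).conjTranspose *
      (c.C I J K a : Matrix (D.V K) (D.V I × D.V J) ℂ)) with hE
  -- Orthonormality with respect to `R'` says that `E` is invisible to every basic intertwiner; as
  -- the intertwiners separate points, `E = 1`.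
  have h1 : ∀ L (b : Fin (D.N I J L)), (c.C I J L b : Matrix (D.V L) (D.V I × D.V J) ℂ) * E =
      (c.C I J L b : Matrix (D.V L) (D.V I × D.V J) ℂ) := by
    intro L b
    rw [hE, Matrix.mul_sum, Finset.sum_eq_single L]
    · rw [Matrix.mul_sum, Finset.sum_eq_single b]
      · rw [Matrix.mul_smul, ← Matrix.mul_assoc, ← Matrix.mul_assoc, c.norm_same, if_pos rfl,
          Matrix.smul_mul, Matrix.one_mul, smul_smul, div_mul_div_cancel₀ (by
            exact mul_ne_zero (c.κ_ne_zero I) (c.κ_ne_zero J)), div_self (c.κ_ne_zero L), one_smul]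
      · intro a _ hab
        rw [Matrix.mul_smul, ← Matrix.mul_assoc, ← Matrix.mul_assoc, c.norm_same, if_neg hab.symm,
          Matrix.zero_mul, smul_zero]
      · simp
    · intro K _ hK
      rw [Matrix.mul_sum]
      refine Finset.sum_eq_zero fun a _ => ?_
      rw [Matrix.mul_smul, ← Matrix.mul_assoc, ← Matrix.mul_assoc, c.norm_diff _ _ _ _ _ _ hK.symm,
        Matrix.zero_mul, smul_zero]
    · simp
  have h2 : ∀ K, ∀ C ∈ D.Intertwiner I J K, C * E = C := by
    intro K C hC
    have := (c.C I J K).sum_repr ⟨C, hC⟩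
    have h3 := congrArg Subtype.val this
    simp only [AddSubmonoidClass.coe_finsetSum, Submodule.coe_smul] at h3
    rw [← h3, Matrix.sum_mul]
    simp only [Matrix.smul_mul, h1]
  have h3 : ∀ y, E.mulVec y = y := by
    intro y
    rw [← sub_eq_zero]
    apply D.eq_zero_of_intertwiner
    intro K C hC
    rw [Matrix.mulVec_sub, Matrix.mulVec_mulVec, h2 K C hC, sub_self]
  apply Matrix.toLin'.injective
  ext1
  ext1
  simp [h3]

/-- The operator `∑ C* τ^K(x) C` in terms of the co-product. -/
theorem sum_fuse (I J : ι) (x : G) : ∑ K, ∑ a : Fin (D.N I J K),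
    (c.C I J K a : Matrix (D.V K) (D.V I × D.V J) ℂ).conjTranspose * D.τ K x *
      (c.C I J K a : Matrix (D.V K) (D.V I × D.V J) ℂ) =
    (c.κ I * c.κ J) • D.tau2 I J (H.Ri' * Coalgebra.comul (R := ℂ)
      (((c.κel⁻¹ : Gˣ) : G) * x)) := by
  have h0 : c.κ I * c.κ J ≠ 0 := mul_ne_zero (c.κ_ne_zero I) (c.κ_ne_zero J)
  have h1 : ∀ K (a : Fin (D.N I J K)),
      (c.C I J K a : Matrix (D.V K) (D.V I × D.V J) ℂ).conjTranspose * D.τ K x *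
        (c.C I J K a : Matrix (D.V K) (D.V I × D.V J) ℂ) =
      (c.κ I * c.κ J) • (D.tau2 I J H.Ri' * ((c.κ K / (c.κ I * c.κ J)) •
        (D.tau2 I J H.R' * (c.C I J K a : Matrix (D.V K) (D.V I × D.V J) ℂ).conjTranspose *
        (c.C I J K a : Matrix (D.V K) (D.V I × D.V J) ℂ))) *
          D.tau2 I J (Coalgebra.comul (R := ℂ) (((c.κel⁻¹ : Gˣ) : G) * x))) := by
    intro K a
    have h2 := (D.mem_intertwiner).mp (c.C I J K a).2 (((c.κel⁻¹ : Gˣ) : G) * x)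
    rw [map_mul (D.τ K), c.τ_κel_inv, smul_mul_assoc, one_mul] at h2
    simp only [Matrix.mul_smul, Matrix.smul_mul, Matrix.mul_assoc, h2, smul_smul]
    rw [← Matrix.mul_assoc (D.tau2 I J H.Ri'), ← D.tau2_mul, H.Ri'_mul, D.tau2_one,
      Matrix.one_mul]
    have h3 : c.κ I * c.κ J * (c.κ K / (c.κ I * c.κ J) * (c.κ K)⁻¹) = 1 := by
      have := c.κ_ne_zero K
      have := c.κ_ne_zero I
      have := c.κ_ne_zero J
      field_simp
    rw [h3, one_smul]
  simp only [h1]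
  rw [D.tau2_mul]
  conv_rhs => rw [← Matrix.mul_one (D.tau2 I J H.Ri'), ← c.completeness I J]
  simp only [Finset.mul_sum, Finset.sum_mul, Finset.smul_sum]

/-- The positive operator which measures the non-unitarity of the tensor product. -/
def Om : G ⊗[ℂ] G := ((c.κel : G) ⊗ₜ (c.κel : G)) * (H.Ri' *
  Coalgebra.comul (R := ℂ) ((c.κel⁻¹ : Gˣ) : G))

theorem κκ_central (z : G ⊗[ℂ] G) :
    ((c.κel : G) ⊗ₜ[ℂ] (c.κel : G)) * z = z * ((c.κel : G) ⊗ₜ (c.κel : G)) := by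
  induction z with
  | zero => simp
  | tmul x y => simp [c.κel_central]
  | add x y hx hy => simp only [mul_add, add_mul, hx, hy]

/-- A second expression of `Ω`, from `R'R Δ(v) = v ⊗ v` and `κ² = v`. The definition exhibits
positivity; this form is the one produced by the *-operation, see `leg_Om`. -/
theorem Om_eq : c.Om * ((c.κel : G) ⊗ₜ (c.κel : G)) =
    (H.R : G ⊗[ℂ] G) * Coalgebra.comul (R := ℂ) (c.κel : G) := by
  have h := H.comul_ribbon
  have h1 : (H.R : G ⊗[ℂ] G) * Coalgebra.comul (R := ℂ) (H.ribbon : G) =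
      H.Ri' * ((H.ribbon : G) ⊗ₜ (H.ribbon : G)) := by
    rw [← h, mul_assoc (swap G _), ← mul_assoc H.Ri']
    have : H.Ri' * swap G (H.R : G ⊗[ℂ] G) = 1 := H.Ri'_mul
    rw [this, one_mul]
  have h2 : Coalgebra.comul (R := ℂ) (c.κel : G) *
      Coalgebra.comul (R := ℂ) ((c.κel⁻¹ : Gˣ) : G) = 1 := by
    rw [← Bialgebra.comul_mul, Units.mul_inv, Bialgebra.comul_one]
  have h3 : (H.R : G ⊗[ℂ] G) * Coalgebra.comul (R := ℂ) (c.κel : G) =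
      H.Ri' * (((c.κel : G) ⊗ₜ (c.κel : G)) * ((c.κel : G) ⊗ₜ (c.κel : G))) *
        Coalgebra.comul (R := ℂ) ((c.κel⁻¹ : Gˣ) : G) := by
    rw [Algebra.TensorProduct.tmul_mul_tmul, c.κel_sq, ← h1, ← c.κel_sq, Bialgebra.comul_mul,
      mul_assoc, mul_assoc, h2, mul_one]
  have h4 := c.κκ_central (Coalgebra.comul (R := ℂ) ((c.κel⁻¹ : Gˣ) : G))
  rw [h3, Om, c.κκ_central]
  simp only [mul_assoc]
  rw [h4, ← mul_assoc ((c.κel : G) ⊗ₜ[ℂ] (c.κel : G))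
    (Coalgebra.comul (R := ℂ) ((c.κel⁻¹ : Gˣ) : G)), h4, mul_assoc]

-- In each `V^I ⊗ V^J` the operator `Ω` is `∑ C*C`, by `sum_fuse` at `x = 1`, hence has a square
-- root; the square roots assemble to one element of `G ⊗ G`. Here `star` is the factorwise one.
open scoped ComplexOrder in
theorem exists_Om_sqrt : ∃ Y : G ⊗[ℂ] G, c.Om = star Y * Y := by
  have h : ∀ I J, ∃ B : Matrix (D.V I × D.V J) (D.V I × D.V J) ℂ,
      D.tau2 I J c.Om = B.conjTranspose * B := by
    intro I J
    have h1 := c.sum_fuse I J 1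
    rw [mul_one] at h1
    have h2 : D.tau2 I J c.Om = (c.κ I * c.κ J) • D.tau2 I J (H.Ri' * Coalgebra.comul (R := ℂ)
        ((c.κel⁻¹ : Gˣ) : G)) := by
      rw [Om, D.tau2_mul, D.tau2_tmul, c.τ_κel, c.τ_κel]
      simp [smul_smul, Matrix.smul_kronecker, Matrix.kronecker_smul, mul_comm]
    have h3 : (D.tau2 I J c.Om).PosSemidef := by
      rw [h2, ← h1]
      refine Matrix.posSemidef_sum _ fun K _ => Matrix.posSemidef_sum _ fun a _ => ?_
      rw [map_one, Matrix.mul_one]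
      exact Matrix.posSemidef_conjTranspose_mul_self _
    open scoped MatrixOrder in
    obtain ⟨B, hB⟩ := (CStarAlgebra.nonneg_iff_eq_star_mul_self).mp h3.nonneg
    exact ⟨B, hB⟩
  choose B hB using h
  obtain ⟨Y, hY⟩ := D.exists_tau2 B
  refine ⟨Y, D.tau2_ext fun I J => ?_⟩
  rw [D.tau2_mul, D.tau2_star, hY, hB]

end ClebschGordan

end CG

/-! ### Factorizability -/

section Factor

variable {G : Type u} [Ring G] [HopfAlgebra ℂ G]

/-- The first leg of `G ⊗ G`. -/
abbrev il (G : Type*) [Ring G] [Algebra ℂ G] : G →ₐ[ℂ] G ⊗[ℂ] G :=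
  Algebra.TensorProduct.includeLeft

/-- The second leg of `G ⊗ G`. -/
abbrev ir (G : Type*) [Ring G] [Algebra ℂ G] : G →ₐ[ℂ] G ⊗[ℂ] G :=
  Algebra.TensorProduct.includeRight

theorem cm_il_ir : Cm (il G) (ir G) := fun x y => by simp [commute_iff_eq]

theorem leg_il_ir (z : G ⊗[ℂ] G) : leg (il G) (ir G) z = z := by
  induction z with
  | zero => simp
  | tmul x y => simp
  | add x y hx hy => simp only [map_add, hx, hy]

theorem comul_eq_cvL : (Coalgebra.comul : G →ₗ[ℂ] G ⊗[ℂ] G) =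
    cvL (il G).toLinearMap (ir G).toLinearMap := by
  ext x
  rw [← cv_eq_cvL _ _ cm_il_ir, cv_apply, leg_il_ir]

theorem antipode_cvL_comul : cvL ((il G).toLinearMap ∘ₗ HopfAlgebra.antipode ℂ)
    (Coalgebra.comul : G →ₗ[ℂ] G ⊗[ℂ] G) = (ir G).toLinearMap := by
  rw [comul_eq_cvL, ← cvL_assoc, cvL_antipode_left, eps_cvL]

theorem ct_mul_right {P X : Type*} [Ring P] [Algebra ℂ P] [Ring X] [Algebra ℂ X]
    (f : Module.Dual ℂ P) (z : P ⊗[ℂ] X) (y : X) :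
    ct f (z * (1 ⊗ₜ y)) = ct f z * y := by
  induction z with
  | zero => simp
  | tmul x y => simp
  | add x y hx hy => simp only [add_mul, map_add, hx, hy]

theorem ct_mul_left {P X : Type*} [Ring P] [Algebra ℂ P] [Ring X] [Algebra ℂ X]
    (f : Module.Dual ℂ P) (z : P ⊗[ℂ] X) (y : X) :
    ct f ((1 ⊗ₜ y) * z) = y * ct f z := by
  induction z with
  | zero => simp
  | tmul x y => simp
  | add x y hx hy => simp only [mul_add, map_add, hx, hy]

theorem ct_left_mul {P X : Type*} [Ring P] [Algebra ℂ P] [Ring X] [Algebra ℂ X]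
    (f : Module.Dual ℂ P) (z : P ⊗[ℂ] X) (x : P) :
    ct f ((x ⊗ₜ 1) * z) = ct (f ∘ₗ LinearMap.mulLeft ℂ x) z := by
  induction z with
  | zero => simp
  | tmul x y => simp
  | add x y hx hy => simp only [mul_add, map_add, hx, hy]

theorem antipode_mul_sum [FiniteDimensional ℂ G] {κ : Type*} [Fintype κ] [DecidableEq κ]
    (b : Module.Basis κ ℂ G) (x : G) :
    ∑ i, HopfAlgebra.antipode ℂ (b i) * ct (b.coord i) (Coalgebra.comul (R := ℂ) x) =
      algebraMap ℂ G (Coalgebra.counit (R := ℂ) x) := by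
  rw [← HopfAlgebra.mul_antipode_rTensor_comul_apply (R := ℂ) x]
  conv_rhs => rw [← sum_basis_ct b (Coalgebra.comul (R := ℂ) x)]
  simp

variable [StarRing G] [StarModule ℂ G]

section Haar

variable [FiniteDimensional ℂ G] [IsSemisimpleRing G]
  {ι : Type v} [Fintype ι] [DecidableEq ι] (D : IrrepSystem G ι)

namespace IrrepSystem

/-- Write `1 ⊗ x` as `∑ (S(x₁) ⊗ 1)Δ(x₂)`; the factor `Δ(x₂)` is absorbed by `Δ(h)`. -/
theorem mul_comul_haar (x : G) : ((1 : G) ⊗ₜ[ℂ] x) * Coalgebra.comul (R := ℂ) D.haar =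
    (HopfAlgebra.antipode ℂ x ⊗ₜ[ℂ] (1 : G)) * Coalgebra.comul (R := ℂ) D.haar := by
  set d := Coalgebra.comul (R := ℂ) D.haar with hd
  have h2 : LinearMap.mulRight ℂ d ∘ₗ (Coalgebra.comul : G →ₗ[ℂ] G ⊗[ℂ] G) =
      LinearMap.mulRight ℂ d ∘ₗ epsL _ := by
    ext x
    simp only [LinearMap.comp_apply, LinearMap.mulRight_apply, hd, epsL_apply]
    rw [← Bialgebra.comul_mul, D.mul_haar, map_smul, Algebra.smul_def]
  have h1 := LinearMap.congr_fun (antipode_cvL_comul (G := G)) x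
  have h3 : (ir G).toLinearMap x * d =
      ((il G).toLinearMap ∘ₗ HopfAlgebra.antipode ℂ) x * d := by
    rw [← h1, ← cvL_mul_right, h2, cvL_mul_right, cvL_eps]
  simpa using h3

/-- Left multiplication of a contraction of `Δ(h)` only changes the contracting functional. A
functional `g` that kills all contractions thus kills all their left multiples, and the antipode
axiom at `h`, where `ε(h) = 1`, writes every `x` as a sum of such multiples. -/
theorem haar_span (K : Submodule ℂ G)
    (h : ∀ f, ct f (Coalgebra.comul (R := ℂ) D.haar) ∈ K) : K = ⊤ := by
  by_contra hK
  obtain ⟨g, hg0, hg⟩ := Submodule.exists_le_ker_of_lt_top K (lt_top_iff_ne_top.mpr hK)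
  apply hg0
  have h1 : ∀ x f, g (x * ct f (Coalgebra.comul (R := ℂ) D.haar)) = 0 := by
    intro x f
    rw [← ct_mul_left, D.mul_comul_haar, ct_left_mul]
    exact hg (h _)
  ext x
  have h2 := antipode_mul_sum (Module.finBasis ℂ G) D.haar
  rw [D.counit_haar, map_one] at h2
  rw [← mul_one x, ← h2, Finset.mul_sum, map_sum]
  simp only [← mul_assoc, h1, Finset.sum_const_zero, LinearMap.zero_apply]

end IrrepSystem

end Haar

namespace RibbonHopfStar

variable (H : RibbonHopfStar G)

/-- The monodromy element `R' R`. -/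
def Q : G ⊗[ℂ] G := H.R' * (H.R : G ⊗[ℂ] G)

variable {H} {Y Z : Type*} [Ring Y] [Algebra ℂ Y] [Ring Z] [Algebra ℂ Z]

theorem leg_R' {f g : G →ₐ[ℂ] Y} (h : Cm f g) : leg f g H.R' = H.rm g f := by
  exact Cm.leg_comm h.symm _

theorem leg_Ri' {f g : G →ₐ[ℂ] Y} (h : Cm f g) : leg f g H.Ri' = H.ri g f := by
  exact Cm.leg_comm h.symm _

theorem leg_Q {f g : G →ₐ[ℂ] Y} (h : Cm f g) : leg f g H.Q = H.rm g f * H.rm f g := by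
  rw [Q, h.leg_mul, leg_R' h]
  rfl

theorem Q_comul (x : G) : H.Q * Coalgebra.comul (R := ℂ) x = Coalgebra.comul (R := ℂ) x * H.Q := by
  have h := H.R_comul x
  have h2 := congrArg (swap G) h
  have h3 : swap G (swap G (Coalgebra.comul (R := ℂ) x)) = Coalgebra.comul (R := ℂ) x :=
    (swap G).symm_apply_apply _
  rw [map_mul, map_mul, h3] at h2
  rw [Q, R', mul_assoc, h, ← mul_assoc, h2, mul_assoc]

theorem idComul_Q : idComul G H.Q = H.rm (i2 G G) (i1 G G) * (leg13 G H.Q * H.rm (i1 G G) (i2 G G)) := by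
  have h : ∀ z : G ⊗[ℂ] G, idComul G z = leg (i1 G G) (cv (i2 G G) (i3 G G) cm_i23) z := fun z => by
    induction z with
    | zero => simp
    | add x y hx hy => simp only [map_add, hx, hy]
    | tmul x y =>
      rw [leg_tmul, cv_apply]
      simp only [idComul, Algebra.TensorProduct.map_tmul, AlgHom.id_apply,
        Bialgebra.comulAlgHom_apply]
      induction Coalgebra.comul (R := ℂ) y with
      | zero => simp
      | add p q hp hq => simp only [TensorProduct.tmul_add, map_add, mul_add, hp, hq]
      | tmul p q => simp
  have h13 : ∀ z : G ⊗[ℂ] G, leg13 G z = leg (i1 G G) (i3 G G) z := fun z => by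
    induction z with
    | zero => simp
    | add x y hx hy => simp only [map_add, hx, hy]
    | tmul x y => simp
  rw [h, leg_Q (Cm.cv_right cm_i12 cm_i13), h13, leg_Q cm_i13, hexL cm_i23 cm_i13.symm,
    hexR cm_i23 cm_i12 cm_i13]
  simp only [mul_assoc]

/-- The factors in legs 1 and 2 only change the functionals, so what remains is a contraction of
`z`. Applied to `(id ⊗ Δ)(R'R) = R₂₁(R'R)₁₃R₁₂`. -/
theorem ct_ct_mem (K : Submodule ℂ G) (z u w : G ⊗[ℂ] G) (hK : ∀ f, ct f z ∈ K)
    (f g : Module.Dual ℂ G) :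
    ct g (ct f (leg (i2 G G) (i1 G G) u * (leg13 G z * leg (i1 G G) (i2 G G) w))) ∈ K := by
  induction u with
  | zero => simp
  | add u u' hu hu' => simpa only [map_add, add_mul] using K.add_mem hu hu'
  | tmul u1 u2 =>
    induction w with
    | zero => simp
    | add u u' hu hu' => simpa only [map_add, mul_add] using K.add_mem hu hu'
    | tmul w1 w2 =>
      have : ct g (ct f (leg (i2 G G) (i1 G G) (u1 ⊗ₜ u2) *
          (leg13 G z * leg (i1 G G) (i2 G G) (w1 ⊗ₜ w2)))) =
          g (u1 * w2) • ct (f ∘ₗ LinearMap.mulLeft ℂ u2 ∘ₗ LinearMap.mulRight ℂ w1) z := by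
        clear hK
        induction z with
        | zero => simp
        | add u u' hu hu' => simp only [map_add, mul_add, add_mul, smul_add, hu, hu']
        | tmul x y => simp [smul_smul, mul_comm]
      rw [this]
      exact K.smul_mem _ (hK _)

end RibbonHopfStar

section Trace

variable [FiniteDimensional ℂ G] [IsSemisimpleRing G]
  {ι : Type v} [Fintype ι] [DecidableEq ι] (H : RibbonHopfStar G) (D : IrrepSystem G ι)

/-- The quantum trace in the representation `τ^I`. -/
def trq (I : ι) : Module.Dual ℂ G :=
  Matrix.traceLinearMap (D.V I) ℂ ℂ ∘ₗ (D.τ I).toAlgHom.toLinearMap ∘ₗ LinearMap.mulRight ℂ H.g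

theorem trq_apply (I : ι) (x : G) : trq H D I x = (D.τ I (x * H.g)).trace := rfl

/-- Cyclicity of the trace brings the antipode to the other side of `g`, where `g S²(x) = x g` turns
it into a co-unit. -/
theorem trq_ad (I : ι) (x y : G) :
    trq H D I (cvL (HopfAlgebra.antipode ℂ) (LinearMap.mulLeft ℂ y) x) =
      Coalgebra.counit (R := ℂ) x * trq H D I y := by
  have h1 : ∀ z : G ⊗[ℂ] G, trq H D I (LinearMap.mul' ℂ G (TensorProduct.map
      (HopfAlgebra.antipode ℂ) (LinearMap.mulLeft ℂ y) z)) =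
      (D.τ I (y * H.g * HopfAlgebra.antipode ℂ (LinearMap.mul' ℂ G
        ((HopfAlgebra.antipode ℂ).lTensor G z)))).trace := fun z => by
    induction z with
    | zero => simp
    | add u w hu hw => simp only [map_add, mul_add, hu, hw, Matrix.trace_add]
    | tmul u w =>
      simp only [TensorProduct.map_tmul, LinearMap.mul'_apply, LinearMap.mulLeft_apply,
        LinearMap.lTensor_tmul, trq_apply, HopfAlgebra.antipode_mul_antidistrib]
      rw [mul_assoc, map_mul, Matrix.trace_mul_comm, ← map_mul, mul_assoc y H.g,
        ← mul_assoc H.g, H.g_mul_antipode_sq]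
      simp only [mul_assoc]
  rw [cvL_eq, h1, HopfAlgebra.mul_antipode_lTensor_comul_apply, Algebra.algebraMap_eq_smul_one,
    map_smul, HopfAlgebra.antipode_one]
  simp [trq_apply]

/-- `R'R` commutes with the co-product. Expanding `1 ⊗ x` as `∑ (S(x₁) ⊗ 1)Δ(x₂)` and passing
`Δ(x₂)` through `R'R` leaves an adjoint action on the first leg, which the quantum trace does not
see. -/
theorem ct_trq_central (I : ι) (x : G) : x * ct (trq H D I) H.Q = ct (trq H D I) H.Q * x := by
  set f := trq H D I with hf
  set p : G →ₗ[ℂ] G ⊗[ℂ] G := cvL ((il G).toLinearMap ∘ₗ HopfAlgebra.antipode ℂ)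
    (LinearMap.mulLeft ℂ H.Q ∘ₗ (il G).toLinearMap) with hp
  have h1 : ((1 : G) ⊗ₜ[ℂ] x) * H.Q = cvL p (ir G).toLinearMap x := by
    have h2 := LinearMap.congr_fun (antipode_cvL_comul (G := G)) x
    have h3 : (ir G).toLinearMap x * H.Q = cvL p (ir G).toLinearMap x := by
      rw [← h2, ← cvL_mul_right]
      have h4 : LinearMap.mulRight ℂ H.Q ∘ₗ (Coalgebra.comul : G →ₗ[ℂ] G ⊗[ℂ] G) =
          cvL (LinearMap.mulLeft ℂ H.Q ∘ₗ (il G).toLinearMap) (ir G).toLinearMap := by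
        ext x
        rw [cvL_mul_left, ← comul_eq_cvL]
        exact (H.Q_comul x).symm
      rw [h4, hp, cvL_assoc]
    simpa using h3
  have h5 : ∀ (q : G ⊗[ℂ] G) (y : G), ct f (cvL ((il G).toLinearMap ∘ₗ HopfAlgebra.antipode ℂ)
      (LinearMap.mulLeft ℂ q ∘ₗ (il G).toLinearMap) y) =
      Coalgebra.counit (R := ℂ) y • ct f q := fun q y => by
    induction q with
    | zero => 
      rw [cvL_eq]
      induction Coalgebra.comul (R := ℂ) y with
      | zero => simp
      | tmul x y => simp
      | add x y hx hy => simp only [map_add, hx, hy]; simp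
    | add u w hu hw =>
      have : ∀ z : G ⊗[ℂ] G, LinearMap.mul' ℂ (G ⊗[ℂ] G) (TensorProduct.map
          ((il G).toLinearMap ∘ₗ HopfAlgebra.antipode ℂ)
          (LinearMap.mulLeft ℂ (u + w) ∘ₗ (il G).toLinearMap) z) =
          LinearMap.mul' ℂ (G ⊗[ℂ] G) (TensorProduct.map
          ((il G).toLinearMap ∘ₗ HopfAlgebra.antipode ℂ)
          (LinearMap.mulLeft ℂ u ∘ₗ (il G).toLinearMap) z) +
          LinearMap.mul' ℂ (G ⊗[ℂ] G) (TensorProduct.map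
          ((il G).toLinearMap ∘ₗ HopfAlgebra.antipode ℂ)
          (LinearMap.mulLeft ℂ w ∘ₗ (il G).toLinearMap) z) := fun z => by
        induction z with
        | zero => simp
        | tmul x y => simp [mul_add, add_mul]
        | add x y hx hy => simp only [map_add, hx, hy]; abel
      rw [cvL_eq] at hu hw ⊢
      rw [this, map_add, hu, hw, map_add, smul_add]
    | tmul u w =>
      have : ∀ z : G ⊗[ℂ] G, LinearMap.mul' ℂ (G ⊗[ℂ] G) (TensorProduct.map
          ((il G).toLinearMap ∘ₗ HopfAlgebra.antipode ℂ)
          (LinearMap.mulLeft ℂ (u ⊗ₜ w) ∘ₗ (il G).toLinearMap) z) =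
          LinearMap.mul' ℂ G (TensorProduct.map (HopfAlgebra.antipode ℂ)
            (LinearMap.mulLeft ℂ u) z) ⊗ₜ w := fun z => by
        induction z with
        | zero => simp
        | tmul x y => simp
        | add x y hx hy => simp only [map_add, hx, hy, TensorProduct.add_tmul]
      rw [cvL_eq, this, ct_tmul, ← cvL_eq, hf, trq_ad, ct_tmul, smul_smul]
  rw [← ct_mul_left, h1]
  have h6 : ∀ z : G ⊗[ℂ] G, ct f (LinearMap.mul' ℂ _ (TensorProduct.map p (ir G).toLinearMap z)) =
      LinearMap.mul' ℂ G (TensorProduct.map (ct f ∘ₗ p) (AlgHom.id ℂ G).toLinearMap z) := fun z => by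
    induction z with
    | zero => simp
    | tmul x y => simp [ct_mul_right]
    | add x y hx hy => simp only [map_add, hx, hy]
  have h7 : ct f ∘ₗ p = LinearMap.mulLeft ℂ (ct f H.Q) ∘ₗ epsL G := by
    ext y
    rw [LinearMap.comp_apply, hp, h5]
    simp [Algebra.algebraMap_eq_smul_one]
  rw [cvL_eq, h6, ← cvL_eq, h7, cvL_mul_left, eps_cvL]
  simp

theorem trace_tau_ct_trq (I J : ι) : (D.τ J (ct (trq H D I) H.Q * H.g)).trace =
    (D.tau2 I J (H.R' * (H.R : G ⊗[ℂ] G)) * (D.τ I H.g ⊗ₖ D.τ J H.g)).trace := by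
  change _ = (D.tau2 I J H.Q * _).trace
  induction H.Q with
  | zero => simp
  | add x y hx hy =>
    simp only [map_add, add_mul, Matrix.trace_add, hx, hy]
  | tmul x y =>
    rw [D.tau2_tmul, ← Matrix.mul_kronecker_mul, Matrix.trace_kronecker, ct_tmul, trq_apply]
    simp

theorem exists_scalar_of_central {z : G} (hz : ∀ x, x * z = z * x) (J : ι) :
    ∃ s : ℂ, D.τ J z = s • 1 := by
  have h : ∀ M : Matrix (D.V J) (D.V J) ℂ, Commute M (D.τ J z) := fun M => by
    obtain ⟨x, hx⟩ := D.exists_tau (Pi.single J M)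
    have h1 := hx J
    rw [Pi.single_eq_same] at h1
    rw [← h1, commute_iff_eq, ← map_mul, hz, map_mul]
  have h2 := (Matrix.mem_range_scalar_iff_commute_single' (M := D.τ J z)).mpr
    (fun i j => h _)
  obtain ⟨s, hs⟩ := h2
  exact ⟨s, by rw [← hs]; ext; simp [Matrix.one_apply, Matrix.diagonal_apply]⟩

variable {H D}

/-- Contractions with quantum traces are central, hence scalars in each `V^J`, and these scalars
times `d_J` form the S-matrix up to normalization. Inverting it produces an element supported on the
trivial representation. -/
theorem exists_ct_eq_haar (hd : ∀ I, qdim H D I ≠ 0) (hS : IsUnit (SMatrix H D)) :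
    ∃ f, ct f H.Q = D.haar := by
  set 𝒩 : ℂ := (((Real.sqrt (∑ K, (qdim H D K).re ^ 2))⁻¹ : ℝ) : ℂ) with hN
  obtain ⟨U, hU⟩ := hS
  -- The row of the inverse S-matrix that belongs to the trivial representation.
  set cc : ι → ℂ := fun I => ((U⁻¹ : (Matrix ι ι ℂ)ˣ) : Matrix ι ι ℂ) D.zero I
  have hc : ∀ J, ∑ I, cc I * SMatrix H D I J = if D.zero = J then 1 else 0 := by
    intro J
    have : ((U⁻¹ : (Matrix ι ι ℂ)ˣ) : Matrix ι ι ℂ) * SMatrix H D = 1 := by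
      rw [← hU, Units.inv_mul]
    have := congrFun (congrFun this D.zero) J
    rwa [Matrix.mul_apply, Matrix.one_apply] at this
  set F : Module.Dual ℂ G := ∑ I, cc I • trq H D I
  have hF : ct F H.Q = ∑ I, cc I • ct (trq H D I) H.Q := by
    have : ctL H.Q F = _ := rfl
    rw [← ctL_apply, map_sum]
    simp only [map_smul, ctL_apply]
  have hz : ∀ x, x * ct F H.Q = ct F H.Q * x := by
    intro x
    simp only [hF, Finset.mul_sum, Finset.sum_mul, mul_smul_comm, smul_mul_assoc, ct_trq_central]
  choose s hs using exists_scalar_of_central (D := D) hz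
  have h1 : ∀ J, 𝒩 * (s J * qdim H D J) = if D.zero = J then 1 else 0 := by
    intro J
    rw [← hc]
    have : s J * qdim H D J = (D.τ J (ct F H.Q * H.g)).trace := by
      rw [map_mul, hs]; simp [qdim]
    rw [this, hF, Finset.sum_mul, map_sum, Matrix.trace_sum, Finset.mul_sum]
    refine Finset.sum_congr rfl fun I _ => ?_
    rw [smul_mul_assoc, map_smul, Matrix.trace_smul, trace_tau_ct_trq]
    simp only [SMatrix, Matrix.of_apply, smul_eq_mul, ← hN]
    ring
  have h0 := h1 D.zero
  rw [if_pos rfl] at h0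
  have hN0 : 𝒩 ≠ 0 := by rintro h; simp [h] at h0
  have hs0 : s D.zero ≠ 0 := by rintro h; simp [h] at h0
  refine ⟨(s D.zero)⁻¹ • F, ?_⟩
  rw [ct_smul_left]
  refine D.tau_ext fun J => ?_
  rw [map_smul, hs]
  ext a b
  rw [D.coef_haar]
  split_ifs with h
  · subst h
    have := D.subsingleton_zero
    simp [hs0, Subsingleton.elim a b]
  · have := h1 J
    rw [if_neg (Ne.symm h)] at this
    have : s J = 0 := by simpa [hN0, hd J] using this
    simp [this]

/-- Factorizability. The co-product of the Haar integral is a contraction of `(id ⊗ Δ)(R'R)`, so its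
own contractions are contractions of `R'R`, and they span `G`. -/
theorem ct_Q_surjective (hd : ∀ I, qdim H D I ≠ 0) (hS : IsUnit (SMatrix H D)) :
    Function.Surjective (fun f => ct f H.Q) := by
  have h : LinearMap.range (ctL H.Q) = ⊤ := by
    apply D.haar_span
    obtain ⟨f, hf⟩ := exists_ct_eq_haar hd hS
    intro g
    have h1 : Coalgebra.comul (R := ℂ) D.haar = ct f (idComul G H.Q) := by
      rw [← hf]; exact map_ct (Coalgebra.comul (R := ℂ)) f H.Q
    rw [h1, H.idComul_Q]
    exact RibbonHopfStar.ct_ct_mem _ _ _ _ (fun f => LinearMap.mem_range_self (ctL H.Q) f) f g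
  exact LinearMap.range_eq_top.mp h

end Trace

end Factor

/-! ### The relations of the handle algebra in terms of the legs -/

section Matrices

variable {G : Type u} [Ring G] [HopfAlgebra ℂ G] [StarRing G] [StarModule ℂ G]
  [FiniteDimensional ℂ G] [IsSemisimpleRing G]
  {ι : Type v} [Fintype ι] [DecidableEq ι] {H : RibbonHopfStar G} (D : IrrepSystem G ι)
  (X : Type*) [Ring X] [Algebra ℂ X]

/-- Matrices of complex numbers as matrices over `X`. -/
def numHom (n : Type*) [Fintype n] [DecidableEq n] : Matrix n n ℂ →ₐ[ℂ] Matrix n n X :=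
  (Algebra.ofId ℂ X).mapMatrix

theorem numHom_apply {n : Type*} [Fintype n] [DecidableEq n] (M : Matrix n n ℂ) :
    numHom X n M = num X M := rfl

/-- The elements of `X` as scalar matrices. -/
abbrev scHom (n : Type*) [Fintype n] [DecidableEq n] : X →ₐ[ℂ] Matrix n n X :=
  Matrix.scalarAlgHom n ℂ

theorem cm_num_sc (n : Type*) [Fintype n] [DecidableEq n] {P : Type*} [Ring P] [Algebra ℂ P]
    (f : P →ₐ[ℂ] Matrix n n ℂ) : Cm ((numHom X n).comp f) (scHom X n) := fun x a => by
  rw [commute_iff_eq]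
  ext i j
  simp [numHom_apply, Matrix.diagonal, Matrix.mul_apply, Algebra.commutes]

theorem num_mul_sc_apply {n : Type*} [Fintype n] [DecidableEq n] (M : Matrix n n ℂ) (a : X)
    (i j : n) : (numHom X n M * scHom X n a) i j = M i j • a := by
  simp [numHom_apply, Matrix.diagonal, Matrix.mul_apply, Algebra.smul_def]

namespace IrrepSystem

/-- `τ^I ⊗ τ^J` as a homomorphism. -/
def tau2Hom (I J : ι) : G ⊗[ℂ] G →ₐ[ℂ] Matrix (D.V I × D.V J) (D.V I × D.V J) ℂ :=
  AlgHom.ofLinearMap (D.tau2 I J) (D.tau2_one I J) (D.tau2_mul I J)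

theorem tau2Hom_apply (I J : ι) (z : G ⊗[ℂ] G) : D.tau2Hom I J z = D.tau2 I J z := rfl

/-- `τ^I` in the first factor. -/
def j1 (I J : ι) : G →ₐ[ℂ] Matrix (D.V I × D.V J) (D.V I × D.V J) X :=
  (numHom X _).comp ((D.tau2Hom I J).comp (il G))

/-- `τ^J` in the second factor. -/
def j2 (I J : ι) : G →ₐ[ℂ] Matrix (D.V I × D.V J) (D.V I × D.V J) X :=
  (numHom X _).comp ((D.tau2Hom I J).comp (ir G))

theorem cm_j12 (I J : ι) : Cm (D.j1 X I J) (D.j2 X I J) := (cm_il_ir.map _).map _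

theorem cm_j13 (I J : ι) : Cm (D.j1 X I J) (scHom X _) := cm_num_sc X _ _

theorem cm_j23 (I J : ι) : Cm (D.j2 X I J) (scHom X _) := cm_num_sc X _ _

theorem leg_j12 (I J : ι) (z : G ⊗[ℂ] G) :
    leg (D.j1 X I J) (D.j2 X I J) z = num X (D.tau2 I J z) := by
  rw [j1, j2, ← map_leg, ← map_leg, leg_il_ir]
  rfl

theorem leg_j13 (I J : ι) (z : G ⊗[ℂ] X) : leg (D.j1 X I J) (scHom X _) z =
    inFirst (D.V J) (Matrix.of fun a b => ct (D.coef I a b) z) := by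
  ext p q
  induction z with
  | zero => simp
  | add x y hx hy =>
    simp only [map_add, Matrix.add_apply, hx, hy, Matrix.of_apply]
    split_ifs <;> simp
  | tmul x a =>
    rw [leg_tmul, j1, AlgHom.comp_apply, num_mul_sc_apply]
    simp [tau2Hom_apply, Matrix.one_apply]

theorem leg_j23 (I J : ι) (z : G ⊗[ℂ] X) : leg (D.j2 X I J) (scHom X _) z =
    inSecond (D.V I) (Matrix.of fun a b => ct (D.coef J a b) z) := by
  ext p q
  induction z with
  | zero => simp
  | add x y hx hy =>
    simp only [map_add, Matrix.add_apply, hx, hy, Matrix.of_apply]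
    split_ifs <;> simp
  | tmul x a =>
    rw [leg_tmul, j2, AlgHom.comp_apply, num_mul_sc_apply]
    simp [tau2Hom_apply, Matrix.one_apply]

/-- `τ^I ⊗ τ^J ⊗ id`. -/
def j123 (I J : ι) :
    G ⊗[ℂ] (G ⊗[ℂ] X) →ₐ[ℂ] Matrix (D.V I × D.V J) (D.V I × D.V J) X :=
  lift3 (D.j1 X I J) (D.j2 X I J) (scHom X _) (D.cm_j12 X I J) (D.cm_j13 X I J) (D.cm_j23 X I J)

theorem j123_apply (I J : ι) (z : G ⊗[ℂ] (G ⊗[ℂ] X)) (p q : D.V I × D.V J) :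
    D.j123 X I J z p q = ct (D.coef J p.2 q.2) (ct (D.coef I p.1 q.1) z) := by
  induction z with
  | zero => simp
  | add x y hx hy => simp only [map_add, Matrix.add_apply, hx, hy]
  | tmul x z =>
    induction z with
    | zero => simp
    | add y w hy hw => simp only [TensorProduct.tmul_add, map_add, Matrix.add_apply, hy, hw]
    | tmul y a =>
      rw [j123, lift3_tmul, ← mul_assoc]
      change (numHom X _ (D.tau2Hom I J (x ⊗ₜ 1)) * numHom X _ (D.tau2Hom I J (1 ⊗ₜ y)) *
        scHom X (D.V I × D.V J) a : Matrix (D.V I × D.V J) (D.V I × D.V J) X) p q = _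
      rw [← map_mul, num_mul_sc_apply]
      simp [tau2Hom_apply, ← Matrix.mul_kronecker_mul, smul_smul]

variable {X}

theorem j123_ext {z w : G ⊗[ℂ] (G ⊗[ℂ] X)}
    (h : ∀ I J, D.j123 X I J z = D.j123 X I J w) :
    z = w := by
  refine D.ct_coef_ext fun I a b => D.ct_coef_ext fun J c d => ?_
  have := congrFun (congrFun (h I J) (a, c)) (b, d)
  rwa [j123_apply, j123_apply] at this

end IrrepSystem

end Matrices

/-! ### Functoriality, exchange and covariance as identities in legs. -/

section Data

variable {G : Type u} [Ring G] [HopfAlgebra ℂ G] [StarRing G] [StarModule ℂ G]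
  (H : RibbonHopfStar G) {X Y Z : Type*} [Ring X] [Algebra ℂ X] [Ring Y] [Algebra ℂ Y]
  [Ring Z] [Algebra ℂ Z]

/-- A solution of the functoriality relations. -/
structure IsFus (M : G ⊗[ℂ] X) : Prop where
  unit : ct Coalgebra.counit M = 1
  fus : H.rm (i2 G X) (i1 G X) * leg (i1 G X) (i3 G X) M * H.rm (i1 G X) (i2 G X) *
    leg (i2 G X) (i3 G X) M = leg (cv (i1 G X) (i2 G X) cm_i12) (i3 G X) M

/-- The exchange relation. -/
def IsExch (M N : G ⊗[ℂ] X) : Prop :=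
  H.ri (i1 G X) (i2 G X) * leg (i1 G X) (i3 G X) M * H.rm (i1 G X) (i2 G X) *
    leg (i2 G X) (i3 G X) N =
  leg (i2 G X) (i3 G X) N * H.rm (i2 G X) (i1 G X) * leg (i1 G X) (i3 G X) M *
    H.rm (i1 G X) (i2 G X)

/-- Covariance with respect to a homomorphism from `G`. -/
def IsCov (h : G →ₐ[ℂ] X) (M : G ⊗[ℂ] X) : Prop :=
  ∀ x : G, Commute (leg Algebra.TensorProduct.includeLeft
    ((Algebra.TensorProduct.includeRight : X →ₐ[ℂ] G ⊗[ℂ] X).comp h) (Coalgebra.comul (R := ℂ) x)) M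

variable {H}

theorem comp_cv_i12 (f g : G →ₐ[ℂ] Y) (k : X →ₐ[ℂ] Y) (hfg : Cm f g) (hfk : Cm f k)
    (hgk : Cm g k) : (lift3 f g k hfg hfk hgk).comp (cv (i1 G X) (i2 G X) cm_i12) =
      cv f g hfg := by
  rw [comp_cv]
  congr 1 <;> [exact lift3_i1 ..; exact lift3_i2 ..]

theorem IsFus.apply {M : G ⊗[ℂ] X} (hM : IsFus H M) {f g : G →ₐ[ℂ] Y} {k : X →ₐ[ℂ] Y}
    (hfg : Cm f g) (hfk : Cm f k) (hgk : Cm g k) :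
    H.rm g f * leg f k M * H.rm f g * leg g k M = leg (cv f g hfg) k M := by
  have h := congrArg (lift3 f g k hfg hfk hgk) hM.fus
  simpa only [map_mul, RibbonHopfStar.map_rm, map_leg, lift3_i1, lift3_i2, lift3_i3,
    comp_cv_i12] using h

theorem IsExch.apply {M N : G ⊗[ℂ] X} (hM : IsExch H M N) {f g : G →ₐ[ℂ] Y} {k : X →ₐ[ℂ] Y}
    (hfg : Cm f g) (hfk : Cm f k) (hgk : Cm g k) :
    H.ri f g * leg f k M * H.rm f g * leg g k N =
      leg g k N * H.rm g f * leg f k M * H.rm f g := by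
  have h := congrArg (lift3 f g k hfg hfk hgk) hM
  simpa only [map_mul, RibbonHopfStar.map_rm, RibbonHopfStar.map_ri, map_leg, lift3_i1, lift3_i2,
    lift3_i3] using h

theorem IsCov.apply {h : G →ₐ[ℂ] X} {M : G ⊗[ℂ] X} (hM : IsCov h M) {f : G →ₐ[ℂ] Y}
    {k : X →ₐ[ℂ] Y} (hfk : Cm f k) (x : G) :
    Commute (leg f (k.comp h) (Coalgebra.comul (R := ℂ) x)) (leg f k M) := by
  have e := (hM x).map (Algebra.TensorProduct.lift f k hfk)
  have e1 : (Algebra.TensorProduct.lift f k hfk).comp Algebra.TensorProduct.includeLeft = f :=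
    AlgHom.ext fun y => (Algebra.TensorProduct.lift_tmul f k hfk _ _).trans (by simp)
  have e2 : (Algebra.TensorProduct.lift f k hfk).comp ((Algebra.TensorProduct.includeRight :
      X →ₐ[ℂ] G ⊗[ℂ] X).comp h) = k.comp h :=
    AlgHom.ext fun y => (Algebra.TensorProduct.lift_tmul f k hfk _ _).trans (by simp)
  rwa [map_leg, ← leg_eq_lift, e1, e2] at e

end Data

/-! ### Matrix relations versus leg identities. -/

section Correspondence

variable {G : Type u} [Ring G] [HopfAlgebra ℂ G] [StarRing G] [StarModule ℂ G]
  [FiniteDimensional ℂ G] [IsSemisimpleRing G]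
  {ι : Type v} [Fintype ι] [DecidableEq ι] {H : RibbonHopfStar G} {D : IrrepSystem G ι}
  {X : Type*} [Ring X] [Algebra ℂ X] (c : ClebschGordan H D)

variable (D) in
/-- The element of `G ⊗ X` with given images in all irreducible representations. -/
def asm (A : ∀ I, Matrix (D.V I) (D.V I) X) : G ⊗[ℂ] X :=
  ∑ I, ∑ a, ∑ b, D.e I a b ⊗ₜ[ℂ] A I a b

theorem ct_coef_asm (A : ∀ I, Matrix (D.V I) (D.V I) X) (I : ι) (a b : D.V I) :
    ct (D.coef I a b) (asm D A) = A I a b := by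
  simp only [asm, map_sum, ct_tmul, IrrepSystem.coef_apply]
  rw [Finset.sum_eq_single I]
  · simp [Matrix.single_apply, ite_and, ite_smul]
  · intro J _ hJ
    simp [D.tau_e_ne hJ.symm]
  · simp

/-- `κ⁻¹ A`. -/
def datum (A : ∀ I, Matrix (D.V I) (D.V I) X) : G ⊗[ℂ] X :=
  (((c.κel⁻¹ : Gˣ) : G) ⊗ₜ[ℂ] (1 : X)) * asm D A

theorem κ_mul_datum (A : ∀ I, Matrix (D.V I) (D.V I) X) :
    ((c.κel : G) ⊗ₜ[ℂ] (1 : X)) * datum c A = asm D A := by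
  rw [datum, ← mul_assoc, Algebra.TensorProduct.tmul_mul_tmul, Units.mul_inv, mul_one,
    ← Algebra.TensorProduct.one_def, one_mul]

theorem ct_coef_κ_mul (z : G ⊗[ℂ] X) (I : ι) (a b : D.V I) :
    ct (D.coef I a b) (((c.κel : G) ⊗ₜ[ℂ] (1 : X)) * z) = c.κ I • ct (D.coef I a b) z := by
  rw [ct_left_mul, ← ct_smul_left]
  congr 1
  ext x
  simp [c.τ_κel]

theorem apply_eq_ct_datum (A : ∀ I, Matrix (D.V I) (D.V I) X) (I : ι) (a b : D.V I) :
    A I a b = c.κ I • ct (D.coef I a b) (datum c A) := by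
  rw [← ct_coef_κ_mul, κ_mul_datum, ct_coef_asm]

theorem leg_j1_asm (A : ∀ I, Matrix (D.V I) (D.V I) X) (I J : ι) :
    inFirst (D.V J) (A I) = c.κ I • leg (D.j1 X I J) (scHom X _) (datum c A) := by
  rw [D.leg_j13]
  ext p q
  simp only [Matrix.of_apply, Matrix.smul_apply, apply_eq_ct_datum c A]
  split_ifs <;> simp

theorem leg_j2_asm (A : ∀ I, Matrix (D.V I) (D.V I) X) (I J : ι) :
    inSecond (D.V I) (A J) = c.κ J • leg (D.j2 X I J) (scHom X _) (datum c A) := by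
  rw [D.leg_j23]
  ext p q
  simp only [Matrix.of_apply, Matrix.smul_apply, apply_eq_ct_datum c A]
  split_ifs <;> simp

/-- Both sides are linear in `z`. For a pure tensor the element of `X` passes through the numerical
Clebsch-Gordan matrices, and `sum_fuse` applies. -/
theorem fuse_ct (z : G ⊗[ℂ] X) (I J : ι) :
    fuse c (fun K => Matrix.of fun a b => ct (D.coef K a b) z) I J =
      (c.κ I * c.κ J) • (H.ri (D.j2 X I J) (D.j1 X I J) *
        leg (cv (D.j1 X I J) (D.j2 X I J) (D.cm_j12 X I J)) (scHom X _)
          ((((c.κel⁻¹ : Gˣ) : G) ⊗ₜ[ℂ] (1 : X)) * z)) := by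
  induction z with
  | zero =>
    simp only [map_zero, mul_zero, smul_zero, fuse]
    refine Finset.sum_eq_zero fun K _ => Finset.sum_eq_zero fun a _ => ?_
    have : (Matrix.of fun a b : D.V K => (0 : X)) = 0 := rfl
    rw [this, Matrix.mul_zero, Matrix.zero_mul]
  | add x y hx hy =>
    rw [mul_add, map_add, mul_add, smul_add, ← hx, ← hy]
    simp only [fuse, ← Finset.sum_add_distrib, ← Matrix.add_mul, ← Matrix.mul_add]
    refine Finset.sum_congr rfl fun K _ => Finset.sum_congr rfl fun a _ => ?_
    congr 2
    ext i j
    simp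
  | tmul x y =>
    have h1 : ∀ K, (Matrix.of fun a b : D.V K => ct (D.coef K a b) (x ⊗ₜ[ℂ] y)) =
        num X (D.τ K x) * Matrix.scalar (D.V K) y := fun K => by
      ext a b
      simp [Matrix.diagonal, Matrix.mul_apply, Algebra.smul_def]
    have h2 : ∀ K (C : Matrix (D.V K) (D.V I × D.V J) ℂ),
        num X C.conjTranspose * (num X (D.τ K x) * Matrix.scalar (D.V K) y) * num X C =
          numHom X _ (C.conjTranspose * D.τ K x * C) * scHom X _ y := fun K C => by
      rw [numHom_apply]
      have e : Matrix.scalar (D.V K) y * num X C = num X C * Matrix.scalar _ y := by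
        ext i j
        exact (Matrix.diagonal_mul _ _ i j).trans ((Algebra.commutes _ _).symm.trans
          (Matrix.mul_diagonal (fun _ => y) (num X C) i j).symm)
      have e2 : ∀ {m n k : Type _} [Fintype n] (P : Matrix m n ℂ) (Q : Matrix n k ℂ),
          num X (P * Q) = num X P * num X Q := fun P Q => Matrix.map_mul
      rw [e2, e2, ← Matrix.mul_assoc, Matrix.mul_assoc _ (Matrix.scalar _ y), e]
      simp only [Matrix.mul_assoc]
      rfl
    simp only [fuse, h1, h2]
    simp only [← Finset.sum_mul, ← map_sum]
    rw [c.sum_fuse, map_smul, smul_mul_assoc, Algebra.TensorProduct.tmul_mul_tmul, one_mul,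
      leg_tmul, ← mul_assoc, cv_apply, ← RibbonHopfStar.leg_Ri' (D.cm_j12 X I J),
      ← (D.cm_j12 X I J).leg_mul, D.leg_j12]
    rfl

theorem fuse_asm (A : ∀ I, Matrix (D.V I) (D.V I) X) (I J : ι) :
    fuse c A I J = (c.κ I * c.κ J) • (H.ri (D.j2 X I J) (D.j1 X I J) *
        leg (cv (D.j1 X I J) (D.j2 X I J) (D.cm_j12 X I J)) (scHom X _) (datum c A)) := by
  rw [datum, ← fuse_ct]
  congr 1
  ext K a b
  simp [ct_coef_asm]

/-- After the rescaling by `κ⁻¹` both sides carry the same nonzero factor `κ_I κ_J`, and the factor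
`R'⁻¹` left by the Clebsch-Gordan sum is moved to the other side as `R₂₁`. -/
theorem fun_iff (A : ∀ I, Matrix (D.V I) (D.V I) X) (I J : ι) :
    inFirst (D.V J) (A I) * num X (D.tau2 I J H.R) * inSecond (D.V I) (A J) = fuse c A I J ↔
    D.j123 X I J (H.rm (i2 G X) (i1 G X) * leg (i1 G X) (i3 G X) (datum c A) *
      H.rm (i1 G X) (i2 G X) * leg (i2 G X) (i3 G X) (datum c A)) =
    D.j123 X I J (leg (cv (i1 G X) (i2 G X) cm_i12) (i3 G X) (datum c A)) := by
  simp only [IrrepSystem.j123, map_mul, RibbonHopfStar.map_rm, map_leg, lift3_i1, lift3_i2, lift3_i3,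
    comp_cv_i12]
  rw [leg_j1_asm c, leg_j2_asm c, fuse_asm, ← D.leg_j12]
  simp only [smul_mul_assoc, mul_smul_comm, smul_smul]
  rw [mul_comm (c.κ J), (smul_right_injective _ (mul_ne_zero (c.κ_ne_zero I)
    (c.κ_ne_zero J))).eq_iff]
  have h1 := H.rm_mul_ri (D.cm_j12 X I J).symm
  have h2 := H.ri_mul_rm (D.cm_j12 X I J).symm
  constructor
  · intro h
    rw [mul_assoc, mul_assoc, ← mul_assoc (leg _ _ _)]
    change _ * (_ * leg _ _ _ * _) = _
    rw [h, ← mul_assoc, h1, one_mul]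
  · intro h
    rw [← h]
    simp only [← mul_assoc]
    rw [h2, one_mul]
    rfl

theorem exch_iff (A B : ∀ I, Matrix (D.V I) (D.V I) X) (I J : ι) :
    num X (D.tau2 I J ((H.R⁻¹ : (G ⊗[ℂ] G)ˣ) : G ⊗[ℂ] G)) * inFirst (D.V J) (A I) *
        num X (D.tau2 I J H.R) * inSecond (D.V I) (B J) =
      inSecond (D.V I) (B J) * num X (D.tau2 I J H.R') * inFirst (D.V J) (A I) *
        num X (D.tau2 I J H.R) ↔
    D.j123 X I J (H.ri (i1 G X) (i2 G X) * leg (i1 G X) (i3 G X) (datum c A) *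
      H.rm (i1 G X) (i2 G X) * leg (i2 G X) (i3 G X) (datum c B)) =
    D.j123 X I J (leg (i2 G X) (i3 G X) (datum c B) * H.rm (i2 G X) (i1 G X) *
      leg (i1 G X) (i3 G X) (datum c A) * H.rm (i1 G X) (i2 G X)) := by
  simp only [IrrepSystem.j123, map_mul, RibbonHopfStar.map_rm, RibbonHopfStar.map_ri, map_leg,
    lift3_i1, lift3_i2, lift3_i3]
  rw [leg_j1_asm c, leg_j2_asm c]
  simp only [← D.leg_j12, smul_mul_assoc, mul_smul_comm, smul_smul]
  rw [mul_comm (c.κ I), (smul_right_injective _ (mul_ne_zero (c.κ_ne_zero J)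
    (c.κ_ne_zero I))).eq_iff, RibbonHopfStar.leg_R' (D.cm_j12 X I J)]
  rfl

theorem tau2_zero_zero (z : G ⊗[ℂ] G) (p q : D.V D.zero × D.V D.zero) :
    D.tau2 D.zero D.zero z p q = leg (eps G ℂ) (eps G ℂ) z := by
  have := D.subsingleton_zero
  rw [Subsingleton.elim p (D.zeroIdx, D.zeroIdx), Subsingleton.elim q (D.zeroIdx, D.zeroIdx)]
  induction z with
  | zero => simp
  | add x y hx hy => simp only [map_add, Matrix.add_apply, hx, hy]
  | tmul x y => simp [eps_apply, D.counit_eq]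

theorem ClebschGordan.counit_κel : Coalgebra.counit (R := ℂ) (c.κel : G) = c.κ D.zero := by
  rw [D.counit_eq, c.τ_κel]; simp

/-- The normalization `ε(v) = 1` leaves the two signs `±1`. The value of `Ω` in the trivial
representation is `κ_0`, and `Ω` is positive, so the sign is `+`. -/
theorem ClebschGordan.κ_zero : c.κ D.zero = 1 := by
  have h2 : Coalgebra.counit (R := ℂ) ((c.κel⁻¹ : Gˣ) : G) = (c.κ D.zero)⁻¹ := by
    rw [D.counit_eq, c.τ_κel_inv]; simp
  have h1 : leg (eps G ℂ) (eps G ℂ) c.Om = c.κ D.zero := by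
    rw [ClebschGordan.Om, (cm_eps (eps G ℂ)).leg_mul, (cm_eps (eps G ℂ)).leg_mul,
      RibbonHopfStar.leg_Ri' (cm_eps (eps G ℂ)), H.ri_eps_left, ← cv_apply _ _ (cm_eps (eps G ℂ)),
      cv_eps_left, leg_tmul, eps_apply, eps_apply, h2, c.counit_κel]
    have := c.κ_ne_zero D.zero
    simp only [Algebra.algebraMap_self, RingHom.id_apply]
    field_simp
  obtain ⟨Y, hY⟩ := c.exists_Om_sqrt
  rw [← tau2_zero_zero c.Om (D.zeroIdx, D.zeroIdx) (D.zeroIdx, D.zeroIdx), hY, D.tau2_mul,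
    D.tau2_star, Matrix.mul_apply] at h1
  have h3 : ∃ r : ℝ, 0 ≤ r ∧ c.κ D.zero = r := by
    refine ⟨∑ p, Complex.normSq (D.tau2 D.zero D.zero Y p (D.zeroIdx, D.zeroIdx)),
      Finset.sum_nonneg fun p _ => Complex.normSq_nonneg _, ?_⟩
    rw [← h1, Complex.ofReal_sum]
    refine Finset.sum_congr rfl fun p _ => ?_
    rw [Complex.normSq_eq_conj_mul_self]
    rfl
  obtain ⟨r, hr, hr2⟩ := h3
  have h4 : c.κ D.zero ^ 2 = 1 := by
    have := H.counit_ribbon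
    rw [D.counit_eq, c.κ_sq] at this
    simpa using this
  rw [hr2] at h4 ⊢
  norm_cast at h4 ⊢
  nlinarith

theorem unit_iff (A : ∀ I, Matrix (D.V I) (D.V I) X) :
    (∀ a b, A D.zero a b = (1 : Matrix (D.V D.zero) (D.V D.zero) X) a b) ↔
      ct Coalgebra.counit (datum c A) = 1 := by
  have := D.subsingleton_zero
  have h1 : (Coalgebra.counit : G →ₗ[ℂ] ℂ) = D.coef D.zero D.zeroIdx D.zeroIdx := by
    ext x; rw [D.counit_eq]; rfl
  have h0 : c.κ D.zero = 1 := c.κ_zero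
  have h2 : ct Coalgebra.counit (datum c A) = A D.zero D.zeroIdx D.zeroIdx := by
    rw [apply_eq_ct_datum c A, h1, h0, one_smul]
  rw [h2]
  constructor
  · intro h; rw [h, Matrix.one_apply_eq]
  · intro h a b
    rw [Subsingleton.elim a D.zeroIdx, Subsingleton.elim b D.zeroIdx, h, Matrix.one_apply_eq]

end Correspondence

/-! ### Representations of the handle algebra in terms of the legs -/

section Lifts

variable {G : Type u} [Ring G] [HopfAlgebra ℂ G] [StarRing G] [StarModule ℂ G]
  [FiniteDimensional ℂ G] [IsSemisimpleRing G]
  {ι : Type v} [Fintype ι] [DecidableEq ι] {H : RibbonHopfStar G} {D : IrrepSystem G ι}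
  {X : Type*} [Ring X] [Algebra ℂ X] {c : ClebschGordan H D}

theorem handleRel_sound {A B : ∀ I, Matrix (D.V I) (D.V I) X}
    (hA : IsFus H (datum c A)) (hB : IsFus H (datum c B)) (hAB : IsExch H (datum c A) (datum c B))
    {x y : X} (h : HandleRel c A B x y) : x = y := by
  cases h with
  | unit_A a b => exact (unit_iff c A).mpr hA.unit a b
  | unit_B a b => exact (unit_iff c B).mpr hB.unit a b
  | fun_A I J p q => rw [(fun_iff c A I J).mpr (by rw [hA.fus])]
  | fun_B I J p q => rw [(fun_iff c B I J).mpr (by rw [hB.fus])]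
  | exchange I J p q => rw [(exch_iff c A B I J).mpr (by rw [hAB])]

theorem isFus_of_rel_A {A B : ∀ I, Matrix (D.V I) (D.V I) X}
    (h : ∀ x y, HandleRel c A B x y → x = y) : IsFus H (datum c A) where
  unit := (unit_iff c A).mp fun a b => h _ _ (.unit_A a b)
  fus := D.j123_ext fun I J => (fun_iff c A I J).mp (Matrix.ext fun p q => h _ _ (.fun_A I J p q))

theorem isFus_of_rel_B {A B : ∀ I, Matrix (D.V I) (D.V I) X}
    (h : ∀ x y, HandleRel c A B x y → x = y) : IsFus H (datum c B) where
  unit := (unit_iff c B).mp fun a b => h _ _ (.unit_B a b)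
  fus := D.j123_ext fun I J => (fun_iff c B I J).mp (Matrix.ext fun p q => h _ _ (.fun_B I J p q))

theorem isExch_of_rel {A B : ∀ I, Matrix (D.V I) (D.V I) X}
    (h : ∀ x y, HandleRel c A B x y → x = y) : IsExch H (datum c A) (datum c B) :=
  D.j123_ext fun I J => (exch_iff c A B I J).mp
    (Matrix.ext fun p q => h _ _ (.exchange I J p q))

variable (D) in
/-- `τ^I ⊗ id`, with values in the matrices over `X`. -/
def kHom (I : ι) : G ⊗[ℂ] X →ₐ[ℂ] Matrix (D.V I) (D.V I) X :=
  Algebra.TensorProduct.lift ((numHom X _).comp (D.τ I).toAlgHom) (scHom X _)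
    (cm_num_sc X _ (D.τ I).toAlgHom)

theorem kHom_apply (I : ι) (z : G ⊗[ℂ] X) (a b : D.V I) :
    kHom D I z a b = ct (D.coef I a b) z := by
  induction z with
  | zero => simp
  | add x y hx hy => simp only [map_add, Matrix.add_apply, hx, hy]
  | tmul x y =>
    change (numHom X (D.V I) (D.τ I x) * scHom X (D.V I) y : Matrix (D.V I) (D.V I) X) a b = _
    rw [num_mul_sc_apply]
    simp

theorem kHom_ext {z w : G ⊗[ℂ] X} (h : ∀ I, kHom D I z = kHom D I w) : z = w :=
  D.ct_coef_ext fun I a b => by rw [← kHom_apply, h, kHom_apply]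

theorem tauId_map (h : G →ₐ[ℂ] X) (I : ι) (z : G ⊗[ℂ] G) :
    (D.tauId I z).map h = kHom D I (leg Algebra.TensorProduct.includeLeft
      ((Algebra.TensorProduct.includeRight : X →ₐ[ℂ] G ⊗[ℂ] X).comp h) z) := by
  ext a b
  rw [kHom_apply]
  induction z with
  | zero => simp
  | add x y hx hy => simp only [map_add, Matrix.map_apply, Matrix.add_apply] at *; rw [hx, hy]
  | tmul x y => simp [IrrepSystem.tauId]

theorem kHom_asm (A : ∀ I, Matrix (D.V I) (D.V I) X) (I : ι) : kHom D I (asm D A) = A I := by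
  ext a b
  rw [kHom_apply, ct_coef_asm]

theorem kHom_datum (A : ∀ I, Matrix (D.V I) (D.V I) X) (I : ι) :
    A I = c.κ I • kHom D I (datum c A) := by
  ext a b
  rw [Matrix.smul_apply, kHom_apply, apply_eq_ct_datum c A]

theorem isCov_iff {h : G →ₐ[ℂ] X} {A : ∀ I, Matrix (D.V I) (D.V I) X} :
    IsCov h (datum c A) ↔ ∀ (x : G) (I : ι) (a b : D.V I),
      ((D.mu I x).map h * A I) a b = (A I * (D.mu I x).map h) a b := by
  have key : ∀ (x : G) (I : ι), (D.mu I x).map h * A I = A I * (D.mu I x).map h ↔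
      kHom D I (leg Algebra.TensorProduct.includeLeft
      ((Algebra.TensorProduct.includeRight : X →ₐ[ℂ] G ⊗[ℂ] X).comp h)
        (Coalgebra.comul (R := ℂ) x) * datum c A) =
      kHom D I (datum c A * leg Algebra.TensorProduct.includeLeft
      ((Algebra.TensorProduct.includeRight : X →ₐ[ℂ] G ⊗[ℂ] X).comp h)
        (Coalgebra.comul (R := ℂ) x)) := fun x I => by
    rw [IrrepSystem.mu, tauId_map, kHom_datum (c := c) A, map_mul, map_mul, mul_smul_comm,
      smul_mul_assoc, (smul_right_injective _ (c.κ_ne_zero I)).eq_iff]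
  constructor
  · intro hc x I a b
    rw [(key x I).mpr (by rw [(hc x).eq])]
  · intro hc x
    exact kHom_ext fun I => (key x I).mp (Matrix.ext (hc x I))

theorem asm_map {Y : Type*} [Ring Y] [Algebra ℂ Y] (f : X →ₐ[ℂ] Y)
    (A : ∀ I, Matrix (D.V I) (D.V I) X) :
    Algebra.TensorProduct.map (AlgHom.id ℂ G) f (asm D A) = asm D (fun I => (A I).map f) := by
  simp [asm]

theorem datum_map {Y : Type*} [Ring Y] [Algebra ℂ Y] (f : X →ₐ[ℂ] Y)
    (A : ∀ I, Matrix (D.V I) (D.V I) X) :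
    Algebra.TensorProduct.map (AlgHom.id ℂ G) f (datum c A) =
      datum c (fun I => (A I).map f) := by
  rw [datum, map_mul, asm_map, datum]
  simp

variable (c) in
/-- The matrices which belong to an element of `G ⊗ X`. -/
def matOf (M : G ⊗[ℂ] X) (I : ι) : Matrix (D.V I) (D.V I) X := c.κ I • kHom D I M

theorem datum_matOf (M : G ⊗[ℂ] X) : datum c (matOf c M) = M := by
  refine kHom_ext (D := D) fun I => ?_
  have := kHom_datum (c := c) (matOf c M) I
  exact (smul_right_injective _ (c.κ_ne_zero I) this).symm

/-- Used for the quotient map of the free algebra: it shows that the generators of the quotient, as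
matrices, satisfy the relations themselves. -/
theorem handleRel_map {F : Type*} [Ring F] [Algebra ℂ F] {f : F →ₐ[ℂ] X}
    {A B : ∀ I, Matrix (D.V I) (D.V I) F} (hf : ∀ x y, HandleRel c A B x y → f x = f y) {x y : X}
    (h : HandleRel c (fun I => (A I).map f) (fun I => (B I).map f) x y) : x = y := by
  cases h with
  | unit_A a b =>
    rw [← Matrix.map_one f (map_zero f) (map_one f)]
    exact hf _ _ (.unit_A a b)
  | unit_B a b =>
    rw [← Matrix.map_one f (map_zero f) (map_one f)]
    exact hf _ _ (.unit_B a b)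
  | fun_A I J p q =>
    simp only [← fuse_map, ← inFirst_map, ← inSecond_map, ← num_map f, ← Matrix.map_mul]
    exact hf _ _ (.fun_A I J p q)
  | fun_B I J p q =>
    simp only [← fuse_map, ← inFirst_map, ← inSecond_map, ← num_map f, ← Matrix.map_mul]
    exact hf _ _ (.fun_B I J p q)
  | exchange I J p q =>
    simp only [← inFirst_map, ← inSecond_map, ← num_map f, ← Matrix.map_mul]
    exact hf _ _ (.exchange I J p q)

theorem semiRel_map {F : Type*} [Ring F] [Algebra ℂ F] {f : F →ₐ[ℂ] X}
    {A B : ∀ I, Matrix (D.V I) (D.V I) F} {j : G → F}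
    (hf : ∀ x y, SemiRel c A B j x y → f x = f y) {x y : X}
    (h : SemiRel c (fun I => (A I).map f) (fun I => (B I).map f) (fun x => f (j x)) x y) :
    x = y := by
  cases h with
  | handle h => exact handleRel_map (fun x y h => hf x y (.handle h)) h
  | add x y => simpa using hf _ _ (.add x y)
  | smul r x => simpa using hf _ _ (.smul r x)
  | one => simpa using hf _ _ .one
  | mul x y => simpa using hf _ _ (.mul x y)
  | cov_A x I a b =>
    have e : (D.mu I x).map (fun x => f (j x)) = ((D.mu I x).map j).map f := by
      rw [Matrix.map_map]; rfl
    simp only [e, ← Matrix.map_mul]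
    exact hf _ _ (.cov_A x I a b)
  | cov_B x I a b =>
    have e : (D.mu I x).map (fun x => f (j x)) = ((D.mu I x).map j).map f := by
      rw [Matrix.map_map]; rfl
    simp only [e, ← Matrix.map_mul]
    exact hf _ _ (.cov_B x I a b)

namespace Handle

variable (c) in
/-- The homomorphism from the handle algebra given by a solution of the relations. -/
def lift (A B : ∀ I, Matrix (D.V I) (D.V I) X) (h : ∀ x y, HandleRel c A B x y → x = y) :
    Handle c →ₐ[ℂ] X :=
  RingQuot.liftAlgHom ℂ
    ⟨FreeAlgebra.lift ℂ (Sum.elim (fun i => A i.1 i.2.1 i.2.2) (fun i => B i.1 i.2.1 i.2.2)), by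
      intro x y hxy
      have h' := hxy.map (FreeAlgebra.lift ℂ
        (Sum.elim (fun i => A i.1 i.2.1 i.2.2) (fun i => B i.1 i.2.1 i.2.2)))
      refine h _ _ ?_
      convert h' using 1
      · ext I a b; simp
      · ext I a b; simp⟩

theorem lift_A {A B : ∀ I, Matrix (D.V I) (D.V I) X} (h : ∀ x y, HandleRel c A B x y → x = y)
    (I : ι) (a b : D.V I) : lift c A B h (Handle.A c I a b) = A I a b := by
  simp [lift, Handle.A]

theorem lift_B {A B : ∀ I, Matrix (D.V I) (D.V I) X} (h : ∀ x y, HandleRel c A B x y → x = y)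
    (I : ι) (a b : D.V I) : lift c A B h (Handle.B c I a b) = B I a b := by
  simp [lift, Handle.B]

theorem rel {x y : Handle c} (h : HandleRel c (Handle.A c) (Handle.B c) x y) : x = y :=
  handleRel_map (f := RingQuot.mkAlgHom ℂ _) (fun _ _ h => RingQuot.mkAlgHom_rel ℂ h) h

variable (c) in
theorem isFus_A : IsFus H (datum c (Handle.A c)) := isFus_of_rel_A fun _ _ => rel

variable (c) in
theorem isFus_B : IsFus H (datum c (Handle.B c)) := isFus_of_rel_B fun _ _ => rel

variable (c) in
theorem isExch : IsExch H (datum c (Handle.A c)) (datum c (Handle.B c)) :=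
  isExch_of_rel fun _ _ => rel

variable (c) in
theorem adjoin_eq_top : Algebra.adjoin ℂ ({x | ∃ I a b, x = Handle.A c I a b} ∪
    {x | ∃ I a b, x = Handle.B c I a b}) = ⊤ := by
  have h := FreeAlgebra.adjoin_range_ι (R := ℂ) (X := Gen D)
  have h2 := congrArg (Subalgebra.map (RingQuot.mkAlgHom ℂ (HandleRel c (X := FreeAlgebra ℂ (Gen D))
    (fun I => Matrix.of fun a b => FreeAlgebra.ι ℂ (Sum.inl ⟨I, a, b⟩))
    (fun I => Matrix.of fun a b => FreeAlgebra.ι ℂ (Sum.inr ⟨I, a, b⟩))))) h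
  rw [AlgHom.map_adjoin, Algebra.map_top, (AlgHom.range_eq_top _).mpr
    (RingQuot.mkAlgHom_surjective ℂ _)] at h2
  rw [eq_top_iff, ← h2]
  refine Algebra.adjoin_mono ?_
  rintro _ ⟨_, ⟨i | i, rfl⟩, rfl⟩
  · exact Or.inl ⟨i.1, i.2.1, i.2.2, rfl⟩
  · exact Or.inr ⟨i.1, i.2.1, i.2.2, rfl⟩

variable (c) in
theorem hom_ext {f g : Handle c →ₐ[ℂ] X} (hA : ∀ I a b, f (Handle.A c I a b) = g (Handle.A c I a b))
    (hB : ∀ I a b, f (Handle.B c I a b) = g (Handle.B c I a b)) : f = g := by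
  refine AlgHom.ext_of_adjoin_eq_top (adjoin_eq_top c) ?_
  rintro _ (⟨I, a, b, rfl⟩ | ⟨I, a, b, rfl⟩)
  · exact hA I a b
  · exact hB I a b

end Handle

namespace Semi

theorem rel {x y : Semi c} (h : SemiRel c (Semi.A c) (Semi.B c) (Semi.ofG c) x y) : x = y :=
  semiRel_map (f := RingQuot.mkAlgHom ℂ _) (fun _ _ h => RingQuot.mkAlgHom_rel ℂ h) h

variable (c) in
/-- The homomorphism `G → T ⋊ G`. -/
def hG : G →ₐ[ℂ] Semi c where
  toFun := Semi.ofG c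
  map_one' := rel .one
  map_mul' x y := rel (.mul x y)
  map_zero' := by
    have := rel (c := c) (.smul 0 0)
    simpa using this
  map_add' x y := rel (.add x y)
  commutes' r := by
    rw [Algebra.algebraMap_eq_smul_one, rel (c := c) (.smul r 1), rel (c := c) .one,
      ← Algebra.algebraMap_eq_smul_one]

theorem hG_apply (x : G) : hG c x = ofG c x := rfl

variable (c) in
theorem isFus_A : IsFus H (datum c (Semi.A c)) := isFus_of_rel_A fun _ _ h => rel (.handle h)

variable (c) in
theorem isFus_B : IsFus H (datum c (Semi.B c)) := isFus_of_rel_B fun _ _ h => rel (.handle h)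

variable (c) in
theorem isExch : IsExch H (datum c (Semi.A c)) (datum c (Semi.B c)) :=
  isExch_of_rel fun _ _ h => rel (.handle h)

variable (c) in
theorem isCov_A : IsCov (hG c) (datum c (Semi.A c)) :=
  isCov_iff.mpr fun x I a b => rel (.cov_A x I a b)

variable (c) in
theorem isCov_B : IsCov (hG c) (datum c (Semi.B c)) :=
  isCov_iff.mpr fun x I a b => rel (.cov_B x I a b)

variable (c) in
/-- The homomorphism from the semi-direct product given by a solution of the relations. -/
def lift (A B : ∀ I, Matrix (D.V I) (D.V I) X) (h : G →ₐ[ℂ] X)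
    (hr : ∀ x y, HandleRel c A B x y → x = y) (hA : IsCov h (datum c A))
    (hB : IsCov h (datum c B)) : Semi c →ₐ[ℂ] X :=
  RingQuot.liftAlgHom ℂ
    ⟨FreeAlgebra.lift ℂ (Sum.elim (Sum.elim (fun i => A i.1 i.2.1 i.2.2)
      (fun i => B i.1 i.2.1 i.2.2)) h), by
      intro x y hxy
      set f := FreeAlgebra.lift ℂ (Sum.elim (Sum.elim (fun i : Σ I : ι, D.V I × D.V I =>
        A i.1 i.2.1 i.2.2) (fun i : Σ I : ι, D.V I × D.V I => B i.1 i.2.1 i.2.2)) h) with hf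
      have eA : (fun I => (Matrix.of fun a b => FreeAlgebra.ι ℂ
          (Sum.inl (Sum.inl ⟨I, a, b⟩) : Gen D ⊕ G) : Matrix (D.V I) (D.V I) _).map f) = A := by
        ext I a b; simp [hf]
      have eB : (fun I => (Matrix.of fun a b => FreeAlgebra.ι ℂ
          (Sum.inl (Sum.inr ⟨I, a, b⟩) : Gen D ⊕ G) : Matrix (D.V I) (D.V I) _).map f) = B := by
        ext I a b; simp [hf]
      have ej : ∀ x, f (FreeAlgebra.ι ℂ (Sum.inr x)) = h x := fun x => by simp [hf]
      cases hxy with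
      | handle hh =>
        have h' := hh.map f
        rw [eA, eB] at h'
        exact hr _ _ h'
      | add x y => simp [ej]
      | smul r x => simp [ej]
      | one => simp [ej]
      | mul x y => simp [ej]
      | cov_A x I a b =>
        have e := isCov_iff.mp hA x I a b
        rw [← congrFun eA I] at e
        rw [← Matrix.map_apply (f := f), ← Matrix.map_apply (f := f), Matrix.map_mul,
          Matrix.map_mul, Matrix.map_map]
        convert e using 4 <;> (ext; simp [ej])
      | cov_B x I a b =>
        have e := isCov_iff.mp hB x I a b
        rw [← congrFun eB I] at e
        rw [← Matrix.map_apply (f := f), ← Matrix.map_apply (f := f), Matrix.map_mul,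
          Matrix.map_mul, Matrix.map_map]
        convert e using 4 <;> (ext; simp [ej])⟩

section

variable {A B : ∀ I, Matrix (D.V I) (D.V I) X} {h : G →ₐ[ℂ] X}
    (hr : ∀ x y, HandleRel c A B x y → x = y) (hA : IsCov h (datum c A))
    (hB : IsCov h (datum c B))

theorem lift_A (I : ι) (a b : D.V I) : lift c A B h hr hA hB (Semi.A c I a b) = A I a b := by
  simp [lift, Semi.A]

theorem lift_B (I : ι) (a b : D.V I) : lift c A B h hr hA hB (Semi.B c I a b) = B I a b := by
  simp [lift, Semi.B]

theorem lift_ofG (x : G) : lift c A B h hr hA hB (Semi.ofG c x) = h x := by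
  simp [lift, Semi.ofG]

end

variable (c) in
theorem adjoin_eq_top : Algebra.adjoin ℂ ({x | ∃ I a b, x = Semi.A c I a b} ∪
    {x | ∃ I a b, x = Semi.B c I a b} ∪ Set.range (Semi.ofG c)) = ⊤ := by
  have h := FreeAlgebra.adjoin_range_ι (R := ℂ) (X := Gen D ⊕ G)
  have h2 := congrArg (Subalgebra.map (RingQuot.mkAlgHom ℂ
    (SemiRel c (X := FreeAlgebra ℂ (Gen D ⊕ G))
    (fun I => Matrix.of fun a b => FreeAlgebra.ι ℂ (Sum.inl (Sum.inl ⟨I, a, b⟩)))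
    (fun I => Matrix.of fun a b => FreeAlgebra.ι ℂ (Sum.inl (Sum.inr ⟨I, a, b⟩)))
    (fun x => FreeAlgebra.ι ℂ (Sum.inr x))))) h
  rw [AlgHom.map_adjoin, Algebra.map_top, (AlgHom.range_eq_top _).mpr
    (RingQuot.mkAlgHom_surjective ℂ _)] at h2
  rw [eq_top_iff, ← h2]
  refine Algebra.adjoin_mono ?_
  rintro _ ⟨_, ⟨(i | i) | i, rfl⟩, rfl⟩
  · exact Or.inl (Or.inl ⟨i.1, i.2.1, i.2.2, rfl⟩)
  · exact Or.inl (Or.inr ⟨i.1, i.2.1, i.2.2, rfl⟩)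
  · exact Or.inr ⟨i, rfl⟩

end Semi

end Lifts

/-! ### Homomorphisms from solutions of the functoriality relations -/

section Sand

variable {G : Type u} [Ring G] [HopfAlgebra ℂ G] {Y : Type*} [Ring Y] [Algebra ℂ Y]

/-- `∑ g(w₂) z f(w₁)`. -/
def sand (f g : G →ₐ[ℂ] Y) (z : Y) : G ⊗[ℂ] G →ₗ[ℂ] Y :=
  legL (LinearMap.mulRight ℂ z ∘ₗ g.toLinearMap) f.toLinearMap ∘ₗ (swap G).toLinearMap

@[simp] theorem sand_tmul (f g : G →ₐ[ℂ] Y) (z : Y) (x y : G) :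
    sand f g z (x ⊗ₜ y) = g y * z * f x := rfl

@[simp] theorem sand_one (f g : G →ₐ[ℂ] Y) (z : Y) : sand f g z 1 = z := by
  simp [Algebra.TensorProduct.one_def]

theorem sand_sand (f g : G →ₐ[ℂ] Y) (z : Y) (u w : G ⊗[ℂ] G) :
    sand f g (sand f g z u) (TensorProduct.map LinearMap.id (HopfAlgebra.antipode ℂ) w) =
      sand f g z (legL (il G).toLinearMap (legL ((ir G).toLinearMap ∘ₗ HopfAlgebra.antipode ℂ)
        (ir G).toLinearMap) (leg13 G u * leg12 G w)) := by
  induction w with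
  | zero => simp
  | add x y hx hy => simp only [map_add, mul_add, hx, hy]
  | tmul w1 w2 =>
    induction u with
    | zero => simp [sand]
    | add x y hx hy =>
      simp only [map_add, add_mul, ← hx, ← hy]
      simp only [TensorProduct.map_tmul, sand_tmul, mul_add, add_mul]
    | tmul u1 u2 => simp [mul_assoc]

variable [StarRing G] [StarModule ℂ G] {H : RibbonHopfStar G}

-- By the second hexagon identity the two successive insertions combine to one, with the convolution
-- of the antipode and the identity in the second leg. That convolution is the co-unit, for which
-- `R` is trivial.
variable (H) in
theorem sand_R_left_inv (f g : G →ₐ[ℂ] Y) (z : Y) :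
    sand f g (sand f g z (H.R : G ⊗[ℂ] G))
      (TensorProduct.map LinearMap.id (HopfAlgebra.antipode ℂ) (H.R : G ⊗[ℂ] G)) = z := by
  rw [sand_sand, ← RibbonHopfStar.legL_cvL_right (il G) _ _ _ H.idComul_R, cvL_antipode_left]
  have : legL (il G).toLinearMap (epsL (G ⊗[ℂ] G)) (H.R : G ⊗[ℂ] G) = 1 := H.rm_eps_right (il G)
  rw [this, sand_one]

theorem sand_R_injective {f g : G →ₐ[ℂ] Y} {z z' : Y}
    (h : sand f g z (H.R : G ⊗[ℂ] G) = sand f g z' (H.R : G ⊗[ℂ] G)) : z = z' := by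
  rw [← sand_R_left_inv H f g z, h, sand_R_left_inv]

/-- A factor such as the `R₁₂` between `M₁₃` and `M₂₃` can be pulled out around the product, since
each leg commutes with one of the neighbours. By `sand_R_injective` it can then be cancelled. -/
theorem mul_leg_mul {f g : G →ₐ[ℂ] Y} (h : Cm f g) {z z' : Y} (hz : ∀ x, Commute z (g x))
    (hz' : ∀ x, Commute z' (f x)) (w : G ⊗[ℂ] G) : z * leg f g w * z' = sand f g (z * z') w := by
  induction w with
  | zero => simp
  | add x y hx hy => simp only [map_add, mul_add, add_mul, hx, hy]
  | tmul x y =>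
    rw [leg_tmul, sand_tmul, (h x y).eq, mul_assoc, mul_assoc, ← (hz' x).eq, ← mul_assoc,
      (hz y).eq, mul_assoc, mul_assoc, mul_assoc]

end Sand

section Central

variable {P X : Type*} [Ring P] [Algebra ℂ P] [Ring X] [Algebra ℂ X]

theorem commute_tmul_one {x : P} (hx : ∀ y, x * y = y * x) (z : P ⊗[ℂ] X) :
    Commute (x ⊗ₜ[ℂ] (1 : X)) z := by
  induction z with
  | zero => exact Commute.zero_right _
  | add a b ha hb => exact ha.add_right hb
  | tmul a b => simp [commute_iff_eq, hx]

theorem commute_one_tmul {x : X} (hx : ∀ y, x * y = y * x) (z : P ⊗[ℂ] X) :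
    Commute ((1 : P) ⊗ₜ[ℂ] x) z := by
  induction z with
  | zero => exact Commute.zero_right _
  | add a b ha hb => exact ha.add_right hb
  | tmul a b => simp [commute_iff_eq, hx]

end Central

/-! ### The solution `v₁⁻¹R'R` of the functoriality relations. -/

section Qv

variable {G : Type u} [Ring G] [HopfAlgebra ℂ G] [StarRing G] [StarModule ℂ G]
  (H : RibbonHopfStar G) {X Y Z : Type*} [Ring X] [Algebra ℂ X] [Ring Y] [Algebra ℂ Y]
  [Ring Z] [Algebra ℂ Z]

namespace RibbonHopfStar

/-- `v⁻¹` -/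
abbrev vi : G := ((H.ribbon⁻¹ : Gˣ) : G)

/-- `v₁⁻¹ R' R`. -/
def Qv : G ⊗[ℂ] G := (H.vi ⊗ₜ 1) * H.Q

variable {H}

theorem vi_central (x : G) : H.vi * x = x * H.vi := by
  have : Commute (H.ribbon : G) x := H.ribbon_central x
  exact this.units_inv_left

theorem leg_Qv {f g : G →ₐ[ℂ] Y} (h : Cm f g) :
    leg f g H.Qv = f H.vi * (H.rm g f * H.rm f g) := by
  rw [Qv, h.leg_mul, leg_Q h]
  simp

theorem comul_vi : Coalgebra.comul (R := ℂ) H.vi = (H.vi ⊗ₜ H.vi) * H.Q := by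
  have h := H.comul_ribbon
  have h1 : Coalgebra.comul (R := ℂ) (H.ribbon : G) * Coalgebra.comul (R := ℂ) H.vi = 1 := by
    rw [← Bialgebra.comul_mul, Units.mul_inv, Bialgebra.comul_one]
  have h2 : (H.vi ⊗ₜ[ℂ] H.vi) * ((H.ribbon : G) ⊗ₜ[ℂ] (H.ribbon : G)) = 1 := by
    rw [Algebra.TensorProduct.tmul_mul_tmul, Units.inv_mul, Algebra.TensorProduct.one_def]
  have h3 : (H.vi ⊗ₜ[ℂ] H.vi) * H.Q * Coalgebra.comul (R := ℂ) (H.ribbon : G) = 1 := by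
    rw [mul_assoc]; exact (congrArg _ h).trans h2
  exact (left_inv_eq_right_inv h3 h1).symm

theorem Q_cv {f g : G →ₐ[ℂ] Y} (h : Cm f g) (x : G) :
    Commute (H.rm g f * H.rm f g) (cv f g h x) := by
  rw [commute_iff_eq, ← leg_Q h, cv_apply, ← h.leg_mul, Q_comul, h.leg_mul]

variable (H) in
theorem counit_vi : Coalgebra.counit (R := ℂ) H.vi = 1 := by
  have h : Coalgebra.counit (R := ℂ) (H.vi * (H.ribbon : G)) = 1 := by
    rw [Units.inv_mul, Bialgebra.counit_one]
  rwa [Bialgebra.counit_mul, H.counit_ribbon, mul_one] at h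

/-- The factor `Δ(v⁻¹) = (v⁻¹ ⊗ v⁻¹)R'R` accounts for the additional R-matrices in the legs 1 and 2;
the rest is two applications of the Yang-Baxter equation. -/
theorem isFus_Qv : IsFus H H.Qv where
  unit := by
    have h := leg_Qv (H := H) (cm_eps (AlgHom.id ℂ G))
    rw [leg_eps, rm_eps_left, rm_eps_right, eps_apply, H.counit_vi] at h
    simpa using h
  fus := by
    have h12 := cm_i12 (G := G) (X := G)
    have h13 := cm_i13 (G := G) (X := G)
    have h23 := cm_i23 (G := G) (X := G)
    have e1 : ∀ z, Commute (i1 G G H.vi) z := commute_tmul_one H.vi_central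
    have e2 : ∀ z, Commute (i2 G G H.vi) z := 
      commute_one_tmul fun z => commute_tmul_one H.vi_central z
    have ec : cv (i1 G G) (i2 G G) h12 H.vi = i1 G G H.vi * i2 G G H.vi *
        (H.rm (i2 G G) (i1 G G) * H.rm (i1 G G) (i2 G G)) := by
      rw [cv_apply, comul_vi, h12.leg_mul, leg_Q h12, leg_tmul]
    have y1 := yangBaxter (H := H) h13.symm h23.symm h12
    have y2 := yangBaxter (H := H) h12 h13 h23
    -- The product `R₁₃R₁₂` is `(id ⊗ Δ)R`, and `R'R` in the legs 2 and 3 commutes with the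
    -- co-product in these legs.
    have y3 : Commute (H.rm (i3 G G) (i2 G G) * H.rm (i2 G G) (i3 G G))
        (H.rm (i1 G G) (i3 G G) * H.rm (i1 G G) (i2 G G)) := by
      rw [← hexR h23 h12 h13]
      refine commute_leg (fun x => ?_) (Q_cv h23) _
      exact ((commute_leg (h13 x) (h12 x) _).mul_right (commute_leg (h12 x) (h13 x) _)).symm
    rw [leg_Qv (Cm.cv_left h13 h23), hexL h12 h23, hexR h12 h13.symm h23.symm, leg_Qv h13,
      leg_Qv h23, ec]
    generalize i1 G G H.vi = v1 at *
    generalize i2 G G H.vi = v2 at *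
    generalize H.rm (i1 G G) (i2 G G) = r12 at *
    generalize H.rm (i2 G G) (i1 G G) = r21 at *
    generalize H.rm (i1 G G) (i3 G G) = r13 at *
    generalize H.rm (i3 G G) (i1 G G) = r31 at *
    generalize H.rm (i2 G G) (i3 G G) = r23 at *
    generalize H.rm (i3 G G) (i2 G G) = r32 at *
    calc r21 * (v1 * (r31 * r13)) * r12 * (v2 * (r32 * r23))
        = v1 * v2 * (r21 * r31 * (r13 * r12 * (r32 * r23))) := by
          rw [← mul_assoc r21, ← (e1 r21).eq, mul_assoc _ v2, ← mul_assoc _ v2,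
            ← (e2 (v1 * r21 * (r31 * r13) * r12)).eq, ← mul_assoc v2]
          simp only [mul_assoc]
          rw [← mul_assoc v2 v1, (e2 v1).eq, mul_assoc]
      _ = v1 * v2 * (r21 * (r31 * (r32 * (r23 * (r13 * r12))))) := by
          rw [← y3.eq]; simp only [mul_assoc]
      _ = v1 * v2 * (r21 * ((r31 * (r32 * r12)) * (r13 * r23))) := by
          rw [← y2]; simp only [mul_assoc]
      _ = _ := by
          rw [y1]; simp only [mul_assoc]

end RibbonHopfStar

variable {H}

theorem leg_map (f : G →ₐ[ℂ] Y) (k : Z →ₐ[ℂ] Y) (φ : X →ₐ[ℂ] Z) (z : G ⊗[ℂ] X) :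
    leg f k (Algebra.TensorProduct.map (AlgHom.id ℂ G) φ z) = leg f (k.comp φ) z := by
  induction z with
  | zero => simp
  | add x y hx hy => simp only [map_add, hx, hy]
  | tmul x y => simp

theorem ct_map (f : Module.Dual ℂ G) (φ : X →ₐ[ℂ] Z) (z : G ⊗[ℂ] X) :
    ct f (Algebra.TensorProduct.map (AlgHom.id ℂ G) φ z) = φ (ct f z) :=
  (map_ct φ.toLinearMap f z).symm

theorem IsFus.map {M : G ⊗[ℂ] X} (hM : IsFus H M) (φ : X →ₐ[ℂ] Z) :
    IsFus H (Algebra.TensorProduct.map (AlgHom.id ℂ G) φ M) where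
  unit := by rw [ct_map, hM.unit, map_one]
  fus := by
    simp only [leg_map]
    exact hM.apply cm_i12 (fun x y => cm_i13 x _) (fun x y => cm_i23 x _)

end Qv

/-! ### Universality of `v₁⁻¹R'R`. -/

section ExistsHom

variable {G : Type u} [Ring G] [HopfAlgebra ℂ G] [StarRing G] [StarModule ℂ G]
  {H : RibbonHopfStar G} {X Y Z : Type*} [Ring X] [Algebra ℂ X] [Ring Y] [Algebra ℂ Y]
  [Ring Z] [Algebra ℂ Z]

/-- `id ⊗ id ⊗ a` for a linear map `a`. -/
def map3 (a : X →ₗ[ℂ] Z) : G ⊗[ℂ] (G ⊗[ℂ] X) →ₗ[ℂ] G ⊗[ℂ] (G ⊗[ℂ] Z) :=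
  TensorProduct.map LinearMap.id (TensorProduct.map LinearMap.id a)

theorem map3_i1_mul (a : X →ₗ[ℂ] Z) (x : G) (z : G ⊗[ℂ] (G ⊗[ℂ] X)) :
    map3 a (i1 G X x * z) = i1 G Z x * map3 a z := by
  induction z with
  | zero => simp
  | add u w hu hw => simp only [map_add, mul_add, hu, hw]
  | tmul p q => simp [map3]

theorem map3_mul_i1 (a : X →ₗ[ℂ] Z) (x : G) (z : G ⊗[ℂ] (G ⊗[ℂ] X)) :
    map3 a (z * i1 G X x) = map3 a z * i1 G Z x := by
  induction z with
  | zero => simp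
  | add u w hu hw => simp only [map_add, add_mul, hu, hw]
  | tmul p q => simp [map3]

theorem map3_i2_mul (a : X →ₗ[ℂ] Z) (x : G) (z : G ⊗[ℂ] (G ⊗[ℂ] X)) :
    map3 a (i2 G X x * z) = i2 G Z x * map3 a z := by
  induction z with
  | zero => simp
  | add u w hu hw => simp only [map_add, mul_add, hu, hw]
  | tmul p q =>
    induction q with
    | zero => simp
    | add u w hu hw => simp only [TensorProduct.tmul_add, map_add, mul_add, hu, hw]
    | tmul q r => simp [map3]

theorem map3_sand (a : X →ₗ[ℂ] Z) (w : G ⊗[ℂ] G) (z : G ⊗[ℂ] (G ⊗[ℂ] X)) :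
    map3 a (sand (i1 G X) (i2 G X) z w) = sand (i1 G Z) (i2 G Z) (map3 a z) w := by
  induction w with
  | zero => simp
  | add x y hx hy => simp only [map_add, hx, hy]
  | tmul x y => rw [sand_tmul, sand_tmul, map3_mul_i1, map3_i2_mul]

theorem map3_leg_mul (a : X →ₗ[ℂ] Z) (w : G ⊗[ℂ] G) (z : G ⊗[ℂ] (G ⊗[ℂ] X)) :
    map3 a (leg (i2 G X) (i1 G X) w * z) = leg (i2 G Z) (i1 G Z) w * map3 a z := by
  induction w with
  | zero => simp
  | add x y hx hy => simp only [map_add, add_mul, hx, hy]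
  | tmul x y => rw [leg_tmul, leg_tmul, mul_assoc, mul_assoc, map3_i2_mul, map3_i1_mul]

theorem map3_leg_cv (a : X →ₗ[ℂ] Z) (z : G ⊗[ℂ] X) :
    map3 a (leg (cv (i1 G X) (i2 G X) cm_i12) (i3 G X) z) =
      leg (cv (i1 G Z) (i2 G Z) cm_i12) (i3 G Z) (TensorProduct.map LinearMap.id a z) := by
  induction z with
  | zero => simp
  | add x y hx hy => simp only [map_add, hx, hy]
  | tmul x y =>
    rw [leg_tmul, TensorProduct.map_tmul, leg_tmul, cv_apply, cv_apply]
    induction Coalgebra.comul (R := ℂ) x with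
    | zero => simp
    | add p q hp hq => simp only [map_add, add_mul, hp, hq]
    | tmul p q => simp [map3]

theorem ct_ct_map3 (a : X →ₗ[ℂ] Z) (f g : Module.Dual ℂ G) (z : G ⊗[ℂ] (G ⊗[ℂ] X)) :
    ct g (ct f (map3 a z)) = a (ct g (ct f z)) := by
  rw [map_ct a g (ct f z), map_ct (TensorProduct.map LinearMap.id a) f z]
  rfl

theorem ct_ct_leg_mul (f g : Module.Dual ℂ G) (z w : G ⊗[ℂ] X) :
    ct g (ct f (leg (i1 G X) (i3 G X) z * leg (i2 G X) (i3 G X) w)) = ct f z * ct g w := by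
  induction z with
  | zero => simp
  | add x y hx hy => simp only [map_add, add_mul, hx, hy]
  | tmul x y =>
    induction w with
    | zero => simp
    | add p q hp hq => simp only [map_add, mul_add, hp, hq]
    | tmul p q => simp [smul_smul, mul_comm]

theorem leg_rm_leg (z : G ⊗[ℂ] X) :
    leg (i1 G X) (i3 G X) z * H.rm (i1 G X) (i2 G X) * leg (i2 G X) (i3 G X) z =
      sand (i1 G X) (i2 G X) (leg (i1 G X) (i3 G X) z * leg (i2 G X) (i3 G X) z)
        (H.R : G ⊗[ℂ] G) :=
  mul_leg_mul cm_i12 (fun x => (commute_leg (fun y => (cm_i12 y x).symm) (cm_i23 x) z).symm)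
    (fun x => (commute_leg (cm_i12 x) (cm_i13 x) z).symm) _

/-- Applying `a` to the functoriality relation of `v₁⁻¹R'R` gives the right-hand side of the
relation of `M`. The surrounding R-matrices are the same on both sides and can be cancelled, which
leaves multiplicativity of `a` on contractions. -/
theorem IsFus.ct_mul {M : G ⊗[ℂ] X} (hM : IsFus H M) (a : G →ₗ[ℂ] X)
    (ha : TensorProduct.map LinearMap.id a H.Qv = M) (f g : Module.Dual ℂ G) :
    a (ct f H.Qv * ct g H.Qv) = ct f M * ct g M := by
  have h1 := congrArg (map3 a) (RibbonHopfStar.isFus_Qv (H := H)).fus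
  rw [map3_leg_cv, ha, ← hM.fus, mul_assoc (H.rm _ _), mul_assoc (H.rm _ _),
    mul_assoc (H.rm _ _), mul_assoc (H.rm _ _), leg_rm_leg, leg_rm_leg] at h1
  have h2 : map3 a (H.rm (i2 G G) (i1 G G) * sand (i1 G G) (i2 G G) (leg (i1 G G) (i3 G G) H.Qv *
      leg (i2 G G) (i3 G G) H.Qv) (H.R : G ⊗[ℂ] G)) = _ := map3_leg_mul a _ _
  rw [h2, map3_sand] at h1
  have h3 := congrArg (H.ri (i2 G X) (i1 G X) * ·) h1
  have h4 : ∀ z, H.ri (i2 G X) (i1 G X) * (leg (i2 G X) (i1 G X) (H.R : G ⊗[ℂ] G) * z) = z :=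
    fun z => RibbonHopfStar.ri_mul_rm_assoc cm_i12.symm z
  have h5 : ∀ z, H.ri (i2 G X) (i1 G X) * (H.rm (i2 G X) (i1 G X) * z) = z := h4
  simp only [h4, h5] at h3
  have h6 := sand_R_injective h3
  rw [← ct_ct_leg_mul, ← ct_ct_leg_mul, ← h6, ct_ct_map3]

variable [FiniteDimensional ℂ G]

/-- Contraction of `v₁⁻¹R'R` is surjective, hence bijective by dimension, so `a` may be defined by
sending its contractions to those of `M`. Functoriality of `M` is what makes `a` multiplicative. -/
theorem IsFus.exists_hom {M : G ⊗[ℂ] X} (hM : IsFus H M)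
    (hQ : Function.Surjective fun f => ct f H.Qv) :
    ∃ a : G →ₐ[ℂ] X, Algebra.TensorProduct.map (AlgHom.id ℂ G) a H.Qv = M := by
  have hb : Function.Bijective (ctL H.Qv) := by
    refine ⟨?_, hQ⟩
    rw [LinearMap.injective_iff_surjective_of_finrank_eq_finrank Subspace.dual_finrank_eq]
    exact hQ
  let F := LinearEquiv.ofBijective (ctL H.Qv) hb
  let a : G →ₗ[ℂ] X := ctL M ∘ₗ F.symm.toLinearMap
  have hF : ∀ f, F f = ct f H.Qv := fun f => rfl
  have haF : ∀ f, a (ct f H.Qv) = ct f M := fun f => by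
    change ctL M (F.symm (ct f H.Qv)) = _
    rw [← hF, F.symm_apply_apply]
    rfl
  have ha : TensorProduct.map LinearMap.id a H.Qv = M :=
    ct_ext fun f => by rw [← map_ct, haF]
  have h1 : a 1 = 1 := by rw [← (RibbonHopfStar.isFus_Qv (H := H)).unit, haF, hM.unit]
  have hmul : ∀ x y, a (x * y) = a x * a y := fun x y => by
    obtain ⟨f, rfl⟩ := hQ x
    obtain ⟨g, rfl⟩ := hQ y
    rw [haF, haF]
    exact hM.ct_mul a ha f g
  exact ⟨AlgHom.ofLinearMap a h1 hmul, ha⟩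

end ExistsHom

/-! ### Normal ordering -/

section Order

variable {G : Type u} [Ring G] [HopfAlgebra ℂ G] {X Y : Type*} [Ring X] [Algebra ℂ X] [Ring Y]
  [Algebra ℂ Y]

/-- The space of the contractions of `M ∈ G ⊗ X`. -/
def ctRange (M : G ⊗[ℂ] X) : Submodule ℂ X := LinearMap.range (ctL M)

theorem ct_mem_ctRange (f : Module.Dual ℂ G) (M : G ⊗[ℂ] X) : ct f M ∈ ctRange M := ⟨f, rfl⟩

theorem ct_mul_right' (f : Module.Dual ℂ G) (z : G ⊗[ℂ] X) (x : G) (y : X) :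
    ct f (z * (x ⊗ₜ y)) = ct (f ∘ₗ LinearMap.mulRight ℂ x) z * y := by
  induction z with
  | zero => simp
  | tmul x y => simp
  | add x y hx hy => simp only [add_mul, map_add, hx, hy]

/-- The tensors whose contractions lie in `K`. -/
def tens3 (G : Type u) [Ring G] [Algebra ℂ G] (K : Submodule ℂ X) :
    Submodule ℂ (G ⊗[ℂ] (G ⊗[ℂ] X)) where
  carrier := {z | ∀ f g, ct g (ct f z) ∈ K}
  add_mem' ha hb f g := by rw [map_add, map_add]; exact K.add_mem (ha f g) (hb f g)
  zero_mem' f g := by simp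
  smul_mem' r z hz f g := by rw [map_smul, map_smul]; exact K.smul_mem r (hz f g)

variable {K : Submodule ℂ X} {z : G ⊗[ℂ] (G ⊗[ℂ] X)}

theorem i1_mul_mem (hz : z ∈ tens3 G K) (x : G) : i1 G X x * z ∈ tens3 G K := fun f g => by
  rw [show i1 G X x * z = (x ⊗ₜ[ℂ] (1 : G ⊗[ℂ] X)) * z from rfl, ct_left_mul]
  exact hz _ _

theorem mul_i1_mem (hz : z ∈ tens3 G K) (x : G) : z * i1 G X x ∈ tens3 G K := fun f g => by
  rw [show z * i1 G X x = z * (x ⊗ₜ[ℂ] (1 : G ⊗[ℂ] X)) from rfl, ct_mul_right', mul_one]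
  exact hz _ _

theorem i2_mul_mem (hz : z ∈ tens3 G K) (x : G) : i2 G X x * z ∈ tens3 G K := fun f g => by
  rw [show i2 G X x * z = ((1 : G) ⊗ₜ[ℂ] (x ⊗ₜ[ℂ] (1 : X))) * z from rfl, ct_mul_left, ct_left_mul]
  exact hz _ _

theorem mul_i2_mem (hz : z ∈ tens3 G K) (x : G) : z * i2 G X x ∈ tens3 G K := fun f g => by
  rw [show z * i2 G X x = z * ((1 : G) ⊗ₜ[ℂ] (x ⊗ₜ[ℂ] (1 : X))) from rfl, ct_mul_right,
    ct_mul_right', mul_one]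
  exact hz _ _

theorem sand_mem {f g : G →ₐ[ℂ] G ⊗[ℂ] (G ⊗[ℂ] X)}
    (hf : ∀ x, ∀ z ∈ tens3 G K, z * f x ∈ tens3 G K)
    (hg : ∀ x, ∀ z ∈ tens3 G K, g x * z ∈ tens3 G K) (hz : z ∈ tens3 G K) (w : G ⊗[ℂ] G) :
    sand f g z w ∈ tens3 G K := by
  induction w with
  | zero => rw [map_zero]; exact zero_mem _
  | add x y hx hy => rw [map_add]; exact add_mem hx hy
  | tmul x y => exact hf _ _ (hg _ _ hz)

theorem leg12_mul_mem (hz : z ∈ tens3 G K) (w : G ⊗[ℂ] G) :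
    leg (i1 G X) (i2 G X) w * z ∈ tens3 G K := by
  induction w with
  | zero => rw [map_zero, zero_mul]; exact zero_mem _
  | add x y hx hy => rw [map_add, add_mul]; exact add_mem hx hy
  | tmul x y => rw [leg_tmul, mul_assoc]; exact i1_mul_mem (i2_mul_mem hz _) _

theorem mul_leg12_mem (hz : z ∈ tens3 G K) (w : G ⊗[ℂ] G) :
    z * leg (i1 G X) (i2 G X) w ∈ tens3 G K := by
  induction w with
  | zero => rw [map_zero, mul_zero]; exact zero_mem _
  | add x y hx hy => rw [map_add, mul_add]; exact add_mem hx hy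
  | tmul x y => rw [leg_tmul, ← mul_assoc]; exact mul_i2_mem (mul_i1_mem hz _) _

theorem ct_ct_leg_mul' (f g : Module.Dual ℂ G) (z w : G ⊗[ℂ] X) :
    ct g (ct f (leg (i2 G X) (i3 G X) z * leg (i1 G X) (i3 G X) w)) = ct g z * ct f w := by
  induction z with
  | zero => simp
  | add x y hx hy => simp only [map_add, add_mul, hx, hy]
  | tmul x y =>
    induction w with
    | zero => simp
    | add p q hp hq => simp only [map_add, mul_add, hp, hq]
    | tmul p q => simp [smul_smul]

theorem cvL_mem {K : Submodule ℂ Y} {p q : G →ₗ[ℂ] Y} (h : ∀ x y, p x * q y ∈ K) (x : G) :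
    cvL p q x ∈ K := by
  rw [cvL_eq]
  induction Coalgebra.comul (R := ℂ) x with
  | zero => rw [map_zero, map_zero]; exact zero_mem _
  | add x y hx hy => rw [map_add, map_add]; exact add_mem hx hy
  | tmul x y => exact h x y

theorem one_tmul_eq_cvL (h : G →ₐ[ℂ] X) (x : G) : (1 : G) ⊗ₜ[ℂ] h x =
    cvL ((Algebra.TensorProduct.includeLeft : G →ₐ[ℂ] G ⊗[ℂ] X).toLinearMap ∘ₗ
      HopfAlgebra.antipode ℂ) (cvL (Algebra.TensorProduct.includeLeft : G →ₐ[ℂ] G ⊗[ℂ] X).toLinearMap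
        ((Algebra.TensorProduct.includeRight : X →ₐ[ℂ] G ⊗[ℂ] X).comp h).toLinearMap) x := by
  rw [← cvL_assoc, cvL_antipode_left, eps_cvL]
  rfl

/-- Expand `1 ⊗ h(x)` as `∑ S(x₁)x₂ ⊗ h(x₃)`. Covariance moves `x₂ ⊗ h(x₃)` to the right of `M`, and
`S(x₁)` is absorbed in the contracting functional. -/
theorem IsCov.mul_ctRange_le {h : G →ₐ[ℂ] X} {M : G ⊗[ℂ] X} (hM : IsCov h M) :
    LinearMap.range h.toLinearMap * ctRange M ≤ ctRange M * LinearMap.range h.toLinearMap := by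
  rw [Submodule.mul_le]
  rintro _ ⟨x, rfl⟩ _ ⟨f, rfl⟩
  set d : G →ₗ[ℂ] G ⊗[ℂ] X :=
    cvL (Algebra.TensorProduct.includeLeft : G →ₐ[ℂ] G ⊗[ℂ] X).toLinearMap
        ((Algebra.TensorProduct.includeRight : X →ₐ[ℂ] G ⊗[ℂ] X).comp h).toLinearMap with hd
  have h1 : LinearMap.mulRight ℂ M ∘ₗ d = LinearMap.mulLeft ℂ M ∘ₗ d := by
    ext y; exact (hM y).eq
  have h2 : ∀ y f, ct f (M * d y) ∈ ctRange M * LinearMap.range h.toLinearMap := fun y f => by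
    rw [hd, cvL_eq]
    induction Coalgebra.comul (R := ℂ) y with
    | zero => simp
    | add x y hx hy => simp only [map_add, mul_add]; exact add_mem hx hy
    | tmul x y =>
      have : LinearMap.mul' ℂ (G ⊗[ℂ] X) (TensorProduct.map
        (Algebra.TensorProduct.includeLeft : G →ₐ[ℂ] G ⊗[ℂ] X).toLinearMap
        ((Algebra.TensorProduct.includeRight : X →ₐ[ℂ] G ⊗[ℂ] X).comp h).toLinearMap (x ⊗ₜ[ℂ] y)) =
          x ⊗ₜ h y := by simp
      rw [this, ct_mul_right']
      exact Submodule.mul_mem_mul (ct_mem_ctRange _ _) ⟨y, rfl⟩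
  change h x * ct f M ∈ _
  rw [← ct_mul_left, one_tmul_eq_cvL, ← cvL_mul_right, h1]
  -- All contractions are treated simultaneously, so that `cvL_mem` can be used for a subspace of `G
  -- ⊗ X`.
  let K' : Submodule ℂ (G ⊗[ℂ] X) := ⨅ f, (ctRange M * LinearMap.range h.toLinearMap).comap (ct f)
  have h3 : ∀ z, z ∈ K' ↔ ∀ f, ct f z ∈ ctRange M * LinearMap.range h.toLinearMap := fun z => by
    simp [K', Submodule.mem_iInf]
  refine (h3 _).mp (cvL_mem (fun y y' => (h3 _).mpr fun f => ?_) x) f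
  rw [LinearMap.comp_apply, AlgHom.toLinearMap_apply, Algebra.TensorProduct.includeLeft_apply,
    ct_left_mul]
  exact h2 _ _

variable [StarRing G] [StarModule ℂ G] {H : RibbonHopfStar G}

/-- The exchange relation writes `N₂₃R₂₁M₁₃` as `M₁₃R₁₂N₂₃` between R-matrices in legs 1 and 2, and
such R-matrices do not affect membership. The inner `R₂₁` is then removed by `sand_R_left_inv`. -/
theorem IsExch.mul_ctRange_le {M N : G ⊗[ℂ] X} (h : IsExch H M N) :
    ctRange N * ctRange M ≤ ctRange M * ctRange N := by
  rw [Submodule.mul_le]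
  rintro _ ⟨g, rfl⟩ _ ⟨f, rfl⟩
  set K := ctRange M * ctRange N
  have c1 : ∀ z : G ⊗[ℂ] X, ∀ x, Commute (leg (i1 G X) (i3 G X) z) (i2 G X x) := fun z x =>
    (commute_leg (fun y => (cm_i12 y x).symm) (cm_i23 x) z).symm
  have c2 : ∀ z : G ⊗[ℂ] X, ∀ x, Commute (leg (i2 G X) (i3 G X) z) (i1 G X x) := fun z x =>
    (commute_leg (cm_i12 x) (cm_i13 x) z).symm
  have h0 : leg (i1 G X) (i3 G X) M * leg (i2 G X) (i3 G X) N ∈ tens3 G K := fun f g => by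
    rw [ct_ct_leg_mul]
    exact Submodule.mul_mem_mul (ct_mem_ctRange _ _) (ct_mem_ctRange _ _)
  have h1 : leg (i1 G X) (i3 G X) M * H.rm (i1 G X) (i2 G X) * leg (i2 G X) (i3 G X) N ∈
      tens3 G K := by
    rw [RibbonHopfStar.rm, mul_leg_mul cm_i12 (c1 M) (c2 N)]
    exact sand_mem (fun x z hz => mul_i1_mem hz x) (fun x z hz => i2_mul_mem hz x) h0 _
  have h2 : leg (i2 G X) (i3 G X) N * H.rm (i2 G X) (i1 G X) * leg (i1 G X) (i3 G X) M ∈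
      tens3 G K := by
    have e : leg (i2 G X) (i3 G X) N * H.rm (i2 G X) (i1 G X) * leg (i1 G X) (i3 G X) M =
        H.ri (i1 G X) (i2 G X) * (leg (i1 G X) (i3 G X) M * H.rm (i1 G X) (i2 G X) *
          leg (i2 G X) (i3 G X) N) * H.ri (i1 G X) (i2 G X) := by
      have h' : H.ri (i1 G X) (i2 G X) * (leg (i1 G X) (i3 G X) M * H.rm (i1 G X) (i2 G X) *
          leg (i2 G X) (i3 G X) N) = leg (i2 G X) (i3 G X) N * H.rm (i2 G X) (i1 G X) *
            leg (i1 G X) (i3 G X) M * H.rm (i1 G X) (i2 G X) := by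
        rw [← show _ = _ from h]; simp only [mul_assoc]
      rw [h']
      simp only [mul_assoc, RibbonHopfStar.rm_mul_ri cm_i12, mul_one]
    rw [e]
    exact mul_leg12_mem (leg12_mul_mem h1 _) _
  rw [RibbonHopfStar.rm, mul_leg_mul cm_i12.symm (c2 N) (c1 M)] at h2
  have h3 := sand_mem (f := i2 G X) (g := i1 G X) (fun x z hz => mul_i2_mem hz x)
    (fun x z hz => i1_mul_mem hz x) h2
    (TensorProduct.map LinearMap.id (HopfAlgebra.antipode ℂ) (H.R : G ⊗[ℂ] G))
  rw [sand_R_left_inv] at h3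
  have h4 := h3 f g
  rwa [ct_ct_leg_mul'] at h4

theorem ctRange_map (a : G →ₐ[ℂ] X) (hQ : Function.Surjective fun f => ct f H.Qv) :
    ctRange (Algebra.TensorProduct.map (AlgHom.id ℂ G) a H.Qv) = LinearMap.range a.toLinearMap := by
  ext x
  constructor
  · rintro ⟨f, rfl⟩
    exact ⟨ct f H.Qv, (ct_map f a _).symm⟩
  · rintro ⟨y, rfl⟩
    obtain ⟨f, rfl⟩ := hQ y
    exact ⟨f, ct_map f a _⟩

end Order

section Closed

variable {X : Type*} [Ring X] [Algebra ℂ X]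

theorem range_mul_range {Z : Type*} [Ring Z] [Algebra ℂ Z] (a : Z →ₐ[ℂ] X) :
    LinearMap.range a.toLinearMap * LinearMap.range a.toLinearMap ≤
      LinearMap.range a.toLinearMap := by
  rw [Submodule.mul_le]
  rintro _ ⟨x, rfl⟩ _ ⟨y, rfl⟩
  exact ⟨x * y, by simp⟩

theorem mul_closed {A B : Submodule ℂ X} (hA : A * A ≤ A) (hB : B * B ≤ B)
    (hBA : B * A ≤ A * B) : (A * B) * (A * B) ≤ A * B :=
  calc (A * B) * (A * B) = A * (B * A) * B := by simp only [mul_assoc]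
    _ ≤ A * (A * B) * B := by gcongr
    _ = (A * A) * (B * B) := by simp only [mul_assoc]
    _ ≤ A * B := by gcongr

theorem adjoin_le_of_mul_le {s : Set X} {A : Submodule ℂ X} (h1 : (1 : X) ∈ A) (hA : A * A ≤ A)
    (hs : s ⊆ A) : (Algebra.adjoin ℂ s).toSubmodule ≤ A := by
  have : Algebra.adjoin ℂ s ≤ A.toSubalgebra h1 fun x y hx hy => hA (Submodule.mul_mem_mul hx hy) :=
    Algebra.adjoin_le hs
  exact this

end Closed

/-! ### Normal-ordered spanning sets. -/

section Spans

variable {G : Type u} [Ring G] [HopfAlgebra ℂ G] [StarRing G] [StarModule ℂ G]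
  [FiniteDimensional ℂ G] [IsSemisimpleRing G]
  {ι : Type v} [Fintype ι] [DecidableEq ι] {H : RibbonHopfStar G} {D : IrrepSystem G ι}
  {X : Type*} [Ring X] [Algebra ℂ X] (c : ClebschGordan H D)

theorem entry_mem_ctRange (A : ∀ I, Matrix (D.V I) (D.V I) X) (I : ι) (a b : D.V I) :
    A I a b ∈ ctRange (datum c A) := by
  rw [apply_eq_ct_datum c A]
  exact Submodule.smul_mem _ _ (ct_mem_ctRange _ _)

theorem ctRange_le {A : ∀ I, Matrix (D.V I) (D.V I) X} {K : Submodule ℂ X}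
    (h : ∀ I a b, A I a b ∈ K) : ctRange (datum c A) ≤ K := by
  rintro _ ⟨f, rfl⟩
  rw [D.functional_eq_sum f]
  simp only [map_sum, map_smul]
  refine K.sum_mem fun I _ => K.sum_mem fun a _ => K.sum_mem fun b _ => K.smul_mem _ ?_
  have := apply_eq_ct_datum c A I a b
  rw [ctL_apply, ← (inv_smul_eq_iff₀ (c.κ_ne_zero I)).mpr this]
  exact K.smul_mem _ (h I a b)

variable (hQ : Function.Surjective fun f => ct f H.Qv)
include hQ

theorem IsFus.ctRange_eq {M : G ⊗[ℂ] X} (hM : IsFus H M) :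
    1 ∈ ctRange M ∧ ctRange M * ctRange M ≤ ctRange M := by
  obtain ⟨a, rfl⟩ := hM.exists_hom hQ
  rw [ctRange_map a hQ]
  exact ⟨⟨1, by simp⟩, range_mul_range a⟩

namespace Handle

/-- Normal-ordered products contain `1` and the generators and are closed under multiplication. This
bounds the dimension of the handle algebra by `(dim G)²` and reduces statements about it to products
of one `A` and one `B`. -/
theorem span_eq_top : ctRange (datum c (Handle.A c)) * ctRange (datum c (Handle.B c)) = ⊤ := by
  obtain ⟨a1, a2⟩ := (Handle.isFus_A c).ctRange_eq hQ
  obtain ⟨b1, b2⟩ := (Handle.isFus_B c).ctRange_eq hQ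
  rw [eq_top_iff, ← Algebra.top_toSubmodule, ← Handle.adjoin_eq_top c]
  refine adjoin_le_of_mul_le (by simpa using Submodule.mul_mem_mul a1 b1)
    (mul_closed a2 b2 (Handle.isExch c).mul_ctRange_le) ?_
  rintro _ (⟨I, a, b, rfl⟩ | ⟨I, a, b, rfl⟩)
  · simpa using Submodule.mul_mem_mul (entry_mem_ctRange c (Handle.A c) I a b) b1
  · simpa using Submodule.mul_mem_mul a1 (entry_mem_ctRange c (Handle.B c) I a b)

end Handle

namespace Semi

theorem LAG_eq : (Semi.LAG c).toSubmodule =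
    ctRange (datum c (Semi.A c)) * LinearMap.range (hG c).toLinearMap := by
  obtain ⟨a1, a2⟩ := (Semi.isFus_A c).ctRange_eq hQ
  have c1 : (1 : Semi c) ∈ LinearMap.range (hG c).toLinearMap := ⟨1, by simp⟩
  apply le_antisymm
  · refine adjoin_le_of_mul_le (by simpa using Submodule.mul_mem_mul a1 c1)
      (mul_closed a2 (range_mul_range _) (Semi.isCov_A c).mul_ctRange_le) ?_
    rintro _ (⟨I, a, b, rfl⟩ | ⟨x, rfl⟩)
    · simpa using Submodule.mul_mem_mul (entry_mem_ctRange c (Semi.A c) I a b) c1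
    · have h2 : Semi.ofG c x ∈ LinearMap.range (hG c).toLinearMap := ⟨x, rfl⟩
      simpa using Submodule.mul_mem_mul a1 h2
  · rw [Submodule.mul_le]
    rintro x hx _ ⟨y, rfl⟩
    refine (Semi.LAG c).mul_mem ?_ (Algebra.subset_adjoin (Or.inr ⟨y, rfl⟩))
    exact ctRange_le c (K := (Semi.LAG c).toSubmodule)
      (fun I a b => Algebra.subset_adjoin (Or.inl ⟨I, a, b, rfl⟩)) hx

theorem span_eq_top : ctRange (datum c (Semi.A c)) * (ctRange (datum c (Semi.B c)) *
    LinearMap.range (hG c).toLinearMap) = ⊤ := by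
  obtain ⟨a1, a2⟩ := (Semi.isFus_A c).ctRange_eq hQ
  obtain ⟨b1, b2⟩ := (Semi.isFus_B c).ctRange_eq hQ
  have c1 : (1 : Semi c) ∈ LinearMap.range (hG c).toLinearMap := ⟨1, by simp⟩
  have bc1 : (1 : Semi c) ∈ ctRange (datum c (Semi.B c)) * LinearMap.range (hG c).toLinearMap := by
    simpa using Submodule.mul_mem_mul b1 c1
  have h := mul_closed b2 (range_mul_range _) (Semi.isCov_B c).mul_ctRange_le
  have h' : (ctRange (datum c (Semi.B c)) * LinearMap.range (hG c).toLinearMap) *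
      ctRange (datum c (Semi.A c)) ≤ ctRange (datum c (Semi.A c)) *
        (ctRange (datum c (Semi.B c)) * LinearMap.range (hG c).toLinearMap) :=
    calc _ = ctRange (datum c (Semi.B c)) * (LinearMap.range (hG c).toLinearMap *
          ctRange (datum c (Semi.A c))) := by rw [mul_assoc]
      _ ≤ ctRange (datum c (Semi.B c)) * (ctRange (datum c (Semi.A c)) *
          LinearMap.range (hG c).toLinearMap) := by
        exact mul_le_mul' le_rfl (Semi.isCov_A c).mul_ctRange_le
      _ = ctRange (datum c (Semi.B c)) * ctRange (datum c (Semi.A c)) *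
          LinearMap.range (hG c).toLinearMap := by rw [mul_assoc]
      _ ≤ ctRange (datum c (Semi.A c)) * ctRange (datum c (Semi.B c)) *
          LinearMap.range (hG c).toLinearMap := by
        exact mul_le_mul' (Semi.isExch c).mul_ctRange_le le_rfl
      _ = _ := by rw [mul_assoc]
  rw [eq_top_iff, ← Algebra.top_toSubmodule, ← Semi.adjoin_eq_top c]
  refine adjoin_le_of_mul_le (by simpa using Submodule.mul_mem_mul a1 bc1) (mul_closed a2 h h') ?_
  rintro _ ((⟨I, a, b, rfl⟩ | ⟨I, a, b, rfl⟩) | ⟨x, rfl⟩)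
  · simpa using Submodule.mul_mem_mul (entry_mem_ctRange c (Semi.A c) I a b) bc1
  · have h2 := Submodule.mul_mem_mul (entry_mem_ctRange c (Semi.B c) I a b) c1
    simpa using Submodule.mul_mem_mul a1 h2
  · have h2 : Semi.ofG c x ∈ LinearMap.range (hG c).toLinearMap := ⟨x, rfl⟩
    simpa using Submodule.mul_mem_mul a1 (Submodule.mul_mem_mul b1 h2)

end Semi

end Spans

/-! ### The model on the functionals on `G` -/

section Lift

variable {P X Y Z : Type*} [Ring P] [Algebra ℂ P] [Ring X] [Algebra ℂ X] [Ring Y] [Algebra ℂ Y]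
  [Ring Z] [Algebra ℂ Z]

theorem lift_comp_includeLeft {f : P →ₐ[ℂ] Y} {k : X →ₐ[ℂ] Y} (hfk : Cm f k) :
    (Algebra.TensorProduct.lift f k hfk).comp Algebra.TensorProduct.includeLeft = f :=
  AlgHom.ext fun y => (Algebra.TensorProduct.lift_tmul f k hfk _ _).trans (by simp)

theorem lift_comp_includeRight {f : P →ₐ[ℂ] Y} {k : X →ₐ[ℂ] Y} (hfk : Cm f k) (h : Z →ₐ[ℂ] X) :
    (Algebra.TensorProduct.lift f k hfk).comp
      ((Algebra.TensorProduct.includeRight : X →ₐ[ℂ] P ⊗[ℂ] X).comp h) = k.comp h :=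
  AlgHom.ext fun y => (Algebra.TensorProduct.lift_tmul f k hfk _ _).trans (by simp)

end Lift

section Model

variable (G : Type u) [Ring G] [HopfAlgebra ℂ G]

/-- The operators on the functionals on `G`. -/
abbrev DEnd : Type u := Module.End ℂ (Module.Dual ℂ G)

/-- The left regular action `f ↦ f(S(x) ·)`. -/
def lreg : G →ₐ[ℂ] DEnd G where
  toFun x :=
    { toFun := fun f => f ∘ₗ LinearMap.mulLeft ℂ (HopfAlgebra.antipode ℂ x)
      map_add' := fun f g => by ext; simp
      map_smul' := fun r f => by ext; simp }
  map_one' := by ext; simp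
  map_mul' x y := by ext; simp [HopfAlgebra.antipode_mul_antidistrib]
  map_zero' := by ext; simp
  map_add' x y := by ext; simp [add_mul]
  commutes' r := by
    ext; simp [Algebra.algebraMap_eq_smul_one]

/-- The right regular action `f ↦ f(· x)`. -/
def rreg : G →ₐ[ℂ] DEnd G where
  toFun x :=
    { toFun := fun f => f ∘ₗ LinearMap.mulRight ℂ x
      map_add' := fun f g => by ext; simp
      map_smul' := fun r f => by ext; simp }
  map_one' := by ext; simp
  map_mul' x y := by ext; simp [mul_assoc]
  map_zero' := by ext; simp
  map_add' x y := by ext; simp [mul_add]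
  commutes' r := by
    ext; simp [Algebra.algebraMap_eq_smul_one]

/-- The multiplication `f ↦ ∑ f(·₁) g(·₂)` of functionals. -/
def conv : Module.Dual ℂ G →ₗ[ℂ] DEnd G where
  toFun g :=
    { toFun := fun f => cvL f g
      map_add' := fun f f' => by
        ext x; rw [LinearMap.add_apply, cvL_eq, cvL_eq, cvL_eq, TensorProduct.map_add_left]; simp
      map_smul' := fun r f => by
        ext x; rw [LinearMap.smul_apply, cvL_eq, cvL_eq, TensorProduct.map_smul_left]; simp }
  map_add' g g' := by
    ext f x
    change cvL f (g + g') x = cvL f g x + cvL f g' x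
    rw [cvL_eq, cvL_eq, cvL_eq, TensorProduct.map_add_right]; simp
  map_smul' r g := by
    ext f x
    change cvL f (r • g) x = r * cvL f g x
    rw [cvL_eq, cvL_eq, TensorProduct.map_smul_right]; simp

variable {G}

@[simp] theorem lreg_apply (x : G) (f : Module.Dual ℂ G) (y : G) :
    lreg G x f y = f (HopfAlgebra.antipode ℂ x * y) := rfl

@[simp] theorem rreg_apply (x : G) (f : Module.Dual ℂ G) (y : G) : rreg G x f y = f (y * x) := rfl

theorem conv_apply (g f : Module.Dual ℂ G) : conv G g f = cvL f g := rfl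

theorem cm_lreg_rreg : Cm (lreg G) (rreg G) := fun x y => by
  rw [commute_iff_eq]
  ext f z
  simp [mul_assoc]

theorem conv_mul_conv (g g' : Module.Dual ℂ G) : conv G g' * conv G g = conv G (cvL g g') := by
  ext f x
  simp [conv_apply, cvL_assoc]

theorem conv_counit : conv G Coalgebra.counit = 1 := by
  ext f x
  rw [conv_apply]
  exact LinearMap.congr_fun (cvL_eps f) x

theorem conv_apply_counit (f : Module.Dual ℂ G) : conv G f Coalgebra.counit = f := by
  rw [conv_apply]
  exact eps_cvL f

/-- `f ⊗ g` as a functional on `G ⊗ G`. -/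
def dual2 (f g : Module.Dual ℂ G) : Module.Dual ℂ (G ⊗[ℂ] G) :=
  LinearMap.mul' ℂ ℂ ∘ₗ TensorProduct.map f g

theorem cvL_eq_dual2 (f g : Module.Dual ℂ G) (x : G) :
    cvL f g x = dual2 f g (Coalgebra.comul (R := ℂ) x) := rfl

theorem dual2_left_mul (f g : Module.Dual ℂ G) (x y : G) (z : G ⊗[ℂ] G) :
    dual2 (f ∘ₗ LinearMap.mulLeft ℂ x) (g ∘ₗ LinearMap.mulLeft ℂ y) z =
      dual2 f g ((x ⊗ₜ y) * z) := by
  induction z with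
  | zero => simp
  | add u w hu hw => simp only [map_add, mul_add, hu, hw]
  | tmul u w => simp [dual2]

theorem dual2_right_mul (f g : Module.Dual ℂ G) (x y : G) (z : G ⊗[ℂ] G) :
    dual2 (f ∘ₗ LinearMap.mulRight ℂ x) (g ∘ₗ LinearMap.mulRight ℂ y) z =
      dual2 f g (z * (x ⊗ₜ y)) := by
  induction z with
  | zero => simp
  | add u w hu hw => simp only [map_add, add_mul, hu, hw]
  | tmul u w => simp [dual2]

theorem mul_comul_antipode (x : G) : cvL (ir G).toLinearMap (Coalgebra.comul ∘ₗ
    HopfAlgebra.antipode ℂ) x = HopfAlgebra.antipode ℂ x ⊗ₜ[ℂ] 1 := by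
  have h : (Coalgebra.comul ∘ₗ HopfAlgebra.antipode ℂ : G →ₗ[ℂ] G ⊗[ℂ] G) = _ :=
    LinearMap.ext fun x => comul_antipode x
  rw [h]
  have h2 := LinearMap.congr_fun (cvL_assoc (ir G).toLinearMap ((ir G).toLinearMap ∘ₗ
    HopfAlgebra.antipode ℂ) ((il G).toLinearMap ∘ₗ HopfAlgebra.antipode ℂ)) x
  rw [cvL_antipode_right, eps_cvL] at h2
  exact h2.symm

/-- The co-product is multiplicative, so right translation of a product of functionals translates
both factors by the parts of `Δ(x)`. -/
theorem rreg_mul_conv (x : G) (g : Module.Dual ℂ G) (z : G ⊗[ℂ] G)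
    (hz : z = Coalgebra.comul (R := ℂ) x) : rreg G x * conv G g =
    LinearMap.mul' ℂ (DEnd G) (TensorProduct.map
      (conv G ∘ₗ (LinearMap.mul ℂ G).flip.compr₂ g) (rreg G).toLinearMap (swap G z)) := by
  have h : ∀ z : G ⊗[ℂ] G, ∀ f y, LinearMap.mul' ℂ (DEnd G) (TensorProduct.map
      (conv G ∘ₗ (LinearMap.mul ℂ G).flip.compr₂ g) (rreg G).toLinearMap (swap G z)) f y =
      dual2 f g (Coalgebra.comul (R := ℂ) y * z) := fun z f y => by
    induction z with
    | zero => simp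
    | add u w hu hw => simp only [map_add, mul_add, LinearMap.add_apply, hu, hw]
    | tmul u w =>
      rw [← dual2_right_mul]
      rfl
  ext f y
  rw [h, hz, ← Bialgebra.comul_mul]
  rfl

/-- Left translation contains the antipode, which reverses the co-product. With the multiplication
operator standing on the left, one part of `Δ(x)` cancels against the antipode and a one-sided
translation of `g` remains. -/
theorem lreg_mul_conv (x : G) (g : Module.Dual ℂ G) (z : G ⊗[ℂ] G)
    (hz : z = Coalgebra.comul (R := ℂ) x) : conv G g * lreg G x =
    LinearMap.mul' ℂ (DEnd G) (TensorProduct.map (lreg G).toLinearMap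
      (conv G ∘ₗ (LinearMap.mul ℂ G).compr₂ g) (swap G z)) := by
  have h : ∀ z : G ⊗[ℂ] G, ∀ f y, LinearMap.mul' ℂ (DEnd G) (TensorProduct.map
      (lreg G).toLinearMap (conv G ∘ₗ (LinearMap.mul ℂ G).compr₂ g) (swap G z)) f y =
      dual2 f g (LinearMap.mul' ℂ (G ⊗[ℂ] G) (TensorProduct.map (ir G).toLinearMap
        (Coalgebra.comul ∘ₗ HopfAlgebra.antipode ℂ) z) * Coalgebra.comul (R := ℂ) y) :=
      fun z f y => by
    induction z with
    | zero => simp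
    | add u w hu hw => simp only [map_add, add_mul, LinearMap.add_apply, hu, hw]
    | tmul u w =>
      have : LinearMap.mul' ℂ (G ⊗[ℂ] G) (TensorProduct.map (ir G).toLinearMap
        (Coalgebra.comul ∘ₗ HopfAlgebra.antipode ℂ) (u ⊗ₜ w)) =
          (1 ⊗ₜ u) * Coalgebra.comul (R := ℂ) (HopfAlgebra.antipode ℂ w) := rfl
      rw [this, mul_assoc, ← Bialgebra.comul_mul, ← dual2_left_mul, LinearMap.mulLeft_one]
      rfl
  ext f y
  rw [h, hz, ← cvL_eq, mul_comul_antipode, ← dual2_left_mul, LinearMap.mulLeft_one]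
  rfl

variable [FiniteDimensional ℂ G]

variable (G) in
/-- The canonical element `∑ bᵢ ⊗ ρ(bⁱ)`. -/
def Mr : G ⊗[ℂ] DEnd G :=
  ∑ i, Module.finBasis ℂ G i ⊗ₜ[ℂ] conv G ((Module.finBasis ℂ G).coord i)

theorem ct_Mr (f : Module.Dual ℂ G) : ct f (Mr G) = conv G f := by
  simp only [Mr, map_sum, ct_tmul]
  simp only [← map_smul, ← map_sum]
  congr 1
  exact (Module.finBasis ℂ G).sum_dual_apply_smul_coord f

theorem ct_cv_leg {X : Type*} [Ring X] [Algebra ℂ X] (f g : Module.Dual ℂ G) (z : G ⊗[ℂ] X) :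
    ct g (ct f (leg (cv (i1 G X) (i2 G X) cm_i12) (i3 G X) z)) = ct (cvL f g) z := by
  induction z with
  | zero => simp
  | add x y hx hy => simp only [map_add, hx, hy]
  | tmul x y =>
    rw [leg_tmul, cv_apply, ct_tmul, cvL_eq]
    induction Coalgebra.comul (R := ℂ) x with
    | zero => simp
    | add p q hp hq => simp only [map_add, add_mul, hp, hq, add_smul]
    | tmul p q => simp [smul_smul]

theorem Mr_mul_Mr : leg (i2 G (DEnd G)) (i3 G (DEnd G)) (Mr G) *
    leg (i1 G (DEnd G)) (i3 G (DEnd G)) (Mr G) =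
      leg (cv (i1 G (DEnd G)) (i2 G (DEnd G)) cm_i12) (i3 G (DEnd G)) (Mr G) := by
  refine ct_ext fun f => ct_ext fun g => ?_
  rw [ct_ct_leg_mul', ct_cv_leg, ct_Mr, ct_Mr, ct_Mr, conv_mul_conv]

variable [StarRing G] [StarModule ℂ G] {Y : Type*} [Ring Y] [Algebra ℂ Y]

theorem Mr_fus {f g : G →ₐ[ℂ] Y} {k : DEnd G →ₐ[ℂ] Y} (hfg : Cm f g) (hfk : Cm f k)
    (hgk : Cm g k) : leg g k (Mr G) * leg f k (Mr G) = leg (cv f g hfg) k (Mr G) := by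
  have h := congrArg (lift3 f g k hfg hfk hgk) Mr_mul_Mr
  simp only [map_mul, map_leg, lift3_i1, lift3_i2, lift3_i3] at h
  exact h.trans (congrArg (fun t => leg t k (Mr G)) (comp_cv_i12 f g k hfg hfk hgk))

theorem Mr_lreg {f : G →ₐ[ℂ] Y} {k : DEnd G →ₐ[ℂ] Y} (hfk : Cm f k) (x : G) :
    SemiconjBy (leg f k (Mr G)) (k (lreg G x))
      (cv f (k.comp (lreg G)) (fun a _ => hfk a _) x) := by
  have key : Mr G * (1 ⊗ₜ lreg G x) = leg Algebra.TensorProduct.includeLeft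
      ((Algebra.TensorProduct.includeRight : DEnd G →ₐ[ℂ] G ⊗[ℂ] DEnd G).comp (lreg G))
        (Coalgebra.comul (R := ℂ) x) * Mr G := by
    refine ct_ext fun g => ?_
    rw [ct_mul_right, ct_Mr, lreg_mul_conv x g _ rfl]
    induction Coalgebra.comul (R := ℂ) x with
    | zero => simp
    | add u w hu hw => simp only [map_add, add_mul, hu, hw]
    | tmul u w =>
      have : leg Algebra.TensorProduct.includeLeft
        ((Algebra.TensorProduct.includeRight : DEnd G →ₐ[ℂ] G ⊗[ℂ] DEnd G).comp (lreg G))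
          (u ⊗ₜ w) = (1 ⊗ₜ lreg G w) * (u ⊗ₜ 1) := by simp
      rw [this, mul_assoc, ct_mul_left, ct_left_mul, ct_Mr]
      rfl
  have h := congrArg (Algebra.TensorProduct.lift f k hfk) key
  rw [map_mul, map_mul, map_leg, lift_comp_includeLeft, lift_comp_includeRight, ← leg_eq_lift, ← leg_eq_lift, leg_tmul, map_one,
    one_mul, ← cv_apply f (k.comp (lreg G)) (fun a _ => hfk a _)] at h
  exact h

theorem Mr_rreg {f : G →ₐ[ℂ] Y} {k : DEnd G →ₐ[ℂ] Y} (hfk : Cm f k) (x : G) :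
    SemiconjBy (leg f k (Mr G)) (cv (k.comp (rreg G)) f (fun _ b => (hfk b _).symm) x)
      (k (rreg G x)) := by
  have key : (1 ⊗ₜ rreg G x) * Mr G = Mr G * leg 
      ((Algebra.TensorProduct.includeRight : DEnd G →ₐ[ℂ] G ⊗[ℂ] DEnd G).comp (rreg G))
        Algebra.TensorProduct.includeLeft (Coalgebra.comul (R := ℂ) x) := by
    refine ct_ext fun g => ?_
    rw [ct_mul_left, ct_Mr, rreg_mul_conv x g _ rfl]
    induction Coalgebra.comul (R := ℂ) x with
    | zero => simp
    | add u w hu hw => simp only [map_add, mul_add, hu, hw]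
    | tmul u w =>
      have : leg ((Algebra.TensorProduct.includeRight : DEnd G →ₐ[ℂ] G ⊗[ℂ] DEnd G).comp (rreg G))
          Algebra.TensorProduct.includeLeft (u ⊗ₜ w) = w ⊗ₜ rreg G u := by simp
      rw [this, ct_mul_right', ct_Mr]
      rfl
  have h := congrArg (Algebra.TensorProduct.lift f k hfk) key
  rw [map_mul, map_mul, map_leg, lift_comp_includeLeft, lift_comp_includeRight, ← leg_eq_lift, ← leg_eq_lift, leg_tmul, map_one,
    one_mul, ← cv_apply (k.comp (rreg G)) f (fun _ b => (hfk b _).symm)] at h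
  exact h.symm

end Model

/-! ### The relations of the handle algebra in the model -/

section ModelRel

variable {G : Type u} [Ring G] [HopfAlgebra ℂ G] [StarRing G] [StarModule ℂ G]
  {H : RibbonHopfStar G} {X Y : Type*} [Ring X] [Algebra ℂ X] [Ring Y] [Algebra ℂ Y]

theorem cm_include {P : Type*} [Ring P] [Algebra ℂ P] :
    Cm (Algebra.TensorProduct.includeLeft : P →ₐ[ℂ] P ⊗[ℂ] X)
      (Algebra.TensorProduct.includeRight : X →ₐ[ℂ] P ⊗[ℂ] X) := fun x y => by
  simp [commute_iff_eq]

theorem leg_include {P : Type*} [Ring P] [Algebra ℂ P] (z : P ⊗[ℂ] X) :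
    leg (Algebra.TensorProduct.includeLeft : P →ₐ[ℂ] P ⊗[ℂ] X)
      (Algebra.TensorProduct.includeRight : X →ₐ[ℂ] P ⊗[ℂ] X) z = z := by
  induction z with
  | zero => simp
  | add x y hx hy => simp only [map_add, hx, hy]
  | tmul x y => simp

namespace RibbonHopfStar

theorem commute_rm {m : Y} {f g : G →ₐ[ℂ] Y} (hf : ∀ x, Commute m (f x))
    (hg : ∀ x, Commute m (g x)) : Commute m (H.rm f g) := commute_leg hf hg _

theorem commute_ri {m : Y} {f g : G →ₐ[ℂ] Y} (hf : ∀ x, Commute m (f x))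
    (hg : ∀ x, Commute m (g x)) : Commute m (H.ri f g) := commute_leg hf hg _

theorem ri_qtri {f g : G →ₐ[ℂ] Y} (h : Cm f g) (x : G) :
    SemiconjBy (H.ri f g) (cv g f h.symm x) (cv f g h x) := by
  have h1 := (qtri (H := H) h x).eq
  calc H.ri f g * cv g f h.symm x
      = H.ri f g * (cv g f h.symm x * H.rm f g) * H.ri f g := by
        simp only [mul_assoc, rm_mul_ri h, mul_one]
    _ = cv f g h x * H.ri f g := by
        rw [← h1, ← mul_assoc, ri_mul_rm h, one_mul]

end RibbonHopfStar

open RibbonHopfStar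

variable [FiniteDimensional ℂ G]

variable (H) in
/-- The solution `A` of the functoriality relation in the model. -/
def MA : G ⊗[ℂ] DEnd G :=
  Mr G * H.ri ((Algebra.TensorProduct.includeRight : DEnd G →ₐ[ℂ] G ⊗[ℂ] DEnd G).comp (rreg G))
      Algebra.TensorProduct.includeLeft *
    H.rm Algebra.TensorProduct.includeLeft
      ((Algebra.TensorProduct.includeRight : DEnd G →ₐ[ℂ] G ⊗[ℂ] DEnd G).comp (lreg G))

theorem leg_MA {f : G →ₐ[ℂ] Y} {k : DEnd G →ₐ[ℂ] Y} (hfk : Cm f k) :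
    leg f k (MA H) = leg f k (Mr G) * H.ri (k.comp (rreg G)) f * H.rm f (k.comp (lreg G)) := by
  rw [MA, hfk.leg_mul, hfk.leg_mul, leg_eq_lift hfk (H.ri _ _), leg_eq_lift hfk (H.rm _ _), map_ri,
    map_rm, lift_comp_includeLeft, lift_comp_includeRight, lift_comp_includeRight]

variable (H) in
/-- The solution `B` of the functoriality relation in the model. -/
def MB : G ⊗[ℂ] DEnd G := Algebra.TensorProduct.map (AlgHom.id ℂ G) (lreg G) H.Qv

theorem isFus_MB : IsFus H (MB H) := isFus_Qv.map _

theorem leg_MB {f : G →ₐ[ℂ] Y} {k : DEnd G →ₐ[ℂ] Y} (hfk : Cm f k) :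
    leg f k (MB H) = f H.vi * (H.rm (k.comp (lreg G)) f * H.rm f (k.comp (lreg G))) := by
  rw [MB, leg_map, leg_Qv fun x y => hfk x _]

/-- Moving the dressing factors of the first leg past the canonical element of the second leg
absorbs `R₁₂` on one side and creates `R₂₁⁻¹` on the other. The latter cancels the explicit `R₂₁`
once that has passed through the product of the canonical elements, which is a co-product. -/
theorem isFus_MA : IsFus H (MA H) where
  unit := by
    have h := leg_MA (H := H) (cm_eps (G := G) (AlgHom.id ℂ (DEnd G)))
    rw [leg_eps, leg_eps, ri_eps_right, rm_eps_left, ct_Mr, conv_counit] at h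
    simpa using h
  fus := by
    have h12 := cm_i12 (G := G) (X := DEnd G)
    have h13 := cm_i13 (G := G) (X := DEnd G)
    have h23 := cm_i23 (G := G) (X := DEnd G)
    have hc3 := Cm.cv_left (h := h12) h13 h23
    rw [leg_MA h13, leg_MA h23, leg_MA hc3]
    set f := i1 G (DEnd G)
    set g := i2 G (DEnd G)
    set k := i3 G (DEnd G)
    set L := k.comp (lreg G)
    set R := k.comp (rreg G)
    have h1L : Cm f L := fun x y => h13 x _
    have h1R : Cm f R := fun x y => h13 x _
    have h2L : Cm g L := fun x y => h23 x _
    have h2R : Cm g R := fun x y => h23 x _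
    have hLR : Cm L R := cm_lreg_rreg.map k
    have e1 : leg f k (Mr G) * leg g k (Mr G) = leg (cv g f h12.symm) k (Mr G) :=
      Mr_fus h12.symm h23 h13
    have m1 : ∀ x, Commute (leg f k (Mr G)) (g x) := fun x =>
      (commute_leg (fun y => (h12 y x).symm) (h23 x) _).symm
    have m2 : ∀ x, Commute (leg g k (Mr G)) (f x) := fun x =>
      (commute_leg (h12 x) (h13 x) _).symm
    have e2 : H.rm f L * H.rm f g * leg g k (Mr G) = leg g k (Mr G) * H.rm f L := by
      rw [← hexR h2L h12 h1L]
      exact (leg_semiconj m2 (Mr_lreg h23) _).eq.symm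
    have e3 : H.ri R f * leg g k (Mr G) = leg g k (Mr G) * (H.ri g f * H.ri R f) := by
      rw [← ri_hexL h2R.symm h12.symm h1R.symm]
      exact (leg_semiconj (Mr_rreg h23) m2 _).eq.symm
    have e4 : H.rm g f * leg (cv g f h12.symm) k (Mr G) = leg (cv f g h12) k (Mr G) * H.rm g f :=
      (rm_leg_left h12.symm h23 h13 _).eq
    have e5 : Commute (H.rm f L) (H.ri R g) :=
      commute_ri (fun x => (commute_rm (fun y => (h1R y x).symm) (fun y => (hLR y x).symm)).symm)
        (fun x => (commute_rm (fun y => (h12 y x).symm) (fun y => h2L x y)).symm)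
    rw [hexL h12 h2L, ri_hexR h12 h1R.symm]
    have e6 := rm_mul_ri (H := H) h12.symm
    generalize H.rm f L = a at *
    generalize H.rm f g = b at *
    generalize leg f k (Mr G) = m at *
    generalize leg g k (Mr G) = n at *
    generalize H.ri R f = p at *
    generalize H.ri R g = q at *
    generalize H.rm g L = s at *
    calc H.rm g f * (m * p * a) * b * (n * q * s)
        = H.rm g f * (m * (p * ((a * b * n) * (q * s)))) := by simp only [mul_assoc]
      _ = H.rm g f * (m * ((p * n) * (a * q * s))) := by rw [e2]; simp only [mul_assoc]
      _ = H.rm g f * (m * n) * (H.ri g f * p) * (a * q * s) := by rw [e3]; simp only [mul_assoc]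
      _ = leg (cv f g h12) k (Mr G) * (H.rm g f * H.ri g f) * p * (a * q * s) := by
          rw [e1, e4]; simp only [mul_assoc]
      _ = _ := by rw [e6, mul_one, e5.eq]; simp only [mul_assoc]; rfl

/-- Each R-matrix of `B` is moved past the canonical element of `A` by `Mr_lreg`, with an R-matrix
in legs 1 and 2 as the price. What is left is that `R'R` in the legs 2 and `lreg` commutes with a
co-product in the same legs. -/
theorem isExch_MA_MB : IsExch H (MA H) (MB H) := by
  have h12 := cm_i12 (G := G) (X := DEnd G)
  have h13 := cm_i13 (G := G) (X := DEnd G)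
  have h23 := cm_i23 (G := G) (X := DEnd G)
  have hv : ∀ z, Commute (i2 G (DEnd G) H.vi) z :=
    commute_one_tmul fun z => commute_tmul_one vi_central z
  rw [IsExch, leg_MA h13, leg_MB h23]
  set f := i1 G (DEnd G)
  set g := i2 G (DEnd G)
  set k := i3 G (DEnd G)
  set L := k.comp (lreg G)
  set R := k.comp (rreg G)
  have h1L : Cm f L := fun x y => h13 x _
  have h1R : Cm f R := fun x y => h13 x _
  have h2L : Cm g L := fun x y => h23 x _
  have h2R : Cm g R := fun x y => h23 x _
  have hLR : Cm L R := cm_lreg_rreg.map k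
  have m1 : ∀ x, Commute (leg f k (Mr G)) (g x) := fun x =>
    (commute_leg (fun y => (h12 y x).symm) (h23 x) _).symm
  have e1 : H.rm g L * H.rm g f * leg f k (Mr G) = leg f k (Mr G) * H.rm g L := by
    rw [← hexR h1L h12.symm h2L]
    exact (leg_semiconj m1 (Mr_lreg h13) _).eq.symm
  have e2 : H.rm f g * H.rm L g * leg f k (Mr G) = leg f k (Mr G) * H.rm L g := by
    rw [← hexL h1L h2L.symm]
    exact (leg_semiconj (Mr_lreg h13) m1 _).eq.symm
  have e3 : Commute (H.rm L g * H.rm g L) (H.ri R f) := by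
    refine commute_ri (fun x => ?_) (fun x => ?_)
    · exact ((commute_rm (fun y => (hLR y x).symm) (fun y => (h2R y x).symm)).mul_right
        (commute_rm (fun y => (h2R y x).symm) (fun y => (hLR y x).symm))).symm
    · exact ((commute_rm (fun y => h1L x y) (fun y => h12 x y)).mul_right
        (commute_rm (fun y => h12 x y) (fun y => h1L x y))).symm
  have e4 : Commute (H.rm L g * H.rm g L) (H.rm f L * H.rm f g) := by
    rw [← hexR h2L h12 h1L]
    refine commute_rm (fun x => ?_) (Q_cv h2L)
    exact ((commute_rm (fun y => h1L x y) (fun y => h12 x y)).mul_right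
        (commute_rm (fun y => h12 x y) (fun y => h1L x y))).symm
  have e5 := ri_mul_rm (H := H) h12
  generalize H.rm f L = a at *
  generalize H.rm L g = q1 at *
  generalize H.rm g L = q2 at *
  generalize leg f k (Mr G) = m at *
  generalize H.ri R f = p at *
  generalize H.rm g f = r21 at *
  generalize H.rm f g = b at *
  generalize H.ri f g = bi at *
  symm
  calc g H.vi * (q1 * q2) * r21 * (m * p * a) * b
      = g H.vi * (q1 * ((q2 * r21 * m) * (p * a * b))) := by simp only [mul_assoc]
    _ = g H.vi * ((bi * b) * q1 * m * (q2 * p * a * b)) := by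
        rw [e1, e5]; simp only [mul_assoc, one_mul]
    _ = g H.vi * (bi * (b * q1 * m) * (q2 * p * a * b)) := by simp only [mul_assoc]
    _ = g H.vi * (bi * m * ((q1 * q2) * p) * (a * b)) := by rw [e2]; simp only [mul_assoc]
    _ = g H.vi * (bi * m * p * ((q1 * q2) * (a * b))) := by rw [e3.eq]; simp only [mul_assoc]
    _ = bi * (m * p * a) * b * (g H.vi * (q1 * q2)) := by
        rw [e4.eq, ← mul_assoc _ (g H.vi), ← (hv (bi * (m * p * a) * b)).eq]
        simp only [mul_assoc]

variable (G) in
/-- The adjoint action in the model. -/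
def had : G →ₐ[ℂ] DEnd G := cv (lreg G) (rreg G) cm_lreg_rreg

/-- The co-product of the adjoint action lives in the legs `f`, `L`, `R`. The three factors of `A`
permute the order of these legs: `R(f,L)` exchanges `f` and `L`, `R⁻¹(R,f)` exchanges `f` and `R`,
and the canonical element brings `f` back to the front. -/
theorem commute_leg_MA {f : G →ₐ[ℂ] Y} {k : DEnd G →ₐ[ℂ] Y} (hfk : Cm f k) (x : G) :
    Commute (leg f (k.comp (had G)) (Coalgebra.comul (R := ℂ) x)) (leg f k (MA H)) := by
  set L := k.comp (lreg G) with hL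
  set R := k.comp (rreg G) with hR
  have h1L : Cm f L := fun x y => hfk x _
  have h1R : Cm f R := fun x y => hfk x _
  have hLR : Cm L R := cm_lreg_rreg.map k
  have e0 : k.comp (had G) = cv L R hLR := comp_cv k _ _ _
  rw [e0, ← cv_apply f (cv L R hLR) (Cm.cv_right h1L h1R)]
  have s1 : SemiconjBy (leg f k (Mr G)) (cv (cv L R hLR) f (Cm.cv_left h1L.symm h1R.symm) x)
      (cv f (cv L R hLR) (Cm.cv_right h1L h1R) x) := by
    rw [cv_assoc L R f hLR h1R.symm h1L.symm, ← cv_assoc f L R h1L hLR h1R, cv_apply, cv_apply]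
    have a1 := Mr_lreg (G := G) hfk
    have a2 := Mr_rreg (G := G) hfk
    exact leg_semiconj a1 a2 _
  have s2 : SemiconjBy (H.ri R f) (cv (cv L f h1L.symm) R (Cm.cv_left hLR h1R) x)
      (cv (cv L R hLR) f (Cm.cv_left h1L.symm h1R.symm) x) := by
    rw [cv_assoc L R f hLR h1R.symm h1L.symm, cv_assoc L f R h1L.symm h1R hLR, cv_apply, cv_apply]
    refine leg_semiconj (fun y => ?_) (ri_qtri h1R.symm) _
    exact (commute_ri (fun z => hLR y z) (fun z => h1L.symm y z)).symm
  have s3 : SemiconjBy (H.rm f L) (cv f (cv L R hLR) (Cm.cv_right h1L h1R) x)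
      (cv (cv L f h1L.symm) R (Cm.cv_left hLR h1R) x) := by
    rw [← cv_assoc f L R h1L hLR h1R, cv_apply, cv_apply]
    refine leg_semiconj (qtri h1L) (fun y => ?_) _
    exact (commute_rm (fun z => (h1R z y).symm) (fun z => (hLR z y).symm)).symm
  rw [leg_MA hfk]
  exact ((s1.mul_left s2).mul_left s3).symm

theorem isCov_MA : IsCov (had G) (MA H) := fun x => by
  have h := commute_leg_MA (H := H) (cm_include (P := G) (X := DEnd G)) x
  rwa [leg_include] at h

theorem commute_leg_MB {f : G →ₐ[ℂ] Y} {k : DEnd G →ₐ[ℂ] Y} (hfk : Cm f k) (x : G) :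
    Commute (leg f (k.comp (had G)) (Coalgebra.comul (R := ℂ) x)) (leg f k (MB H)) := by
  set L := k.comp (lreg G) with hL
  set R := k.comp (rreg G) with hR
  have h1L : Cm f L := fun x y => hfk x _
  have h1R : Cm f R := fun x y => hfk x _
  have hLR : Cm L R := cm_lreg_rreg.map k
  have e0 : k.comp (had G) = cv L R hLR := comp_cv k _ _ _
  rw [e0, ← cv_apply f (cv L R hLR) (Cm.cv_right h1L h1R), ← cv_assoc f L R h1L hLR h1R, cv_apply,
    leg_MB hfk]
  refine (commute_leg (fun y => ?_) (fun y => ?_) _).symm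
  · refine Commute.mul_left ?_ (Q_cv h1L y)
    rw [cv_apply]
    exact commute_leg (fun z => Commute.map (vi_central (H := H) z) f) (fun z => h1L _ z) _
  · refine Commute.mul_left (h1R _ _) (Commute.mul_left ?_ ?_)
    · exact (commute_rm (fun z => (hLR z y).symm) (fun z => (h1R z y).symm)).symm
    · exact (commute_rm (fun z => (h1R z y).symm) (fun z => (hLR z y).symm)).symm

theorem isCov_MB : IsCov (had G) (MB H) := fun x => by
  have h := commute_leg_MB (H := H) (cm_include (P := G) (X := DEnd G)) x
  rwa [leg_include] at h

end ModelRel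

/-! ### The ground state of the model -/

section Absorb

variable {G : Type u} [Ring G] [HopfAlgebra ℂ G] [StarRing G] [StarModule ℂ G] {X W : Type*} [Ring X] [Algebra ℂ X]
  [AddCommGroup W] [Module ℂ W]

variable (G X) in
/-- The first leg of `G ⊗ X`. -/
abbrev inl : G →ₐ[ℂ] G ⊗[ℂ] X := Algebra.TensorProduct.includeLeft

variable (G X) in
/-- The second leg of `G ⊗ X`. -/
abbrev inr : X →ₐ[ℂ] G ⊗[ℂ] X := Algebra.TensorProduct.includeRight

theorem eps_eq_smul {Y : Type*} [Ring Y] [Algebra ℂ Y] (y : G) :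
    eps G Y y = Coalgebra.counit (R := ℂ) y • (1 : Y) := by
  rw [eps_apply, Algebra.algebraMap_eq_smul_one]

/-- When the linear map `a` sees the values of `q` only through the co-unit, the second leg of `z`
may be replaced by the co-unit. For an R-matrix the result is trivial, so R-matrices acting on
invariant vectors or before invariant functionals disappear. -/
theorem absorb_right (a : X →ₗ[ℂ] W) (q : G →ₐ[ℂ] X)
    (ha : ∀ T y, a (T * q y) = Coalgebra.counit (R := ℂ) y • a T) (T : G ⊗[ℂ] X) (z : G ⊗[ℂ] G) :
    TensorProduct.map LinearMap.id a (T * leg (inl G X) ((inr G X).comp q) z) =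
      TensorProduct.map LinearMap.id a (T * leg (inl G X) (eps G _) z) := by
  induction z with
  | zero => simp
  | add x y hx hy => simp only [map_add, mul_add, hx, hy]
  | tmul x y =>
    induction T with
    | zero => simp
    | add s t hs ht => simp only [map_add, add_mul, hs, ht]
    | tmul p T =>
      simp [eps_eq_smul (G := G) (Y := G ⊗[ℂ] X) y, ha]

theorem absorb_left (a : X →ₗ[ℂ] W) (q : G →ₐ[ℂ] X)
    (ha : ∀ T y, a (q y * T) = Coalgebra.counit (R := ℂ) y • a T) (T : G ⊗[ℂ] X) (z : G ⊗[ℂ] G) :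
    TensorProduct.map LinearMap.id a (leg (inl G X) ((inr G X).comp q) z * T) =
      TensorProduct.map LinearMap.id a (leg (inl G X) (eps G _) z * T) := by
  induction z with
  | zero => simp
  | add x y hx hy => simp only [map_add, add_mul, hx, hy]
  | tmul x y =>
    induction T with
    | zero => simp
    | add s t hs ht => simp only [map_add, mul_add, hs, ht]
    | tmul p T =>
      simp [eps_eq_smul (G := G) (Y := G ⊗[ℂ] X) y, ha]

theorem cm_inl_inr (q : G →ₐ[ℂ] X) : Cm (inl G X) ((inr G X).comp q) := fun x y => by
  simp [commute_iff_eq]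

variable (H : RibbonHopfStar G)

theorem absorb_rm_right (a : X →ₗ[ℂ] W) (q : G →ₐ[ℂ] X)
    (ha : ∀ T y, a (T * q y) = Coalgebra.counit (R := ℂ) y • a T) (T : G ⊗[ℂ] X) :
    TensorProduct.map LinearMap.id a (T * H.rm (inl G X) ((inr G X).comp q)) =
      TensorProduct.map LinearMap.id a T := by
  rw [RibbonHopfStar.rm, absorb_right a q ha, ← RibbonHopfStar.rm, RibbonHopfStar.rm_eps_right,
    mul_one]

theorem absorb_ri_right' (a : X →ₗ[ℂ] W) (q : G →ₐ[ℂ] X)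
    (ha : ∀ T y, a (T * q y) = Coalgebra.counit (R := ℂ) y • a T) (T : G ⊗[ℂ] X) :
    TensorProduct.map LinearMap.id a (T * H.ri ((inr G X).comp q) (inl G X)) =
      TensorProduct.map LinearMap.id a T := by
  rw [RibbonHopfStar.ri, ← (cm_inl_inr q).symm.leg_comm, absorb_right a q ha,
    (cm_eps (inl G X)).leg_comm, ← RibbonHopfStar.ri, RibbonHopfStar.ri_eps_left, mul_one]

theorem absorb_rm_left (a : X →ₗ[ℂ] W) (q : G →ₐ[ℂ] X)
    (ha : ∀ T y, a (q y * T) = Coalgebra.counit (R := ℂ) y • a T) (T : G ⊗[ℂ] X) :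
    TensorProduct.map LinearMap.id a (H.rm (inl G X) ((inr G X).comp q) * T) =
      TensorProduct.map LinearMap.id a T := by
  rw [RibbonHopfStar.rm, absorb_left a q ha, ← RibbonHopfStar.rm, RibbonHopfStar.rm_eps_right,
    one_mul]

theorem absorb_ri_left (a : X →ₗ[ℂ] W) (q : G →ₐ[ℂ] X)
    (ha : ∀ T y, a (q y * T) = Coalgebra.counit (R := ℂ) y • a T) (T : G ⊗[ℂ] X) :
    TensorProduct.map LinearMap.id a (H.ri (inl G X) ((inr G X).comp q) * T) =
      TensorProduct.map LinearMap.id a T := by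
  rw [RibbonHopfStar.ri, absorb_left a q ha, ← RibbonHopfStar.ri, RibbonHopfStar.ri_eps_right,
    one_mul]

theorem absorb_rm_left' (a : X →ₗ[ℂ] W) (q : G →ₐ[ℂ] X)
    (ha : ∀ T y, a (q y * T) = Coalgebra.counit (R := ℂ) y • a T) (T : G ⊗[ℂ] X) :
    TensorProduct.map LinearMap.id a (H.rm ((inr G X).comp q) (inl G X) * T) =
      TensorProduct.map LinearMap.id a T := by
  rw [RibbonHopfStar.rm, ← (cm_inl_inr q).symm.leg_comm, absorb_left a q ha,
    (cm_eps (inl G X)).leg_comm, ← RibbonHopfStar.rm, RibbonHopfStar.rm_eps_left, one_mul]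

end Absorb

/-! ### Invertibility of solutions of the functoriality relations. -/

section Inverse

variable {G : Type u} [Ring G] [HopfAlgebra ℂ G] [StarRing G] [StarModule ℂ G]
  {H : RibbonHopfStar G} {X : Type*} [Ring X] [Algebra ℂ X]

namespace RibbonHopfStar

theorem Q_mul_inv : H.Q * (((H.R⁻¹ : (G ⊗[ℂ] G)ˣ) : G ⊗[ℂ] G) * H.Ri') = 1 := by
  rw [Q, mul_assoc, ← mul_assoc (H.R : G ⊗[ℂ] G), Units.mul_inv, one_mul, R', Ri',
    ← map_mul, Units.mul_inv, map_one]

theorem inv_mul_Q : (((H.R⁻¹ : (G ⊗[ℂ] G)ˣ) : G ⊗[ℂ] G) * H.Ri') * H.Q = 1 := by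
  rw [Q, mul_assoc, ← mul_assoc H.Ri', R', Ri', ← map_mul, Units.inv_mul, map_one, one_mul,
    Units.inv_mul]

variable (H) in
/-- The unit `v₁⁻¹ R' R`. -/
def QvU : (G ⊗[ℂ] G)ˣ where
  val := H.Qv
  inv := (((H.R⁻¹ : (G ⊗[ℂ] G)ˣ) : G ⊗[ℂ] G) * H.Ri') * ((H.ribbon : G) ⊗ₜ 1)
  val_inv := by
    rw [Qv, mul_assoc, ← mul_assoc H.Q, Q_mul_inv, one_mul, Algebra.TensorProduct.tmul_mul_tmul]
    simp [Algebra.TensorProduct.one_def]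
  inv_val := by
    rw [Qv, mul_assoc, ← mul_assoc (_ ⊗ₜ _), Algebra.TensorProduct.tmul_mul_tmul, Units.mul_inv,
      mul_one, ← Algebra.TensorProduct.one_def, one_mul, inv_mul_Q]

variable [FiniteDimensional ℂ G]

theorem ct_Qv_surjective (hQ : Function.Surjective fun f => ct f H.Q) :
    Function.Surjective fun f => ct f H.Qv := fun x => by
  obtain ⟨f, hf⟩ := hQ x
  refine ⟨f ∘ₗ LinearMap.mulLeft ℂ (H.ribbon : G), ?_⟩
  dsimp only
  rw [← ct_left_mul, Qv, ← mul_assoc, Algebra.TensorProduct.tmul_mul_tmul, Units.mul_inv, mul_one,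
    ← Algebra.TensorProduct.one_def, one_mul]
  exact hf

variable (H) in
theorem sinv_one : H.sinv 1 = 1 := by
  have h := H.sinv_antipode 1
  rwa [HopfAlgebra.antipode_one] at h

variable (H) in
theorem sinv_mul (x y : G) : H.sinv (x * y) = H.sinv y * H.sinv x := by
  have h : Function.Injective (HopfAlgebra.antipode ℂ (A := G)) := fun a b hab => by
    rw [← H.sinv_antipode a, hab, H.sinv_antipode]
  refine h ?_
  rw [HopfAlgebra.antipode_mul_antidistrib]
  simp only [H.antipode_sinv]

end RibbonHopfStar

open RibbonHopfStar

/-- A solution is the image of the invertible element `v₁⁻¹R'R` under a homomorphism, so its inverse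
is the image of the inverse, with contractions in the same subalgebra. -/
theorem IsFus.exists_inv [FiniteDimensional ℂ G] {M : G ⊗[ℂ] X} (hM : IsFus H M)
    (hQ : Function.Surjective fun f => ct f H.Qv) :
    ∃ N : G ⊗[ℂ] X, M * N = 1 ∧ N * M = 1 ∧ ∀ f, ct f N ∈ ctRange M := by
  obtain ⟨a, rfl⟩ := hM.exists_hom hQ
  refine ⟨Algebra.TensorProduct.map (AlgHom.id ℂ G) a ((H.QvU⁻¹ : (G ⊗[ℂ] G)ˣ) : G ⊗[ℂ] G),
    ?_, ?_, fun f => ?_⟩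
  · rw [← map_mul]
    exact (congrArg _ H.QvU.mul_inv).trans (map_one _)
  · rw [← map_mul]
    exact (congrArg _ H.QvU.inv_mul).trans (map_one _)
  · rw [ctRange_map a hQ, ct_map]
    exact ⟨_, rfl⟩

end Inverse

/-! ### The ground state `ε` and the inverse of `A` in the model. -/

section Ground

variable {G : Type u} [Ring G] [HopfAlgebra ℂ G] [StarRing G] [StarModule ℂ G]
  [FiniteDimensional ℂ G] (H : RibbonHopfStar G)

open RibbonHopfStar

theorem lreg_counit (x : G) : lreg G x Coalgebra.counit =
    Coalgebra.counit (R := ℂ) x • (Coalgebra.counit : Module.Dual ℂ G) := by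
  ext y; simp

theorem rreg_counit (x : G) : rreg G x Coalgebra.counit =
    Coalgebra.counit (R := ℂ) x • (Coalgebra.counit : Module.Dual ℂ G) := by
  ext y; simp [mul_comm]

/-- The linear functional `T ↦ (T f)(y)`. -/
def evAt (f : Module.Dual ℂ G) (y : G) : DEnd G →ₗ[ℂ] ℂ where
  toFun T := T f y
  map_add' _ _ := rfl
  map_smul' _ _ := rfl

@[simp] theorem evAt_apply (f : Module.Dual ℂ G) (y : G) (T : DEnd G) : evAt f y T = T f y := rfl

theorem cvL_smul_counit {Y : Type*} [Ring Y] [Algebra ℂ Y]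
    (a : Y →ₗ[ℂ] ℂ) (p q : G →ₗ[ℂ] Y) (w : ℂ)
    (h : ∀ x y, a (p x * q y) =
      (Coalgebra.counit (R := ℂ) x * Coalgebra.counit (R := ℂ) y) • w) (x : G) :
    a (cvL p q x) = Coalgebra.counit (R := ℂ) x • w := by
  have key : ∀ z : G ⊗[ℂ] G, a (LinearMap.mul' ℂ Y (TensorProduct.map p q z)) =
      dual2 Coalgebra.counit Coalgebra.counit z • w := fun z => by
    induction z with
    | zero => simp
    | add s t hs ht => simp only [map_add, hs, ht, add_smul]
    | tmul s t => simp [h, dual2]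
  rw [cvL_eq, key, ← cvL_eq_dual2]
  congr 1
  exact LinearMap.congr_fun (cvL_eps (Coalgebra.counit : G →ₗ[ℂ] ℂ)) x

theorem had_counit (x : G) : had G x Coalgebra.counit =
    Coalgebra.counit (R := ℂ) x • (Coalgebra.counit : Module.Dual ℂ G) := by
  rw [had, cv_eq_cvL]
  ext y
  refine cvL_smul_counit (evAt (Coalgebra.counit : Module.Dual ℂ G) y) _ _ _
    (fun x y => ?_) x
  simp [rreg_counit, lreg_counit, mul_assoc, mul_left_comm]

/-- Both translations act on `ε` through the co-unit, so the dressing of `A` disappears; the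
undressed canonical element multiplies `ε`, the unit of the convolution product, by `f`. Every
vector is thus created from the ground state by `A` alone. -/
theorem ct_MA_counit (f : Module.Dual ℂ G) : ct f (MA H) Coalgebra.counit = f := by
  ext x
  have h := map_ct (evAt (Coalgebra.counit : Module.Dual ℂ G) x) f (MA H)
  rw [MA, absorb_rm_right H _ _ fun T y => ?_, absorb_ri_right' H _ _ fun T y => ?_,
    ← map_ct, ct_Mr] at h
  · rw [MA]
    exact h.trans (LinearMap.congr_fun (conv_apply_counit f) x)
  · simp [rreg_counit]
  · simp [lreg_counit]

theorem ct_MB (f : Module.Dual ℂ G) : ct f (MB H) = lreg G (ct f H.Qv) := ct_map _ _ _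

theorem counit_ct (f : Module.Dual ℂ G) (z : G ⊗[ℂ] G) :
    Coalgebra.counit (R := ℂ) (ct f z) = f (leg (AlgHom.id ℂ G) (eps G G) z) := by
  induction z with
  | zero => simp
  | add x y hx hy => simp only [map_add, hx, hy]
  | tmul x y => simp [eps_apply, Algebra.algebraMap_eq_smul_one, mul_comm]

theorem counit_ct_Qv (f : Module.Dual ℂ G) : Coalgebra.counit (R := ℂ) (ct f H.Qv) = f H.vi := by
  rw [counit_ct, leg_Qv (cm_eps (AlgHom.id ℂ G)).symm, rm_eps_left, rm_eps_right]
  simp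

theorem ct_MB_counit (f : Module.Dual ℂ G) : ct f (MB H) Coalgebra.counit =
    f H.vi • (Coalgebra.counit : Module.Dual ℂ G) := by
  rw [ct_MB, lreg_counit, counit_ct_Qv]

/-- `(p ⊗ id)` applied to the canonical element. -/
def MrL (p : G →ₗ[ℂ] G) : G ⊗[ℂ] DEnd G := TensorProduct.map p LinearMap.id (Mr G)

theorem ct_MrL (p : G →ₗ[ℂ] G) (f : Module.Dual ℂ G) : ct f (MrL p) = conv G (f ∘ₗ p) := by
  rw [← ct_Mr, MrL]
  induction Mr G with
  | zero => simp
  | add x y hx hy => simp only [map_add, hx, hy]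
  | tmul x y => simp

/-- `conv` reverses products, whence the flip of the co-product. For the same reason the inverse of
the canonical element involves the inverse antipode rather than the antipode. -/
theorem ct_MrL_mul (p q : G →ₗ[ℂ] G) (f : Module.Dual ℂ G) : ct f (MrL p * MrL q) =
    conv G (f ∘ₗ LinearMap.mul' ℂ G ∘ₗ TensorProduct.map p q ∘ₗ
      (TensorProduct.comm ℂ G G).toLinearMap ∘ₗ Coalgebra.comul) := by
  have h : ∀ p : G →ₗ[ℂ] G, MrL p = ∑ i, p (Module.finBasis ℂ G i) ⊗ₜ[ℂ]
      conv G ((Module.finBasis ℂ G).coord i) := fun p => by simp [MrL, Mr]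
  rw [h, h, Finset.sum_mul_sum]
  simp only [Algebra.TensorProduct.tmul_mul_tmul, conv_mul_conv, map_sum, ct_tmul]
  simp only [← map_smul, ← map_sum]
  congr 1
  ext x
  simp only [LinearMap.sum_apply, LinearMap.smul_apply, cvL_eq_dual2, LinearMap.comp_apply]
  induction Coalgebra.comul (R := ℂ) x with
  | zero => simp
  | add s t hs ht =>
    simp only [map_add, smul_add, Finset.sum_add_distrib, hs, ht]
  | tmul s t =>
    have hp : p t = ∑ i, (Module.finBasis ℂ G).repr t i • p (Module.finBasis ℂ G i) := by
      conv_lhs => rw [← (Module.finBasis ℂ G).sum_repr t, map_sum]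
      exact Finset.sum_congr rfl fun i _ => map_smul _ _ _
    have hq : q s = ∑ i, (Module.finBasis ℂ G).repr s i • q (Module.finBasis ℂ G i) := by
      conv_lhs => rw [← (Module.finBasis ℂ G).sum_repr s, map_sum]
      exact Finset.sum_congr rfl fun i _ => map_smul _ _ _
    have e : f (LinearMap.mul' ℂ G (TensorProduct.map p q (TensorProduct.comm ℂ G G (s ⊗ₜ t)))) =
        f (p t * q s) := rfl
    refine Eq.trans ?_ e.symm
    rw [hp, hq, Finset.sum_mul_sum, map_sum]
    refine Finset.sum_congr rfl fun i _ => ?_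
    rw [map_sum]
    refine Finset.sum_congr rfl fun j _ => ?_
    simp only [dual2, LinearMap.comp_apply, TensorProduct.map_tmul, LinearMap.mul'_apply,
      Module.Basis.coord_apply, smul_mul_smul_comm, map_smul, smul_eq_mul]
    ring

/-- The inverse of the canonical element. -/
def MrI : G ⊗[ℂ] DEnd G := MrL H.sinv

theorem Mr_eq_MrL : Mr G = MrL LinearMap.id := by simp [MrL]

theorem Mr_mul_MrI : Mr G * MrI H = 1 := by
  refine ct_ext fun f => ?_
  rw [Mr_eq_MrL, MrI, ct_MrL_mul, Algebra.TensorProduct.one_def, ct_tmul, ← conv_counit,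
    ← map_smul]
  congr 1
  ext x
  have h := congrArg H.sinv (LinearMap.congr_fun (cvL_antipode_right (AlgHom.id ℂ G)) x)
  rw [cvL_eq] at h
  have key : ∀ z : G ⊗[ℂ] G, H.sinv (LinearMap.mul' ℂ G (TensorProduct.map
      (AlgHom.id ℂ G).toLinearMap ((AlgHom.id ℂ G).toLinearMap ∘ₗ HopfAlgebra.antipode ℂ) z)) =
      LinearMap.mul' ℂ G (TensorProduct.map LinearMap.id H.sinv (TensorProduct.comm ℂ G G z)) :=
      fun z => by
    induction z with
    | zero => simp
    | add s t hs ht => simp only [map_add, hs, ht]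
    | tmul s t => simp [sinv_mul, H.sinv_antipode]
  rw [key] at h
  simp only [LinearMap.comp_apply, LinearEquiv.coe_coe]
  rw [h, epsL_apply, Algebra.algebraMap_eq_smul_one, map_smul, H.sinv_one]
  simp [mul_comm]

theorem MrI_mul_Mr : MrI H * Mr G = 1 := by
  refine ct_ext fun f => ?_
  rw [Mr_eq_MrL, MrI, ct_MrL_mul, Algebra.TensorProduct.one_def, ct_tmul, ← conv_counit,
    ← map_smul]
  congr 1
  ext x
  have h := congrArg H.sinv (LinearMap.congr_fun (cvL_antipode_left (AlgHom.id ℂ G)) x)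
  rw [cvL_eq] at h
  have key : ∀ z : G ⊗[ℂ] G, H.sinv (LinearMap.mul' ℂ G (TensorProduct.map
      ((AlgHom.id ℂ G).toLinearMap ∘ₗ HopfAlgebra.antipode ℂ) (AlgHom.id ℂ G).toLinearMap z)) =
      LinearMap.mul' ℂ G (TensorProduct.map H.sinv LinearMap.id (TensorProduct.comm ℂ G G z)) :=
      fun z => by
    induction z with
    | zero => simp
    | add s t hs ht => simp only [map_add, hs, ht]
    | tmul s t => simp [sinv_mul, H.sinv_antipode]
  rw [key] at h
  simp only [LinearMap.comp_apply, LinearEquiv.coe_coe]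
  rw [h, epsL_apply, Algebra.algebraMap_eq_smul_one, map_smul, H.sinv_one]
  simp [mul_comm]

/-- The inverse of `MA`. -/
def MAI : G ⊗[ℂ] DEnd G :=
  H.ri (inl G (DEnd G)) ((inr G (DEnd G)).comp (lreg G)) *
    (H.rm ((inr G (DEnd G)).comp (rreg G)) (inl G (DEnd G)) * MrI H)

theorem MA_mul_MAI : MA H * MAI H = 1 := by
  rw [MA, MAI, mul_assoc, rm_mul_ri_assoc (cm_inl_inr _), mul_assoc,
    ri_mul_rm_assoc (cm_inl_inr _).symm, Mr_mul_MrI]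

theorem MAI_mul_MA : MAI H * MA H = 1 := by
  rw [MA, MAI]
  have e1 := ri_mul_rm (H := H) (cm_inl_inr (lreg G))
  have e2 := rm_mul_ri (H := H) (cm_inl_inr (rreg G)).symm
  have e3 := MrI_mul_Mr H
  generalize H.ri (inl G (DEnd G)) _ = a at *
  generalize H.rm (inl G (DEnd G)) _ = b at *
  generalize H.rm _ (inl G (DEnd G)) = p at *
  generalize H.ri _ (inl G (DEnd G)) = q at *
  calc a * (p * MrI H) * (Mr G * q * b) = a * (p * (MrI H * Mr G) * q) * b := by
        simp only [mul_assoc]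
    _ = 1 := by rw [e3, mul_one, e2, mul_one, e1]

/-! ### The Haar functional and the Fourier transform. -/

section Functional

variable [IsSemisimpleRing G] {ι : Type v} [Fintype ι] [DecidableEq ι] (D : IrrepSystem G ι)

include H in
theorem antipode_haar : HopfAlgebra.antipode ℂ D.haar = D.haar := by
  -- The product `h S(h)` is evaluated once as a multiple of `h` and once as the image under the
  -- antipode of a multiple of `h`.
  have h1 : D.haar * HopfAlgebra.antipode ℂ D.haar = D.haar := by
    rw [D.haar_mul, HopfAlgebra.counit_antipode, D.counit_haar, one_smul]
  have h2 : Coalgebra.counit (R := ℂ) (H.sinv D.haar) = 1 := by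
    rw [← HopfAlgebra.counit_antipode (R := ℂ), H.antipode_sinv, D.counit_haar]
  have h3 : D.haar * HopfAlgebra.antipode ℂ D.haar = HopfAlgebra.antipode ℂ D.haar := by
    nth_rw 1 [← H.antipode_sinv D.haar]
    rw [← HopfAlgebra.antipode_mul_antidistrib, D.haar_mul, h2, one_smul]
  exact h3.symm.trans h1

theorem phi_lreg (x : G) (f : Module.Dual ℂ G) :
    lreg G x f D.haar = Coalgebra.counit (R := ℂ) x * f D.haar := by
  rw [lreg_apply, D.mul_haar]
  simp

theorem phi_rreg (x : G) (f : Module.Dual ℂ G) :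
    rreg G x f D.haar = Coalgebra.counit (R := ℂ) x * f D.haar := by
  rw [rreg_apply, D.haar_mul]
  simp

theorem phi_had (x : G) (f : Module.Dual ℂ G) :
    had G x f D.haar = Coalgebra.counit (R := ℂ) x * f D.haar := by
  rw [had, cv_eq_cvL]
  refine (cvL_smul_counit (evAt f D.haar) _ _ (f D.haar) (fun x y => ?_) x).trans rfl
  change lreg G x (rreg G y f) D.haar = _
  rw [phi_lreg, phi_rreg, smul_eq_mul, mul_assoc]

include H in
theorem lreg_haar (f : Module.Dual ℂ G) :
    lreg G D.haar f = f D.haar • (Coalgebra.counit : Module.Dual ℂ G) := by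
  ext y
  rw [lreg_apply, antipode_haar H, D.haar_mul]
  simp [mul_comm]

/-- The Fourier transform of a functional. -/
def four : Module.Dual ℂ G →ₗ[ℂ] G := H.sinv ∘ₗ ctL (Coalgebra.comul (R := ℂ) D.haar)

theorem four_apply (f : Module.Dual ℂ G) :
    four H D f = H.sinv (ct f (Coalgebra.comul (R := ℂ) D.haar)) := rfl

/-- Surjectivity is the statement that the contractions of `Δ(h)` span `G`; injectivity then follows
by dimension. -/
theorem four_bijective : Function.Bijective (four H D) := by
  have hs : Function.Surjective (four H D) := by
    have h1 : LinearMap.range (ctL (Coalgebra.comul (R := ℂ) D.haar)) = ⊤ :=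
      D.haar_span _ fun f => ⟨f, rfl⟩
    have h2 : Function.Surjective H.sinv := fun x => ⟨_, H.sinv_antipode x⟩
    exact h2.comp (LinearMap.range_eq_top.mp h1)
  exact ⟨(LinearMap.injective_iff_surjective_of_finrank_eq_finrank
    (Subspace.dual_finrank_eq)).mpr hs, hs⟩

theorem phi_ct_MrI (f g : Module.Dual ℂ G) : ct g (MrI H) f D.haar = g (four H D f) := by
  rw [MrI, ct_MrL, conv_apply, cvL_eq_dual2, four_apply]
  induction Coalgebra.comul (R := ℂ) D.haar with
  | zero => simp
  | add s t hs ht => simp only [map_add, hs, ht]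
  | tmul s t => simp [dual2]

/-- The dressing stands on the left in `A⁻¹`, where the invariance of evaluation at the Haar
integral removes it. -/
theorem phi_ct_MAI (f g : Module.Dual ℂ G) : ct g (MAI H) f D.haar = g (four H D f) := by
  have h := map_ct (evAt f D.haar) g (MAI H)
  rw [MAI, absorb_ri_left H _ _ fun T y => ?_, absorb_rm_left' H _ _ fun T y => ?_,
    ← map_ct] at h
  · exact h.trans (phi_ct_MrI H D f g)
  · simp [D.haar_mul]
  · exact phi_lreg D y (T f)

end Functional

end Ground

/-! ### The representation -/

section Representation

variable {G : Type u} [Ring G] [HopfAlgebra ℂ G] [StarRing G] [StarModule ℂ G]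
  [FiniteDimensional ℂ G] [IsSemisimpleRing G]
  {ι : Type v} [Fintype ι] [DecidableEq ι] {H : RibbonHopfStar G} {D : IrrepSystem G ι}
  (c : ClebschGordan H D)

theorem handleRel_matOf {x y : DEnd G}
    (h : HandleRel c (matOf c (MA H)) (matOf c (MB H)) x y) : x = y := by
  refine handleRel_sound ?_ ?_ ?_ h
  · rw [datum_matOf]; exact isFus_MA
  · rw [datum_matOf]; exact isFus_MB
  · rw [datum_matOf, datum_matOf]; exact isExch_MA_MB

/-- The representation of the handle algebra on the functionals. -/
def piD : Handle c →ₐ[ℂ] DEnd G :=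
  Handle.lift c (matOf c (MA H)) (matOf c (MB H)) fun _ _ => handleRel_matOf c

/-- The representation of the semi-direct product on the functionals. -/
def piG : Semi c →ₐ[ℂ] DEnd G :=
  Semi.lift c (matOf c (MA H)) (matOf c (MB H)) (had G) (fun _ _ => handleRel_matOf c)
    (by rw [datum_matOf]; exact isCov_MA) (by rw [datum_matOf]; exact isCov_MB)

theorem piG_ofHandle (t : Handle c) : piG c (Semi.ofHandle c t) = piD c t := by
  have h : (piG c).comp (Semi.ofHandle c) = piD c := by
    refine Handle.hom_ext c (fun I a b => ?_) fun I a b => ?_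
    · rw [AlgHom.comp_apply, Semi.ofHandle_A, piG, Semi.lift_A, piD, Handle.lift_A]
    · rw [AlgHom.comp_apply, Semi.ofHandle_B, piG, Semi.lift_B, piD, Handle.lift_B]
  exact DFunLike.congr_fun h t

theorem piG_ofG (x : G) : piG c (Semi.ofG c x) = had G x := Semi.lift_ofG _ _ _ x

theorem map_piD_A :
    Algebra.TensorProduct.map (AlgHom.id ℂ G) (piD c) (datum c (Handle.A c)) = MA H := by
  refine (datum_map (piD c) _).trans (Eq.trans ?_ (datum_matOf (c := c) (MA H)))
  congr 1
  refine funext fun I => Matrix.ext fun a b => ?_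
  exact Handle.lift_A (fun _ _ => handleRel_matOf c) I a b

theorem map_piD_B :
    Algebra.TensorProduct.map (AlgHom.id ℂ G) (piD c) (datum c (Handle.B c)) = MB H := by
  refine (datum_map (piD c) _).trans (Eq.trans ?_ (datum_matOf (c := c) (MB H)))
  congr 1
  refine funext fun I => Matrix.ext fun a b => ?_
  exact Handle.lift_B (fun _ _ => handleRel_matOf c) I a b

theorem piD_ct_A (f : Module.Dual ℂ G) : piD c (ct f (datum c (Handle.A c))) = ct f (MA H) := by
  rw [← ct_map, map_piD_A]

theorem piD_ct_B (f : Module.Dual ℂ G) : piD c (ct f (datum c (Handle.B c))) = ct f (MB H) := by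
  rw [← ct_map, map_piD_B]

theorem map_piG_A :
    Algebra.TensorProduct.map (AlgHom.id ℂ G) (piG c) (datum c (Semi.A c)) = MA H := by
  refine (datum_map (piG c) _).trans (Eq.trans ?_ (datum_matOf (c := c) (MA H)))
  congr 1
  refine funext fun I => Matrix.ext fun a b => ?_
  exact Semi.lift_A (fun _ _ => handleRel_matOf c) _ _ I a b

theorem map_piG_B :
    Algebra.TensorProduct.map (AlgHom.id ℂ G) (piG c) (datum c (Semi.B c)) = MB H := by
  refine (datum_map (piG c) _).trans (Eq.trans ?_ (datum_matOf (c := c) (MB H)))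
  congr 1
  refine funext fun I => Matrix.ext fun a b => ?_
  exact Semi.lift_B (fun _ _ => handleRel_matOf c) _ _ I a b

theorem piG_ct_A (f : Module.Dual ℂ G) : piG c (ct f (datum c (Semi.A c))) = ct f (MA H) := by
  rw [← ct_map, map_piG_A]

theorem piG_ct_B (f : Module.Dual ℂ G) : piG c (ct f (datum c (Semi.B c))) = ct f (MB H) := by
  rw [← ct_map, map_piG_B]

theorem τ_vi (I : ι) : D.τ I H.vi = ((c.κ I)⁻¹ * (c.κ I)⁻¹) • 1 := by
  have h : H.vi = ((c.κel⁻¹ : Gˣ) : G) * ((c.κel⁻¹ : Gˣ) : G) := by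
    have e : H.ribbon = c.κel * c.κel := Units.ext (by rw [← c.κel_sq]; rfl)
    rw [RibbonHopfStar.vi, e, mul_inv_rev, Units.val_mul]
  rw [h, map_mul, c.τ_κel_inv]
  simp [smul_smul]

theorem piD_apply_counit (f : Module.Dual ℂ G) :
    piD c (ct f (datum c (Handle.A c))) Coalgebra.counit = f := by
  rw [piD_ct_A, ct_MA_counit]

theorem counit_ne_zero : (Coalgebra.counit : Module.Dual ℂ G) ≠ 0 := fun h => by
  have := LinearMap.congr_fun h 1
  simp at this

theorem isVacuum_piD : IsVacuum c (piD c) (Coalgebra.counit : Module.Dual ℂ G) where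
  ne_zero := counit_ne_zero
  cyclic f := ⟨_, piD_apply_counit c f⟩
  B_apply I a b := by
    rw [apply_eq_ct_datum c (Handle.B c), map_smul, piD_ct_B, LinearMap.smul_apply, ct_MB_counit,
      smul_smul]
    change (c.κ I * D.τ I H.vi a b) • _ = _
    have := c.κ_ne_zero I
    rw [τ_vi c]
    by_cases h : a = b
    · subst h
      simp [this]
    · simp [h]

/-- The eigenvalue `κ_I⁻¹` and the rescaling by `κ⁻¹` combine to `v⁻¹`; matrix coefficients span all
functionals. -/
theorem IsVacuum.ct_B_apply {W : Type*} [AddCommGroup W] [Module ℂ W]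
    {ρ : Handle c →ₐ[ℂ] Module.End ℂ W} {w : W} (h : IsVacuum c ρ w) (g : Module.Dual ℂ G) :
    ρ (ct g (datum c (Handle.B c))) w = g H.vi • w := by
  have h1 : ∀ I a b, ρ (ct (D.coef I a b) (datum c (Handle.B c))) w = D.coef I a b H.vi • w := by
    intro I a b
    have h2 := h.B_apply I a b
    have h0 := c.κ_ne_zero I
    rw [apply_eq_ct_datum c (Handle.B c), map_smul, LinearMap.smul_apply] at h2
    have h3 := congrArg (fun t => (c.κ I)⁻¹ • t) h2
    simp only [smul_smul, inv_mul_cancel₀ h0, one_smul] at h3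
    rw [h3]
    change _ = D.τ I H.vi a b • w
    rw [τ_vi c]
    by_cases hab : a = b
    · subst hab
      simp [smul_smul]
    · simp [hab]
  have h4 : LinearMap.applyₗ w ∘ₗ ρ.toLinearMap ∘ₗ ctL (datum c (Handle.B c)) =
      (LinearMap.toSpanSingleton ℂ W w) ∘ₗ LinearMap.applyₗ (R := ℂ) H.vi := by
    ext g
    rw [D.functional_eq_sum g]
    simp only [map_sum, map_smul]
    refine Finset.sum_congr rfl fun I _ => Finset.sum_congr rfl fun a _ =>
      Finset.sum_congr rfl fun b _ => ?_
    congr 1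
    exact h1 I a b
  exact LinearMap.congr_fun h4 g

variable {c} (hQ : Function.Surjective fun f => ct f H.Qv)
include hQ

/-- Every operator of rank one is `A_f P A⁻¹_g`: here `A_f` sends `ε` to `f`, the operator `P` is
left translation by the Haar integral, which maps `h` to `h(haar) ε`, and `A⁻¹_g` followed by
evaluation at the Haar integral is an arbitrary functional because the Fourier transform is
bijective. -/
theorem piD_surjective : Function.Surjective (piD c) := by
  have hr : ∀ f ψ : Module.Dual ℂ G, ∀ θ : Module.Dual ℂ (Module.Dual ℂ G),
      ∃ t, piD c t = dualTensorHom ℂ _ _ (θ ⊗ₜ f) := by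
    intro f ψ θ
    obtain ⟨g, hg⟩ : ∃ g : Module.Dual ℂ G, ∀ h, g (four H D h) = θ h := by
      let J := LinearEquiv.ofBijective (four H D) (four_bijective H D)
      exact ⟨θ ∘ₗ J.symm.toLinearMap, fun h => congrArg θ (J.symm_apply_apply h)⟩
    obtain ⟨N, h1, h2, -⟩ := (Handle.isFus_A c).exists_inv hQ
    -- Factorizability provides the element of the algebra of the `B^I` that acts as the Haar
    -- integral.
    obtain ⟨k, hk⟩ := hQ D.haar
    have hN : Algebra.TensorProduct.map (AlgHom.id ℂ G) (piD c) N = MAI H := by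
      have e1 := congrArg (Algebra.TensorProduct.map (AlgHom.id ℂ G) (piD c)) h2
      rw [map_mul, map_one, map_piD_A] at e1
      exact left_inv_eq_right_inv e1 (MA_mul_MAI H)
    refine ⟨ct f (datum c (Handle.A c)) * (ct k (datum c (Handle.B c)) * ct g N), ?_⟩
    ext1 h
    rw [map_mul, map_mul, piD_ct_A, piD_ct_B, ← ct_map g (piD c), hN, ct_MB]
    change ct f (MA H) (lreg G (ct k H.Qv) (ct g (MAI H) h)) = _
    have hk' : ct k H.Qv = D.haar := hk
    rw [hk', lreg_haar H, phi_ct_MAI, map_smul, ct_MA_counit, hg]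
    rfl
  have h2 : LinearMap.range (piD c).toLinearMap = ⊤ := by
    rw [eq_top_iff, ← LinearMap.range_eq_top.mpr (dualTensorHomEquiv ℂ (Module.Dual ℂ G)
      (Module.Dual ℂ G)).surjective]
    rintro _ ⟨z, rfl⟩
    induction z with
    | zero => rw [map_zero]; exact zero_mem _
    | add x y hx hy => rw [map_add]; exact add_mem hx hy
    | tmul θ f =>
      obtain ⟨t, ht⟩ := hr f f θ
      exact ⟨t, ht.trans (by simp)⟩
  exact LinearMap.range_eq_top.mp h2

/-- Normal ordering bounds the dimension of the handle algebra by that of the operator algebra, and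
a surjection between spaces of equal finite dimension is injective. -/
theorem piD_injective : Function.Injective (piD c) := by
  let m : Module.Dual ℂ G ⊗[ℂ] Module.Dual ℂ G →ₗ[ℂ] Handle c :=
    LinearMap.mul' ℂ _ ∘ₗ TensorProduct.map (ctL (datum c (Handle.A c)))
      (ctL (datum c (Handle.B c)))
  have hm : Function.Surjective m := by
    rw [← LinearMap.range_eq_top, eq_top_iff, ← Handle.span_eq_top c hQ, Submodule.mul_le]
    rintro _ ⟨f, rfl⟩ _ ⟨g, rfl⟩
    exact ⟨f ⊗ₜ g, rfl⟩
  have hfd : FiniteDimensional ℂ (Handle c) := Module.Finite.of_surjective m hm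
  have h1 : Module.finrank ℂ (Handle c) ≤ Module.finrank ℂ (DEnd G) := by
    refine (LinearMap.finrank_le_finrank_of_surjective hm).trans (le_of_eq ?_)
    rw [Module.finrank_tensorProduct, Module.finrank_linearMap (M := Module.Dual ℂ G)]
  have hs : Function.Surjective (piD c).toLinearMap := piD_surjective hQ
  have h2 : Module.finrank ℂ (DEnd G) ≤ Module.finrank ℂ (Handle c) :=
    LinearMap.finrank_le_finrank_of_surjective hs
  exact (LinearMap.injective_iff_surjective_of_finrank_eq_finrank (le_antisymm h1 h2)).mpr hs

theorem exists_piD_apply {f : Module.Dual ℂ G} (hf : f ≠ 0) (g : Module.Dual ℂ G) :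
    ∃ t, piD c t f = g := by
  obtain ⟨y, hy⟩ : ∃ y, f y ≠ 0 := by
    by_contra! h
    exact hf (LinearMap.ext h)
  obtain ⟨t, ht⟩ := piD_surjective (c := c) hQ
    (dualTensorHom ℂ _ _ (LinearMap.applyₗ (R := ℂ) y ⊗ₜ[ℂ] ((f y)⁻¹ • g)))
  refine ⟨t, ?_⟩
  rw [ht, dualTensorHom_apply, LinearMap.applyₗ_apply_apply, smul_smul, mul_inv_cancel₀ hy,
    one_smul]

theorem isIrred_piD : IsIrred (piD c) :=
  ⟨⟨_, _, counit_ne_zero (G := G)⟩, fun p hp => by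
    rw [or_iff_not_imp_left]
    intro h
    obtain ⟨f, hf, hf0⟩ := p.ne_bot_iff.mp h
    rw [eq_top_iff]
    rintro g -
    obtain ⟨t, rfl⟩ := exists_piD_apply (c := c) hQ hf0 g
    exact hp t f hf⟩

section Unique

variable {W : Type*} [AddCommGroup W] [Module ℂ W] {ρ : Handle c →ₐ[ℂ] Module.End ℂ W} {w : W}

/-- On normal-ordered products `B` acts on the ground state by the same scalar in both
representations, so only a contraction of `A` survives, and in the model it records the vector. -/
theorem IsVacuum.apply_eq (h : IsVacuum c ρ w) (t : Handle c) :
    ρ (ct (piD c t Coalgebra.counit) (datum c (Handle.A c))) w = ρ t w := by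
  have key : LinearMap.applyₗ w ∘ₗ ρ.toLinearMap ∘ₗ ctL (datum c (Handle.A c)) ∘ₗ
      LinearMap.applyₗ (Coalgebra.counit : Module.Dual ℂ G) ∘ₗ (piD c).toLinearMap =
      LinearMap.applyₗ w ∘ₗ ρ.toLinearMap := by
    rw [← sub_eq_zero, ← LinearMap.ker_eq_top, eq_top_iff, ← Handle.span_eq_top c hQ,
      Submodule.mul_le]
    rintro _ ⟨f, rfl⟩ _ ⟨g, rfl⟩
    rw [LinearMap.mem_ker, LinearMap.sub_apply, sub_eq_zero]
    change ρ (ct (piD c (ct f _ * ct g _) Coalgebra.counit) (datum c (Handle.A c))) w =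
      ρ (ct f _ * ct g _) w
    rw [map_mul, map_mul, Module.End.mul_apply, Module.End.mul_apply, h.ct_B_apply,
      (isVacuum_piD c).ct_B_apply, map_smul, map_smul, piD_apply_counit, ct_smul_left, map_smul,
      LinearMap.smul_apply]
  exact LinearMap.congr_fun key t

theorem IsVacuum.existsUnique (h : IsVacuum c ρ w) : ∃! e : Module.Dual ℂ G ≃ₗ[ℂ] W,
    e Coalgebra.counit = w ∧ ∀ t a, e (piD c t a) = ρ t (e a) := by
  let e : Module.Dual ℂ G →ₗ[ℂ] W :=
    LinearMap.applyₗ w ∘ₗ ρ.toLinearMap ∘ₗ ctL (datum c (Handle.A c))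
  have he : ∀ t, e (piD c t Coalgebra.counit) = ρ t w := h.apply_eq hQ
  have he' : ∀ t a, e (piD c t a) = ρ t (e a) := fun t a => by
    obtain ⟨s, rfl⟩ := (isVacuum_piD c).cyclic a
    rw [← Module.End.mul_apply, ← map_mul, he, he, map_mul, Module.End.mul_apply]
  have he0 : e Coalgebra.counit = w := by
    have := he 1
    rwa [map_one, map_one] at this
  have hb : Function.Bijective e := by
    refine ⟨(injective_iff_map_eq_zero e).mpr fun f hf => ?_, fun x => ?_⟩
    -- A nonzero vector of the kernel could be moved to `ε` by some `t`, and then `w` would vanish.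
    · by_contra h0
      obtain ⟨t, ht⟩ := exists_piD_apply (c := c) hQ h0 Coalgebra.counit
      have := he' t f
      rw [ht, he0, hf, map_zero] at this
      exact h.ne_zero this
    · obtain ⟨t, rfl⟩ := h.cyclic x
      exact ⟨_, he t⟩
  refine ⟨LinearEquiv.ofBijective e hb, ⟨he0, he'⟩, ?_⟩
  rintro e' ⟨h1, h2⟩
  ext f
  obtain ⟨s, rfl⟩ := (isVacuum_piD c).cyclic f
  rw [h2, h1]
  exact (he s).symm

end Unique

end Representation

/-! ### The conjugate opposite algebra -/

/-- The opposite algebra with the conjugate complex structure. -/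
def COp (X : Type*) : Type _ := Xᵐᵒᵖ

section COp

variable {G : Type u} [Ring G] [HopfAlgebra ℂ G] [StarRing G] [StarModule ℂ G]
  {H : RibbonHopfStar G} {X Y : Type*} [Ring X] [Ring Y]

instance : Ring (COp X) := inferInstanceAs (Ring Xᵐᵒᵖ)

/-- The identity, as an anti-isomorphism onto the conjugate opposite algebra. -/
def cop : X ≃+ COp X := MulOpposite.opAddEquiv

theorem cop_mul (a b : X) : cop (a * b) = cop b * cop a := rfl

theorem cop_one : cop (1 : X) = 1 := rfl

theorem cop_symm_mul (a b : COp X) : cop.symm (a * b) = cop.symm b * cop.symm a := rfl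

variable [Algebra ℂ X] [Algebra ℂ Y]

instance : Algebra ℂ (COp X) :=
  RingHom.toAlgebra'
    { toFun := fun r => cop (algebraMap ℂ X (conj r))
      map_one' := by rw [map_one, map_one]; rfl
      map_mul' := fun r s => by rw [map_mul, mul_comm, map_mul, cop_mul]
      map_zero' := by rw [map_zero, map_zero, map_zero]
      map_add' := fun r s => by rw [map_add, map_add, map_add] }
    fun r x => by
      obtain ⟨a, rfl⟩ := cop.surjective x
      exact congrArg cop (Algebra.commutes (conj r) a).symm

theorem smul_cop (r : ℂ) (a : X) : r • cop a = cop (conj r • a) := by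
  have : r • cop a = cop (a * algebraMap ℂ X (conj r)) := rfl
  rw [this, ← Algebra.commutes, ← Algebra.smul_def]

theorem cop_symm_smul (r : ℂ) (a : COp X) : cop.symm (r • a) = conj r • cop.symm a := by
  obtain ⟨a, rfl⟩ := cop.surjective a
  rw [smul_cop, AddEquiv.symm_apply_apply, AddEquiv.symm_apply_apply]

/-- A homomorphism, as a homomorphism of the conjugate opposite algebras. -/
def cmap (k : X →ₐ[ℂ] Y) : COp X →ₐ[ℂ] COp Y where
  toFun a := cop (k (cop.symm a))
  map_one' := congrArg cop (map_one k)
  map_mul' a b := by rw [cop_symm_mul, map_mul, cop_mul]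
  map_zero' := by simp
  map_add' a b := by simp
  commutes' r := congrArg cop (k.commutes (conj r))

@[simp] theorem cmap_cop (k : X →ₐ[ℂ] Y) (a : X) : cmap k (cop a) = cop (k a) := rfl

/-- `x ↦ f(x*)`, with values in the conjugate opposite algebra. -/
def cstar (f : G →ₐ[ℂ] Y) : G →ₐ[ℂ] COp Y where
  toFun x := cop (f (star x))
  map_one' := by rw [star_one, map_one, cop_one]
  map_mul' x y := by rw [star_mul, map_mul, cop_mul]
  map_zero' := by simp
  map_add' x y := by simp
  commutes' r := by
    rw [Algebra.algebraMap_eq_smul_one, star_smul, star_one, map_smul, map_one]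
    change _ = cop (algebraMap ℂ Y (conj r))
    rw [Algebra.algebraMap_eq_smul_one]
    rfl

@[simp] theorem cstar_apply (f : G →ₐ[ℂ] Y) (x : G) : cstar f x = cop (f (star x)) := rfl

theorem Cm.cstar {f g : G →ₐ[ℂ] Y} (h : Cm f g) : Cm (cstar f) (cstar g) := fun x y =>
  congrArg cop (h (star x) (star y)).eq.symm

theorem Cm.cstar_cmap {f : G →ₐ[ℂ] Y} {k : X →ₐ[ℂ] Y} (h : Cm f k) :
    Cm (HandleAlg.cstar f) (cmap k) := fun x y =>
  congrArg cop (h (star x) (cop.symm y)).eq.symm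

theorem leg_cstar {f g : G →ₐ[ℂ] Y} (h : Cm f g) (z : G ⊗[ℂ] G) :
    leg (cstar f) (cstar g) z = cop (leg f g (star z)) := by
  induction z with
  | zero => simp
  | add x y hx hy => simp only [map_add, star_add, hx, hy]
  | tmul x y =>
    rw [leg_tmul, TensorProduct.star_tmul, leg_tmul, (h _ _).eq, cop_mul]
    rfl

theorem cv_cstar {f g : G →ₐ[ℂ] Y} (h : Cm f g) (H : RibbonHopfStar G) :
    cv (cstar f) (cstar g) h.cstar = cstar (cv g f h.symm) := by
  ext x
  rw [cv_apply, leg_cstar h, cstar_apply, cv_apply, H.comul_star, h.leg_comm]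

theorem RibbonHopfStar.star_R' : star (H.R : G ⊗[ℂ] G) = H.Ri' := by
  rw [RibbonHopfStar.Ri', ← H.star_R]
  exact ((swap G).symm_apply_apply _).symm

theorem RibbonHopfStar.star_Ri : star ((H.R⁻¹ : (G ⊗[ℂ] G)ˣ) : G ⊗[ℂ] G) = H.R' := by
  have h : ∀ z : G ⊗[ℂ] G, star (swap G z) = swap G (star z) := fun z => by
    induction z with
    | zero => simp
    | add x y hx hy => simp only [map_add, star_add, hx, hy]
    | tmul x y => simp
  rw [← H.star_R, h, star_star, RibbonHopfStar.R']

/-- Since `R* = R⁻¹` for the `*` that exchanges the factors, the factorwise `*` sends `R` to the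
flipped inverse. Hence `R₁₂` turns into `R₂₁⁻¹` under conjugation. -/
theorem rm_cstar {f g : G →ₐ[ℂ] Y} (h : Cm f g) :
    H.rm (cstar f) (cstar g) = cop (H.ri g f) := by
  rw [RibbonHopfStar.rm, leg_cstar h, RibbonHopfStar.star_R', RibbonHopfStar.leg_Ri' h]

theorem ri_cstar {f g : G →ₐ[ℂ] Y} (h : Cm f g) :
    H.ri (cstar f) (cstar g) = cop (H.rm g f) := by
  rw [RibbonHopfStar.ri, leg_cstar h, RibbonHopfStar.star_Ri, RibbonHopfStar.leg_R' h]

/-- The functional `x ↦ conj (f(x*))`. -/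
def starF (f : Module.Dual ℂ G) : Module.Dual ℂ G where
  toFun x := conj (f (star x))
  map_add' x y := by simp
  map_smul' r x := by simp

@[simp] theorem starF_apply (f : Module.Dual ℂ G) (x : G) : starF f x = conj (f (star x)) := rfl

@[simp] theorem starF_starF (f : Module.Dual ℂ G) : starF (starF f) = f := by
  ext x; simp

theorem starF_counit (H : RibbonHopfStar G) :
    starF (Coalgebra.counit : Module.Dual ℂ G) = Coalgebra.counit := by
  ext x
  rw [starF_apply, H.counit_star, Complex.conj_conj]

/-- `x ⊗ a ↦ x* ⊗ a`, from the tensor product with the conjugate opposite algebra. -/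
def flat : G ⊗[ℂ] COp X →ₐ[ℂ] COp (G ⊗[ℂ] X) :=
  Algebra.TensorProduct.lift (cstar (inl G X)) (cmap (inr G X)) (cm_include).cstar_cmap

theorem flat_tmul (x : G) (a : X) : flat (x ⊗ₜ[ℂ] cop a) = cop (star x ⊗ₜ[ℂ] a) := by
  refine (Algebra.TensorProduct.lift_tmul _ _ _ _ _).trans ?_
  rw [cstar_apply, cmap_cop, ← cop_mul]
  simp

theorem ct_flat (f : Module.Dual ℂ G) (z : G ⊗[ℂ] COp X) :
    ct f (cop.symm (flat z)) = cop.symm (ct (starF f) z) := by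
  induction z with
  | zero => simp
  | add x y hx hy => simp only [map_add, hx, hy]
  | tmul x a =>
    obtain ⟨a, rfl⟩ := cop.surjective a
    rw [flat_tmul, ct_tmul, AddEquiv.symm_apply_apply, ct_tmul, smul_cop,
      AddEquiv.symm_apply_apply, starF_apply, Complex.conj_conj]

theorem leg_cstar_cmap {f : G →ₐ[ℂ] Y} {k : X →ₐ[ℂ] Y} (h : Cm f k) (z : G ⊗[ℂ] COp X) :
    leg (cstar f) (cmap k) z = cop (leg f k (cop.symm (flat z))) := by
  induction z with
  | zero => simp
  | add x y hx hy => simp only [map_add, hx, hy]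
  | tmul x a =>
    obtain ⟨a, rfl⟩ := cop.surjective a
    rw [flat_tmul, AddEquiv.symm_apply_apply, leg_tmul, leg_tmul, (h _ _).eq]
    rfl

theorem flat_injective [FiniteDimensional ℂ G] : Function.Injective (flat (G := G) (X := X)) :=
    fun z w h => ct_ext fun f => by
  have h1 := congrArg (fun t => ct (starF f) (cop.symm t)) h
  simp only [ct_flat, starF_starF] at h1
  exact cop.symm.injective h1

/-- `x ⊗ y ⊗ a ↦ x* ⊗ y* ⊗ a`. -/
def flat3 : G ⊗[ℂ] (G ⊗[ℂ] COp X) →ₐ[ℂ] COp (G ⊗[ℂ] (G ⊗[ℂ] X)) :=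
  lift3 (cstar (i1 G X)) (cstar (i2 G X)) (cmap (i3 G X)) cm_i12.cstar cm_i13.cstar_cmap
    cm_i23.cstar_cmap

theorem ct_ct_flat3 (f g : Module.Dual ℂ G) (z : G ⊗[ℂ] (G ⊗[ℂ] COp X)) :
    ct g (ct f (cop.symm (flat3 z))) = cop.symm (ct (starF g) (ct (starF f) z)) := by
  induction z with
  | zero => simp
  | add x y hx hy => simp only [map_add, hx, hy]
  | tmul x z =>
    induction z with
    | zero => simp
    | add p q hp hq => simp only [TensorProduct.tmul_add, map_add, hp, hq]
    | tmul y a =>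
      obtain ⟨a, rfl⟩ := cop.surjective a
      have e : flat3 (x ⊗ₜ[ℂ] (y ⊗ₜ[ℂ] cop a)) = cop (star x ⊗ₜ[ℂ] (star y ⊗ₜ[ℂ] a)) := by
        rw [flat3, lift3_tmul, cstar_apply, cstar_apply, cmap_cop, ← cop_mul, ← cop_mul]
        simp
      rw [e, AddEquiv.symm_apply_apply]
      simp only [ct_tmul, map_smul, cop_symm_smul, starF_apply, Complex.conj_conj,
        AddEquiv.symm_apply_apply]

theorem flat3_injective [FiniteDimensional ℂ G] : Function.Injective (flat3 (G := G) (X := X)) :=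
    fun z w h => ct_ext fun f => ct_ext fun g => by
  have h1 := congrArg (fun t => ct (starF g) (ct (starF f) (cop.symm t))) h
  simp only [ct_ct_flat3, starF_starF] at h1
  exact cop.symm.injective h1

section Conditions

variable [FiniteDimensional ℂ G] {M N : G ⊗[ℂ] COp X}

/-- The hypothesis `h` is the functoriality relation of `M` read in the conjugate opposite algebra:
products are reversed, `R₁₂` and `R₂₁` become `R₂₁⁻¹` and `R₁₂⁻¹`, and the co-product becomes the
opposite one. -/
theorem isFus_of_flat (hu : ct Coalgebra.counit (cop.symm (flat M)) = 1)
    (h : leg (i2 G X) (i3 G X) (cop.symm (flat M)) * H.ri (i2 G X) (i1 G X) *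
      leg (i1 G X) (i3 G X) (cop.symm (flat M)) * H.ri (i1 G X) (i2 G X) =
        leg (cv (i2 G X) (i1 G X) cm_i12.symm) (i3 G X) (cop.symm (flat M))) : IsFus H M where
  unit := by
    rw [ct_flat, starF_counit H] at hu
    exact cop.symm.injective hu
  fus := by
    refine flat3_injective ?_
    rw [map_mul, map_mul, map_mul, RibbonHopfStar.map_rm, RibbonHopfStar.map_rm, map_leg, map_leg,
      map_leg, flat3, comp_cv_i12, lift3_i1, lift3_i2, lift3_i3, rm_cstar cm_i12,
      rm_cstar cm_i12.symm, leg_cstar_cmap cm_i13, leg_cstar_cmap cm_i23, cv_cstar cm_i12 H,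
      leg_cstar_cmap (Cm.cv_left cm_i23 cm_i13), ← h]
    simp only [cop_mul, mul_assoc]

theorem isExch_of_flat
    (h : leg (i2 G X) (i3 G X) (cop.symm (flat N)) * H.ri (i2 G X) (i1 G X) *
      leg (i1 G X) (i3 G X) (cop.symm (flat M)) * H.rm (i2 G X) (i1 G X) =
      H.ri (i2 G X) (i1 G X) * leg (i1 G X) (i3 G X) (cop.symm (flat M)) *
        H.ri (i1 G X) (i2 G X) * leg (i2 G X) (i3 G X) (cop.symm (flat N))) : IsExch H M N := by
  refine flat3_injective ?_
  simp only [map_mul, RibbonHopfStar.map_rm, RibbonHopfStar.map_ri, map_leg]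
  rw [flat3, lift3_i1, lift3_i2, lift3_i3, rm_cstar cm_i12,
    rm_cstar cm_i12.symm, ri_cstar cm_i12, leg_cstar_cmap cm_i13, leg_cstar_cmap cm_i23]
  simpa only [cop_mul, mul_assoc] using congrArg cop h

theorem isCov_of_flat {h : G →ₐ[ℂ] X} (H : RibbonHopfStar G)
    (hM : ∀ x, Commute (cv ((inr G X).comp h) (inl G X) (cm_inl_inr h).symm x)
      (cop.symm (flat M))) : IsCov (cstar h) M := fun x => by
  refine flat_injective ?_
  rw [map_mul, map_mul, map_leg]
  have e1 : (flat (G := G) (X := X)).comp Algebra.TensorProduct.includeLeft =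
    cstar (inl G X) := lift_comp_includeLeft _
  have e2 : (flat (G := G) (X := X)).comp ((inr G (COp X)).comp (cstar h)) =
    cstar ((inr G X).comp h) := lift_comp_includeRight _ _
  rw [e1, e2, leg_cstar (cm_inl_inr h)]
  have e3 := congrArg cop (hM (star x)).eq
  rw [cop_mul, cop_mul, cv_apply, H.comul_star, (cm_inl_inr h).leg_comm] at e3
  exact e3.symm

end Conditions

end COp

/-! ### The adjoint of a solution of the relations -/

section Groups

variable {Γ : Type*} [Group Γ] {m₁ m₂ r₁₂ r₂₁ a b k : Γ}

/-- Here `m₁`, `m₂` stand for `M` in the legs 1 and 2, `r₁₂`, `r₂₁` for the R-matrices between these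
legs, `a`, `b` for those between the leg 1 or 2 and the image of `G`, and `k` for `κ`. The
hypotheses `h₁`, `h₂` are covariance, `yb`, `yb'` the Yang-Baxter equations. The bracket on the
right is `(Δ' ⊗ id)M` up to functoriality, with `Δ'` the opposite co-product. -/
theorem adjoint_fus (h₁ : Commute (b * r₂₁) m₁) (h₂ : Commute (a * r₁₂) m₂)
    (yb : r₁₂ * (a * b) = b * (a * r₁₂)) (yb' : r₂₁ * (b * a) = a * (b * r₂₁))
    (hk₁ : Commute k r₂₁) (hk₂ : Commute k r₁₂) :
    (k⁻¹ * b * m₂⁻¹ * b⁻¹ * k) * r₂₁⁻¹ * (k⁻¹ * a * m₁⁻¹ * a⁻¹ * k) * r₁₂⁻¹ =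
      k⁻¹ * (b * a) * (r₁₂ * (r₂₁ * m₁ * r₁₂ * m₂) * r₁₂⁻¹)⁻¹ * (b * a)⁻¹ * k := by
  have e1 : k * r₂₁⁻¹ * k⁻¹ = r₂₁⁻¹ := by rw [hk₁.inv_right.eq]; group
  have e2 : b⁻¹ * r₂₁⁻¹ * a = a * (b * r₂₁)⁻¹ := by
    rw [eq_mul_inv_iff_mul_eq, mul_assoc _ a, ← yb']; group
  have e3 : r₂₁⁻¹ * b⁻¹ * a⁻¹ * r₁₂⁻¹ = r₂₁⁻¹ * r₁₂⁻¹ * a⁻¹ * b⁻¹ := by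
    have := congrArg (fun t => r₂₁⁻¹ * t⁻¹) yb
    simpa only [mul_inv_rev, mul_assoc] using this
  calc _ = k⁻¹ * b * m₂⁻¹ * (b⁻¹ * (k * r₂₁⁻¹ * k⁻¹) * a) * m₁⁻¹ * a⁻¹ * (k * r₁₂⁻¹) := by
        simp only [mul_assoc]
    _ = k⁻¹ * b * m₂⁻¹ * a * ((b * r₂₁)⁻¹ * m₁⁻¹) * a⁻¹ * (r₁₂⁻¹ * k) := by
        rw [e1, e2, hk₂.inv_right.eq]; simp only [mul_assoc]
    _ = k⁻¹ * b * m₂⁻¹ * a * m₁⁻¹ * (r₂₁⁻¹ * b⁻¹ * a⁻¹ * r₁₂⁻¹) * k := by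
        rw [h₁.inv_inv.eq]; simp only [mul_assoc, mul_inv_rev]
    _ = k⁻¹ * b * (m₂⁻¹ * (a * r₁₂)) * r₁₂⁻¹ * m₁⁻¹ * (r₂₁⁻¹ * r₁₂⁻¹ * a⁻¹ * b⁻¹) * k := by
        rw [e3]; group
    _ = _ := by rw [← h₂.inv_right.eq]; group

/-- The same dictionary as for `adjoint_fus`, except that `m₂` comes from the second of the two
exchanging solutions and `he` is their exchange relation. -/
theorem adjoint_exch (h₁ : Commute (b * r₂₁) m₁) (h₂ : Commute (a * r₁₂) m₂)
    (yb : r₁₂ * (a * b) = b * (a * r₁₂)) (yb' : r₂₁ * (b * a) = a * (b * r₂₁))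
    (hk₁ : Commute k r₂₁) (hk₂ : Commute k r₁₂)
    (he : r₁₂⁻¹ * m₁ * r₁₂ * m₂ = m₂ * r₂₁ * m₁ * r₁₂) :
    (k⁻¹ * b * m₂⁻¹ * b⁻¹ * k) * r₂₁⁻¹ * (k⁻¹ * a * m₁⁻¹ * a⁻¹ * k) * r₂₁ =
      r₂₁⁻¹ * (k⁻¹ * a * m₁⁻¹ * a⁻¹ * k) * r₁₂⁻¹ * (k⁻¹ * b * m₂⁻¹ * b⁻¹ * k) := by
  have e1 : k * r₂₁⁻¹ * k⁻¹ = r₂₁⁻¹ := by rw [hk₁.inv_right.eq]; group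
  have e1' : k * r₁₂⁻¹ * k⁻¹ = r₁₂⁻¹ := by rw [hk₂.inv_right.eq]; group
  have e2 : b⁻¹ * r₂₁⁻¹ * a = a * (b * r₂₁)⁻¹ := by
    rw [eq_mul_inv_iff_mul_eq, mul_assoc _ a, ← yb']; group
  have e2' : a⁻¹ * r₁₂⁻¹ * b = b * (a * r₁₂)⁻¹ := by
    rw [eq_mul_inv_iff_mul_eq, mul_assoc _ b, ← yb]; group
  have e3 : r₂₁⁻¹ * b⁻¹ * a⁻¹ * r₂₁ = a⁻¹ * b⁻¹ := by
    have := congrArg (fun t => t⁻¹ * r₂₁) yb'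
    simpa only [mul_inv_rev, mul_assoc, inv_mul_cancel, mul_one] using this.symm
  have e4 : r₂₁⁻¹ * a * b * r₂₁ = b * a := by
    rw [mul_assoc, mul_assoc, ← yb', inv_mul_cancel_left]
  have e5 : m₁⁻¹ * r₂₁⁻¹ * m₂⁻¹ * r₁₂⁻¹ = r₁₂ * m₂⁻¹ * r₁₂⁻¹ * m₁⁻¹ := by
    have := congrArg (fun t => r₁₂ * t⁻¹ * r₁₂⁻¹) he
    simp only [mul_inv_rev, mul_assoc, inv_inv, mul_inv_cancel_left, mul_inv_cancel, mul_one] at this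
    simpa only [mul_assoc] using this.symm
  calc _ = k⁻¹ * b * m₂⁻¹ * (b⁻¹ * (k * r₂₁⁻¹ * k⁻¹) * a) * m₁⁻¹ * a⁻¹ * (k * r₂₁) := by
        simp only [mul_assoc]
    _ = k⁻¹ * b * m₂⁻¹ * a * ((b * r₂₁)⁻¹ * m₁⁻¹) * a⁻¹ * (r₂₁ * k) := by
        rw [e1, e2, hk₁.eq]; simp only [mul_assoc]
    _ = k⁻¹ * b * (m₂⁻¹ * (a * r₁₂)) * r₁₂⁻¹ * m₁⁻¹ * (r₂₁⁻¹ * b⁻¹ * a⁻¹ * r₂₁) * k := by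
        rw [h₁.inv_inv.eq]; simp only [mul_assoc, mul_inv_rev, mul_inv_cancel_left]
    _ = k⁻¹ * (b * a) * (r₁₂ * m₂⁻¹ * r₁₂⁻¹ * m₁⁻¹) * a⁻¹ * b⁻¹ * k := by
        rw [e3, ← h₂.inv_right.eq]; simp only [mul_assoc]
    _ = k⁻¹ * r₂₁⁻¹ * a * ((b * r₂₁) * m₁⁻¹) * r₂₁⁻¹ * (m₂⁻¹ * (a * r₁₂)⁻¹) * b⁻¹ * k := by
        rw [← e4, ← e5]; simp only [mul_assoc, mul_inv_rev]
    _ = k⁻¹ * r₂₁⁻¹ * a * m₁⁻¹ * (b * (a * r₁₂)⁻¹) * m₂⁻¹ * b⁻¹ * k := by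
        rw [h₁.inv_right.eq, ← h₂.inv_inv.eq]; simp only [mul_assoc, mul_inv_cancel_left]
    _ = (k⁻¹ * r₂₁⁻¹) * a * m₁⁻¹ * a⁻¹ * (k * r₁₂⁻¹ * k⁻¹) * b * m₂⁻¹ * b⁻¹ * k := by
        rw [← e2', e1']; simp only [mul_assoc]
    _ = _ := by rw [hk₁.inv_inv.eq]; simp only [mul_assoc]

/-- With `a = R`, `a' = R'`, `k = κ` and `d = Δ(v)⁻¹`, the hypothesis `hQ` is the ribbon identity
with `κ² = v`. The double adjoint is conjugation by `v₁Δ(v)⁻¹`, and both factors commute with `M`.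
-/
theorem adjoint_adjoint {m a a' k v₁ d : Γ} (h₁ : Commute v₁ m) (hd : Commute d m)
    (ha' : Commute k a') (hQ : a' * a = k * k * (v₁ * d)) :
    k⁻¹ * a' * (k⁻¹ * a * m⁻¹ * a⁻¹ * k)⁻¹ * a'⁻¹ * k = m := by
  have e : k⁻¹ * a' * (k⁻¹ * a) = v₁ * d := by
    rw [mul_assoc, ← mul_assoc a', ← ha'.inv_left.eq, mul_assoc, hQ]; group
  calc _ = (k⁻¹ * a' * (k⁻¹ * a)) * m * (k⁻¹ * a' * (k⁻¹ * a))⁻¹ := by group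
    _ = m := by rw [e, (h₁.mul_left hd).eq, mul_inv_cancel_right]

end Groups

/-! ### The relations satisfied by `κ⁻¹RM⁻¹R⁻¹κ`. -/

section Adjoint

variable {G : Type u} [Ring G] [HopfAlgebra ℂ G] [StarRing G] [StarModule ℂ G]
  {X Y : Type*} [Ring X] [Algebra ℂ X] [Ring Y] [Algebra ℂ Y] {P : Type*} [Ring P] [Algebra ℂ P]

theorem Cm.unit_eq {f : P →ₐ[ℂ] Y} {k : X →ₐ[ℂ] Y} (h : Cm f k) (U : (P ⊗[ℂ] X)ˣ) :
    h.unit U = Units.map (Algebra.TensorProduct.lift f k h).toRingHom.toMonoidHom U :=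
  Units.ext (leg_eq_lift h _)

variable (H : RibbonHopfStar G) (κ : Gˣ) (h : G →ₐ[ℂ] X)

/-- The element of `G`, as a unit. -/
abbrev umap (φ : X →ₐ[ℂ] Y) : Xˣ →* Yˣ := Units.map φ.toRingHom.toMonoidHom

/-- The adjoint `κ⁻¹ R M⁻¹ R⁻¹ κ`. -/
def adj (M : (G ⊗[ℂ] X)ˣ) : (G ⊗[ℂ] X)ˣ :=
  (umap ((inr G X).comp h) κ)⁻¹ * (cm_inl_inr h).unit H.R * M⁻¹ * ((cm_inl_inr h).unit H.R)⁻¹ *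
    umap ((inr G X).comp h) κ

variable {H κ h}

theorem unit_adj {f : G →ₐ[ℂ] Y} {k : X →ₐ[ℂ] Y} (hfk : Cm f k)
    (hfh : Cm f (k.comp h)) (M : (G ⊗[ℂ] X)ˣ) : hfk.unit (adj H κ h M) =
      (umap (k.comp h) κ)⁻¹ * hfh.unit H.R * (hfk.unit M)⁻¹ * (hfh.unit H.R)⁻¹ *
        umap (k.comp h) κ := by
  have e1 : umap (Algebra.TensorProduct.lift f k hfk) ((cm_inl_inr h).unit H.R) = hfh.unit H.R := by
    refine Units.ext ?_
    refine (map_leg (Algebra.TensorProduct.lift f k hfk) _ _ _).trans ?_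
    rw [lift_comp_includeLeft, lift_comp_includeRight]
    rfl
  have e2 : umap (Algebra.TensorProduct.lift f k hfk) (umap ((inr G X).comp h) κ) =
      umap (k.comp h) κ :=
    Units.ext (DFunLike.congr_fun (lift_comp_includeRight hfk h) (κ : G))
  rw [Cm.unit_eq hfk, Cm.unit_eq hfk, adj, map_mul, map_mul, map_mul, map_mul, map_inv, map_inv,
    map_inv]
  rw [← e1, ← e2]

section Rel

variable {M N : (G ⊗[ℂ] X)ˣ} (hκ : ∀ x, (κ : G) * x = x * κ)

/-- By the hexagon identity the product of the two R-matrices has a co-product in its second leg,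
and covariance says that this co-product commutes with `M`. -/
theorem commute_cov {f g : G →ₐ[ℂ] Y} {k : X →ₐ[ℂ] Y} (hM : IsCov h (M : G ⊗[ℂ] X))
    (hfg : Cm f g) (hfk : Cm f k) (hgk : Cm g k) (hfh : Cm f (k.comp h)) :
    Commute (hfh.unit H.R * hfg.unit H.R) (hgk.unit M) := by
  refine Commute.units_of_val ?_
  have hgh : Cm g (k.comp h) := fun x y => hgk x _
  change Commute (H.rm f (k.comp h) * H.rm f g) (leg g k (M : G ⊗[ℂ] X))
  rw [← RibbonHopfStar.hexR hgh hfg hfh]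
  refine (RibbonHopfStar.commute_rm (fun x => ?_) fun x => ?_).symm
  · exact (commute_leg (fun y => hfg x y) (fun y => hfk x y) _).symm
  · rw [cv_apply]
    exact (hM.apply hgk x).symm

include hκ

theorem commute_κ {f g : G →ₐ[ℂ] Y} {k : G →ₐ[ℂ] Y} (hfg : Cm f g) (hfk : Cm f k) (hgk : Cm g k) :
    Commute (umap k κ) (hfg.unit H.R) :=
  Commute.units_of_val (commute_leg (fun x => (hfk x _).symm) (fun x => (hgk x _).symm) _)

theorem adj_fus {f g : G →ₐ[ℂ] Y} {k : X →ₐ[ℂ] Y} (hF : IsFus H (M : G ⊗[ℂ] X))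
    (hM : IsCov h (M : G ⊗[ℂ] X)) (hfg : Cm f g) (hfk : Cm f k) (hgk : Cm g k) :
    leg g k (adj H κ h M : G ⊗[ℂ] X) * H.ri g f * leg f k (adj H κ h M : G ⊗[ℂ] X) * H.ri f g =
      leg (cv g f hfg.symm) k (adj H κ h M : G ⊗[ℂ] X) := by
  have hfh : Cm f (k.comp h) := fun x y => hfk x _
  have hgh : Cm g (k.comp h) := fun x y => hgk x _
  have hc : Cm (cv g f hfg.symm) k := Cm.cv_left hgk hfk
  have hch : Cm (cv g f hfg.symm) (k.comp h) := Cm.cv_left hgh hfh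
  have key := adjoint_fus (k := umap (k.comp h) κ) (commute_cov (H := H) hM hfg.symm hgk hfk hgh)
    (commute_cov (H := H) hM hfg hfk hgk hfh)
    (Units.ext (RibbonHopfStar.yangBaxter (H := H) hfg hfh hgh))
    (Units.ext (RibbonHopfStar.yangBaxter (H := H) hfg.symm hgh hfh))
    (commute_κ hκ hfg.symm hgh hfh) (commute_κ hκ hfg hfh hgh)
  -- Functoriality of `M` together with conjugation by `R₁₂`, which exchanges the co-product and its
  -- opposite.
  have e1 : hfg.unit H.R * (hfg.symm.unit H.R * hfk.unit M * hfg.unit H.R * hgk.unit M) *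
      (hfg.unit H.R)⁻¹ = hc.unit M := by
    rw [mul_inv_eq_iff_eq_mul]
    refine Units.ext ?_
    have e2 := RibbonHopfStar.rm_leg_left (H := H) hfg hfk hgk (M : G ⊗[ℂ] X)
    rw [← hF.apply hfg hfk hgk] at e2
    exact e2.eq
  have e3 : hgh.unit H.R * hfh.unit H.R = hch.unit H.R :=
    Units.ext (RibbonHopfStar.hexL hfg.symm hfh).symm
  rw [e1, e3, ← unit_adj hgk hgh, ← unit_adj hfk hfh, ← unit_adj hc hch] at key
  exact congrArg Units.val key

theorem adj_exch {f g : G →ₐ[ℂ] Y} {k : X →ₐ[ℂ] Y} (hE : IsExch H (M : G ⊗[ℂ] X) (N : G ⊗[ℂ] X))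
    (hM : IsCov h (M : G ⊗[ℂ] X)) (hN : IsCov h (N : G ⊗[ℂ] X))
    (hfg : Cm f g) (hfk : Cm f k) (hgk : Cm g k) :
    leg g k (adj H κ h N : G ⊗[ℂ] X) * H.ri g f * leg f k (adj H κ h M : G ⊗[ℂ] X) * H.rm g f =
      H.ri g f * leg f k (adj H κ h M : G ⊗[ℂ] X) * H.ri f g *
        leg g k (adj H κ h N : G ⊗[ℂ] X) := by
  have hfh : Cm f (k.comp h) := fun x y => hfk x _
  have hgh : Cm g (k.comp h) := fun x y => hgk x _
  have key := adjoint_exch (k := umap (k.comp h) κ) (commute_cov (H := H) hM hfg.symm hgk hfk hgh)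
    (commute_cov (H := H) hN hfg hfk hgk hfh)
    (Units.ext (RibbonHopfStar.yangBaxter (H := H) hfg hfh hgh))
    (Units.ext (RibbonHopfStar.yangBaxter (H := H) hfg.symm hgh hfh))
    (commute_κ hκ hfg.symm hgh hfh) (commute_κ hκ hfg hfh hgh)
    (Units.ext (hE.apply hfg hfk hgk))
  rw [← unit_adj hgk hgh, ← unit_adj hfk hfh] at key
  exact congrArg Units.val key

/-- `M⁻¹` commutes with the co-product, and conjugation by `R` exchanges the co-product with its
opposite; `κ` is central. -/
theorem adj_cov (hM : IsCov h (M : G ⊗[ℂ] X)) (x : G) :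
    Commute (cv ((inr G X).comp h) (inl G X) (cm_inl_inr h).symm x)
      (adj H κ h M : G ⊗[ℂ] X) := by
  have hfh := cm_inl_inr (X := X) h
  have hk : Commute (cv ((inr G X).comp h) (inl G X) hfh.symm x)
      (umap ((inr G X).comp h) κ : (G ⊗[ℂ] X)ˣ).val := by
    refine Commute.symm ?_
    rw [cv_apply]
    exact commute_leg (fun y => Commute.map (hκ y) ((inr G X).comp h)) (fun y => (hfh y _).symm) _
  have hM' : Commute (cv (inl G X) ((inr G X).comp h) hfh x) ((M⁻¹ : (G ⊗[ℂ] X)ˣ) : G ⊗[ℂ] X) := by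
    refine Commute.units_inv_right ?_
    rw [cv_apply]
    exact hM x
  have hq := RibbonHopfStar.qtri (H := H) hfh x
  have hr : SemiconjBy (hfh.unit H.R).val (cv (inl G X) ((inr G X).comp h) hfh x)
      (cv ((inr G X).comp h) (inl G X) hfh.symm x) := RibbonHopfStar.qtri hfh x
  have hk' := hk.symm.units_inv_left
  exact Commute.symm (SemiconjBy.mul_left (SemiconjBy.mul_left (SemiconjBy.mul_left
    (SemiconjBy.mul_left hk' hr) hM'.symm) hr.units_inv_symm_left) hk.symm)

theorem adj_unit (hF : IsFus H (M : G ⊗[ℂ] X)) :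
    ct Coalgebra.counit (adj H κ h M : G ⊗[ℂ] X) = 1 := by
  have h1 := unit_adj (H := H) (κ := κ) (cm_eps (G := G) (AlgHom.id ℂ X))
    (cm_eps ((AlgHom.id ℂ X).comp h)) M
  have h2 : (cm_eps (G := G) (AlgHom.id ℂ X)).unit M = 1 :=
    Units.ext ((leg_eps _ _).trans hF.unit)
  have h3 : (cm_eps (G := G) ((AlgHom.id ℂ X).comp h)).unit H.R = 1 :=
    Units.ext (RibbonHopfStar.rm_eps_left _)
  rw [h2, h3] at h1
  have h4 : (cm_eps (G := G) (AlgHom.id ℂ X)).unit (adj H κ h M) = 1 := h1.trans (by group)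
  exact (leg_eps (AlgHom.id ℂ X) _).symm.trans (congrArg Units.val h4)

end Rel

end Adjoint

/-! ### The *-operation of the semi-direct product -/

section Star

variable {G : Type u} [Ring G] [HopfAlgebra ℂ G] [StarRing G] [StarModule ℂ G]
  [FiniteDimensional ℂ G] [IsSemisimpleRing G]
  {ι : Type v} [Fintype ι] [DecidableEq ι] {H : RibbonHopfStar G} {D : IrrepSystem G ι}
  {c : ClebschGordan H D} {X Y : Type*} [Ring X] [Algebra ℂ X] [Ring Y] [Algebra ℂ Y]

theorem starF_coef (I : ι) (a b : D.V I) : starF (D.coef I a b) = D.coef I b a := by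
  ext x
  change conj (D.τ I (star x) a b) = D.τ I x b a
  rw [map_star, Matrix.star_apply, Complex.star_def, Complex.conj_conj]

theorem exists_flat (D : IrrepSystem G ι) (z : G ⊗[ℂ] X) : ∃ w, flat w = cop z := by
  refine ⟨∑ I, ∑ a, ∑ b, D.e I a b ⊗ₜ[ℂ] cop (ct (D.coef I b a) z), ?_⟩
  simp only [map_sum, flat_tmul, D.star_e]
  simp only [← map_sum]
  refine congrArg cop (Eq.trans ?_ (D.sum_e_ct z))
  exact Finset.sum_congr rfl fun I _ => Finset.sum_comm

/-- The unit of `X` which belongs to a unit of the conjugate opposite algebra. -/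
def uncop (U : (COp X)ˣ) : Xˣ where
  val := cop.symm U
  inv := cop.symm (U⁻¹ : (COp X)ˣ)
  val_inv := by rw [← cop_symm_mul, Units.inv_mul]; rfl
  inv_val := by rw [← cop_symm_mul, Units.mul_inv]; rfl

theorem uncop_mul (U V : (COp X)ˣ) : uncop (U * V) = uncop V * uncop U := Units.ext rfl

theorem uncop_inv (U : (COp X)ˣ) : uncop U⁻¹ = (uncop U)⁻¹ := Units.ext rfl

theorem IsFus.exists_unit {M : G ⊗[ℂ] X} (hM : IsFus H M)
    (hQ : Function.Surjective fun f => ct f H.Qv) :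
    ∃ U : (G ⊗[ℂ] X)ˣ, (U : G ⊗[ℂ] X) = M ∧
      ∀ f, ct f ((U⁻¹ : (G ⊗[ℂ] X)ˣ) : G ⊗[ℂ] X) ∈ ctRange M := by
  obtain ⟨N, h1, h2, h3⟩ := hM.exists_inv hQ
  exact ⟨⟨M, N, h1, h2⟩, rfl, h3⟩

/-- A homomorphism to the conjugate opposite algebra, extended by the *-operation of `G`. -/
def sharp (F : X →ₐ[ℂ] COp X) : G ⊗[ℂ] X →ₐ[ℂ] COp (G ⊗[ℂ] X) :=
  flat.comp (Algebra.TensorProduct.map (AlgHom.id ℂ G) F)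

theorem ct_sharp (F : X →ₐ[ℂ] COp X) (f : Module.Dual ℂ G) (z : G ⊗[ℂ] X) :
    cop.symm (F (ct f z)) = ct (starF f) (cop.symm (sharp F z)) := by
  rw [sharp, AlgHom.comp_apply, ct_flat, starF_starF, ct_map]

section Involution

variable {κ : Gˣ} {h : G →ₐ[ℂ] X} {F : X →ₐ[ℂ] COp X}

theorem sharp_comp_inl : (sharp F).comp (inl G X) = cstar (inl G X) := by
  ext x
  change flat (x ⊗ₜ F 1) = _
  rw [map_one, ← cop_one, flat_tmul]
  rfl

theorem sharp_comp_inr (hF : ∀ x, F (h x) = cop (h (star x))) :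
    (sharp F).comp ((inr G X).comp h) = cstar ((inr G X).comp h) := by
  ext x
  change flat (1 ⊗ₜ F (h x)) = _
  rw [hF, flat_tmul, star_one]
  rfl

/-- Applying the conjugation to `κ⁻¹RM⁻¹R⁻¹κ` gives an expression of the same shape with `R'` in
place of `R` and the adjoint in place of `M`, because `κ* = κ⁻¹` and `R* = R⁻¹`. Then
`adjoint_adjoint` applies. -/
theorem sharp_adj (hF : ∀ x, F (h x) = cop (h (star x))) (hκ : ∀ x, (κ : G) * x = x * κ)
    (hκs : star (κ : G) = ((κ⁻¹ : Gˣ) : G)) (hκ2 : (κ : G) * κ = H.ribbon)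
    {M : (G ⊗[ℂ] X)ˣ} (hM : IsCov h (M : G ⊗[ℂ] X))
    (hFM : sharp F (M : G ⊗[ℂ] X) = cop (adj H κ h M : G ⊗[ℂ] X)) :
    cop.symm (sharp F (adj H κ h M : G ⊗[ℂ] X)) = M := by
  have hfh := cm_inl_inr (X := X) h
  have e1 : uncop (umap (sharp F) (umap ((inr G X).comp h) κ)) =
      (umap ((inr G X).comp h) κ)⁻¹ := by
    refine Units.ext ?_
    have := DFunLike.congr_fun (sharp_comp_inr hF) (κ : G)
    refine (congrArg cop.symm this).trans ?_
    rw [cstar_apply, AddEquiv.symm_apply_apply, hκs]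
    rfl
  have e2 : uncop (umap (sharp F) (hfh.unit H.R)) = (hfh.symm.unit H.R)⁻¹ := by
    refine Units.ext ?_
    have := RibbonHopfStar.map_rm (H := H) (sharp F) (inl G X) ((inr G X).comp h)
    rw [sharp_comp_inl, sharp_comp_inr hF, rm_cstar hfh] at this
    exact congrArg cop.symm this
  have e3 : uncop (umap (sharp F) M) = adj H κ h M :=
    Units.ext (congrArg cop.symm hFM)
  have e4 : uncop (umap (sharp F) (adj H κ h M)) = (umap ((inr G X).comp h) κ)⁻¹ *
      hfh.symm.unit H.R * (adj H κ h M)⁻¹ * (hfh.symm.unit H.R)⁻¹ *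
        umap ((inr G X).comp h) κ := by
    conv_lhs => rw [adj]
    simp only [map_mul, map_inv, uncop_mul, uncop_inv, e1, e2, e3, inv_inv, mul_assoc]
  have hκ' : Commute (umap ((inr G X).comp h) κ) (hfh.symm.unit H.R) :=
    Commute.units_of_val (commute_leg (fun x => Commute.map (hκ x) ((inr G X).comp h))
      (fun x => (hfh x _).symm) _)
  have e5 := adjoint_adjoint (m := M) (a := hfh.unit H.R) (a' := hfh.symm.unit H.R)
    (k := umap ((inr G X).comp h) κ) (v₁ := umap (inl G X) H.ribbon)
    (d := (umap (cv (inl G X) ((inr G X).comp h) hfh) H.ribbon)⁻¹) ?_ ?_ ?_ ?_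
  · rw [← adj, ← e4] at e5
    exact congrArg Units.val e5
  · exact Commute.units_of_val (commute_tmul_one H.ribbon_central _)
  · refine Commute.inv_left (Commute.units_of_val ?_)
    have := hM (H.ribbon : G)
    rw [← cv_apply _ _ hfh] at this
    exact this
  · exact hκ'
  -- The ribbon identity `R'R Δ(v) = v ⊗ v`, with `v = κ²` inserted in the second leg.
  · rw [← mul_assoc, eq_mul_inv_iff_mul_eq]
    refine Units.ext ?_
    have e6 := congrArg (leg (inl G X) ((inr G X).comp h)) H.comul_ribbon
    rw [hfh.leg_mul, ← cv_apply _ _ hfh, hfh.leg_mul, ← RibbonHopfStar.R',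
      RibbonHopfStar.leg_R' hfh, leg_tmul, (hfh _ _).eq] at e6
    refine e6.trans ?_
    have e7 : ((inr G X).comp h) (H.ribbon : G) =
        ((inr G X).comp h) (κ : G) * ((inr G X).comp h) (κ : G) := by rw [← hκ2, map_mul]
    rw [e7]
    rfl

end Involution

end Star

/-! ### Existence and uniqueness of the *-operation. -/

section StarExists

variable {G : Type u} [Ring G] [HopfAlgebra ℂ G] [StarRing G] [StarModule ℂ G]
  [FiniteDimensional ℂ G] [IsSemisimpleRing G]
  {ι : Type v} [Fintype ι] [DecidableEq ι] {H : RibbonHopfStar G} {D : IrrepSystem G ι}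
  {c : ClebschGordan H D}

/-- The adjoint matrices of the monodromies `M` in the semi-direct product. -/
abbrev Semi.adj (c : ClebschGordan H D) (U : (G ⊗[ℂ] Semi c)ˣ) : (G ⊗[ℂ] Semi c)ˣ :=
  HandleAlg.adj H c.κel (Semi.hG c) U

theorem kHom_inr (X : Type*) [Ring X] [Algebra ℂ X] (I : ι) (y z : X) (t : G ⊗[ℂ] X)
    (a b : D.V I) :
    kHom D I ((1 ⊗ₜ y) * t * (1 ⊗ₜ z)) a b = y * kHom D I t a b * z := by
  rw [kHom_apply, kHom_apply, ct_mul_right, ct_mul_left]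

/-- Translates the adjoint of the rescaled element back to the matrices: `U` is `κ⁻¹A` with `κ` in
the first leg, where it is central, so the surplus factor `κ` of `U⁻¹` is compensated by `κ_I⁻¹`. -/
theorem Semi.exists_inverse {U : (G ⊗[ℂ] Semi c)ˣ} {Am : ∀ I, Matrix (D.V I) (D.V I) (Semi c)}
    (hU : (U : G ⊗[ℂ] Semi c) = datum c Am) (I : ι) :
    ∃ A' : Matrix (D.V I) (D.V I) (Semi c), Am I * A' = 1 ∧ A' * Am I = 1 ∧
      ∀ a b, (c.κ I)⁻¹ • ct (D.coef I a b) (Semi.adj c U : G ⊗[ℂ] Semi c) =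
        Semi.ofG c ((c.κel⁻¹ : Gˣ) : G) * ((D.tauId I H.R).map (Semi.ofG c) * A' *
          (D.tauId I ((H.R⁻¹ : (G ⊗[ℂ] G)ˣ) : G ⊗[ℂ] G)).map (Semi.ofG c)) a b *
            Semi.ofG c (c.κel : G) := by
  have hA : Am I = kHom D I ((umap (inl G (Semi c)) c.κel * U : (G ⊗[ℂ] Semi c)ˣ) :
      G ⊗[ℂ] Semi c) := by
    rw [Units.val_mul, hU]
    exact (kHom_asm Am I).symm.trans (congrArg (kHom D I) (κ_mul_datum c Am).symm)
  refine ⟨kHom D I (((umap (inl G (Semi c)) c.κel * U)⁻¹ : (G ⊗[ℂ] Semi c)ˣ) : G ⊗[ℂ] Semi c),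
    ?_, ?_, fun a b => ?_⟩
  · rw [hA, ← map_mul, Units.mul_inv, map_one]
  · rw [hA, ← map_mul, Units.inv_mul, map_one]
  · have e1 : ∀ z : G ⊗[ℂ] G, (D.tauId I z).map (Semi.ofG c) = kHom D I
        (leg (inl G (Semi c)) ((inr G (Semi c)).comp (Semi.hG c)) z) := tauId_map (Semi.hG c) I
    rw [e1, e1, ← map_mul, ← map_mul, ← Semi.hG_apply, ← Semi.hG_apply, ← kHom_inr, kHom_apply]
    have e2 : ∀ z : G ⊗[ℂ] Semi c, (c.κ I)⁻¹ • ct (D.coef I a b) z =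
        ct (D.coef I a b) ((((c.κel⁻¹ : Gˣ) : G) ⊗ₜ 1) * z) := fun z => by
      rw [inv_smul_eq_iff₀ (c.κ_ne_zero I), ← ct_coef_κ_mul c, ← mul_assoc,
        Algebra.TensorProduct.tmul_mul_tmul, Units.mul_inv, mul_one,
        ← Algebra.TensorProduct.one_def, one_mul]
    rw [e2]
    congr 1
    have hc : ∀ z : (G ⊗[ℂ] Semi c)ˣ, Commute (umap (inl G (Semi c)) c.κel)⁻¹ z := fun z =>
      Commute.inv_left (Commute.units_of_val (commute_tmul_one c.κel_central _))
    have hfh := cm_inl_inr (Semi.hG c)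
    have e3 : (umap (inl G (Semi c)) c.κel)⁻¹ * Semi.adj c U =
        (umap ((inr G (Semi c)).comp (Semi.hG c)) c.κel)⁻¹ * (hfh.unit H.R *
          (umap (inl G (Semi c)) c.κel * U)⁻¹ * (hfh.unit H.R)⁻¹) *
            umap ((inr G (Semi c)).comp (Semi.hG c)) c.κel := by
      rw [mul_inv_rev, Semi.adj, HandleAlg.adj, ← (hc U⁻¹).eq]
      simp only [← mul_assoc]
      rw [(hc (umap ((inr G (Semi c)).comp (Semi.hG c)) c.κel)⁻¹).eq,
        mul_assoc _ (umap (inl G (Semi c)) c.κel)⁻¹, (hc (hfh.unit H.R)).eq]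
      simp only [mul_assoc]
    exact congrArg Units.val e3

/-- The adjoints of both solutions, moved to the conjugate opposite algebra by `exists_flat`,
satisfy all defining relations of the semi-direct product, so the universal property yields the
homomorphism. -/
theorem Semi.exists_hom {UA UB : (G ⊗[ℂ] Semi c)ˣ}
    (hA : (UA : G ⊗[ℂ] Semi c) = datum c (Semi.A c))
    (hB : (UB : G ⊗[ℂ] Semi c) = datum c (Semi.B c)) :
    ∃ F : Semi c →ₐ[ℂ] COp (Semi c), (∀ x, F (Semi.hG c x) = cop (Semi.hG c (star x))) ∧
      sharp F (UA : G ⊗[ℂ] Semi c) = cop (Semi.adj c UA : G ⊗[ℂ] Semi c) ∧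
      sharp F (UB : G ⊗[ℂ] Semi c) = cop (Semi.adj c UB : G ⊗[ℂ] Semi c) := by
  obtain ⟨MA', hMA⟩ := exists_flat D (Semi.adj c UA : G ⊗[ℂ] Semi c)
  obtain ⟨MB', hMB⟩ := exists_flat D (Semi.adj c UB : G ⊗[ℂ] Semi c)
  have hMA' : cop.symm (flat MA') = (Semi.adj c UA : G ⊗[ℂ] Semi c) := by
    rw [hMA, AddEquiv.symm_apply_apply]
  have hMB' : cop.symm (flat MB') = (Semi.adj c UB : G ⊗[ℂ] Semi c) := by
    rw [hMB, AddEquiv.symm_apply_apply]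
  have fA : IsFus H (UA : G ⊗[ℂ] Semi c) := hA ▸ Semi.isFus_A c
  have fB : IsFus H (UB : G ⊗[ℂ] Semi c) := hB ▸ Semi.isFus_B c
  have cA : IsCov (Semi.hG c) (UA : G ⊗[ℂ] Semi c) := hA ▸ Semi.isCov_A c
  have cB : IsCov (Semi.hG c) (UB : G ⊗[ℂ] Semi c) := hB ▸ Semi.isCov_B c
  have eAB : IsExch H (UA : G ⊗[ℂ] Semi c) (UB : G ⊗[ℂ] Semi c) := by
    rw [hA, hB]; exact Semi.isExch c
  have fA' : IsFus H MA' := isFus_of_flat (by rw [hMA']; exact adj_unit c.κel_central fA)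
    (by rw [hMA']; exact adj_fus c.κel_central fA cA cm_i12 cm_i13 cm_i23)
  have fB' : IsFus H MB' := isFus_of_flat (by rw [hMB']; exact adj_unit c.κel_central fB)
    (by rw [hMB']; exact adj_fus c.κel_central fB cB cm_i12 cm_i13 cm_i23)
  have eAB' : IsExch H MA' MB' := isExch_of_flat
    (by rw [hMA', hMB']; exact adj_exch c.κel_central eAB cA cB cm_i12 cm_i13 cm_i23)
  have cA' : IsCov (cstar (Semi.hG c)) MA' := isCov_of_flat H
    (fun x => by rw [hMA']; exact adj_cov c.κel_central cA x)
  have cB' : IsCov (cstar (Semi.hG c)) MB' := isCov_of_flat H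
    (fun x => by rw [hMB']; exact adj_cov c.κel_central cB x)
  have hr : ∀ x y, HandleRel c (matOf c MA') (matOf c MB') x y → x = y := fun x y =>
    handleRel_sound (by rw [datum_matOf]; exact fA') (by rw [datum_matOf]; exact fB')
      (by rw [datum_matOf, datum_matOf]; exact eAB')
  have hcA : IsCov (cstar (Semi.hG c)) (datum c (matOf c MA')) := by rw [datum_matOf]; exact cA'
  have hcB : IsCov (cstar (Semi.hG c)) (datum c (matOf c MB')) := by rw [datum_matOf]; exact cB'
  refine ⟨Semi.lift c (matOf c MA') (matOf c MB') (cstar (Semi.hG c)) hr hcA hcB, fun x => ?_,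
    ?_, ?_⟩
  · exact Semi.lift_ofG hr hcA hcB x
  · rw [← hMA, sharp, AlgHom.comp_apply, hA]
    refine congrArg flat ((datum_map _ _).trans (Eq.trans ?_ (datum_matOf (c := c) MA')))
    congr 1
    exact funext fun I => Matrix.ext fun a b => Semi.lift_A hr hcA hcB I a b
  · rw [← hMB, sharp, AlgHom.comp_apply, hB]
    refine congrArg flat ((datum_map _ _).trans (Eq.trans ?_ (datum_matOf (c := c) MB')))
    congr 1
    exact funext fun I => Matrix.ext fun a b => Semi.lift_B hr hcA hcB I a b

theorem cop_symm_entry {F : Semi c →ₐ[ℂ] COp (Semi c)} {U : (G ⊗[ℂ] Semi c)ˣ}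
    {Am : ∀ I, Matrix (D.V I) (D.V I) (Semi c)} (hU : (U : G ⊗[ℂ] Semi c) = datum c Am)
    (hF : sharp F (U : G ⊗[ℂ] Semi c) = cop (Semi.adj c U : G ⊗[ℂ] Semi c)) (I : ι)
    (a b : D.V I) : cop.symm (F (Am I b a)) =
      (c.κ I)⁻¹ • ct (D.coef I a b) (Semi.adj c U : G ⊗[ℂ] Semi c) := by
  rw [apply_eq_ct_datum c Am, map_smul, cop_symm_smul, ct_sharp, ← hU, hF,
    AddEquiv.symm_apply_apply, starF_coef, c.conj_κ]

/-- The *-operation which belongs to a homomorphism to the conjugate opposite algebra. -/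
def stOf {X : Type*} [Ring X] [Algebra ℂ X] (F : X →ₐ[ℂ] COp X) (x : X) : X := cop.symm (F x)

/-- The square of the *-operation, as a homomorphism. -/
def stSq {X : Type*} [Ring X] [Algebra ℂ X] (F : X →ₐ[ℂ] COp X) : X →ₐ[ℂ] X where
  toFun x := stOf F (stOf F x)
  map_one' := by rw [stOf, stOf, map_one, ← cop_one, AddEquiv.symm_apply_apply, map_one]; rfl
  map_mul' x y := by simp only [stOf, map_mul, cop_symm_mul]
  map_zero' := by simp [stOf]
  map_add' x y := by simp [stOf]
  commutes' r := by
    simp only [stOf, AlgHom.commutes]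
    rw [Algebra.algebraMap_eq_smul_one, cop_symm_smul, map_smul, cop_symm_smul, Complex.conj_conj,
      ← cop_one, AddEquiv.symm_apply_apply, map_one, ← cop_one, AddEquiv.symm_apply_apply,
      Algebra.algebraMap_eq_smul_one]

theorem stOf_stOf_entry {F : Semi c →ₐ[ℂ] COp (Semi c)}
    (hF : ∀ x, F (Semi.hG c x) = cop (Semi.hG c (star x))) {U : (G ⊗[ℂ] Semi c)ˣ}
    {Am : ∀ I, Matrix (D.V I) (D.V I) (Semi c)} (hU : (U : G ⊗[ℂ] Semi c) = datum c Am)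
    (hc : IsCov (Semi.hG c) (U : G ⊗[ℂ] Semi c))
    (hFU : sharp F (U : G ⊗[ℂ] Semi c) = cop (Semi.adj c U : G ⊗[ℂ] Semi c)) (I : ι)
    (a b : D.V I) : stOf F (stOf F (Am I a b)) = Am I a b := by
  conv_lhs => rw [stOf, stOf, cop_symm_entry hU hFU]
  rw [map_smul, cop_symm_smul, ct_sharp, starF_coef, map_inv₀, c.conj_κ, inv_inv,
    apply_eq_ct_datum c Am, ← hU]
  congr 2
  exact sharp_adj hF c.κel_central c.star_κel c.κel_sq hc hFU

theorem isHandleStar_stOf {F : Semi c →ₐ[ℂ] COp (Semi c)}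
    (hF : ∀ x, F (Semi.hG c x) = cop (Semi.hG c (star x))) {UA UB : (G ⊗[ℂ] Semi c)ˣ}
    (hA : (UA : G ⊗[ℂ] Semi c) = datum c (Semi.A c))
    (hB : (UB : G ⊗[ℂ] Semi c) = datum c (Semi.B c))
    (hFA : sharp F (UA : G ⊗[ℂ] Semi c) = cop (Semi.adj c UA : G ⊗[ℂ] Semi c))
    (hFB : sharp F (UB : G ⊗[ℂ] Semi c) = cop (Semi.adj c UB : G ⊗[ℂ] Semi c)) :
    IsHandleStar c (stOf F) where
  add x y := by simp [stOf]
  smul r x := by rw [stOf, map_smul, cop_symm_smul, stOf]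
  mul x y := by rw [stOf, map_mul, cop_symm_mul, stOf, stOf]
  invol x := by
    have e : stSq F = AlgHom.id ℂ _ := by
      refine AlgHom.ext_of_adjoin_eq_top (Semi.adjoin_eq_top c) ?_
      rintro _ ((⟨I, a, b, rfl⟩ | ⟨I, a, b, rfl⟩) | ⟨x, rfl⟩)
      · exact stOf_stOf_entry hF hA (hA ▸ Semi.isCov_A c) hFA I a b
      · exact stOf_stOf_entry hF hB (hB ▸ Semi.isCov_B c) hFB I a b
      · change stOf F (stOf F (Semi.hG c x)) = Semi.hG c x
        rw [stOf, stOf, hF, AddEquiv.symm_apply_apply, hF, AddEquiv.symm_apply_apply, star_star]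
    exact DFunLike.congr_fun e x
  ofG x := congrArg cop.symm (hF x)
  A I := by
    obtain ⟨A', h1, h2, h3⟩ := Semi.exists_inverse hA I
    exact ⟨A', h1, h2, fun a b => (cop_symm_entry hA hFA I a b).trans (h3 a b)⟩
  B I := by
    obtain ⟨A', h1, h2, h3⟩ := Semi.exists_inverse hB I
    exact ⟨A', h1, h2, fun a b => (cop_symm_entry hB hFB I a b).trans (h3 a b)⟩

theorem IsHandleStar.unique {st st' : Semi c → Semi c} (h : IsHandleStar c st)
    (h' : IsHandleStar c st') : st' = st := by
  -- That the unit is fixed is not among the axioms of the *-operation; agreement on it comes from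
  -- the unit of `G`.
  have hone : st' 1 = st 1 := by
    have e : Semi.ofG c 1 = 1 := map_one (Semi.hG c)
    rw [← e, h.ofG, h'.ofG]
  funext x
  have hx : x ∈ Algebra.adjoin ℂ ({x | ∃ I a b, x = Semi.A c I a b} ∪
      {x | ∃ I a b, x = Semi.B c I a b} ∪ Set.range (Semi.ofG c)) := by
    rw [Semi.adjoin_eq_top]; trivial
  induction hx using Algebra.adjoin_induction with
  | mem x hx =>
    rcases hx with (⟨I, a, b, rfl⟩ | ⟨I, a, b, rfl⟩) | ⟨x, rfl⟩
    · obtain ⟨A₁, h1, h2, h3⟩ := h.A I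
      obtain ⟨A₂, h1', h2', h3'⟩ := h'.A I
      rw [h3, h3', left_inv_eq_right_inv h2' h1]
    · obtain ⟨A₁, h1, h2, h3⟩ := h.B I
      obtain ⟨A₂, h1', h2', h3'⟩ := h'.B I
      rw [h3, h3', left_inv_eq_right_inv h2' h1]
    · rw [h.ofG, h'.ofG]
  | algebraMap r => rw [Algebra.algebraMap_eq_smul_one, h.smul, h'.smul, hone]
  | add x y _ _ hx hy => rw [h.add, h'.add, hx, hy]
  | mul x y _ _ hx hy => rw [h.mul, h'.mul, hx, hy]

end StarExists

/-! ### The Fourier transform and the matrix units -/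

section Fourier

variable {G : Type u} [Ring G] [HopfAlgebra ℂ G] [StarRing G] [StarModule ℂ G]
  [FiniteDimensional ℂ G] [IsSemisimpleRing G]
  {ι : Type v} [Fintype ι] [DecidableEq ι] (H : RibbonHopfStar G) (D : IrrepSystem G ι)

theorem comul_cvL_antipode : cvL (Coalgebra.comul : G →ₗ[ℂ] G ⊗[ℂ] G)
    ((ir G).toLinearMap ∘ₗ HopfAlgebra.antipode ℂ) = (il G).toLinearMap := by
  rw [comul_eq_cvL, cvL_assoc, cvL_antipode_right]
  exact cvL_eps _

theorem IrrepSystem.comul_haar_mul (x : G) :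
    Coalgebra.comul (R := ℂ) D.haar * (x ⊗ₜ 1) =
      Coalgebra.comul (R := ℂ) D.haar * (1 ⊗ₜ HopfAlgebra.antipode ℂ x) := by
  have h := LinearMap.congr_fun (comul_cvL_antipode (G := G)) x
  have h1 : Coalgebra.comul (R := ℂ) D.haar * (x ⊗ₜ 1) =
      cvL (LinearMap.mulLeft ℂ (Coalgebra.comul (R := ℂ) D.haar) ∘ₗ Coalgebra.comul)
        ((ir G).toLinearMap ∘ₗ HopfAlgebra.antipode ℂ) x := by
    rw [cvL_mul_left, h]; rfl
  have h2 : (LinearMap.mulLeft ℂ (Coalgebra.comul (R := ℂ) D.haar) ∘ₗ Coalgebra.comul :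
      G →ₗ[ℂ] G ⊗[ℂ] G) =
      LinearMap.mulLeft ℂ (Coalgebra.comul (R := ℂ) D.haar) ∘ₗ epsL (G ⊗[ℂ] G) := by
    ext y
    change Coalgebra.comul (R := ℂ) D.haar * Coalgebra.comul (R := ℂ) y =
      Coalgebra.comul (R := ℂ) D.haar * epsL (G ⊗[ℂ] G) y
    rw [← Bialgebra.comul_mul, D.haar_mul, map_smul, epsL_apply, ← Algebra.commutes,
      Algebra.smul_def]
  rw [h1, h2, cvL_mul_left, eps_cvL]
  rfl

theorem four_rreg (x : G) (f : Module.Dual ℂ G) : four H D (rreg G x f) = x * four H D f := by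
  rw [four_apply, four_apply]
  have h := ct_mul_right' f (Coalgebra.comul (R := ℂ) D.haar) x 1
  rw [mul_one] at h
  change H.sinv (ct (f ∘ₗ LinearMap.mulRight ℂ x) _) = _
  rw [← h, D.comul_haar_mul, ct_mul_right, H.sinv_mul, H.sinv_antipode]

theorem four_lreg (x : G) (f : Module.Dual ℂ G) :
    four H D (lreg G x f) = four H D f * H.sinv x := by
  rw [four_apply, four_apply]
  change H.sinv (ct (f ∘ₗ LinearMap.mulLeft ℂ (HopfAlgebra.antipode ℂ x)) _) = _
  rw [← ct_left_mul, ← D.mul_comul_haar, ct_mul_left, H.sinv_mul]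

/-- The Fourier transform, multiplied with the grouplike element. -/
def fourG : Module.Dual ℂ G →ₗ[ℂ] G := LinearMap.mulRight ℂ H.g ∘ₗ four H D

theorem fourG_apply (f : Module.Dual ℂ G) : fourG H D f = four H D f * H.g := rfl

/-- The Fourier transform alone is only equivariant up to `S⁻²` on the right. The factor `g` removes
this twist, since it implements the square of the antipode. -/
theorem fourG_mul (x y : G) (f : Module.Dual ℂ G) :
    fourG H D (f ∘ₗ LinearMap.mulLeft ℂ y ∘ₗ LinearMap.mulRight ℂ x) = x * fourG H D f * y := by
  have e : f ∘ₗ LinearMap.mulLeft ℂ y ∘ₗ LinearMap.mulRight ℂ x =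
      rreg G x (lreg G (H.sinv y) f) := by
    ext z
    simp
  rw [e, fourG_apply, four_rreg, four_lreg, fourG_apply]
  have h := RibbonHopfStar.g_mul_antipode_sq (H := H) (H.sinv (H.sinv y))
  rw [H.antipode_sinv, H.antipode_sinv] at h
  simp only [mul_assoc, h]

theorem tau_single_mul {m : ℕ} (A : Matrix (Fin m) (Fin m) ℂ) (a b c d : Fin m) :
    Matrix.single a b 1 * A * Matrix.single c d 1 = A b c • Matrix.single a d (1 : ℂ) := by
  rw [Matrix.single_mul_mul_single]
  simp

theorem e_mul_mul_e (x : G) (I : ι) (a b p q : D.V I) :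
    D.e I a b * x * D.e I p q = D.τ I x b p • D.e I a q := by
  refine D.tau_ext fun J => ?_
  by_cases h : J = I
  · subst h
    simp only [map_mul, map_smul, D.tau_e_same, tau_single_mul]
  · simp [D.tau_e_ne h]

/-- Schur's lemma in matrix form: the transform, multiplied on both sides by matrix units, is
computed once inside `G` and once by equivariance. It follows that matrix coefficients go to
multiples of matrix units, with one constant `fc` for each representation. -/
theorem fourG_coef_smul (f : Module.Dual ℂ G) (I : ι) (a b p q : D.V I) :
    D.τ I (fourG H D f) b p • D.e I a q = f (D.e I p b) • fourG H D (D.coef I q a) := by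
  rw [← e_mul_mul_e, ← fourG_mul, ← map_smul]
  congr 1
  ext z
  simp only [LinearMap.comp_apply, LinearMap.mulRight_apply, LinearMap.mulLeft_apply,
    ← mul_assoc, e_mul_mul_e, map_smul, LinearMap.smul_apply, smul_eq_mul]
  rw [mul_comm]
  rfl

/-- The first index. -/
def IrrepSystem.idx (I : ι) : D.V I := ⟨0, D.n_pos I⟩

/-- The coefficient of the Fourier transform in the representation `τ^I`. -/
def fc (I : ι) : ℂ :=
  D.τ I (fourG H D (D.coef I (D.idx I) (D.idx I))) (D.idx I) (D.idx I)

theorem coef_e (I : ι) (a b p q : D.V I) :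
    D.coef I a b (D.e I p q) = if p = a ∧ q = b then 1 else 0 := by
  change D.τ I (D.e I p q) a b = _
  rw [D.tau_e_same, Matrix.single_apply]

theorem fourG_coef (I : ι) (p q : D.V I) :
    fourG H D (D.coef I p q) = fc H D I • D.e I q p := by
  have h := fourG_coef_smul H D (D.coef I (D.idx I) (D.idx I)) I q (D.idx I) (D.idx I) p
  rw [coef_e, if_pos ⟨rfl, rfl⟩, one_smul] at h
  exact h.symm

theorem tau_fourG (f : Module.Dual ℂ G) (I : ι) (b p : D.V I) :
    D.τ I (fourG H D f) b p = fc H D I * f (D.e I p b) := by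
  have h := fourG_coef_smul H D f I (D.idx I) b p (D.idx I)
  rw [fourG_coef, smul_smul] at h
  have h2 := congrArg (fun t => D.τ I t (D.idx I) (D.idx I)) h
  simpa [D.tau_e_same, mul_comm] using h2

/-- The inverse antipode applied to `∑ S(h₁)h₂ = 1`. It fixes the constants `fc` in `fc_mul_trace`.
-/
theorem sum_four_mul_e : ∑ I, ∑ a, ∑ b, four H D (D.coef I a b) * D.e I a b = 1 := by
  have h := congrArg H.sinv (LinearMap.congr_fun (cvL_antipode_left (AlgHom.id ℂ G)) D.haar)
  rw [cvL_eq, ← D.sum_e_ct (Coalgebra.comul (R := ℂ) D.haar), epsL_apply, D.counit_haar, map_one,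
    H.sinv_one] at h
  simpa [H.sinv_mul, H.sinv_antipode, four_apply] using h

theorem fc_mul_trace (I : ι) : fc H D I * (D.τ I ((H.gU⁻¹ : Gˣ) : G)).trace = 1 := by
  have h := congrArg (fun t => D.τ I t (D.idx I) (D.idx I)) (sum_four_mul_e H D)
  have e1 : ∀ f, four H D f = fourG H D f * ((H.gU⁻¹ : Gˣ) : G) := fun f => by
    rw [fourG_apply, ← RibbonHopfStar.gU_val, Units.mul_inv_cancel_right]
  simp only [map_sum, Matrix.sum_apply, map_mul, map_one, Matrix.one_apply_eq] at h
  rw [Finset.sum_eq_single I (fun J _ hJ => by simp [D.tau_e_ne (Ne.symm hJ)]) (by simp)] at h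
  rw [← h, Matrix.trace, Finset.mul_sum]
  refine Finset.sum_congr rfl fun a _ => ?_
  rw [Finset.sum_eq_single (D.idx I) (fun b _ hb => by
    rw [D.tau_e_same, Matrix.mul_single_apply_of_ne _ _ _ _ _ (Ne.symm hb)]) (by simp)]
  rw [D.tau_e_same, Matrix.mul_single_apply_same, mul_one, e1, fourG_coef, map_mul, map_smul,
    D.tau_e_same, Matrix.smul_mul, Matrix.smul_apply, Matrix.single_mul_apply_same, one_mul,
    Matrix.diag_apply, smul_eq_mul]

theorem trace_g_inv (I : ι) : (D.τ I ((H.gU⁻¹ : Gˣ) : G)).trace = conj (qdim H D I) := by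
  rw [← RibbonHopfStar.star_g, map_star, qdim]
  exact Matrix.trace_conjTranspose _

end Fourier

/-! ### Explicit vacuum expectation values of the adjoint of `A`. -/

section Pairing

variable {G : Type u} [Ring G] [HopfAlgebra ℂ G] [StarRing G] [StarModule ℂ G]
  [FiniteDimensional ℂ G] [IsSemisimpleRing G]
  {ι : Type v} [Fintype ι] [DecidableEq ι] (H : RibbonHopfStar G) (D : IrrepSystem G ι)

/-- `x ⊗ y ↦ y m x`. -/
def sw (m : G) : G ⊗[ℂ] G →ₗ[ℂ] G :=
  LinearMap.mul' ℂ G ∘ₗ TensorProduct.map (LinearMap.mulRight ℂ m) LinearMap.id ∘ₗ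
    (TensorProduct.comm ℂ G G).toLinearMap

@[simp] theorem sw_tmul (m x y : G) : sw m (x ⊗ₜ y) = y * m * x := rfl

theorem phi_MrI_lreg (g f : Module.Dual ℂ G) (z : G ⊗[ℂ] G) :
    ct g (MrI H * leg (inl G (DEnd G)) ((inr G (DEnd G)).comp (lreg G)) z) f D.haar =
      g (four H D f * LinearMap.mul' ℂ G (TensorProduct.map H.sinv LinearMap.id (swap G z))) := by
  induction z with
  | zero => simp
  | add x y hx hy => simp only [map_add, mul_add, LinearMap.add_apply, hx, hy]
  | tmul x y =>
    have e : leg (inl G (DEnd G)) ((inr G (DEnd G)).comp (lreg G)) (x ⊗ₜ y) = x ⊗ₜ lreg G y := by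
      simp
    rw [e, ct_mul_right', Module.End.mul_apply, phi_ct_MrI, four_lreg]
    simp [mul_assoc]

theorem phi_MrI_lreg_rreg (g f : Module.Dual ℂ G) (w : G ⊗[ℂ] G) :
    ct g (MrI H * H.ri (inl G (DEnd G)) ((inr G (DEnd G)).comp (lreg G)) *
      leg (inl G (DEnd G)) ((inr G (DEnd G)).comp (rreg G)) w) f D.haar =
        g (sw (four H D f * ((H.uU⁻¹ : Gˣ) : G)) w) := by
  induction w with
  | zero => simp
  | add x y hx hy => simp only [map_add, mul_add, LinearMap.add_apply, hx, hy]
  | tmul x y =>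
    have e : leg (inl G (DEnd G)) ((inr G (DEnd G)).comp (rreg G)) (x ⊗ₜ y) = x ⊗ₜ rreg G y := by
      simp
    rw [e, ct_mul_right', Module.End.mul_apply, RibbonHopfStar.ri, phi_MrI_lreg,
      RibbonHopfStar.sum_sinv_R_inv, four_rreg]
    simp [mul_assoc]

theorem sw_R_inv (m : G) : sw (m * ((H.uU⁻¹ : Gˣ) : G)) ((H.R⁻¹ : (G ⊗[ℂ] G)ˣ) : G ⊗[ℂ] G) * H.u =
    sw m (TensorProduct.map H.sinv LinearMap.id (H.R : G ⊗[ℂ] G)) := by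
  rw [← RibbonHopfStar.map_antipode_id_R]
  induction (H.R : G ⊗[ℂ] G) with
  | zero => simp
  | add x y hx hy => simp only [map_add, add_mul, hx, hy]
  | tmul x y =>
    rw [TensorProduct.map_tmul, TensorProduct.map_tmul, sw_tmul, sw_tmul, H.sinv_apply,
      RibbonHopfStar.uU_val]
    simp only [mul_assoc, LinearMap.id_apply]

theorem four_leg (z : G ⊗[ℂ] G) (f : Module.Dual ℂ G) :
    four H D (leg (lreg G) (rreg G) z f) =
      sw (four H D f) (TensorProduct.map H.sinv LinearMap.id z) := by
  induction z with
  | zero => simp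
  | add x y hx hy => simp only [map_add, LinearMap.add_apply, hx, hy]
  | tmul x y =>
    rw [leg_tmul, (cm_lreg_rreg x y).eq, Module.End.mul_apply, four_rreg, four_lreg]
    simp [mul_assoc]

/-- The hexagon identity splits `R⁻¹` into a part acting by left translations, which sums to `u⁻¹`,
and a part acting by right translations. Moved through `u⁻¹`, the latter becomes `R` acting on the
functional before the Fourier transform. -/
theorem phi_MrI_had (g f : Module.Dual ℂ G) :
    ct g (MrI H * H.ri (inl G (DEnd G)) ((inr G (DEnd G)).comp (had G))) f D.haar =
      g (four H D (H.rm (lreg G) (rreg G) f) * ((H.uU⁻¹ : Gˣ) : G)) := by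
  have e : (inr G (DEnd G)).comp (had G) = cv ((inr G (DEnd G)).comp (lreg G))
      ((inr G (DEnd G)).comp (rreg G)) (cm_lreg_rreg.map _) := comp_cv _ _ _ _
  rw [e, RibbonHopfStar.ri_hexR (cm_lreg_rreg.map _) (cm_inl_inr _), ← mul_assoc]
  refine (phi_MrI_lreg_rreg H D g f ((H.R⁻¹ : (G ⊗[ℂ] G)ˣ) : G ⊗[ℂ] G)).trans ?_
  rw [RibbonHopfStar.rm, four_leg, ← sw_R_inv, ← RibbonHopfStar.uU_val, Units.mul_inv_cancel_right]

variable {H D} (c : ClebschGordan H D)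

variable (H) in
/-- The solution `A` in the model, as a unit. -/
def MAU : (G ⊗[ℂ] DEnd G)ˣ := ⟨MA H, MAI H, MA_mul_MAI H, MAI_mul_MA H⟩

theorem counit_κel_inv : Coalgebra.counit (R := ℂ) ((c.κel⁻¹ : Gˣ) : G) = 1 := by
  rw [D.counit_eq, c.τ_κel_inv, c.κ_zero]
  simp

/-- Evaluation at the Haar integral is invariant under the adjoint action, so the left factors `κ⁻¹`
and `R` of the adjoint drop out. -/
theorem phi_adj_left (U : (G ⊗[ℂ] DEnd G)ˣ) (g f : Module.Dual ℂ G) :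
    ct g (adj H c.κel (had G) U : G ⊗[ℂ] DEnd G) f D.haar =
      ct g (((U⁻¹ : (G ⊗[ℂ] DEnd G)ˣ) : G ⊗[ℂ] DEnd G) *
        H.ri (inl G (DEnd G)) ((inr G (DEnd G)).comp (had G))) (had G c.κel f) D.haar := by
  have e : (adj H c.κel (had G) U : G ⊗[ℂ] DEnd G) =
      (1 ⊗ₜ had G ((c.κel⁻¹ : Gˣ) : G)) * ((H.rm (inl G (DEnd G)) ((inr G (DEnd G)).comp (had G)) *
        (((U⁻¹ : (G ⊗[ℂ] DEnd G)ˣ) : G ⊗[ℂ] DEnd G) *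
          H.ri (inl G (DEnd G)) ((inr G (DEnd G)).comp (had G)))) * (1 ⊗ₜ had G c.κel)) := by
    simp only [adj, Units.val_mul, mul_assoc]
    rfl
  rw [e, ct_mul_left, Module.End.mul_apply, phi_had, counit_κel_inv, one_mul, ct_mul_right,
    Module.End.mul_apply]
  have h := map_ct (evAt (had G c.κel f) D.haar) g
    (H.rm (inl G (DEnd G)) ((inr G (DEnd G)).comp (had G)) *
        (((U⁻¹ : (G ⊗[ℂ] DEnd G)ˣ) : G ⊗[ℂ] DEnd G) *
          H.ri (inl G (DEnd G)) ((inr G (DEnd G)).comp (had G))))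
  rw [absorb_rm_left H _ _ fun T y => phi_had D y (T (had G c.κel f)), ← map_ct] at h
  exact h

theorem sinv_κ_central (x : G) : H.sinv c.κel * x = x * H.sinv c.κel := by
  rw [← H.sinv_antipode x, ← H.sinv_mul, ← H.sinv_mul, c.κel_central]

theorem leg_Om (f : Module.Dual ℂ G) : H.rm (lreg G) (rreg G) (had G c.κel f) =
    lreg G c.κel (rreg G c.κel (leg (lreg G) (rreg G) c.Om f)) := by
  have e2 := congrArg (leg (lreg G) (rreg G)) c.Om_eq
  rw [← c.κκ_central, cm_lreg_rreg.leg_mul, cm_lreg_rreg.leg_mul, leg_tmul] at e2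
  have e3 := LinearMap.congr_fun e2.symm f
  rw [had, cv_apply]
  exact e3

/-- With `u⁻¹ = gκ⁻²` and `leg_Om`, the R-matrix and the remaining powers of `κ` combine to the
positive element `Ω` and the central factor `S(κ)κ⁻¹`. This is the explicit form of the scalar
product. -/
theorem phi_adj_MA (g f : Module.Dual ℂ G) :
    ct g (adj H c.κel (had G) (MAU H) : G ⊗[ℂ] DEnd G) f D.haar =
      g (fourG H D (leg (lreg G) (rreg G) c.Om f) *
        (H.sinv c.κel * ((c.κel⁻¹ : Gˣ) : G))) := by
  rw [phi_adj_left]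
  change ct g (MAI H * H.ri (inl G (DEnd G)) ((inr G (DEnd G)).comp (had G)))
    (had G c.κel f) D.haar = _
  have h := map_ct (evAt (had G c.κel f) D.haar) g
    (MAI H * H.ri (inl G (DEnd G)) ((inr G (DEnd G)).comp (had G)))
  rw [MAI, mul_assoc, absorb_ri_left H _ _ fun T y => phi_lreg D y (T (had G c.κel f)), mul_assoc,
    absorb_rm_left' H _ _ fun T y => phi_rreg D y (T (had G c.κel f)), ← map_ct] at h
  rw [MAI, mul_assoc, mul_assoc]
  refine h.trans ?_
  rw [evAt_apply, phi_MrI_had]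
  congr 1
  rw [leg_Om, four_lreg, four_rreg, fourG_apply]
  have e4 : ((H.uU⁻¹ : Gˣ) : G) = H.g * (((c.κel⁻¹ : Gˣ) : G) * ((c.κel⁻¹ : Gˣ) : G)) := by
    have e5 : H.ribbon = c.κel * c.κel := Units.ext (by rw [← c.κel_sq]; rfl)
    rw [RibbonHopfStar.g_eq, e5, Units.val_mul]
    simp [mul_assoc]
  rw [e4, mul_assoc _ (H.sinv _), sinv_κ_central, c.κel_central]
  have e6 := sinv_κ_central c
  generalize H.sinv c.κel = s at *
  have e7 : ∀ x : G, ((c.κel⁻¹ : Gˣ) : G) * x = x * ((c.κel⁻¹ : Gˣ) : G) := fun x =>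
    (Commute.units_inv_left (c.κel_central x)).eq
  simp only [mul_assoc]
  rw [← mul_assoc (c.κel : G), c.κel_central]
  simp only [mul_assoc]
  rw [e6]
  simp

end Pairing

/-! ### The scalar product on the functionals -/

section Form

variable {G : Type u} [Ring G] [HopfAlgebra ℂ G] [StarRing G] [StarModule ℂ G]
  [FiniteDimensional ℂ G] [IsSemisimpleRing G]
  {ι : Type v} [Fintype ι] [DecidableEq ι] {H : RibbonHopfStar G} {D : IrrepSystem G ι}

open scoped ComplexOrder

variable (D) in
/-- The values of a functional on the matrix units. -/
def mat (I : ι) : Module.Dual ℂ G →ₗ[ℂ] Matrix (D.V I) (D.V I) ℂ where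
  toFun f := Matrix.of fun a b => f (D.e I a b)
  map_add' _ _ := rfl
  map_smul' _ _ := rfl

@[simp] theorem mat_apply (I : ι) (f : Module.Dual ℂ G) (a b : D.V I) :
    mat D I f a b = f (D.e I a b) := rfl

theorem mat_lreg (I : ι) (y : G) (f : Module.Dual ℂ G) :
    mat D I (lreg G y f) = (D.τ I (HopfAlgebra.antipode ℂ y)).transpose * mat D I f := by
  ext a b
  simp [Matrix.mul_apply, D.mul_e]

theorem mat_rreg (I : ι) (y : G) (f : Module.Dual ℂ G) :
    mat D I (rreg G y f) = mat D I f * (D.τ I y).transpose := by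
  ext a b
  simp [Matrix.mul_apply, D.e_mul, mul_comm]

theorem mat_ext {f g : Module.Dual ℂ G} (h : ∀ I, mat D I f = mat D I g) : f = g := by
  rw [D.functional_eq_sum f, D.functional_eq_sum g]
  refine Finset.sum_congr rfl fun I _ => Finset.sum_congr rfl fun a _ =>
    Finset.sum_congr rfl fun b _ => ?_
  have := congrFun (congrFun (h I) a) b
  rw [mat_apply, mat_apply] at this
  rw [this]

variable (D) in
/-- The component `I` of the scalar product. -/
def frm (I : ι) (f g : Module.Dual ℂ G) : ℂ := ((mat D I f).conjTranspose * mat D I g).trace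

/-- In matrix form the translations are left and right multiplications by transposed values of
*-representations, and the antipode commutes with `*`. The adjoint for the trace form is therefore
given by the factorwise `*`. -/
theorem frm_leg (I : ι) (z : G ⊗[ℂ] G) (f g : Module.Dual ℂ G) (H : RibbonHopfStar G) :
    frm D I (leg (lreg G) (rreg G) z f) g = frm D I f (leg (lreg G) (rreg G) (star z) g) := by
  have ht : ∀ x, (D.τ I (star x)).transpose = (D.τ I x).transpose.conjTranspose := fun x => by
    rw [map_star]; rfl
  unfold frm
  induction z with
  | zero => simp
  | add x y hx hy =>
    simp only [map_add, star_add, LinearMap.add_apply, Matrix.conjTranspose_add, Matrix.add_mul,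
      Matrix.mul_add, Matrix.trace_add, hx, hy]
  | tmul x y =>
    rw [TensorProduct.star_tmul, leg_tmul, leg_tmul, Module.End.mul_apply, Module.End.mul_apply,
      mat_lreg, mat_rreg, mat_lreg, mat_rreg, H.antipode_star, ht, ht, Matrix.conjTranspose_mul,
      Matrix.conjTranspose_mul, Matrix.mul_assoc, Matrix.mul_assoc, Matrix.trace_mul_comm]
    simp only [Matrix.mul_assoc]

theorem frm_self_nonneg (I : ι) (f : Module.Dual ℂ G) : 0 ≤ frm D I f f :=
  (Matrix.posSemidef_conjTranspose_mul_self _).trace_nonneg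

theorem mat_eq_zero (I : ι) (f : Module.Dual ℂ G) (h : frm D I f f = 0) : mat D I f = 0 :=
  Matrix.trace_conjTranspose_mul_self_eq_zero_iff.mp h

theorem conj_frm (I : ι) (f g : Module.Dual ℂ G) : conj (frm D I f g) = frm D I g f := by
  rw [frm, frm, ← Complex.star_def, ← Matrix.trace_conjTranspose, Matrix.conjTranspose_mul,
    Matrix.conjTranspose_conjTranspose]

variable (c : ClebschGordan H D)

theorem antipode_κ_central (x : G) : HopfAlgebra.antipode ℂ (c.κel : G) * x =
    x * HopfAlgebra.antipode ℂ (c.κel : G) := by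
  rw [← H.antipode_sinv x, ← HopfAlgebra.antipode_mul_antidistrib, ← HopfAlgebra.antipode_mul_antidistrib,
    c.κel_central]

theorem sinv_κ : H.sinv (c.κel : G) = HopfAlgebra.antipode ℂ (c.κel : G) := by
  rw [H.sinv_apply, antipode_κ_central, Units.inv_mul_cancel_left]

/-- The value of `S(κ) κ⁻¹` in the representation `τ^I`. -/
theorem exists_twist (I : ι) : ∃ s : ℂ, s ≠ 0 ∧
    D.τ I (H.sinv c.κel * ((c.κel⁻¹ : Gˣ) : G)) = s • 1 ∧
    D.τ I (HopfAlgebra.antipode ℂ ((c.κel⁻¹ : Gˣ) : G)) = (s⁻¹ * (c.κ I)⁻¹) • 1 := by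
  obtain ⟨s, hs⟩ := exists_scalar_of_central (D := D)
    (fun x => (antipode_κ_central c x).symm) I
  have : Nonempty (D.V I) := ⟨D.idx I⟩
  have e : D.τ I (HopfAlgebra.antipode ℂ ((c.κel⁻¹ : Gˣ) : G)) * D.τ I (HopfAlgebra.antipode ℂ (c.κel : G)) = 1 := by
    rw [← map_mul, ← HopfAlgebra.antipode_mul_antidistrib, Units.mul_inv, HopfAlgebra.antipode_one,
      map_one]
  rw [hs, mul_smul_comm, mul_one] at e
  have hs0 : s ≠ 0 := by
    rintro rfl
    rw [zero_smul] at e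
    exact zero_ne_one e
  refine ⟨s * (c.κ I)⁻¹, mul_ne_zero hs0 (inv_ne_zero (c.κ_ne_zero I)), ?_, ?_⟩
  · rw [map_mul, sinv_κ, hs, c.τ_κel_inv, smul_mul_smul_comm, mul_one]
  · rw [mul_inv, inv_inv, mul_assoc, mul_inv_cancel₀ (c.κ_ne_zero I), mul_one, ← e, smul_smul,
      inv_mul_cancel₀ hs0, one_smul]

/-- The scalar by which `S(κ) κ⁻¹` acts in the representation `τ^I`. -/
def tw (I : ι) : ℂ := (exists_twist c I).choose

theorem tw_ne_zero (I : ι) : tw c I ≠ 0 := (exists_twist c I).choose_spec.1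

theorem τ_tw (I : ι) : D.τ I (H.sinv c.κel * ((c.κel⁻¹ : Gˣ) : G)) = tw c I • 1 :=
  (exists_twist c I).choose_spec.2.1

theorem τ_antipode_κ_inv (I : ι) : D.τ I (HopfAlgebra.antipode ℂ ((c.κel⁻¹ : Gˣ) : G)) =
    ((tw c I)⁻¹ * (c.κ I)⁻¹) • 1 := (exists_twist c I).choose_spec.2.2

/-- The scalar product. -/
def sform (f g : Module.Dual ℂ G) : ℂ :=
  starF f (fourG H D (leg (lreg G) (rreg G) c.Om g) * (H.sinv c.κel * ((c.κel⁻¹ : Gˣ) : G)))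

theorem sform_eq_sum (f g : Module.Dual ℂ G) : sform c f g =
    ∑ I, (tw c I * fc H D I) * frm D I f (leg (lreg G) (rreg G) c.Om g) := by
  rw [sform]
  conv_lhs => rw [← D.sum_tau_e (fourG H D (leg (lreg G) (rreg G) c.Om g) *
    (H.sinv c.κel * ((c.κel⁻¹ : Gˣ) : G)))]
  rw [map_sum]
  refine Finset.sum_congr rfl fun I _ => ?_
  rw [map_mul, τ_tw, Matrix.mul_smul, mul_one, frm, Matrix.trace, Finset.mul_sum, map_sum]
  refine Finset.sum_congr rfl fun a _ => ?_
  rw [map_sum, Matrix.diag_apply, Matrix.mul_apply, Finset.mul_sum]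
  refine Finset.sum_congr rfl fun b _ => ?_
  rw [map_smul, starF_apply, D.star_e, Matrix.smul_apply, tau_fourG, Matrix.conjTranspose_apply,
    mat_apply, mat_apply, Complex.star_def, smul_eq_mul, smul_eq_mul]
  ring

theorem had_trq (I : ι) (x : G) :
    had G x (trq H D I) = Coalgebra.counit (R := ℂ) x • trq H D I := by
  ext y
  refine Eq.trans ?_ (trq_ad H D I x y)
  rw [had, cv_apply, cvL_eq]
  induction Coalgebra.comul (R := ℂ) x with
  | zero => simp
  | add x y hx hy => simp only [map_add, LinearMap.add_apply, hx, hy]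
  | tmul p q => simp [mul_assoc]

/-- The trace of the representation `τ^I`. -/
def trI (D : IrrepSystem G ι) (I : ι) : Module.Dual ℂ G :=
  Matrix.traceLinearMap (D.V I) ℂ ℂ ∘ₗ (D.τ I).toAlgHom.toLinearMap

theorem trI_apply (I : ι) (x : G) : trI D I x = (D.τ I x).trace := rfl

/-- Cyclicity gathers the R-matrix to `∑ r₂ g S(r₁)`, which is the ribbon element. -/
theorem rm_trq (I : ι) : H.rm (lreg G) (rreg G) (trq H D I) = (c.κ I) ^ 2 • trI D I := by
  ext y
  have h : ∀ z : G ⊗[ℂ] G, leg (lreg G) (rreg G) z (trq H D I) y =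
      (D.τ I (y * LinearMap.mul' ℂ G (TensorProduct.map (LinearMap.mulRight ℂ H.g)
        (HopfAlgebra.antipode ℂ) (swap G z)))).trace := fun z => by
    induction z with
    | zero => simp
    | add x y hx hy => simp only [map_add, LinearMap.add_apply, mul_add, Matrix.trace_add, hx, hy]
    | tmul p q =>
      rw [leg_tmul, Module.End.mul_apply, lreg_apply, rreg_apply, trq_apply]
      simp only [Algebra.TensorProduct.comm_tmul, TensorProduct.map_tmul, LinearMap.mul'_apply,
        LinearMap.mulRight_apply, mul_assoc]
      rw [map_mul, Matrix.trace_mul_comm, ← map_mul]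
      simp only [mul_assoc]
  rw [RibbonHopfStar.rm, h, H.sum_g_R, map_mul, c.κ_sq, mul_smul_comm, mul_one, Matrix.trace_smul]
  rfl

/-- Quantum traces are invariant under the adjoint action and `κ_0 = 1`, so `leg_Om` can be solved
for the action of `Ω`; `rm_trq` supplies the value of the R-matrix. -/
theorem Om_trq (I : ι) : leg (lreg G) (rreg G) c.Om (trq H D I) = (tw c I)⁻¹ • trI D I := by
  have h := congrArg (fun f => lreg G ((c.κel⁻¹ : Gˣ) : G) (rreg G ((c.κel⁻¹ : Gˣ) : G) f))
    (leg_Om c (trq H D I))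
  have e : ∀ f, lreg G ((c.κel⁻¹ : Gˣ) : G) (rreg G ((c.κel⁻¹ : Gˣ) : G)
      (lreg G c.κel (rreg G c.κel f))) = f := fun f => by
    rw [← Module.End.mul_apply (rreg G _) (lreg G _), ← (cm_lreg_rreg _ _).eq, Module.End.mul_apply,
      ← Module.End.mul_apply (lreg G _), ← map_mul, ← Module.End.mul_apply (rreg G _), ← map_mul,
      Units.inv_mul, map_one, map_one]
    rfl
  rw [e, had_trq, D.counit_eq, c.τ_κel, c.κ_zero] at h
  rw [← h]
  simp only [one_smul, Matrix.smul_apply, Matrix.one_apply_eq, smul_eq_mul, mul_one, rm_trq c,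
    map_smul]
  ext y
  simp only [LinearMap.smul_apply, lreg_apply, rreg_apply, trI_apply, map_mul, τ_antipode_κ_inv,
    c.τ_κel_inv, Matrix.smul_mul, Matrix.mul_smul, one_mul, mul_one, Matrix.trace_smul, smul_eq_mul]
  field_simp [c.κ_ne_zero I]

theorem frm_trq (I : ι) : frm D I (trq H D I) (trI D I) = conj (qdim H D I) := by
  have e : mat D I (trI D I) = 1 := by
    ext a b
    rw [mat_apply, trI_apply, D.tau_e_same, Matrix.one_apply]
    by_cases h : a = b
    · subst h; simp
    · simp [h, Matrix.trace_single_eq_of_ne]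
  rw [frm, e, mul_one, ← Complex.star_def, Matrix.trace_conjTranspose]
  congr 1
  simp only [Matrix.trace, qdim, Matrix.diag_apply, mat_apply, trq_apply, map_mul, D.tau_e_same]
  refine Finset.sum_congr rfl fun a _ => ?_
  rw [Finset.sum_eq_single a (fun b _ hb => Matrix.single_mul_apply_of_ne _ _ _ _ _ hb _) (by simp)]
  simp

/-- For `Ω = Y*Y` the trace form of `Y` applied to the quantum trace is nonnegative. By `Om_trq` it
equals the conjugate of `d_I` divided by `tw`, which is the inverse of the weight because `fc` is
the inverse of that conjugate. -/
theorem weight_pos (I : ι) : 0 < tw c I * fc H D I := by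
  obtain ⟨Y, hY⟩ := c.exists_Om_sqrt
  have h1 : fc H D I * conj (qdim H D I) = 1 := by rw [← trace_g_inv, fc_mul_trace]
  have h2 : frm D I (leg (lreg G) (rreg G) Y (trq H D I)) (leg (lreg G) (rreg G) Y (trq H D I)) =
      (tw c I * fc H D I)⁻¹ := by
    rw [frm_leg _ _ _ _ H, ← Module.End.mul_apply, ← cm_lreg_rreg.leg_mul, ← hY, Om_trq, frm,
      map_smul, Matrix.mul_smul, Matrix.trace_smul, ← frm, frm_trq, mul_inv,
      eq_inv_of_mul_eq_one_right h1, smul_eq_mul]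
  have h3 := frm_self_nonneg (D := D) I (leg (lreg G) (rreg G) Y (trq H D I))
  rw [h2] at h3
  have h4 : (tw c I * fc H D I)⁻¹ ≠ 0 :=
    inv_ne_zero (mul_ne_zero (tw_ne_zero c I) (left_ne_zero_of_mul_eq_one h1))
  exact inv_pos.mp (lt_of_le_of_ne h3 h4.symm)

theorem conj_sform (f g : Module.Dual ℂ G) : conj (sform c f g) = sform c g f := by
  obtain ⟨Y, hY⟩ := c.exists_Om_sqrt
  have e : star c.Om = c.Om := by rw [hY, star_mul, star_star]
  simp only [sform_eq_sum, map_sum]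
  refine Finset.sum_congr rfl fun I _ => ?_
  rw [map_mul, conj_frm, frm_leg _ _ _ _ H, e]
  congr 1
  -- The weight is real, being positive.
  exact Complex.conj_eq_iff_im.mpr (Complex.nonneg_iff.mp (weight_pos c I).le).2.symm

theorem sform_self_nonneg (f : Module.Dual ℂ G) : 0 ≤ sform c f f := by
  obtain ⟨Y, hY⟩ := c.exists_Om_sqrt
  rw [sform_eq_sum]
  refine Finset.sum_nonneg fun I _ => mul_nonneg (weight_pos c I).le ?_
  rw [hY, cm_lreg_rreg.leg_mul, Module.End.mul_apply, ← frm_leg _ _ _ _ H]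
  exact frm_self_nonneg I _

/-- Up to invertible translations by `κ`, the action of `Ω` is the composition of the adjoint action
of `κ` and the action of `R`, both of which have inverses. -/
theorem leg_Om_injective : Function.Injective (leg (lreg G) (rreg G) c.Om) := fun f g h => by
  have h1 := leg_Om c f
  rw [h, ← leg_Om] at h1
  have h2 := congrArg (fun f => had G ((c.κel⁻¹ : Gˣ) : G) (H.ri (lreg G) (rreg G) f)) h1
  have e1 : ∀ f, H.ri (lreg G) (rreg G) (H.rm (lreg G) (rreg G) f) = f := fun f => by
    rw [← Module.End.mul_apply, RibbonHopfStar.ri_mul_rm cm_lreg_rreg]; rfl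
  have e2 : ∀ f, had G ((c.κel⁻¹ : Gˣ) : G) (had G (c.κel : G) f) = f := fun f => by
    rw [← Module.End.mul_apply, ← map_mul, Units.inv_mul, map_one]; rfl
  simpa only [e1, e2] using h2

theorem eq_zero_of_sform (f : Module.Dual ℂ G) (h : sform c f f = 0) : f = 0 := by
  obtain ⟨Y, hY⟩ := c.exists_Om_sqrt
  have hf : ∀ I, frm D I f (leg (lreg G) (rreg G) c.Om f) =
      frm D I (leg (lreg G) (rreg G) Y f) (leg (lreg G) (rreg G) Y f) := fun I => by
    rw [hY, cm_lreg_rreg.leg_mul, Module.End.mul_apply, ← frm_leg _ _ _ _ H]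
  rw [sform_eq_sum] at h
  simp only [hf] at h
  rw [Finset.sum_eq_zero_iff_of_nonneg fun I _ =>
    mul_nonneg (weight_pos c I).le (frm_self_nonneg I _)] at h
  have h0 : leg (lreg G) (rreg G) Y f = 0 := mat_ext (D := D) fun I => by
    rw [map_zero]
    exact mat_eq_zero I _ ((mul_eq_zero.mp (h I (Finset.mem_univ I))).resolve_left
      (weight_pos c I).ne')
  refine leg_Om_injective c ?_
  rw [map_zero, hY, cm_lreg_rreg.leg_mul, Module.End.mul_apply, h0, map_zero]

end Form

/-! ### The representation of the semi-direct product is a *-representation -/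

section Adjoint

variable {G : Type u} [Ring G] [HopfAlgebra ℂ G] [StarRing G] [StarModule ℂ G]
  {X Y : Type*} [Ring X] [Algebra ℂ X] [Ring Y] [Algebra ℂ Y]

theorem umap_adj (H : RibbonHopfStar G) (κ : Gˣ) (h : G →ₐ[ℂ] X)
    (φ : X →ₐ[ℂ] Y) (U : (G ⊗[ℂ] X)ˣ) :
    umap (Algebra.TensorProduct.map (AlgHom.id ℂ G) φ) (adj H κ h U) =
      adj H κ (φ.comp h) (umap (Algebra.TensorProduct.map (AlgHom.id ℂ G) φ) U) := by
  have e1 : umap (Algebra.TensorProduct.map (AlgHom.id ℂ G) φ) (umap ((inr G X).comp h) κ) =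
      umap ((inr G Y).comp (φ.comp h)) κ := Units.ext (by simp)
  have e2 : umap (Algebra.TensorProduct.map (AlgHom.id ℂ G) φ) ((cm_inl_inr h).unit H.R) =
      (cm_inl_inr (φ.comp h)).unit H.R := by
    refine Units.ext ((map_leg _ _ _ _).trans ?_)
    change _ = leg (inl G Y) ((inr G Y).comp (φ.comp h)) (H.R : G ⊗[ℂ] G)
    congr 1
    congr 1
    ext x
    simp
  simp only [adj, map_mul, map_inv, e1, e2]

theorem leg_inl_inr (h : G →ₐ[ℂ] X) (z : G ⊗[ℂ] G) : leg (inl G X) ((inr G X).comp h) z =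
    Algebra.TensorProduct.map (AlgHom.id ℂ G) h z := by
  rw [← leg_map, leg_include]

variable [FiniteDimensional ℂ G]

/-- Turns a condition on contractions into membership in a subalgebra, so that it passes to products
in `G ⊗ X`. -/
theorem mem_range_map (S : Subalgebra ℂ X) (z : G ⊗[ℂ] X) :
    z ∈ (Algebra.TensorProduct.map (AlgHom.id ℂ G) S.val).range ↔ ∀ f, ct f z ∈ S := by
  constructor
  · rintro ⟨w, rfl⟩ f
    change ct f (Algebra.TensorProduct.map (AlgHom.id ℂ G) S.val w) ∈ S
    rw [ct_map]
    exact (ct f w).2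
  · intro h
    rw [← sum_basis_ct (Module.finBasis ℂ G) z]
    exact Subalgebra.sum_mem _ fun i _ => ⟨_ ⊗ₜ ⟨_, h _⟩, rfl⟩

theorem ct_adj_mem (H : RibbonHopfStar G) (κ : Gˣ) (h : G →ₐ[ℂ] X)
    (U : (G ⊗[ℂ] X)ˣ) (S : Subalgebra ℂ X) (hh : ∀ x, h x ∈ S)
    (hU : ∀ f, ct f ((U⁻¹ : (G ⊗[ℂ] X)ˣ) : G ⊗[ℂ] X) ∈ S) (f : Module.Dual ℂ G) :
    ct f (adj H κ h U : G ⊗[ℂ] X) ∈ S := by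
  refine (mem_range_map S _).mp ?_ f
  have h1 : ∀ x, (1 : G) ⊗ₜ[ℂ] h x ∈ (Algebra.TensorProduct.map (AlgHom.id ℂ G) S.val).range :=
    fun x => ⟨1 ⊗ₜ ⟨h x, hh x⟩, rfl⟩
  have h2 : ∀ z : G ⊗[ℂ] G, leg (inl G X) ((inr G X).comp h) z ∈
      (Algebra.TensorProduct.map (AlgHom.id ℂ G) S.val).range := fun z =>
    (mem_range_map S _).mpr fun f => by rw [leg_inl_inr, ct_map]; exact hh _
  have e : (adj H κ h U : G ⊗[ℂ] X) = (1 ⊗ₜ h ((κ⁻¹ : Gˣ) : G)) *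
      leg (inl G X) ((inr G X).comp h) (H.R : G ⊗[ℂ] G) * ((U⁻¹ : (G ⊗[ℂ] X)ˣ) : G ⊗[ℂ] X) *
      leg (inl G X) ((inr G X).comp h) ((H.R⁻¹ : (G ⊗[ℂ] G)ˣ) : G ⊗[ℂ] G) * (1 ⊗ₜ h (κ : G)) := rfl
  rw [e]
  exact mul_mem (mul_mem (mul_mem (mul_mem (h1 _) (h2 _)) ((mem_range_map S _).mpr hU)) (h2 _))
    (h1 _)

end Adjoint

/-! ### The adjoint property of the representation. -/

section StarRep

variable {G : Type u} [Ring G] [HopfAlgebra ℂ G] [StarRing G] [StarModule ℂ G]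
  [FiniteDimensional ℂ G] [IsSemisimpleRing G]
  {ι : Type v} [Fintype ι] [DecidableEq ι] {H : RibbonHopfStar G} {D : IrrepSystem G ι}
  {c : ClebschGordan H D}

theorem piG_comp_hG : (piG c).comp (Semi.hG c) = had G := AlgHom.ext (piG_ofG c)

theorem piG_ct_adj {U : (G ⊗[ℂ] Semi c)ˣ} {V : (G ⊗[ℂ] DEnd G)ˣ}
    (h : Algebra.TensorProduct.map (AlgHom.id ℂ G) (piG c) (U : G ⊗[ℂ] Semi c) = V)
    (f : Module.Dual ℂ G) : piG c (ct f (Semi.adj c U : G ⊗[ℂ] Semi c)) =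
      ct f (adj H c.κel (had G) V : G ⊗[ℂ] DEnd G) := by
  have e := umap_adj H c.κel (Semi.hG c) (piG c) U
  have eV : umap (Algebra.TensorProduct.map (AlgHom.id ℂ G) (piG c)) U = V := Units.ext h
  rw [piG_comp_hG, eV] at e
  rw [← e, ← ct_map]
  rfl

variable (H) in
/-- The solution `B` in the model, as a unit. -/
def MBU : (G ⊗[ℂ] DEnd G)ˣ := umap (Algebra.TensorProduct.map (AlgHom.id ℂ G) (lreg G)) H.QvU

theorem leg_QvU_inv : leg (inl G (DEnd G)) (eps G (G ⊗[ℂ] DEnd G))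
    ((H.QvU⁻¹ : (G ⊗[ℂ] G)ˣ) : G ⊗[ℂ] G) = (H.ribbon : G) ⊗ₜ 1 := by
  change leg _ _ ((((H.R⁻¹ : (G ⊗[ℂ] G)ˣ) : G ⊗[ℂ] G) * H.Ri') * ((H.ribbon : G) ⊗ₜ 1)) = _
  have hc := (cm_eps (G := G) (inl G (DEnd G))).symm
  rw [hc.leg_mul, hc.leg_mul, RibbonHopfStar.leg_Ri' hc, leg_tmul, map_one, mul_one]
  have e : leg (inl G (DEnd G)) (eps G (G ⊗[ℂ] DEnd G)) ((H.R⁻¹ : (G ⊗[ℂ] G)ˣ) : G ⊗[ℂ] G) = 1 :=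
    RibbonHopfStar.ri_eps_right _
  rw [e, RibbonHopfStar.ri_eps_left, one_mul, one_mul]
  rfl

/-- Besides the left factors also `B⁻¹` acts by translations. All R-matrices collapse under the
invariant functional, and only the factor `v` in the first leg of `B⁻¹` remains. -/
theorem phi_adj_MB (g f : Module.Dual ℂ G) :
    ct g (adj H c.κel (had G) (MBU H) : G ⊗[ℂ] DEnd G) f D.haar =
      g H.ribbon * f D.haar := by
  rw [phi_adj_left]
  have h := map_ct (evAt (had G c.κel f) D.haar) g
    (leg (inl G (DEnd G)) ((inr G (DEnd G)).comp (lreg G)) ((H.QvU⁻¹ : (G ⊗[ℂ] G)ˣ) : G ⊗[ℂ] G) *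
      H.ri (inl G (DEnd G)) ((inr G (DEnd G)).comp (had G)))
  rw [absorb_left _ _ fun T y => phi_lreg D y (T (had G c.κel f)), ← map_ct, leg_QvU_inv,
    ct_left_mul] at h
  have h' := map_ct (evAt (had G c.κel f) D.haar) (g ∘ₗ LinearMap.mulLeft ℂ (H.ribbon : G))
    (H.ri (inl G (DEnd G)) ((inr G (DEnd G)).comp (had G)) * 1)
  rw [absorb_ri_left H _ _ fun T y => phi_had D y (T (had G c.κel f)), ← map_ct, mul_one,
    Algebra.TensorProduct.one_def, ct_tmul] at h'
  rw [h', leg_inl_inr] at h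
  refine h.trans ?_
  simp only [map_smul, evAt_apply, Module.End.one_apply, phi_had, D.counit_eq, c.τ_κel, c.κ_zero,
    smul_eq_mul, LinearMap.comp_apply, LinearMap.mulLeft_apply, mul_one, Matrix.smul_apply,
    Matrix.one_apply_eq, one_mul]

theorem sform_add_left (f f' g : Module.Dual ℂ G) :
    sform c (f + f') g = sform c f g + sform c f' g := by simp [sform]

theorem sform_smul_left (r : ℂ) (f g : Module.Dual ℂ G) :
    sform c (r • f) g = conj r * sform c f g := by simp [sform]

variable {F : Semi c →ₐ[ℂ] COp (Semi c)} (hF : ∀ x, F (Semi.hG c x) = cop (Semi.hG c (star x)))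
  {UA UB : (G ⊗[ℂ] Semi c)ˣ} (hA : (UA : G ⊗[ℂ] Semi c) = datum c (Semi.A c))
  (hB : (UB : G ⊗[ℂ] Semi c) = datum c (Semi.B c))
  (hFA : sharp F (UA : G ⊗[ℂ] Semi c) = cop (Semi.adj c UA : G ⊗[ℂ] Semi c))
  (hFB : sharp F (UB : G ⊗[ℂ] Semi c) = cop (Semi.adj c UB : G ⊗[ℂ] Semi c))

include hA hFA in
theorem phi_stOf_A (f f' : Module.Dual ℂ G) :
    piG c (stOf F (ct f (datum c (Semi.A c)))) f' D.haar = sform c f f' := by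
  rw [stOf, ct_sharp, ← hA, hFA, AddEquiv.symm_apply_apply,
    piG_ct_adj (V := MAU H) (by rw [hA]; exact map_piG_A c), phi_adj_MA]
  rfl

include hB hFB in
theorem phi_stOf_B (g f : Module.Dual ℂ G) :
    piG c (stOf F (ct g (datum c (Semi.B c)))) f D.haar = conj (g H.vi) * f D.haar := by
  rw [stOf, ct_sharp, ← hB, hFB, AddEquiv.symm_apply_apply,
    piG_ct_adj (V := MBU H) (by rw [hB]; exact map_piG_B c), phi_adj_MB, starF_apply, H.star_ribbon,
    RibbonHopfStar.vi]

include hF in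
theorem phi_stOf_G (x : G) (f : Module.Dual ℂ G) :
    piG c (stOf F (Semi.hG c x)) f D.haar = conj (Coalgebra.counit (R := ℂ) x) * f D.haar := by
  rw [stOf, hF, AddEquiv.symm_apply_apply, Semi.hG_apply, piG_ofG, phi_had, H.counit_star]

theorem stOf_mul (x y : Semi c) : stOf F (x * y) = stOf F y * stOf F x := by
  simp only [stOf, map_mul, cop_symm_mul]

-- It suffices to treat normal-ordered products of `A`, `B` and an element of `G`. The adjoints of
-- the latter two become scalars under the invariant functional, the same scalars conjugated by
-- which they act on `ε`; the adjoint of `A` produces the scalar product.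
include hF hA hB hFA hFB in
theorem phi_stOf (hQ : Function.Surjective fun f => ct f H.Qv) (s : Semi c)
    (f : Module.Dual ℂ G) :
    piG c (stOf F s) f D.haar = sform c (piG c s Coalgebra.counit) f := by
  let K : Submodule ℂ (Semi c) :=
    { carrier := {s | ∀ f, piG c (stOf F s) f D.haar = sform c (piG c s Coalgebra.counit) f}
      add_mem' := fun {s t} hs ht f => by
        have e : stOf F (s + t) = stOf F s + stOf F t := by simp [stOf]
        rw [e, map_add, map_add, LinearMap.add_apply, LinearMap.add_apply (piG c s),
          sform_add_left, ← hs, ← ht, LinearMap.add_apply]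
      zero_mem' := fun f => by simp [stOf, sform]
      smul_mem' := fun r s hs f => by
        have e : stOf F (r • s) = conj r • stOf F s := by rw [stOf, map_smul, cop_symm_smul, stOf]
        rw [e, map_smul, map_smul, LinearMap.smul_apply, LinearMap.smul_apply r (piG c s),
          sform_smul_left, ← hs, LinearMap.smul_apply, smul_eq_mul] }
  suffices h : (⊤ : Submodule ℂ (Semi c)) ≤ K from h (Submodule.mem_top (x := s)) f
  rw [← Semi.span_eq_top c hQ, Submodule.mul_le]
  rintro _ ⟨a, rfl⟩ n hn
  suffices h : ctRange (datum c (Semi.B c)) * LinearMap.range (Semi.hG c).toLinearMap ≤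
      K.comap (LinearMap.mulLeft ℂ (ctL (datum c (Semi.A c)) a)) from h hn
  rw [Submodule.mul_le]
  rintro _ ⟨b, rfl⟩ _ ⟨x, rfl⟩ f
  change piG c (stOf F (ct a (datum c (Semi.A c)) * (ct b (datum c (Semi.B c)) * Semi.hG c x))) f _ =
    sform c (piG c (ct a (datum c (Semi.A c)) * (ct b (datum c (Semi.B c)) * Semi.hG c x)) _) f
  rw [stOf_mul, stOf_mul, map_mul, map_mul, map_mul, map_mul]
  simp only [Module.End.mul_apply]
  rw [phi_stOf_G hF, phi_stOf_B hB hFB, phi_stOf_A hA hFA, Semi.hG_apply, piG_ofG, had_counit,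
    map_smul, map_smul, piG_ct_B, ct_MB_counit, piG_ct_A, map_smul, ct_MA_counit, sform_smul_left,
    sform_smul_left]

-- Every vector `f` is `A_f ε`, so both sides are vacuum expectation values of `A_f* t` acting on
-- `g`.
include hF hA hB hFA hFB in
theorem sform_piG (hQ : Function.Surjective fun f => ct f H.Qv) (t : Semi c)
    (f g : Module.Dual ℂ G) :
    sform c (piG c (stOf F t) f) g = sform c f (piG c t g) := by
  have hf : piG c (ct f (datum c (Semi.A c))) Coalgebra.counit = f := by
    rw [piG_ct_A, ct_MA_counit]
  have e := (isHandleStar_stOf hF hA hB hFA hFB).invol t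
  conv_lhs => rw [← hf, ← Module.End.mul_apply, ← map_mul, ← phi_stOf hF hA hB hFA hFB hQ, stOf_mul,
    e, map_mul, Module.End.mul_apply]
  rw [phi_stOf hF hA hB hFA hFB hQ, hf]

/-! ### The integral -/

variable (c) in
/-- The vacuum expectation value, as a functional on `L(A) ⋊ G`. -/
def omegaA : Semi.LAG c →ₗ[ℂ] ℂ :=
  evAt (Coalgebra.counit : Module.Dual ℂ G) D.haar ∘ₗ (piG c).toLinearMap ∘ₗ
    (Semi.LAG c).val.toLinearMap

theorem omegaA_apply (z : Semi.LAG c) : omegaA c z = piG c z Coalgebra.counit D.haar := rfl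

theorem isIntegralA_omegaA : IsIntegralA c (omegaA c) := fun I a b x => by
  rw [omegaA_apply]
  change piG c (Semi.A c I a b * Semi.ofG c x) Coalgebra.counit D.haar = _
  rw [map_mul, Module.End.mul_apply, piG_ofG, had_counit, map_smul, apply_eq_ct_datum c (Semi.A c),
    map_smul, piG_ct_A, LinearMap.smul_apply, LinearMap.smul_apply (c.κ I), ct_MA_counit]
  change Coalgebra.counit (R := ℂ) x • c.κ I • D.τ I D.haar a b = _
  rw [D.coef_haar]
  split_ifs with h
  · subst h
    rw [c.κ_zero]
    simp
  · simp

theorem IsIntegralA.unique (hQ : Function.Surjective fun f => ct f H.Qv)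
    {ω ω' : Semi.LAG c →ₗ[ℂ] ℂ} (h : IsIntegralA c ω) (h' : IsIntegralA c ω') : ω' = ω := by
  -- The set where both functionals agree is pushed forward to the full semi-direct product, where
  -- the products of entries of `A` with elements of `G` are known to span the subalgebra.
  let K : Submodule ℂ (Semi c) := (LinearMap.eqLocus ω' ω).map (Semi.LAG c).val.toLinearMap
  have hK : (Semi.LAG c).toSubmodule ≤ K := by
    rw [Semi.LAG_eq c hQ, Submodule.mul_le]
    rintro m hm _ ⟨x, rfl⟩
    have h1 : ctRange (datum c (Semi.A c)) ≤ K.comap (LinearMap.mulRight ℂ (Semi.hG c x)) :=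
      ctRange_le c fun I a b => ⟨Semi.LAG.monomial c I a b x, (h' I a b x).trans (h I a b x).symm,
        rfl⟩
    exact h1 hm
  ext z
  obtain ⟨w, hw, hwz⟩ := hK z.2
  have e : w = z := Subtype.ext hwz
  rw [← e]
  exact hw

include hA hFA in
theorem stOf_mem_LAG (hU : ∀ f, ct f ((UA⁻¹ : (G ⊗[ℂ] Semi c)ˣ) : G ⊗[ℂ] Semi c) ∈
    ctRange (datum c (Semi.A c))) {t : Handle c} (ht : t ∈ Handle.LA c) :
    stOf F (Semi.ofHandle c t) ∈ Semi.LAG c := by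
  have hmem : ctRange (datum c (Semi.A c)) ≤ (Semi.LAG c).toSubmodule :=
    ctRange_le c fun I a b => Algebra.subset_adjoin (Or.inl ⟨I, a, b, rfl⟩)
  induction ht using Algebra.adjoin_induction with
  | mem t ht =>
    obtain ⟨I, a, b, rfl⟩ := ht
    rw [Semi.ofHandle_A, stOf, cop_symm_entry hA hFA]
    -- The adjoint of `A` contains `A⁻¹`, whose contractions are again contractions of `A`, and
    -- otherwise only elements of `G`.
    have hG : ∀ x, Semi.hG c x ∈ Semi.LAG c := fun x =>
      Algebra.subset_adjoin (Or.inr ⟨x, rfl⟩)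
    exact (Semi.LAG c).smul_mem (ct_adj_mem H _ _ _ _ hG (fun f => hmem (hU f)) _) _
  | algebraMap r =>
    rw [AlgHom.commutes, stOf, AlgHom.commutes, Algebra.algebraMap_eq_smul_one, cop_symm_smul]
    exact (Semi.LAG c).smul_mem (Semi.LAG c).one_mem _
  | add x y _ _ hx hy =>
    have e : stOf F (Semi.ofHandle c (x + y)) =
        stOf F (Semi.ofHandle c x) + stOf F (Semi.ofHandle c y) := by simp [stOf]
    rw [e]
    exact add_mem hx hy
  | mul x y _ _ hx hy =>
    rw [map_mul, stOf_mul]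
    exact mul_mem hy hx

theorem ofHandle_mem_LAG {t : Handle c} (ht : t ∈ Handle.LA c) :
    Semi.ofHandle c t ∈ Semi.LAG c := by
  have h : Handle.LA c ≤ (Semi.LAG c).comap (Semi.ofHandle c) := by
    refine Algebra.adjoin_le ?_
    rintro _ ⟨I, a, b, rfl⟩
    change Semi.ofHandle c (Handle.A c I a b) ∈ Semi.LAG c
    rw [Semi.ofHandle_A]
    exact Algebra.subset_adjoin (Or.inl ⟨I, a, b, rfl⟩)
  exact h ht

end StarRep

/-! ### The space `⊕_I End(V^I)` -/

section Transport

variable {G : Type u} [Ring G] [HopfAlgebra ℂ G] [StarRing G] [StarModule ℂ G]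
  [FiniteDimensional ℂ G] [IsSemisimpleRing G]
  {ι : Type v} [Fintype ι] [DecidableEq ι] {H : RibbonHopfStar G} {D : IrrepSystem G ι}

variable (D) in
/-- Functionals on `G` are families of matrices. -/
def matEquiv : Module.Dual ℂ G ≃ₗ[ℂ] Reg D :=
  LinearMap.linearEquivOfInjective (LinearMap.pi fun I => mat D I)
    (fun _ _ h => mat_ext (D := D) fun I => congrFun h I)
    (by rw [Subspace.dual_finrank_eq]; exact D.tauEquiv.toLinearEquiv.finrank_eq)

variable (c : ClebschGordan H D)

open scoped ComplexOrder in
/-- The scalar product on `⊕_I End(V^I)`. -/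
abbrev regCore : InnerProductSpace.Core ℂ (Reg D) where
  inner a b := sform c ((matEquiv D).symm a) ((matEquiv D).symm b)
  conj_inner_symm a b := conj_sform c _ _
  re_inner_nonneg a := (Complex.nonneg_iff.mp (sform_self_nonneg c _)).1
  add_left a b d := by rw [map_add, sform_add_left]
  smul_left a b r := by rw [map_smul, sform_smul_left]
  definite a h := (matEquiv D).symm.map_eq_zero_iff.mp (eq_zero_of_sform c _ h)

theorem regCore_inner (f g : Module.Dual ℂ G) :
    (regCore c).inner (matEquiv D f) (matEquiv D g) = sform c f g := by
  change sform c ((matEquiv D).symm (matEquiv D f)) ((matEquiv D).symm (matEquiv D g)) = _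
  rw [LinearEquiv.symm_apply_apply, LinearEquiv.symm_apply_apply]

/-- A representation, transported by a linear isomorphism. -/
def conjRep {A M N : Type*} [Ring A] [Algebra ℂ A] [AddCommGroup M] [Module ℂ M]
    [AddCommGroup N] [Module ℂ N] (e : M ≃ₗ[ℂ] N) (ρ : A →ₐ[ℂ] Module.End ℂ M) :
    A →ₐ[ℂ] Module.End ℂ N := (e.conjAlgEquiv ℂ).toAlgHom.comp ρ

@[simp] theorem conjRep_apply {A M N : Type*} [Ring A] [Algebra ℂ A] [AddCommGroup M] [Module ℂ M]
    [AddCommGroup N] [Module ℂ N] (e : M ≃ₗ[ℂ] N) (ρ : A →ₐ[ℂ] Module.End ℂ M) (t : A) (x : M) :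
    conjRep e ρ t (e x) = e (ρ t x) := by
  change e (ρ t (e.symm (e x))) = _
  rw [LinearEquiv.symm_apply_apply]

theorem IsVacuum.conj {M N : Type*} [AddCommGroup M] [Module ℂ M] [AddCommGroup N]
    [Module ℂ N] (e : M ≃ₗ[ℂ] N) {ρ : Handle c →ₐ[ℂ] Module.End ℂ M} {x : M}
    (h : IsVacuum c ρ x) : IsVacuum c (conjRep e ρ) (e x) where
  ne_zero := e.map_ne_zero_iff.mpr h.ne_zero
  cyclic y := by
    obtain ⟨t, ht⟩ := h.cyclic (e.symm y)
    exact ⟨t, by rw [conjRep_apply, ht, LinearEquiv.apply_symm_apply]⟩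
  B_apply I a b := by
    rw [conjRep_apply, h.B_apply]
    split_ifs <;> simp

theorem IsIrred.conj {A M N : Type*} [Ring A] [Algebra ℂ A] [AddCommGroup M] [Module ℂ M]
    [AddCommGroup N] [Module ℂ N] (e : M ≃ₗ[ℂ] N) {ρ : A →ₐ[ℂ] Module.End ℂ M}
    (h : IsIrred ρ) : IsIrred (conjRep e ρ) := by
  obtain ⟨h1, h2⟩ := h
  refine ⟨e.symm.toEquiv.nontrivial, fun p hp => ?_⟩
  have e1 : p = (p.comap e.toLinearMap).map e.toLinearMap :=
    (Submodule.map_comap_eq_of_surjective e.surjective p).symm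
  have e2 : ∀ a, ∀ x ∈ p.comap e.toLinearMap, ρ a x ∈ p.comap e.toLinearMap := fun a x hx => by
    have h3 := hp a _ hx
    rw [LinearEquiv.coe_coe, conjRep_apply] at h3
    exact h3
  rcases h2 _ e2 with h3 | h3
  · left
    rw [e1, h3, Submodule.map_bot]
  · right
    rw [e1, h3, Submodule.map_top, LinearMap.range_eq_top]
    exact e.surjective

end Transport

end HandleAlg

end

/-! ### The theorem. -/

theorem mainTheorem10
    {G : Type u} [Ring G] [HopfAlgebra ℂ G] [StarRing G] [StarModule ℂ G]
    [FiniteDimensional ℂ G] [IsSemisimpleRing G]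
    {ι : Type v} [Fintype ι] [DecidableEq ι]
    (H : HandleAlg.RibbonHopfStar G) (D : HandleAlg.IrrepSystem G ι)
    (c : HandleAlg.ClebschGordan H D)
    (hdim : ∀ I, ∃ r : ℝ, 0 < r ∧ HandleAlg.qdim H D I = (r : ℂ))
    (hS : IsUnit (HandleAlg.SMatrix H D)) :
    ∃ (π : HandleAlg.Handle c →ₐ[ℂ] Module.End ℂ (HandleAlg.Reg D)) (vac : HandleAlg.Reg D),
      -- the ground state is cyclic and is an eigenvector of the `B^I`
      HandleAlg.IsVacuum c π vac ∧
      -- uniqueness, on any representation space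
      (∀ (W : Type w) [AddCommGroup W] [Module ℂ W]
        (ρ : HandleAlg.Handle c →ₐ[ℂ] Module.End ℂ W) (x : W), HandleAlg.IsVacuum c ρ x →
        ∃! e : HandleAlg.Reg D ≃ₗ[ℂ] W,
          e vac = x ∧ ∀ t a, e (π t a) = ρ t (e a)) ∧
      -- faithfulness and irreducibility
      Function.Injective π ∧
      HandleAlg.IsIrred π ∧
      -- extension to the semi-direct product
      ∃ πG : HandleAlg.Semi c →ₐ[ℂ] Module.End ℂ (HandleAlg.Reg D),
        (∀ t, πG (HandleAlg.Semi.ofHandle c t) = π t) ∧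
        (∀ x : G, πG (HandleAlg.Semi.ofG c x) vac = Coalgebra.counit (R := ℂ) x • vac) ∧
        -- the *-operation of the semi-direct product and the integral
        ∃ st : HandleAlg.Semi c → HandleAlg.Semi c,
          HandleAlg.IsHandleStar c st ∧
          (∀ st', HandleAlg.IsHandleStar c st' → st' = st) ∧
          ∃ ω : HandleAlg.Semi.LAG c →ₗ[ℂ] ℂ,
            HandleAlg.IsIntegralA c ω ∧
            (∀ ω', HandleAlg.IsIntegralA c ω' → ω' = ω) ∧
            -- the scalar product induced by the integral; `π` is a *-representation
            (∀ a : HandleAlg.Reg D, ∃ X ∈ HandleAlg.Handle.LA c, π X vac = a) ∧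
            ∃ sp : InnerProductSpace.Core ℂ (HandleAlg.Reg D),
              (∀ X ∈ HandleAlg.Handle.LA c, ∀ Y ∈ HandleAlg.Handle.LA c,
                ∃ h : st (HandleAlg.Semi.ofHandle c X) * HandleAlg.Semi.ofHandle c Y ∈
                    HandleAlg.Semi.LAG c,
                  sp.inner (π X vac) (π Y vac) =
                    ω ⟨st (HandleAlg.Semi.ofHandle c X) * HandleAlg.Semi.ofHandle c Y, h⟩) ∧
              (∀ (t : HandleAlg.Semi c) (a b : HandleAlg.Reg D),
                sp.inner (πG (st t) a) b = sp.inner a (πG t b)) := by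
  -- Factorizability from the nonvanishing of the quantum dimensions and the invertible S-matrix;
  -- the central unit `v⁻¹` in the first leg does not change the set of contractions.
  have hQ : Function.Surjective fun f => HandleAlg.ct f H.Qv :=
    HandleAlg.RibbonHopfStar.ct_Qv_surjective (HandleAlg.ct_Q_surjective (D := D) (fun I => by
      obtain ⟨r, hr, h⟩ := hdim I
      rw [h]
      exact_mod_cast hr.ne') hS)
  obtain ⟨UA, hA, hUA⟩ := (HandleAlg.Semi.isFus_A c).exists_unit hQ
  obtain ⟨UB, hB, -⟩ := (HandleAlg.Semi.isFus_B c).exists_unit hQ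
  obtain ⟨F, hF, hFA, hFB⟩ := HandleAlg.Semi.exists_hom hA hB
  set e := HandleAlg.matEquiv D with he
  have hst := HandleAlg.isHandleStar_stOf hF hA hB hFA hFB
  refine ⟨HandleAlg.conjRep e (HandleAlg.piD c), e Coalgebra.counit,
    (HandleAlg.isVacuum_piD c).conj c e, fun W _ _ ρ x hx => ?_,
    (e.conjAlgEquiv ℂ).injective.comp (HandleAlg.piD_injective hQ),
    (HandleAlg.isIrred_piD hQ).conj e,
    HandleAlg.conjRep e (HandleAlg.piG c), fun t => ?_, fun x => ?_,
    HandleAlg.stOf F, hst, fun st' h' => hst.unique h',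
    HandleAlg.omegaA c, HandleAlg.isIntegralA_omegaA, fun ω' h' =>
      HandleAlg.isIntegralA_omegaA.unique hQ h', fun a => ?_, HandleAlg.regCore c,
    fun X hX Y hY => ⟨mul_mem (HandleAlg.stOf_mem_LAG hA hFA hUA hX)
      (HandleAlg.ofHandle_mem_LAG hY), ?_⟩, fun t a b => ?_⟩
  · obtain ⟨k, ⟨hk1, hk2⟩, hk3⟩ := HandleAlg.IsVacuum.existsUnique hQ hx
    refine ⟨e.symm.trans k, ⟨by simp [hk1], fun t a => ?_⟩, fun k' ⟨h1, h2⟩ => ?_⟩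
    · obtain ⟨f, rfl⟩ := e.surjective a
      simp [hk2]
    · have h3 := hk3 (e.trans k') ⟨h1, fun t f => by
        rw [LinearEquiv.trans_apply, ← HandleAlg.conjRep_apply, h2, LinearEquiv.trans_apply]⟩
      rw [← h3]
      ext a
      simp
  · exact congrArg (e.conjAlgEquiv ℂ) (HandleAlg.piG_ofHandle c t)
  · rw [HandleAlg.conjRep_apply, HandleAlg.piG_ofG, HandleAlg.had_counit, map_smul]
  · obtain ⟨f, rfl⟩ := e.surjective a
    -- The contraction of `A` with `f` creates the functional `f` from the ground state.
    refine ⟨HandleAlg.ct f (HandleAlg.datum c (HandleAlg.Handle.A c)), ?_, ?_⟩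
    · exact HandleAlg.ctRange_le c (K := (HandleAlg.Handle.LA c).toSubmodule)
        (fun I a b => Algebra.subset_adjoin ⟨I, a, b, rfl⟩) (HandleAlg.ct_mem_ctRange f _)
    · rw [HandleAlg.conjRep_apply, HandleAlg.piD_apply_counit]
  · rw [HandleAlg.conjRep_apply, HandleAlg.conjRep_apply, HandleAlg.regCore_inner,
      HandleAlg.omegaA_apply, map_mul, Module.End.mul_apply,
      HandleAlg.phi_stOf hF hA hB hFA hFB hQ, HandleAlg.piG_ofHandle, HandleAlg.piG_ofHandle]
  · obtain ⟨f, rfl⟩ := e.surjective a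
    obtain ⟨g, rfl⟩ := e.surjective b
    rw [HandleAlg.conjRep_apply, HandleAlg.conjRep_apply, HandleAlg.regCore_inner,
      HandleAlg.regCore_inner, HandleAlg.sform_piG hF hA hB hFA hFB hQ]
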